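/- **Setting.** Let $\mathfrak g$ be a finite-dimensional real semisimple Lie algebra with Killing form $B$. Choose a Cartan involution $\theta$, a maximal abelian subspace $\mathfrak a$ of its $(-1)$-eigenspace, and a system $\Pi$ of simple roots of the restricted root system $\bar B\subset\mathfrak a^*$; let $r=\dim\mathfrak a$ and let $\vartheta$ be the highest root of $\bar B$. Scale $B|_{\mathfrak a}$ so that on $\mathfrak a^*$ one has $(\vartheta|\vartheta)=2$. On the space $\mathbb R^2\oplus\mathfrak a$ of logarithmic scale factors $\beta^1,\beta^2$ and dilatons $\phi$, linear forms have the scalar product $$(f|g)=\sum_{i}\partial_{\beta^i}f\,\partial_{\beta^i}g-\Big(\sum_i\partial_{\beta^i}f\Big)\Big(\sum_i\partial_{\beta^i}g\Big)+(f|_{\mathfrak a}\,|\,g|_{\mathfrak a}).$$ The *billiard* of $\mathfrak g$ (of the coset model $G/H$ coupled to gravity in three dimensions) is the region where all wall forms are $\ge 0$; the wall forms are $\lambda(\phi)$ and $\beta^i-\lambda(\phi)$ ($\lambda\in\bar B$ positive, $i=1,2$) and $\beta^2-\beta^1$. A *maximal split subalgebra* $\mathcal F$ of $\mathfrak g$ is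 a semisimple $\theta$-stable subalgebra for which $\mathfrak a$ is a split Cartan subalgebra and whose roots, all of multiplicity one, are the $\lambda\in\bar B$ with $\lambda/2\notin\bar B$. For a finite-type Cartan matrix $X$, $X^{\wedge\wedge}$ is obtained from the untwisted affine extension (affine root $\alpha_0=\delta-\vartheta$) by attaching one further root to $\alpha_0$ by a single line; $A_{2}^{(2)\wedge}$ and $A_4^{(2)\wedge}$ are obtained from the twisted affine diagrams $A_2^{(2)}$, $A_4^{(2)}$ by attaching one further root by a single line to the longest root (the one with label $1$). $X_{n|s}$ denotes the real form of $X_n$ whose Killing form has signature $s$. **Theorem.** Let $\mathcal U_3$ be the real Lie algebra of symmetries, after toroidal reduction to $D=3$, of the pure $D=4$ supergravity with $N=1,2,3,4,5,6,8$, or of $D=4$, $N=4$ supergravity with $k\ge 0$ Maxwell multiplets, as listed in the second column. For every choice of $\theta$, $\mathfrak a$, $\Pi$ (and such choices exist), the restricted root system is $\bar B$, a maximal split subalgebra exists and is of type $\mathcal F$, and the billiard is the fundamental Weyl chamber of the Kac–Moody algebra $\mathcal A$: the $r+2$ dominant wall forms $\sigma(\phi)$ $(\sigma\in\Pi)$,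 $\beta^1-\vartheta(\phi)$, $\beta^2-\beta^1$ are the simple roots of a realization of the Cartan matrix of $\mathcal A$ on the space of scale factors, with Cartan matrix $2(\alpha_i|\alpha_j)/(\alpha_i|\alpha_i)$; every wall form is a combination of them with non-negative integer coefficients; and the billiard is the region where they are all $\ge 0$. Moreover each $\mathcal A$ is hyperbolic. $$\begin{array}{c|c|c|c|c} \text{theory}&\mathcal U_3&\bar B&\mathcal F&\mathcal A\\\hline N=1&\mathfrak{sl}(2,\mathbb R)&a_1&A_1&A_1^{\wedge\wedge}\\ N=2&\mathfrak{su}(2,1)&bc_1&A_1&A_2^{(2)\wedge}\\ N=3&\mathfrak{su}(4,1)&bc_1&A_1&A_2^{(2)\wedge}\\ N=4&\mathfrak{so}(8,2)&c_2&C_2&C_2^{\wedge\wedge}\\ N=5&E_{6|-14}&bc_2&C_2&A_4^{(2)\wedge}\\ N=6&E_{7|-5}&f_4&F_4&F_4^{\wedge\wedge}\\ N=8&E_{8|8}&e_8&E_8&E_8^{\wedge\wedge}\\ N=4,\ k<6&\mathfrak{so}(8,k+2)&b_{k+2}&B_{k+2}&B_{k+2}^{\wedge\wedge}\\ N=4,\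 k=6&\mathfrak{so}(8,8)&d_8&D_8&D_8^{\wedge\wedge}\\ N=4,\ k>6&\mathfrak{so}(8,k+2)&b_8&B_8&B_8^{\wedge\wedge} \end{array}$$ -/

import Mathlib

open Matrix Module

set_option linter.unusedSectionVars false

/-! ### Simply laced Lie algebras -/

/-- A symmetric positive definite integer matrix with diagonal entries `2`, i.e. the Cartan matrix
of a simply laced finite root system.  Positive definiteness is recorded in the quantitative form
`∑ xᵢ² ≤ N * (x | x)`. -/
class IsSimplyLacedCartan {n : ℕ} (C : Matrix (Fin n) (Fin n) ℤ) : Prop where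
  symm : ∀ i j, C i j = C j i
  diag : ∀ i, C i i = 2
  coercive : ∃ N : ℤ, ∀ x : Fin n → ℤ, ∑ i, x i ^ 2 ≤ N * (x ⬝ᵥ C *ᵥ x)

section LatticeLie

variable {n : ℕ}

/-- The roots: the vectors of norm `2` in the root lattice `ℤⁿ`. -/
abbrev LatticeRoot (C : Matrix (Fin n) (Fin n) ℤ) : Type :=
  {v : Fin n → ℤ // v ⬝ᵥ C *ᵥ v = 2}

lemma latticeRoot_finite (C : Matrix (Fin n) (Fin n) ℤ) [hC : IsSimplyLacedCartan C] :
    Finite (LatticeRoot C) := by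
  obtain ⟨N, hN⟩ := hC.coercive
  refine Set.Finite.subset (Set.Finite.pi' (ι := Fin n) (t := fun _ => Set.Icc (-(N * 2)) (N * 2))
    (fun _ => Set.finite_Icc _ _)) ?_
  intro v hv i
  have h1 := hN v
  have hv' : v ⬝ᵥ C *ᵥ v = 2 := hv
  rw [hv'] at h1
  have h2 : v i ^ 2 ≤ ∑ j, v j ^ 2 :=
    Finset.single_le_sum (f := fun j => v j ^ 2) (fun j _ => sq_nonneg (v j)) (Finset.mem_univ i)
  constructor <;> nlinarith

noncomputable instance (C : Matrix (Fin n) (Fin n) ℤ) [IsSimplyLacedCartan C] :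
    Fintype (LatticeRoot C) :=
  haveI := latticeRoot_finite C
  Fintype.ofFinite _

/-- The bilinear form on the lattice. -/
def latForm (C : Matrix (Fin n) (Fin n) ℤ) (v w : Fin n → ℤ) : ℤ := v ⬝ᵥ C *ᵥ w

/-- A bilinear form `T` on the root lattice with `T(v,w) + T(w,v) = (v | w)` and
`T(v,v) = (v | v) / 2`. -/
def latExponent (C : Matrix (Fin n) (Fin n) ℤ) (v w : Fin n → ℤ) : ℤ :=
  ∑ i, ∑ j, (if i = j then 1 else if i < j then C i j else 0) * v i * w j

/-- The bimultiplicative sign `ε(v,w) = (-1)^{T(v,w)}`. -/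
def latSign (C : Matrix (Fin n) (Fin n) ℤ) (v w : Fin n → ℤ) : ℤ :=
  ((latExponent C v w).negOnePow : ℤ)

/-- The simply laced Lie algebra over `K` with Cartan matrix `C`: the element with components
`cart = h` and `root = x` is `∑ᵢ hᵢ αᵢ + ∑_α x_α e_α`, and the bracket (see `bracket`) is given by
`[αᵢ, αⱼ] = 0`, `[αᵢ, e_β] = (αᵢ | β) e_β`, `[e_α, e_{-α}] = -α`,
`[e_α, e_β] = ε(α, β) e_{α+β}` if `α + β` is a root, and
`[e_α, e_β] = 0` if `α + β` is neither a root nor zero. -/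
@[ext]
structure LatticeLie (K : Type*) (C : Matrix (Fin n) (Fin n) ℤ) where
  cart : Fin n → K
  root : LatticeRoot C → K

namespace LatticeLie

section Module

variable {K : Type*} [Field K] {C : Matrix (Fin n) (Fin n) ℤ}

/-- The underlying vector space. -/
def equivProd : LatticeLie K C ≃ (Fin n → K) × (LatticeRoot C → K) where
  toFun x := (x.cart, x.root)
  invFun p := ⟨p.1, p.2⟩
  left_inv _ := rfl
  right_inv _ := rfl

instance : AddCommGroup (LatticeLie K C) := equivProd.addCommGroup

instance {R : Type*} [CommRing R] [Algebra R K] : Module R (LatticeLie K C) := equivProd.module R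

instance {R : Type*} [Field R] [Algebra R K] [FiniteDimensional R K] [IsSimplyLacedCartan C] :
    FiniteDimensional R (LatticeLie K C) :=
  LinearEquiv.finiteDimensional (equivProd.linearEquiv R).symm

@[simp] lemma add_cart (x y : LatticeLie K C) : (x + y).cart = x.cart + y.cart := rfl
@[simp] lemma add_root (x y : LatticeLie K C) : (x + y).root = x.root + y.root := rfl
@[simp] lemma neg_cart (x : LatticeLie K C) : (-x).cart = -x.cart := rfl
@[simp] lemma neg_root (x : LatticeLie K C) : (-x).root = -x.root := rfl
@[simp] lemma zero_cart : (0 : LatticeLie K C).cart = 0 := rfl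
@[simp] lemma zero_root : (0 : LatticeLie K C).root = 0 := rfl
@[simp] lemma smul_cart {R : Type*} [CommRing R] [Algebra R K] (c : R) (x : LatticeLie K C) :
    (c • x).cart = c • x.cart := rfl
@[simp] lemma smul_root {R : Type*} [CommRing R] [Algebra R K] (c : R) (x : LatticeLie K C) :
    (c • x).root = c • x.root := rfl

/-- The coefficient of `e_v` in `x`, zero if the lattice vector `v` is not a root. -/
def coeff (x : LatticeLie K C) (v : Fin n → ℤ) : K :=
  if hv : v ⬝ᵥ C *ᵥ v = 2 then x.root ⟨v, hv⟩ else 0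

/-- The value `(h | v)` for `h = ∑ hᵢ αᵢ`. -/
def pair (C : Matrix (Fin n) (Fin n) ℤ) (h : Fin n → K) (v : Fin n → ℤ) : K :=
  ∑ i, h i * ((C *ᵥ v) i : K)

lemma coeff_add (x y : LatticeLie K C) (v) : coeff (x + y) v = coeff x v + coeff y v := by
  unfold coeff; split_ifs <;> simp [Pi.add_apply]

lemma coeff_smul {R : Type*} [CommRing R] [Algebra R K] (c : R) (x : LatticeLie K C) (v) :
    coeff (c • x) v = c • coeff x v := by
  unfold coeff; split_ifs <;> simp

lemma pair_add (h h' : Fin n → K) (v) : pair C (h + h') v = pair C h v + pair C h' v := by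
  simp [pair, add_mul, Finset.sum_add_distrib]

lemma pair_smul {R : Type*} [CommRing R] [Algebra R K] (c : R) (h : Fin n → K) (v) :
    pair C (c • h) v = c • pair C h v := by
  simp [pair, Finset.smul_sum]

/-- The element `∑ hᵢ αᵢ`. -/
def H (C : Matrix (Fin n) (Fin n) ℤ) (h : Fin n → K) : LatticeLie K C := ⟨h, 0⟩

/-- The root vector `e_v`, zero if `v` is not a root. -/
def e (K : Type*) [Field K] (C : Matrix (Fin n) (Fin n) ℤ) (v : Fin n → ℤ) : LatticeLie K C :=
  ⟨0, fun a => if a.1 = v then 1 else 0⟩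

end Module

section Bracket

variable {K : Type*} [Field K] {C : Matrix (Fin n) (Fin n) ℤ} [IsSimplyLacedCartan C]

/-- The bracket. -/
noncomputable def bracket (x y : LatticeLie K C) : LatticeLie K C where
  cart i := -∑ a : LatticeRoot C, x.root a * coeff y (-a.1) * (a.1 i : K)
  root g := pair C x.cart g.1 * y.root g - pair C y.cart g.1 * x.root g +
     ∑ a : LatticeRoot C, (latSign C a.1 (g.1 - a.1) : K) * x.root a * coeff y (g.1 - a.1)

lemma bracket_add_left (x y z : LatticeLie K C) :
    bracket (x + y) z = bracket x z + bracket y z := by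
  ext i
  · simp only [bracket, add_root, add_cart, Pi.add_apply, add_mul, Finset.sum_add_distrib]; ring
  · simp only [bracket, add_root, add_cart, Pi.add_apply, add_mul, mul_add,
      Finset.sum_add_distrib, pair_add]; ring

lemma bracket_add_right (x y z : LatticeLie K C) :
    bracket x (y + z) = bracket x y + bracket x z := by
  ext i
  · simp only [bracket, add_cart, Pi.add_apply, coeff_add, add_mul, mul_add,
      Finset.sum_add_distrib]; ring
  · simp only [bracket, add_root, add_cart, Pi.add_apply, coeff_add, add_mul, mul_add,
      Finset.sum_add_distrib, pair_add]; ring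

lemma bracket_smul_right {R : Type*} [CommRing R] [Algebra R K] (c : R) (x y : LatticeLie K C) :
    bracket x (c • y) = c • bracket x y := by
  ext i
  · simp only [bracket, smul_cart, Pi.smul_apply, coeff_smul, smul_neg, Finset.smul_sum,
      mul_smul_comm, smul_mul_assoc]
  · simp only [bracket, smul_cart, smul_root, Pi.smul_apply, coeff_smul, pair_smul, smul_add,
      smul_sub, Finset.smul_sum, mul_smul_comm, smul_mul_assoc]

lemma bracket_smul_left {R : Type*} [CommRing R] [Algebra R K] (c : R) (x y : LatticeLie K C) :
    bracket (c • x) y = c • bracket x y := by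
  ext i
  · simp only [bracket, smul_cart, smul_root, Pi.smul_apply, smul_neg, Finset.smul_sum,
      mul_smul_comm, smul_mul_assoc]
  · simp only [bracket, smul_cart, smul_root, Pi.smul_apply, pair_smul, smul_add,
      smul_sub, Finset.smul_sum, mul_smul_comm, smul_mul_assoc]

lemma bracket_sum_left {ι : Type*} (s : Finset ι) (f : ι → LatticeLie K C) (y) :
    bracket (∑ i ∈ s, f i) y = ∑ i ∈ s, bracket (f i) y :=
  map_sum (AddMonoidHom.mk' (fun x => bracket x y) fun a b => bracket_add_left a b y) f s

lemma bracket_sum_right {ι : Type*} (s : Finset ι) (f : ι → LatticeLie K C) (y) :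
    bracket y (∑ i ∈ s, f i) = ∑ i ∈ s, bracket y (f i) :=
  map_sum (AddMonoidHom.mk' (fun x => bracket y x) fun a b => bracket_add_right y a b) f s

lemma e_eq_zero {v : Fin n → ℤ} (h : latForm C v v ≠ 2) : e K C v = 0 := by
  ext a
  · rfl
  · have : a.1 ≠ v := fun h' => h (h' ▸ a.2)
    simp [e, this]

lemma coeff_e (v w : Fin n → ℤ) (hv : latForm C v v = 2) :
    coeff (e K C v) w = if w = v then 1 else 0 := by
  unfold coeff
  split_ifs with h1 h2 h2
  · simp [e, h2]
  · simp [e, h2]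
  · exact absurd (h2 ▸ hv) h1
  · rfl

lemma coeff_H (h : Fin n → K) (w : Fin n → ℤ) : coeff (H C h) w = 0 := by
  unfold coeff; split_ifs <;> simp [H]

lemma decompose (x : LatticeLie K C) :
    x = H C x.cart + ∑ a : LatticeRoot C, x.root a • e K C a.1 := by
  have hc : (∑ a : LatticeRoot C, x.root a • e K C a.1).cart = 0 := by
    rw [show (∑ a : LatticeRoot C, x.root a • e K C a.1).cart =
      ∑ a : LatticeRoot C, (x.root a • e K C a.1).cart from
      map_sum (AddMonoidHom.mk' (fun y : LatticeLie K C => y.cart) fun _ _ => rfl) _ _]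
    simp [e]
  have hr : (∑ a : LatticeRoot C, x.root a • e K C a.1).root = x.root := by
    rw [show (∑ a : LatticeRoot C, x.root a • e K C a.1).root =
      ∑ a : LatticeRoot C, (x.root a • e K C a.1).root from
      map_sum (AddMonoidHom.mk' (fun y : LatticeLie K C => y.root) fun _ _ => rfl) _ _]
    ext b
    simp only [Finset.sum_apply, smul_root, Pi.smul_apply, e, smul_eq_mul]
    rw [Finset.sum_eq_single b]
    · simp
    · intro a _ hab
      have : b.1 ≠ a.1 := fun h => hab (Subtype.ext h.symm)
      simp [this]
    · intro h; exact absurd (Finset.mem_univ _) h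
  ext i
  · simp [hc, H]
  · simp [hr, H]

lemma bracket_H_H (h h' : Fin n → K) : bracket (H C h) (H C h') = 0 := by
  ext <;> simp [bracket, H]

lemma bracket_H_e (h : Fin n → K) (v : Fin n → ℤ) :
    bracket (H C h) (e K C v) = pair C h v • e K C v := by
  ext a
  · simp [bracket, H, e]
  · by_cases hv : a.1 = v <;> simp [bracket, H, e, hv, pair]

lemma bracket_e_H (h : Fin n → K) (v : Fin n → ℤ) :
    bracket (e K C v) (H C h) = -(pair C h v • e K C v) := by
  ext a
  · simp [bracket, e, coeff_H]
  · have : ∀ w, coeff (⟨h, 0⟩ : LatticeLie K C) w = 0 := coeff_H h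
    by_cases hv : a.1 = v <;> simp [bracket, H, e, hv, pair, this]

lemma bracket_e_e {v w : Fin n → ℤ} (hv : latForm C v v = 2) (hw : latForm C w w = 2) :
    bracket (e K C v) (e K C w) =
      if v + w = 0 then -H C (fun i => (v i : K)) else (latSign C v w : K) • e K C (v + w) := by
  have key : ∀ f : LatticeRoot C → K,
      ∑ a : LatticeRoot C, (e K C v).root a * f a = f ⟨v, hv⟩ := by
    intro f
    rw [Finset.sum_eq_single ⟨v, hv⟩]
    · simp [e]
    · intro b _ hb
      have : b.1 ≠ v := fun h => hb (Subtype.ext h)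
      simp [e, this]
    · intro h; exact absurd (Finset.mem_univ _) h
  ext a
  · have : (bracket (e K C v) (e K C w)).cart a = -(coeff (e K C w) (-v) * (v a : K)) := by
      simp only [bracket, mul_assoc]
      rw [key (fun b => coeff (e K C w) (-b.1) * (b.1 a : K))]
    rw [this, coeff_e _ _ hw]
    have hiff : -v = w ↔ v + w = 0 := by
      rw [neg_eq_iff_add_eq_zero]
    by_cases h : v + w = 0
    · simp [hiff, h, H]
    · simp [hiff, h, e]
  · have : (bracket (e K C v) (e K C w)).root a =
        latSign C v (a.1 - v) * coeff (e K C w) (a.1 - v) := by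
      have h0 : ∀ u, pair C (e K C u).cart a.1 = 0 := fun u => by simp [pair, e]
      simp only [bracket, h0, zero_mul, sub_zero, zero_add]
      rw [← key (fun b => (latSign C b.1 (a.1 - b.1) : K) * coeff (e K C w) (a.1 - b.1))]
      exact Finset.sum_congr rfl fun _ _ => by ring
    rw [this, coeff_e _ _ hw]
    have hiff : a.1 - v = w ↔ a.1 = v + w := by
      rw [sub_eq_iff_eq_add, add_comm]
    by_cases h : v + w = 0
    · have : a.1 ≠ 0 := by
        intro h0
        have := a.2
        rw [h0] at this
        simp at this
      simp [hiff, h, H, this]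
    · by_cases h2 : a.1 = v + w
      · simp [h2, h, e]
      · simp [hiff, h2, h, e]

/-! #### The Lie algebra axioms -/

lemma latForm_add_left (u v w : Fin n → ℤ) :
    latForm C (u + v) w = latForm C u w + latForm C v w := by simp [latForm, add_dotProduct]

lemma latForm_add_right (u v w : Fin n → ℤ) :
    latForm C w (u + v) = latForm C w u + latForm C w v := by
  simp [latForm, mulVec_add, dotProduct_add]

lemma latForm_comm (v w : Fin n → ℤ) : latForm C v w = latForm C w v := by
  have h : Cᵀ = C := by
    ext i j; exact IsSimplyLacedCartan.symm j i
  rw [latForm, latForm, dotProduct_mulVec, ← mulVec_transpose, h, dotProduct_comm]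

lemma latForm_neg_right (v w : Fin n → ℤ) : latForm C v (-w) = -latForm C v w := by
  simp [latForm, mulVec_neg]

lemma latForm_neg_left (v w : Fin n → ℤ) : latForm C (-v) w = -latForm C v w := by
  simp [latForm]

lemma latForm_self_nonneg (v : Fin n → ℤ) : 0 ≤ latForm C v v := by
  obtain ⟨N, hN⟩ := IsSimplyLacedCartan.coercive (C := C)
  by_contra h
  push Not at h
  have h1 : 0 ≤ ∑ i, v i ^ 2 := Finset.sum_nonneg fun _ _ => sq_nonneg _
  have h2 := hN v
  change _ ≤ N * latForm C v v at h2
  by_cases hv : v = 0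
  · subst hv; simp [latForm] at h
  obtain ⟨i, hi⟩ := Function.ne_iff.mp hv
  let b : Fin n → ℤ := Pi.single i 1
  have hb : latForm C b b = 2 := by
    simp [latForm, b, IsSimplyLacedCartan.diag (C := C) i]
  have h3 := hN b
  change _ ≤ N * latForm C b b at h3
  have h4 : (0 : ℤ) < ∑ j, b j ^ 2 :=
    Finset.sum_pos' (fun _ _ => sq_nonneg _) ⟨i, Finset.mem_univ _, by simp [b]⟩
  have hN0 : 0 < N := by rw [hb] at h3; linarith
  nlinarith

lemma latForm_self_eq_zero {v : Fin n → ℤ} (h : latForm C v v = 0) : v = 0 := by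
  obtain ⟨N, hN⟩ := IsSimplyLacedCartan.coercive (C := C)
  have h2 := hN v
  change _ ≤ N * latForm C v v at h2
  rw [h, mul_zero] at h2
  have h3 := (Finset.sum_eq_zero_iff_of_nonneg (fun i _ => sq_nonneg (v i))).mp
    (le_antisymm h2 (Finset.sum_nonneg fun _ _ => sq_nonneg _))
  ext i
  simpa using h3 i (Finset.mem_univ _)

lemma latForm_ge {v w : Fin n → ℤ} (hv : latForm C v v = 2) (hw : latForm C w w = 2) :
    -2 ≤ latForm C v w := by
  have := latForm_self_nonneg (C := C) (v + w)
  rw [latForm_add_left, latForm_add_right, latForm_add_right, hv, hw, latForm_comm w v] at this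
  linarith

lemma latForm_add_self {v w : Fin n → ℤ} (hv : latForm C v v = 2) (hw : latForm C w w = 2) :
    latForm C (v + w) (v + w) = 4 + 2 * latForm C v w := by
  rw [latForm_add_left, latForm_add_right, latForm_add_right, hv, hw, latForm_comm w v]
  ring

lemma latExponent_add_left (u v w : Fin n → ℤ) :
    latExponent C (u + v) w = latExponent C u w + latExponent C v w := by
  simp only [latExponent, Pi.add_apply, mul_add, add_mul, Finset.sum_add_distrib]

lemma latExponent_add_right (u v w : Fin n → ℤ) :
    latExponent C w (u + v) = latExponent C w u + latExponent C w v := by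
  simp only [latExponent, Pi.add_apply, mul_add, Finset.sum_add_distrib]

lemma latExponent_add_comm (v w : Fin n → ℤ) :
    latExponent C v w + latExponent C w v = latForm C v w := by
  have h : latExponent C w v =
      ∑ i, ∑ j, (if j = i then 1 else if j < i then C j i else 0) * w j * v i := by
    rw [latExponent, Finset.sum_comm]
  rw [h, latExponent, ← Finset.sum_add_distrib]
  simp only [latForm, dotProduct, mulVec, Finset.mul_sum]
  refine Finset.sum_congr rfl fun i _ => ?_
  rw [← Finset.sum_add_distrib]
  refine Finset.sum_congr rfl fun j _ => ?_
  rcases lt_trichotomy i j with hij | hij | hij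
  · simp [hij, hij.ne, hij.ne', hij.not_gt]; ring
  · subst hij; simp [IsSimplyLacedCartan.diag (C := C) i]; ring
  · simp [hij, hij.ne, hij.ne', hij.not_gt, IsSimplyLacedCartan.symm (C := C) j i]; ring

lemma latSign_add_left (u v w : Fin n → ℤ) :
    latSign C (u + v) w = latSign C u w * latSign C v w := by
  simp [latSign, latExponent_add_left, Int.negOnePow_add]

lemma latSign_add_right (u v w : Fin n → ℤ) :
    latSign C w (u + v) = latSign C w u * latSign C w v := by
  simp [latSign, latExponent_add_right, Int.negOnePow_add]

lemma latSign_sq (v w : Fin n → ℤ) : latSign C v w * latSign C v w = 1 := by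
  rw [latSign, ← Units.val_mul, ← Int.negOnePow_add, Int.negOnePow_even _ ⟨_, rfl⟩]; rfl

lemma latSign_neg_left (v w : Fin n → ℤ) : latSign C (-v) w = latSign C v w := by
  have h := latSign_add_left (C := C) (-v) v w
  have h0 : latSign C (-v + v) w = 1 := by simp [latSign, latExponent]
  rw [h0] at h
  calc latSign C (-v) w = latSign C (-v) w * (latSign C v w * latSign C v w) := by
        rw [latSign_sq, mul_one]
    _ = latSign C v w := by rw [← mul_assoc, ← h, one_mul]

lemma latSign_neg_right (v w : Fin n → ℤ) : latSign C v (-w) = latSign C v w := by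
  have h := latSign_add_right (C := C) (-w) w v
  have h0 : latSign C v (-w + w) = 1 := by simp [latSign, latExponent]
  rw [h0] at h
  calc latSign C v (-w) = latSign C v (-w) * (latSign C v w * latSign C v w) := by
        rw [latSign_sq, mul_one]
    _ = latSign C v w := by rw [← mul_assoc, ← h, one_mul]

lemma latSign_self {v : Fin n → ℤ} (hv : latForm C v v = 2) : latSign C v v = -1 := by
  have h := latExponent_add_comm (C := C) v v
  have : latExponent C v v = 1 := by rw [hv] at h; linarith
  simp [latSign, this]

lemma latSign_swap (v w : Fin n → ℤ) :
    latSign C w v = ((latForm C v w).negOnePow : ℤ) * latSign C v w := by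
  have h := latExponent_add_comm (C := C) v w
  have h2 : latExponent C w v = latForm C v w - latExponent C v w := by linarith
  rw [latSign, h2, Int.negOnePow_sub, Units.val_mul, latSign]

lemma pair_intCast (v w : Fin n → ℤ) : pair C (fun i => (v i : K)) w = (latForm C v w : K) := by
  simp [pair, latForm, dotProduct]

lemma bracket_neg_right (x y : LatticeLie K C) : bracket x (-y) = -bracket x y := by
  have := bracket_smul_right (R := ℤ) (-1) x y
  simpa using this

lemma induction_gen {p : LatticeLie K C → Prop} (hH : ∀ h, p (H C h))
    (he : ∀ v, latForm C v v = 2 → p (e K C v)) (hadd : ∀ x y, p x → p y → p (x + y))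
    (hsmul : ∀ (c : K) x, p x → p (c • x)) (x : LatticeLie K C) : p x := by
  rw [decompose x]
  refine hadd _ _ (hH _) ?_
  refine Finset.sum_induction _ p hadd ?_ fun a _ => hsmul _ _ (he _ a.2)
  simpa using hsmul 0 _ (hH 0)

lemma bracket_antisymm (x y : LatticeLie K C) : bracket x y = -bracket y x := by
  induction x using induction_gen with
  | hadd a b ha hb => rw [bracket_add_left, bracket_add_right, ha, hb, neg_add]
  | hsmul c a ha => rw [bracket_smul_left, bracket_smul_right, ha, smul_neg]
  | hH h =>
    induction y using induction_gen with
    | hadd a b ha hb => rw [bracket_add_left, bracket_add_right, ha, hb, neg_add]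
    | hsmul c a ha => rw [bracket_smul_left, bracket_smul_right, ha, smul_neg]
    | hH h' => simp [bracket_H_H]
    | he v hv => rw [bracket_H_e, bracket_e_H, neg_neg]
  | he v hv =>
    induction y using induction_gen with
    | hadd a b ha hb => rw [bracket_add_left, bracket_add_right, ha, hb, neg_add]
    | hsmul c a ha => rw [bracket_smul_left, bracket_smul_right, ha, smul_neg]
    | hH h' => rw [bracket_H_e, bracket_e_H]
    | he w hw =>
      rw [bracket_e_e hv hw, bracket_e_e hw hv, add_comm w v]
      split_ifs with h
      · have : w = -v := (neg_eq_of_add_eq_zero_right h).symm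
        subst this
        ext i <;> simp [H]
      · by_cases hr : latForm C (v + w) (v + w) = 2
        · have h1 : latForm C v w = -1 := by
            rw [latForm_add_self hv hw] at hr; linarith
          rw [latSign_swap v w, h1]
          simp
        · simp [e_eq_zero hr]

/-- The cyclic sum of the Jacobi identity. -/
noncomputable def jac (x y z : LatticeLie K C) : LatticeLie K C :=
  bracket x (bracket y z) + bracket y (bracket z x) + bracket z (bracket x y)

lemma jac_cyc (x y z : LatticeLie K C) : jac x y z = jac y z x := by
  simp only [jac]; abel

lemma jac_add (a b y z : LatticeLie K C) : jac (a + b) y z = jac a y z + jac b y z := by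
  simp only [jac, bracket_add_left, bracket_add_right]; abel

lemma jac_smul (c : K) (a y z : LatticeLie K C) : jac (c • a) y z = c • jac a y z := by
  simp only [jac, bracket_smul_left, bracket_smul_right, smul_add]

lemma pair_add_vec (h : Fin n → K) (v w : Fin n → ℤ) :
    pair C h (v + w) = pair C h v + pair C h w := by
  simp [pair, mulVec_add, mul_add, Finset.sum_add_distrib]

lemma jac_HHH (h h' h'' : Fin n → K) : jac (H C h) (H C h') (H C h'') = 0 := by
  have : bracket (C := C) (H C h) 0 = 0 := by simpa using bracket_smul_right (0 : K) (H C h) 0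
  have h0 : ∀ k : Fin n → K, bracket (C := C) (H C k) 0 = 0 := fun k => by
    simpa using bracket_smul_right (0 : K) (H C k) 0
  simp [jac, bracket_H_H, h0]

lemma bracket_zero_right (x : LatticeLie K C) : bracket x 0 = 0 := by
  simpa using bracket_smul_right (0 : K) x 0

lemma jac_HHe (h h' : Fin n → K) (v : Fin n → ℤ) : jac (H C h) (H C h') (e K C v) = 0 := by
  simp only [jac, bracket_H_H, bracket_H_e, bracket_e_H, bracket_zero_right, bracket_neg_right,
    bracket_smul_right, smul_smul, mul_comm (pair C h v)]
  simp

lemma jac_Hee (h : Fin n → K) {v w : Fin n → ℤ} (hv : latForm C v v = 2)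
    (hw : latForm C w w = 2) : jac (H C h) (e K C v) (e K C w) = 0 := by
  have hp : v + w = 0 → pair C h w = -pair C h v := by
    intro h0
    have := pair_add_vec (C := C) h v w
    rw [h0] at this
    have h1 : pair C h 0 = 0 := by simp [pair]
    rw [h1] at this
    exact eq_neg_of_add_eq_zero_right this.symm
  rw [jac, bracket_antisymm (e K C w) (bracket (H C h) (e K C v))]
  simp only [bracket_H_e, bracket_e_H, bracket_neg_right, bracket_smul_right, bracket_smul_left,
    bracket_e_e hv hw]
  split_ifs with h0
  · simp [bracket_neg_right, bracket_H_H, hp h0]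
  · simp only [bracket_smul_right, bracket_H_e, pair_add_vec, smul_smul]
    module

lemma double_bracket {a b c : Fin n → ℤ} (ha : latForm C a a = 2) (hb : latForm C b b = 2)
    (hc : latForm C c c = 2) :
    bracket (e K C c) (bracket (e K C a) (e K C b)) =
      if a + b = 0 then (latForm C a c : K) • e K C c
      else if latForm C a b = -1 then
        (latSign C a b : K) • (if c + (a + b) = 0 then -H C (fun i => (c i : K))
          else ((latSign C c a : K) * (latSign C c b : K)) • e K C (c + (a + b)))
      else 0 := by
  rw [bracket_e_e ha hb]
  split_ifs with h0 h1 h2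
  · rw [bracket_neg_right, bracket_e_H, neg_neg, pair_intCast]
  · rw [bracket_smul_right, bracket_e_e hc (by rw [latForm_add_self ha hb, h1]; norm_num), if_pos h2]
  · rw [bracket_smul_right, bracket_e_e hc (by rw [latForm_add_self ha hb, h1]; norm_num), if_neg h2,
      latSign_add_right]
    push_cast; rfl
  · rw [e_eq_zero (v := a + b), smul_zero, bracket_zero_right]
    rw [latForm_add_self ha hb]
    intro h; apply h1; linarith

lemma add_eq_zero_iff_latForm {a b : Fin n → ℤ} (ha : latForm C a a = 2)
    (hb : latForm C b b = 2) : a + b = 0 ↔ latForm C a b = -2 := by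
  constructor
  · intro h
    have := latForm_add_self ha hb
    rw [h] at this
    simp [latForm] at this
    simp only [latForm]; linarith
  · intro h
    exact latForm_self_eq_zero (C := C) (by rw [latForm_add_self ha hb, h]; norm_num)

lemma jac_eee_of_add_eq_zero {a b c : Fin n → ℤ} (ha : latForm C a a = 2)
    (hb : latForm C b b = 2) (hc : latForm C c c = 2) (h : a + b = 0) :
    jac (e K C a) (e K C b) (e K C c) = 0 := by
  obtain rfl : b = -a := (neg_eq_of_add_eq_zero_right h).symm
  have hge := latForm_ge ha hc
  have hge' := latForm_ge hb hc
  rw [latForm_neg_left] at hge'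
  rw [jac, double_bracket hb hc ha, double_bracket hc ha hb, double_bracket ha hb hc, if_pos h]
  have e1 : -a + c = 0 ↔ latForm C a c = 2 := by
    rw [add_eq_zero_iff_latForm hb hc, latForm_neg_left]; omega
  have e2 : c + a = 0 ↔ latForm C a c = -2 := by
    rw [add_eq_zero_iff_latForm hc ha, latForm_comm]
  have e3 : a + (-a + c) = c := by abel
  have e4 : -a + (c + a) = c := by abel
  have hc0 : c ≠ 0 := by rintro rfl; simp [latForm] at hc
  simp only [e1, e2, e3, e4, hc0, if_false, latForm_neg_left, latForm_comm c a, latSign_neg_left,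
    latSign_neg_right, latForm_comm c (-a), ha, latSign_self ha,
    latSign_swap a c]
  obtain h | h | h | h | h : latForm C a c = -2 ∨ latForm C a c = -1 ∨ latForm C a c = 0 ∨
    latForm C a c = 1 ∨ latForm C a c = 2 := by omega
  · obtain rfl : c = -a := by
      have := (e2.mpr h); exact eq_neg_of_add_eq_zero_left this
    rw [h]
    norm_num
  · rw [h]
    have hs : ((latSign C a c : ℤ) : K) * (latSign C a c : K) = 1 := by
      rw [← Int.cast_mul, latSign_sq, Int.cast_one]
    norm_num
    rw [smul_smul, hs]
    simp
  · rw [h]; norm_num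
  · rw [h]
    have hs : ((latSign C a c : ℤ) : K) * (latSign C a c : K) = 1 := by
      rw [← Int.cast_mul, latSign_sq, Int.cast_one]
    norm_num
    rw [smul_smul, hs]
    simp
  · have : c = a := by
      have := (e1.mpr h); exact (neg_add_eq_zero.mp this).symm
    subst this
    rw [h]
    norm_num

lemma jac_eee_of_sum_eq_zero {a b c : Fin n → ℤ} (ha : latForm C a a = 2)
    (hb : latForm C b b = 2) (hc : latForm C c c = 2) (h : a + b + c = 0) :
    jac (e K C a) (e K C b) (e K C c) = 0 := by
  have p1 : latForm C a b + latForm C a c = -2 := by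
    have := congrArg (latForm C a) h
    rw [latForm_add_right, latForm_add_right, ha] at this
    simp [latForm] at this ⊢; linarith
  have p2 : latForm C a b + latForm C b c = -2 := by
    have := congrArg (latForm C b) h
    rw [latForm_add_right, latForm_add_right, hb, latForm_comm b a] at this
    simp [latForm] at this ⊢; linarith
  have p3 : latForm C a c + latForm C b c = -2 := by
    have := congrArg (latForm C c) h
    rw [latForm_add_right, latForm_add_right, hc, latForm_comm c a, latForm_comm c b] at this
    simp [latForm] at this ⊢; linarith
  have q1 : latForm C a b = -1 := by linarith
  have q2 : latForm C a c = -1 := by linarith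
  have q3 : latForm C b c = -1 := by linarith
  have h1 : a + b ≠ 0 := by rw [Ne, add_eq_zero_iff_latForm ha hb, q1]; norm_num
  have h2 : b + c ≠ 0 := by rw [Ne, add_eq_zero_iff_latForm hb hc, q3]; norm_num
  have h3 : c + a ≠ 0 := by rw [Ne, add_eq_zero_iff_latForm hc ha, latForm_comm, q2]; norm_num
  have hcc : c = -(a + b) := (neg_eq_of_add_eq_zero_right h).symm
  have s1 : latSign C b c = latSign C a b := by
    rw [hcc, latSign_neg_right, latSign_add_right, latSign_self hb, latSign_swap a b, q1]
    simp
  have s2 : latSign C c a = latSign C a b := by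
    rw [hcc, latSign_neg_left, latSign_add_left, latSign_self ha, latSign_swap a b, q1]
    simp
  have k1 : a + (b + c) = 0 := by rw [← h]; abel
  have k2 : b + (c + a) = 0 := by rw [← h]; abel
  have k3 : c + (a + b) = 0 := by rw [← h]; abel
  rw [jac, double_bracket hb hc ha, double_bracket hc ha hb, double_bracket ha hb hc, if_neg h1,
    if_neg h2, if_neg h3, if_pos q1, if_pos q3,
    if_pos (show latForm C c a = -1 by rw [latForm_comm, q2]), if_pos k1, if_pos k2, if_pos k3, s1, s2]
  have hi : ∀ i, (a i : K) + b i + c i = 0 := fun i => by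
    have := congrArg (Int.cast : ℤ → K) (congrFun h i)
    simpa using this
  ext i
  · simp only [add_cart, smul_cart, neg_cart, Pi.add_apply, Pi.smul_apply, Pi.neg_apply, H,
      smul_eq_mul, zero_cart, Pi.zero_apply]
    linear_combination (-(latSign C a b : K)) * hi i
  · simp [H]

lemma jac_eee {a b c : Fin n → ℤ} (ha : latForm C a a = 2)
    (hb : latForm C b b = 2) (hc : latForm C c c = 2) :
    jac (e K C a) (e K C b) (e K C c) = 0 := by
  by_cases h1 : a + b = 0
  · exact jac_eee_of_add_eq_zero ha hb hc h1
  by_cases h2 : b + c = 0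
  · rw [jac_cyc]; exact jac_eee_of_add_eq_zero hb hc ha h2
  by_cases h3 : c + a = 0
  · rw [jac_cyc, jac_cyc]; exact jac_eee_of_add_eq_zero hc ha hb h3
  by_cases h4 : a + b + c = 0
  · exact jac_eee_of_sum_eq_zero ha hb hc h4
  have ea : a + (b + c) = a + b + c := by abel
  have eb : b + (c + a) = a + b + c := by abel
  have ec : c + (a + b) = a + b + c := by abel
  rw [jac, double_bracket hb hc ha, double_bracket hc ha hb, double_bracket ha hb hc, if_neg h1,
    if_neg h2, if_neg h3, ea, eb, ec]
  simp only [if_neg h4]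
  have n1 := latForm_ge ha hb
  have n2 := latForm_ge hb hc
  have n3 := latForm_ge hc ha
  rw [add_eq_zero_iff_latForm ha hb] at h1
  rw [add_eq_zero_iff_latForm hb hc] at h2
  rw [add_eq_zero_iff_latForm hc ha] at h3
  by_cases hN : latForm C (a + b + c) (a + b + c) = 2
  · have hsum : latForm C a b + latForm C b c + latForm C c a = -2 := by
      simp only [latForm_add_left, latForm_add_right, ha, hb, hc, latForm_comm b a,
        latForm_comm c b, latForm_comm a c] at hN
      linarith
    have t1 : (latSign C b a : ℤ) = _ := latSign_swap a b
    have t2 : (latSign C c b : ℤ) = _ := latSign_swap b c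
    have t3 : (latSign C a c : ℤ) = _ := latSign_swap c a
    obtain ⟨r1, r2, r3⟩ | ⟨r1, r2, r3⟩ | ⟨r1, r2, r3⟩ :
      (latForm C a b = -1 ∧ latForm C b c = -1 ∧ latForm C c a = 0) ∨
      (latForm C a b = -1 ∧ latForm C b c = 0 ∧ latForm C c a = -1) ∨
      (latForm C a b = 0 ∧ latForm C b c = -1 ∧ latForm C c a = -1) := by omega
    all_goals
      rw [r1] at t1; rw [r2] at t2; rw [r3] at t3
      simp only [r1, r2, r3, t1, t2, t3]
      simp
      try module
  · simp [e_eq_zero hN]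

lemma jac_eq_zero (x y z : LatticeLie K C) : jac x y z = 0 := by
  have add2 : ∀ a b y z : LatticeLie K C, jac y (a + b) z = jac y a z + jac y b z := by
    intro a b y z; rw [jac_cyc, jac_add, ← jac_cyc y a z, ← jac_cyc y b z]
  have add3 : ∀ a b y z : LatticeLie K C, jac y z (a + b) = jac y z a + jac y z b := by
    intro a b y z; rw [← jac_cyc, jac_add, jac_cyc a, jac_cyc b]
  have smul2 : ∀ (c : K) (a y z : LatticeLie K C), jac y (c • a) z = c • jac y a z := by
    intro c a y z; rw [jac_cyc, jac_smul, ← jac_cyc y a z]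
  have smul3 : ∀ (c : K) (a y z : LatticeLie K C), jac y z (c • a) = c • jac y z a := by
    intro c a y z; rw [← jac_cyc, jac_smul, jac_cyc a]
  induction x using induction_gen with
  | hadd a b ha hb => rw [jac_add, ha, hb, add_zero]
  | hsmul c a ha => rw [jac_smul, ha, smul_zero]
  | hH h =>
    induction y using induction_gen with
    | hadd a b ha hb => rw [add2, ha, hb, add_zero]
    | hsmul c a ha => rw [smul2, ha, smul_zero]
    | hH h' =>
      induction z using induction_gen with
      | hadd a b ha hb => rw [add3, ha, hb, add_zero]
      | hsmul c a ha => rw [smul3, ha, smul_zero]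
      | hH h'' => exact jac_HHH _ _ _
      | he v hv => exact jac_HHe _ _ _
    | he v hv =>
      induction z using induction_gen with
      | hadd a b ha hb => rw [add3, ha, hb, add_zero]
      | hsmul c a ha => rw [smul3, ha, smul_zero]
      | hH h'' => rw [← jac_cyc]; exact jac_HHe _ _ _
      | he w hw => exact jac_Hee _ hv hw
  | he u hu =>
    induction y using induction_gen with
    | hadd a b ha hb => rw [add2, ha, hb, add_zero]
    | hsmul c a ha => rw [smul2, ha, smul_zero]
    | hH h' =>
      induction z using induction_gen with
      | hadd a b ha hb => rw [add3, ha, hb, add_zero]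
      | hsmul c a ha => rw [smul3, ha, smul_zero]
      | hH h'' => rw [jac_cyc]; exact jac_HHe _ _ _
      | he v hv => rw [jac_cyc]; exact jac_Hee _ hv hu
    | he v hv =>
      induction z using induction_gen with
      | hadd a b ha hb => rw [add3, ha, hb, add_zero]
      | hsmul c a ha => rw [smul3, ha, smul_zero]
      | hH h'' => rw [← jac_cyc]; exact jac_Hee _ hu hv
      | he w hw => exact jac_eee hu hv hw

noncomputable instance [CharZero K] : LieRing (LatticeLie K C) where
  bracket := bracket
  add_lie := bracket_add_left
  lie_add := bracket_add_right
  lie_self x := by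
    have h : bracket x x = -bracket x x := bracket_antisymm x x
    have h2 : (2 : K) • bracket x x = 0 := by
      rw [two_smul]; nth_rewrite 1 [h]; simp
    exact (smul_eq_zero.mp h2).resolve_left two_ne_zero
  leibniz_lie x y z := by
    have h := jac_eq_zero x y z
    change bracket x (bracket y z) = bracket (bracket x y) z + bracket y (bracket x z)
    rw [bracket_antisymm (bracket x y) z, bracket_antisymm x z, bracket_neg_right]
    rw [jac, add_assoc] at h
    rw [eq_neg_of_add_eq_zero_left h]; abel

noncomputable instance [CharZero K] {R : Type*} [CommRing R] [Algebra R K] :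
    LieAlgebra R (LatticeLie K C) where
  lie_smul c x y := bracket_smul_right c x y

lemma lie_def [CharZero K] (x y : LatticeLie K C) : ⁅x, y⁆ = bracket x y := rfl

end Bracket

section RealForm

variable {C : Matrix (Fin n) (Fin n) ℤ}

/-- The conjugate-linear map with `αᵢ ↦ -αᵢ` and `e_α ↦ (-1)^{p(α)} e_{-α}`, where `p(α)` is the
coefficient of `α` at the simple root number `k`. -/
noncomputable def conj (k : Fin n) (x : LatticeLie ℂ C) : LatticeLie ℂ C where
  cart i := -(starRingEnd ℂ) (x.cart i)
  root a := ((a.1 k).negOnePow : ℤ) * (starRingEnd ℂ) (coeff x (-a.1))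

lemma coeff_conj (k : Fin n) (x : LatticeLie ℂ C) (v : Fin n → ℤ) :
    coeff (conj k x) v = ((v k).negOnePow : ℤ) * (starRingEnd ℂ) (coeff x (-v)) := by
  have h : (-v) ⬝ᵥ C *ᵥ (-v) = v ⬝ᵥ C *ᵥ v := by simp [mulVec_neg]
  by_cases hv : v ⬝ᵥ C *ᵥ v = 2
  · simp [coeff, hv, conj]
  · simp [coeff, hv, h]

variable [IsSimplyLacedCartan C]

/-- The negative of a root. -/
def negRoot : LatticeRoot C ≃ LatticeRoot C where
  toFun a := ⟨-a.1, by simpa [mulVec_neg] using a.2⟩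
  invFun a := ⟨-a.1, by simpa [mulVec_neg] using a.2⟩
  left_inv a := by simp
  right_inv a := by simp

lemma conj_lie (k : Fin n) (x y : LatticeLie ℂ C) : conj k ⁅x, y⁆ = ⁅conj k x, conj k y⁆ := by
  have hc : ∀ (x : LatticeLie ℂ C) (a : LatticeRoot C), coeff x a.1 = x.root a := fun x a => by
    simp [coeff, a.2]
  have hsq : ∀ m : ℤ, ((m.negOnePow : ℤ) : ℂ) * ((m.negOnePow : ℤ) : ℂ) = 1 := fun m => by
    rw [← Int.cast_mul, ← Units.val_mul, ← Int.negOnePow_add, Int.negOnePow_even _ ⟨_, rfl⟩]; simp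
  have hroot : ∀ (x : LatticeLie ℂ C) (a : LatticeRoot C), coeff x (-a.1) = x.root (negRoot a) :=
    fun x a => hc x (negRoot a)
  ext i
  · simp only [lie_def, bracket, coeff_conj, neg_neg]
    simp only [conj, map_neg, map_sum, map_mul, neg_neg, map_intCast]
    rw [← Finset.sum_neg_distrib, ← Equiv.sum_comp negRoot]
    refine Finset.sum_congr rfl fun a _ => ?_
    have e1 : (negRoot a).1 = -a.1 := rfl
    simp only [e1, hroot, neg_neg, hc, Pi.neg_apply, Int.negOnePow_neg]
    push_cast
    linear_combination ((starRingEnd ℂ) (x.root (negRoot a)) * (starRingEnd ℂ) (y.root a) *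
      (a.1 i : ℂ)) * hsq (a.1 k)
  · have hp : ∀ h : Fin n → ℂ, pair C (fun j => -(starRingEnd ℂ) (h j)) i.1 =
        (starRingEnd ℂ) (pair C h (negRoot i).1) := fun h => by
      simp [pair, negRoot, mulVec_neg]
    have hcj : ∀ z : LatticeLie ℂ C, (conj k z).cart = fun j => -(starRingEnd ℂ) (z.cart j) :=
      fun _ => rfl
    have hrj : ∀ (z : LatticeLie ℂ C) (a : LatticeRoot C), (conj k z).root a =
      ((a.1 k).negOnePow : ℤ) * (starRingEnd ℂ) (z.root (negRoot a)) := fun z a => by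
      rw [← hroot]; rfl
    simp only [hrj, lie_def]
    simp only [bracket, coeff_conj, hcj, hrj, hp, map_add, map_sub, map_mul, map_sum,
      mul_add, mul_sub, Finset.mul_sum,
      map_intCast]
    congr 1
    · ring
    · rw [← Equiv.sum_comp negRoot]
      refine Finset.sum_congr rfl fun a _ => ?_
      have e1 : (negRoot a).1 = -a.1 := rfl
      have e2 : (negRoot i).1 = -i.1 := rfl
      have e3 : -i.1 - -a.1 = -(i.1 - a.1) := by abel
      have e6 : ((((i.1 - a.1) k).negOnePow : ℤ) : ℂ) * (((a.1 k).negOnePow : ℤ) : ℂ) =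
          (((i.1 k).negOnePow : ℤ) : ℂ) := by
        rw [← Int.cast_mul, ← Units.val_mul, ← Int.negOnePow_add]
        simp
      simp only [e1, e2, e3, latSign_neg_left, latSign_neg_right]
      linear_combination (-(latSign C a.1 (i.1 - a.1) : ℂ) * (starRingEnd ℂ) (x.root (negRoot a)) *
        (starRingEnd ℂ) (coeff y (-(i.1 - a.1)))) * e6

/-- The real form of the complex simply laced Lie algebra fixed by the conjugation `conj k`.  The
elements `i αⱼ` span a compact Cartan subalgebra, and the root `α` is noncompact if and only if its
coefficient at the simple root number `k` is odd: this is the real form whose Vogan diagram is the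
Dynkin diagram with trivial automorphism and the vertex `k` painted. -/
noncomputable def realForm (C : Matrix (Fin n) (Fin n) ℤ) [IsSimplyLacedCartan C] (k : Fin n) :
    LieSubalgebra ℝ (LatticeLie ℂ C) where
  carrier := {x | conj k x = x}
  add_mem' {x y} hx hy := by
    have : conj k (x + y) = conj k x + conj k y := by
      ext i
      · simp [conj]; ring
      · simp [conj, coeff_add, mul_add]
    rw [Set.mem_ofPred_eq] at *
    rw [this, hx, hy]
  zero_mem' := by
    rw [Set.mem_ofPred_eq]
    ext i <;> simp [conj, coeff]
  smul_mem' c x hx := by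
    have : conj k (c • x) = c • conj k x := by
      ext i
      · simp [conj]
      · simp [conj, coeff_smul]; ring
    rw [Set.mem_ofPred_eq] at *
    rw [this, hx]
  lie_mem' {x y} hx hy := by
    change conj k ⁅x, y⁆ = ⁅x, y⁆
    rw [conj_lie, show conj k x = x from hx, show conj k y = y from hy]

end RealForm

end LatticeLie

end LatticeLie

instance : IsSimplyLacedCartan CartanMatrix.E₆ where
  symm i j := (CartanMatrix.E₆_isSymm.apply j i)
  diag := CartanMatrix.E₆_diag
  coercive := by
    refine ⟨100, fun x => ?_⟩
    simp [CartanMatrix.E₆, dotProduct, mulVec, Fin.sum_univ_succ]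
    nlinarith [sq_nonneg ((199) * x 0 + (-100) * x 2),
      sq_nonneg ((199) * x 1 + (-100) * x 3),
      sq_nonneg ((29601) * x 2 + (-19900) * x 3),
      sq_nonneg ((480209201) * x 3 + (-589059900) * x 4),
      sq_nonneg ((36655640999) * x 4 + (-48020920100) * x 5),
      sq_nonneg ((1) * x 5)]

instance : IsSimplyLacedCartan CartanMatrix.E₇ where
  symm i j := (CartanMatrix.E₇_isSymm.apply j i)
  diag := CartanMatrix.E₇_diag
  coercive := by
    refine ⟨100, fun x => ?_⟩
    simp [CartanMatrix.E₇, dotProduct, mulVec, Fin.sum_univ_succ]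
    nlinarith [sq_nonneg ((199) * x 0 + (-100) * x 2),
      sq_nonneg ((199) * x 1 + (-100) * x 3),
      sq_nonneg ((29601) * x 2 + (-19900) * x 3),
      sq_nonneg ((480209201) * x 3 + (-589059900) * x 4),
      sq_nonneg ((36655640999) * x 4 + (-48020920100) * x 5),
      sq_nonneg ((2492380548801) * x 5 + (-3665564099900) * x 6),
      sq_nonneg ((1) * x 6)]

instance : IsSimplyLacedCartan CartanMatrix.E₈ where
  symm i j := (CartanMatrix.E₈_isSymm.apply j i)
  diag := CartanMatrix.E₈_diag
  coercive := by
    refine ⟨100, fun x => ?_⟩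
    simp [CartanMatrix.E₈, dotProduct, mulVec, Fin.sum_univ_succ]
    nlinarith [sq_nonneg ((199) * x 0 + (-100) * x 2),
      sq_nonneg ((199) * x 1 + (-100) * x 3),
      sq_nonneg ((29601) * x 2 + (-19900) * x 3),
      sq_nonneg ((480209201) * x 3 + (-589059900) * x 4),
      sq_nonneg ((36655640999) * x 4 + (-48020920100) * x 5),
      sq_nonneg ((2492380548801) * x 5 + (-3665564099900) * x 6),
      sq_nonneg ((129427319221399) * x 6 + (-249238054880100) * x 7),
      sq_nonneg ((1) * x 7)]

/-! ### The real Lie algebras -/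

attribute [local instance 100] LieRing.ofAssociativeRing

/-- The real Lie algebra `su(p, q)` of traceless complex matrices that are skew-Hermitian with
respect to the Hermitian form with `p` signs `+` and `q` signs `-`. -/
noncomputable def su (p q : ℕ) : LieSubalgebra ℝ (Matrix (Fin p ⊕ Fin q) (Fin p ⊕ Fin q) ℂ) where
  carrier := {A | Aᴴ * LieAlgebra.Orthogonal.indefiniteDiagonal (Fin p) (Fin q) ℂ =
      -(LieAlgebra.Orthogonal.indefiniteDiagonal (Fin p) (Fin q) ℂ * A) ∧ A.trace = 0}
  add_mem' {A B} hA hB := by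
    refine ⟨?_, by rw [trace_add, hA.2, hB.2, add_zero]⟩
    rw [conjTranspose_add, add_mul, mul_add, hA.1, hB.1, neg_add]
  zero_mem' := by simp
  smul_mem' c A hA := by
    refine ⟨?_, by rw [trace_smul, hA.2, smul_zero]⟩
    rw [conjTranspose_smul, smul_mul_assoc, mul_smul_comm, hA.1, star_trivial, smul_neg]
  lie_mem' {A B} hA hB := by
    have h1 : Aᴴ * LieAlgebra.Orthogonal.indefiniteDiagonal (Fin p) (Fin q) ℂ = _ := hA.1
    have h2 : Bᴴ * LieAlgebra.Orthogonal.indefiniteDiagonal (Fin p) (Fin q) ℂ = _ := hB.1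
    refine ⟨?_, by rw [Ring.lie_def, trace_sub, trace_mul_comm, sub_self]⟩
    rw [Ring.lie_def, conjTranspose_sub, conjTranspose_mul, conjTranspose_mul, sub_mul, mul_assoc,
      mul_assoc, h1, h2, mul_neg, mul_neg, ← mul_assoc, ← mul_assoc, h1, h2, mul_sub, neg_mul,
      neg_mul, mul_assoc, mul_assoc]
    abel

/-- The real Lie algebra `so(p, q)`. -/
abbrev soReal (p q : ℕ) : LieSubalgebra ℝ (Matrix (Fin p ⊕ Fin q) (Fin p ⊕ Fin q) ℝ) :=
  LieAlgebra.Orthogonal.so' (Fin p) (Fin q) ℝ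

/-- The split real form `E_{8|8}`. -/
abbrev E8split : Type := LatticeLie ℝ CartanMatrix.E₈

/-- The real form `E_{7|-5}` (type EVI): the vertex painted in the Vogan diagram is the end of the
branch of length two, i.e. the one adjacent to the affine vertex. -/
noncomputable abbrev E7minus5 : LieSubalgebra ℝ (LatticeLie ℂ CartanMatrix.E₇) :=
  LatticeLie.realForm CartanMatrix.E₇ 0

/-- The real form `E_{6|-14}` (type EIII): the vertex painted in the Vogan diagram is the end of
a branch of length two. -/
noncomputable abbrev E6minus14 : LieSubalgebra ℝ (LatticeLie ℂ CartanMatrix.E₆) :=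
  LatticeLie.realForm CartanMatrix.E₆ 0

/-- The character of a real Lie algebra: the signature (number of positive minus number of negative
directions) of its Killing form.  It is the number `s` in the notation `X_{n|s}`. -/
noncomputable def killingSignature (L : Type*) [LieRing L] [LieAlgebra ℝ L] : ℤ :=
  (sigPos (killingForm ℝ L).toQuadraticMap : ℤ) - sigNeg (killingForm ℝ L).toQuadraticMap

/-! ### The symmetry algebras in three dimensions -/

/-- Toroidal reduction to `D = 3` of pure `N = 1` supergravity in `D = 4`. -/
abbrev U3_N1 := LieAlgebra.SpecialLinear.sl (Fin 2) ℝ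
/-- Toroidal reduction to `D = 3` of pure `N = 2` supergravity in `D = 4`. -/
noncomputable abbrev U3_N2 := su 2 1
/-- Toroidal reduction to `D = 3` of pure `N = 3` supergravity in `D = 4`. -/
noncomputable abbrev U3_N3 := su 4 1
/-- Toroidal reduction to `D = 3` of `N = 4` supergravity in `D = 4` with `k` Maxwell
multiplets. -/
abbrev U3_N4 (k : ℕ) := soReal 8 (k + 2)
/-- Toroidal reduction to `D = 3` of pure `N = 5` supergravity in `D = 4`. -/
noncomputable abbrev U3_N5 := E6minus14
/-- Toroidal reduction to `D = 3` of pure `N = 6` supergravity in `D = 4`. -/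
noncomputable abbrev U3_N6 := E7minus5
/-- Toroidal reduction to `D = 3` of pure `N = 8` supergravity in `D = 4`. -/
abbrev U3_N8 := E8split

/-! ### Root sets and Cartan matrices

All Cartan matrices below follow the convention `A i j = 2 (αᵢ|αⱼ) / (αᵢ|αᵢ) = αⱼ(αᵢ^∨)`; Mathlib's
matrices `CartanMatrix.X` follow the transposed convention `2 (αᵢ|αⱼ) / (αⱼ|αⱼ)`. -/

section CartanMatrices

variable {ι : Type*} [Fintype ι] [DecidableEq ι]

/-- The closure of a set of vectors (given by their coefficients with respect to the simple roots)
under the simple reflections `v ↦ v - ⟨v, αᵢ^∨⟩ αᵢ`. -/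
inductive WeylClosure (X : Matrix ι ι ℤ) (S : Set (ι → ℤ)) : (ι → ℤ) → Prop
  | base (v : ι → ℤ) (hv : v ∈ S) : WeylClosure X S v
  | reflect (v : ι → ℤ) (i : ι) (hv : WeylClosure X S v) :
      WeylClosure X S (v - Pi.single i (∑ j, X i j * v j))

/-- The root system of a finite type Cartan matrix, in coordinates with respect to the simple
roots. -/
def finiteRoots (X : Matrix ι ι ℤ) : Set (ι → ℤ) :=
  {v | WeylClosure X {w | ∃ i, w = Pi.single i 1} v}

/-- The nonreduced root system `bc_r`, in coordinates with respect to the simple roots, which are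
those of `b_r`, the last one being short: the Weyl group images of the simple roots and of twice the
short simple root. -/
def bcRoots (r : ℕ) : Set (Fin r → ℤ) :=
  {v | WeylClosure (CartanMatrix.B r)ᵀ
    {w | (∃ i, w = Pi.single i 1) ∨ ∃ i : Fin r, (i : ℕ) + 1 = r ∧ w = Pi.single i 2} v}

/-- `E` is the Cartan matrix of the untwisted affine extension of the finite type Cartan matrix `X`:
the additional root `none` is `α₀ = δ - ϑ` with `ϑ` the highest root, so that
`(α₀|α₀) = (ϑ|ϑ)` and `(α₀|αᵢ) = -(ϑ|αᵢ)`.  Here `(αᵢ|αⱼ) = d i * X i j`. -/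
def IsUntwistedAffineExtension (X : Matrix ι ι ℤ) (E : Matrix (Option ι) (Option ι) ℤ) : Prop :=
  ∃ (d : ι → ℤ) (ϑ : ι → ℤ), (∀ i, 0 < d i) ∧ (∀ i j, d i * X i j = d j * X j i) ∧
    ϑ ∈ finiteRoots X ∧ (∀ v ∈ finiteRoots X, ∀ i, v i ≤ ϑ i) ∧
    (∀ i j, E (some i) (some j) = X i j) ∧ E none none = 2 ∧
    (∀ i, E (some i) none = -∑ j, X i j * ϑ j) ∧
    (∀ i, (∑ k, ∑ j, ϑ k * (d k * X k j) * ϑ j) * E none (some i) =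
      -2 * ∑ k, ϑ k * (d k * X k i))

/-- The Lorentzian extension of the affine Cartan matrix `E`: an overextended root `none` is attached
to the root `a` by a single line. -/
def lorentzianExtension (E : Matrix ι ι ℤ) (a : ι) : Matrix (Option ι) (Option ι) ℤ
  | some i, some j => E i j
  | none, none => 2
  | none, some j => if j = a then -1 else 0
  | some i, none => if i = a then -1 else 0

/-- `A` is the Cartan matrix of the overextension `X^∧∧` of the finite type Cartan matrix `X`: the
overextended root is attached to the affine root of the untwisted affine extension `X^∧`. -/
def IsOverextension (X : Matrix ι ι ℤ) (A : Matrix (Option (Option ι)) (Option (Option ι)) ℤ) :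
    Prop :=
  ∃ E, IsUntwistedAffineExtension X E ∧ A = lorentzianExtension E none

/-- The Cartan matrix of the twisted affine algebra `A₂⁽²⁾`; the longest root, which is the root with
label `1`, is the last one. -/
def twistedA2 : Matrix (Fin 2) (Fin 2) ℤ :=
  !![ 2, -4;
     -1,  2]

/-- The Cartan matrix of the twisted affine algebra `A₄⁽²⁾`; the longest root, which is the root with
label `1`, is the last one. -/
def twistedA4 : Matrix (Fin 3) (Fin 3) ℤ :=
  !![ 2, -2,  0;
     -1,  2, -2;
      0, -1,  2]

/-- The Cartan matrix of the Lorentzian extension `A₂⁽²⁾^∧`. -/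
def twistedA2Ext : Matrix (Option (Fin 2)) (Option (Fin 2)) ℤ := lorentzianExtension twistedA2 1

/-- The Cartan matrix of the Lorentzian extension `A₄⁽²⁾^∧`. -/
def twistedA4Ext : Matrix (Option (Fin 3)) (Option (Fin 3)) ℤ := lorentzianExtension twistedA4 2

/-- `A` is a generalized Cartan matrix of hyperbolic type: it is indecomposable, symmetrizable and of
indefinite type, and all its proper subdiagrams have components of finite or affine type.  A connected
diagram is of finite or affine type if `A u ≥ 0` for some `u > 0`, and of indefinite type if `A u < 0`
for some `u > 0`. -/
structure IsHyperbolicGCM (A : Matrix ι ι ℤ) : Prop where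
  diag : ∀ i, A i i = 2
  nonpos : ∀ i j, i ≠ j → A i j ≤ 0
  zero_symm : ∀ i j, A i j = 0 → A j i = 0
  symmetrizable : ∃ d : ι → ℝ, (∀ i, 0 < d i) ∧ ∀ i j, d i * A i j = d j * A j i
  indecomposable : ∀ S : Finset ι, S.Nonempty → S ≠ Finset.univ → ∃ i ∈ S, ∃ j ∉ S, A i j ≠ 0
  indefinite : ∃ u : ι → ℝ, (∀ i, 0 < u i) ∧ ∀ i, ∑ j, A i j * u j < 0
  proper : ∀ S : Finset ι, S ≠ Finset.univ →
    ∃ u : ι → ℝ, (∀ i ∈ S, 0 < u i) ∧ ∀ i ∈ S, 0 ≤ ∑ j ∈ S, A i j * u j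

/-- A realization of the generalized Cartan matrix `A`: linearly independent simple roots `α i` in
`V*` and linearly independent simple coroots `αv i` in `V` with `αⱼ(αᵢ^∨) = A i j`, in a space of
dimension `2 n - rank A`.  The space `V` is the (split real) Cartan subalgebra of the Kac-Moody
algebra with Cartan matrix `A`. -/
structure IsRealization {V : Type*} [AddCommGroup V] [Module ℝ V] (A : Matrix ι ι ℤ)
    (α : ι → Dual ℝ V) (αv : ι → V) : Prop where
  independent_roots : LinearIndependent ℝ α
  independent_coroots : LinearIndependent ℝ αv
  apply_coroot : ∀ i j, α j (αv i) = A i j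
  dim : finrank ℝ V + (A.map (Int.cast : ℤ → ℝ)).rank = 2 * Fintype.card ι

/-- The fundamental Weyl chamber. -/
def fundamentalChamber {V : Type*} [AddCommGroup V] [Module ℝ V] (α : ι → Dual ℝ V) : Set V :=
  {x | ∀ i, 0 ≤ α i x}

end CartanMatrices

/-! ### Simple systems -/

section SimpleSystems

variable {V : Type*} [AddCommGroup V] [Module ℝ V]

/-- `Δ` is a system of simple roots of the (possibly nonreduced) root system `Φ`. -/
structure IsSimpleSystem (Φ Δ : Set V) : Prop where
  subset : Δ ⊆ Φ
  independent : LinearIndepOn ℝ id Δ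
  pos_or_neg : ∀ v ∈ Φ, v ∈ AddSubmonoid.closure Δ ∨ -v ∈ AddSubmonoid.closure Δ

/-- `ϑ` is the highest root of `Φ` with respect to the simple roots `Δ`. -/
def IsHighestRoot (Φ Δ : Set V) (ϑ : V) : Prop :=
  ϑ ∈ Φ ∧ ∀ v ∈ Φ, ϑ - v ∈ AddSubmonoid.closure Δ

end SimpleSystems

/-! ### Restricted roots -/

section Restricted

variable {L : Type*} [LieRing L] [LieAlgebra ℝ L]

/-- A Cartan involution: an involutive automorphism `θ` such that `-B(x, θ x)` is positive definite,
where `B` is the Killing form. -/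
structure IsCartanInvolution (θ : L ≃ₗ⁅ℝ⁆ L) : Prop where
  involutive : ∀ x, θ (θ x) = x
  pos : ∀ x, x ≠ 0 → 0 < -killingForm ℝ L x (θ x)

/-- The `-1` eigenspace of `θ`, the noncompact part of the Cartan decomposition. -/
def noncompactPart (θ : L ≃ₗ⁅ℝ⁆ L) : Submodule ℝ L where
  carrier := {x | θ x = -x}
  add_mem' {x y} hx hy := by
    have h1 : θ x = -x := hx
    have h2 : θ y = -y := hy
    change θ (x + y) = -(x + y)
    rw [map_add, h1, h2, neg_add]
  zero_mem' := by simp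
  smul_mem' c x hx := by
    have h1 : θ x = -x := hx
    change θ (c • x) = -(c • x)
    rw [map_smul, h1, smul_neg]

/-- The simultaneous eigenspace with eigenvalue `l` of the operators `ad h`, `h ∈ 𝔞`. -/
def restrictedRootSpace (𝔞 : Submodule ℝ L) (l : Dual ℝ 𝔞) : Submodule ℝ L where
  carrier := {x | ∀ h : 𝔞, ⁅(h : L), x⁆ = l h • x}
  add_mem' {x y} hx hy h := by rw [lie_add, hx h, hy h, smul_add]
  zero_mem' h := by simp
  smul_mem' c x hx h := by rw [lie_smul, hx h, smul_comm]

/-- The restricted roots: the nonzero `l` with nonzero eigenspace. -/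
def restrictedRoots (𝔞 : Submodule ℝ L) : Set (Dual ℝ 𝔞) :=
  {l | l ≠ 0 ∧ restrictedRootSpace 𝔞 l ≠ ⊥}

variable (L) in
/-- The choices that enter the Iwasawa decomposition: a Cartan involution, a maximal abelian subspace
`𝔞` of its noncompact part (the noncompact part of a maximally noncompact Cartan subalgebra), and a
system of simple restricted roots. -/
structure IwasawaDatum where
  θ : L ≃ₗ⁅ℝ⁆ L
  isCartanInvolution : IsCartanInvolution θ
  𝔞 : Submodule ℝ L
  maximal : Maximal (fun U : Submodule ℝ L =>
    U ≤ noncompactPart θ ∧ ∀ x ∈ U, ∀ y ∈ U, ⁅x, y⁆ = 0) 𝔞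
  simple : Set (Dual ℝ 𝔞)
  isSimpleSystem : IsSimpleSystem (restrictedRoots 𝔞) simple

namespace IwasawaDatum

variable (D : IwasawaDatum L)

/-- The restricted root system. -/
def roots : Set (Dual ℝ D.𝔞) := restrictedRoots D.𝔞

/-- The positive restricted roots. -/
def positiveRoots : Set (Dual ℝ D.𝔞) := {l ∈ D.roots | l ∈ AddSubmonoid.closure D.simple}

/-- The Killing form restricted to `𝔞`. -/
noncomputable def killingOn : LinearMap.BilinForm ℝ D.𝔞 := (killingForm ℝ L).restrict D.𝔞

lemma killingOn_pos (x : D.𝔞) (hx : x ≠ 0) : 0 < D.killingOn x x := by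
  have h1 : D.θ x = -(x : L) := D.maximal.prop.1 x.2
  have h2 := D.isCartanInvolution.pos x (by simpa using hx)
  rw [h1] at h2
  simpa [killingOn] using h2

lemma killingOn_nondegenerate : D.killingOn.Nondegenerate := by
  constructor
  · intro x hx
    by_contra h
    exact (D.killingOn_pos x h).ne' (hx x)
  · intro x hx
    by_contra h
    exact (D.killingOn_pos x h).ne' (hx x)

/-! #### The maximal split subalgebra -/

/-- `𝔣` is a maximal split subalgebra: a semisimple `θ`-stable subalgebra in which `𝔞` is a split
Cartan subalgebra and whose roots with respect to `𝔞`, all with multiplicity one, are the restricted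
roots `l` such that `l / 2` is not a restricted root. -/
structure IsMaximalSplitSubalgebra (𝔣 : LieSubalgebra ℝ L) : Prop where
  isKilling : LieAlgebra.IsKilling ℝ 𝔣
  stable : ∀ x ∈ 𝔣, D.θ x ∈ 𝔣
  cartan : 𝔣.toSubmodule ⊓ restrictedRootSpace D.𝔞 0 = D.𝔞
  indivisible : ∀ l ∈ D.roots, (1 / 2 : ℝ) • l ∉ D.roots →
    finrank ℝ ↥(𝔣.toSubmodule ⊓ restrictedRootSpace D.𝔞 l) = 1
  divisible : ∀ l ∈ D.roots, (1 / 2 : ℝ) • l ∈ D.roots →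
    𝔣.toSubmodule ⊓ restrictedRootSpace D.𝔞 l = ⊥

/-- The roots of the subalgebra `𝔣` with respect to `𝔞`. -/
def rootsOf (𝔣 : LieSubalgebra ℝ L) : Set (Dual ℝ D.𝔞) :=
  {l | l ≠ 0 ∧ 𝔣.toSubmodule ⊓ restrictedRootSpace D.𝔞 l ≠ ⊥}

/-! #### The billiard of the coset model coupled to gravity in three dimensions -/

/-- The space of the logarithmic scale factors `β¹, β²` and of the dilatons `φ ∈ 𝔞`. -/
abbrev ScaleSpace : Type _ := (Fin 2 → ℝ) × D.𝔞

/-- The linear form `βⁱ` (`β 0` is `β¹` and `β 1` is `β²`). -/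
def β (i : Fin 2) : Dual ℝ D.ScaleSpace := LinearMap.proj i ∘ₗ LinearMap.fst ℝ (Fin 2 → ℝ) D.𝔞

/-- A linear form `l(φ)` in the dilatons. -/
def dil (l : Dual ℝ D.𝔞) : Dual ℝ D.ScaleSpace := l ∘ₗ LinearMap.snd ℝ (Fin 2 → ℝ) D.𝔞

/-- The derivative of a linear form with respect to `βⁱ`. -/
def derivβ (f : Dual ℝ D.ScaleSpace) (i : Fin 2) : ℝ := f (Pi.single i 1, 0)

/-- The restriction of a linear form to the dilatons. -/
def derivφ (f : Dual ℝ D.ScaleSpace) : Dual ℝ D.𝔞 := f ∘ₗ LinearMap.inr ℝ (Fin 2 → ℝ) D.𝔞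

/-- The wall forms: the electric walls `l(φ)` and the magnetic walls `βⁱ - l(φ)` of the axions, which
correspond to the positive restricted roots `l`, and the symmetry wall `β² - β¹`. -/
inductive IsWallForm : Dual ℝ D.ScaleSpace → Prop
  | electric (l : Dual ℝ D.𝔞) (hl : l ∈ D.positiveRoots) : IsWallForm (D.dil l)
  | magnetic (l : Dual ℝ D.𝔞) (hl : l ∈ D.positiveRoots) (i : Fin 2) :
      IsWallForm (D.β i - D.dil l)
  | symmetry : IsWallForm (D.β 1 - D.β 0)

/-- The billiard table. -/
def billiard : Set D.ScaleSpace := {x | ∀ w, D.IsWallForm w → 0 ≤ w x}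

/-- The dominant wall forms. -/
def dominantWalls (ϑ : Dual ℝ D.𝔞) : Set (Dual ℝ D.ScaleSpace) :=
  D.dil '' D.simple ∪ {D.β 0 - D.dil ϑ, D.β 1 - D.β 0}

/-! #### Scalar products and the identification of the billiard -/

variable [FiniteDimensional ℝ L]

/-- The scalar product on the dual of `𝔞` induced by the Killing form. -/
noncomputable def dualForm (l m : Dual ℝ D.𝔞) : ℝ :=
  l ((D.killingOn.toDual D.killingOn_nondegenerate).symm m)

/-- The set `Φ` of restricted roots, with the simple roots of `D`, is of the type given by the Cartan
matrix `X` and the set `R` of coefficient vectors of all roots. -/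
def HasType {ι : Type*} [Fintype ι] (Φ : Set (Dual ℝ D.𝔞)) (X : Matrix ι ι ℤ) (R : Set (ι → ℤ)) :
    Prop :=
  ∃ σ : ι ≃ D.simple,
    (∀ i j, 2 * D.dualForm (σ i) (σ j) / D.dualForm (σ i) (σ i) = X i j) ∧
    Φ = {l | ∃ c ∈ R, l = ∑ i, c i • (σ i : Dual ℝ D.𝔞)}

/-- The inverse of the metric `∑ (dβⁱ)² - (∑ dβⁱ)² + dφ²` on the space of scale factors, where `dφ²`
is the multiple of the Killing form for which the root `ϑ` has length squared `2`. -/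
noncomputable def inverseMetric (ϑ : Dual ℝ D.𝔞) (f g : Dual ℝ D.ScaleSpace) : ℝ :=
  ∑ i, D.derivβ f i * D.derivβ g i - (∑ i, D.derivβ f i) * (∑ i, D.derivβ g i) +
    2 / D.dualForm ϑ ϑ * D.dualForm (D.derivφ f) (D.derivφ g)

/-- The billiard is the fundamental Weyl chamber of the Kac-Moody algebra with Cartan matrix `A`: the
dominant wall forms, of which all wall forms are linear combinations with nonnegative integer
coefficients, are the simple roots `α` of a realization of `A` on the space of scale factors, whose
coroots are given by the metric, and the billiard is its fundamental Weyl chamber. -/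
def BilliardIsWeylChamber {κ : Type*} [Fintype κ] [DecidableEq κ] (A : Matrix κ κ ℤ) : Prop :=
  ∃ ϑ : Dual ℝ D.𝔞, IsHighestRoot D.roots D.simple ϑ ∧
    ∃ (α : κ → Dual ℝ D.ScaleSpace) (αv : κ → D.ScaleSpace),
      Set.range α = D.dominantWalls ϑ ∧
      (∀ i, D.IsWallForm (α i)) ∧
      (∀ w, D.IsWallForm w → w ∈ AddSubmonoid.closure (Set.range α)) ∧
      (∀ i f, f (αv i) = 2 * D.inverseMetric ϑ f (α i) / D.inverseMetric ϑ (α i) (α i)) ∧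
      IsRealization A α αv ∧
      D.billiard = fundamentalChamber α

end IwasawaDatum

variable (L) in
/-- A line of the table: whatever the choices in the Iwasawa decomposition of `L`, the restricted
root system has Cartan matrix `X` and roots `R`, there is a maximal split subalgebra and it is of type
`F`, and the billiard of the corresponding coset model coupled to gravity in three dimensions is the
fundamental Weyl chamber of the hyperbolic Kac-Moody algebra with Cartan matrix `A`. -/
structure IsTableLine [FiniteDimensional ℝ L] {ι ι' κ : Type*} [Fintype ι] [Fintype ι']
    [DecidableEq ι'] [Fintype κ] [DecidableEq κ] (X : Matrix ι ι ℤ) (R : Set (ι → ℤ))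
    (F : Matrix ι' ι' ℤ) (A : Matrix κ κ ℤ) : Prop where
  exists_datum : Nonempty (IwasawaDatum L)
  restricted : ∀ D : IwasawaDatum L, D.HasType D.roots X R
  split : ∀ D : IwasawaDatum L, ∃ 𝔣, D.IsMaximalSplitSubalgebra 𝔣 ∧
    D.HasType (D.rootsOf 𝔣) F (finiteRoots F)
  billiard : ∀ D : IwasawaDatum L, D.BilliardIsWeylChamber A
  hyperbolic : IsHyperbolicGCM A

variable (L) in
/-- A line of the table in the untwisted case: the restricted root system and the maximal split
subalgebra are of the reduced type `X`, and the Kac-Moody algebra is the overextension `X^∧∧`. -/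
def IsUntwistedTableLine [FiniteDimensional ℝ L] {ι : Type*} [Fintype ι] [DecidableEq ι]
    (X : Matrix ι ι ℤ) : Prop :=
  ∃ A, IsOverextension X A ∧ IsTableLine L X (finiteRoots X) X A

end Restricted

section CartanInvolution

variable {V : Type*} [AddCommGroup V] [Module ℝ V] [FiniteDimensional ℝ V]

/-- The inner product space core given by a positive definite symmetric bilinear form. -/
@[reducible] def coreOfForm (g : LinearMap.BilinForm ℝ V) (symm : ∀ x y, g x y = g y x)
    (pos : ∀ x, x ≠ 0 → 0 < g x x) : InnerProductSpace.Core ℝ V where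
  inner x y := g x y
  conj_inner_symm x y := by simp [symm x y]
  re_inner_nonneg x := by
    by_cases h : x = 0
    · simp [h]
    · simpa using (pos x h).le
  add_left x y z := by simp
  smul_left x y r := by simp
  definite x h := by
    by_contra hx
    exact (pos x hx).ne' h

lemma iSup_iInf_eigenspace_eq_top_of_form (g : LinearMap.BilinForm ℝ V)
    (symm : ∀ x y, g x y = g y x) (pos : ∀ x, x ≠ 0 → 0 < g x x) {ι : Type*} (T : ι → End ℝ V)
    (hT : ∀ i x y, g (T i x) y = g x (T i y)) (hc : ∀ i j, Commute (T i) (T j)) :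
    ⨆ χ : ι → ℝ, ⨅ i, End.eigenspace (T i) (χ i) = ⊤ := by
  let := (coreOfForm g symm pos).toNormedAddCommGroup
  let _ : InnerProductSpace ℝ V := InnerProductSpace.ofCore (coreOfForm g symm pos).toCore
  exact LinearMap.IsSymmetric.iSup_iInf_eq_top_of_commute (𝕜 := ℝ) (T := T)
    (fun i x y => hT i x y) (fun i j _ => hc i j)

lemma exists_basis_eigenvectors (g : LinearMap.BilinForm ℝ V)
    (symm : ∀ x y, g x y = g y x) (pos : ∀ x, x ≠ 0 → 0 < g x x) (T : End ℝ V)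
    (hT : ∀ x y, g (T x) y = g x (T y)) :
    ∃ (b : Basis (Fin (finrank ℝ V)) ℝ V) (c : Fin (finrank ℝ V) → ℝ), ∀ i, T (b i) = c i • b i := by
  let := (coreOfForm g symm pos).toNormedAddCommGroup
  let _ : InnerProductSpace ℝ V := InnerProductSpace.ofCore (coreOfForm g symm pos).toCore
  have h : T.IsSymmetric := fun x y => hT x y
  exact ⟨(h.eigenvectorBasis rfl).toBasis, h.eigenvalues rfl, fun i => by
    simp [h.apply_eigenvectorBasis rfl i]⟩

lemma trace_eq_sum_of_orthogonal {ι : Type*} [Fintype ι] [DecidableEq ι]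
    (g : LinearMap.BilinForm ℝ V) (b : Basis ι ℝ V) (hb : ∀ i j, i ≠ j → g (b i) (b j) = 0)
    (hb' : ∀ i, g (b i) (b i) ≠ 0) (T : End ℝ V) :
    LinearMap.trace ℝ V T = ∑ i, g (T (b i)) (b i) / g (b i) (b i) := by
  rw [LinearMap.trace_eq_matrix_trace ℝ b, Matrix.trace]
  refine Finset.sum_congr rfl fun i _ => ?_
  rw [Matrix.diag_apply, LinearMap.toMatrix_apply, eq_div_iff (hb' i)]
  conv_rhs => rw [← b.sum_repr (T (b i))]
  rw [map_sum, LinearMap.sum_apply, Finset.sum_eq_single i]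
  · simp
  · intro j _ hj; simp [hb j i hj]
  · simp

variable {L : Type*} [LieRing L] [LieAlgebra ℝ L] [FiniteDimensional ℝ L]

/-- An involution is a Cartan involution if it is so with respect to some invariant form. -/
lemma isCartanInvolution_of_form (θ : L ≃ₗ⁅ℝ⁆ L) (hθ : ∀ x, θ (θ x) = x)
    (β : LinearMap.BilinForm ℝ L) (symm : ∀ x y, β x y = β y x)
    (inv : ∀ x y z : L, β ⁅x, y⁆ z = -β y ⁅x, z⁆) (hβ : ∀ x y, β (θ x) (θ y) = β x y)
    (pos : ∀ x, x ≠ 0 → 0 < -β x (θ x)) (center : ∀ x : L, (∀ y : L, ⁅x, y⁆ = 0) → x = 0) :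
    IsCartanInvolution θ := by
  refine ⟨hθ, fun x hx => ?_⟩
  let g : LinearMap.BilinForm ℝ L := -(β.compl₂ (θ : L →ₗ[ℝ] L))
  have hg : ∀ x y, g x y = -β x (θ y) := fun x y => rfl
  have gsymm : ∀ x y, g x y = g y x := fun x y => by
    rw [hg, hg, ← hβ, hθ, symm]
  have gpos : ∀ x, x ≠ 0 → 0 < g x x := pos
  let := (coreOfForm g gsymm gpos).toNormedAddCommGroup
  let _ : InnerProductSpace ℝ L := InnerProductSpace.ofCore (coreOfForm g gsymm gpos).toCore
  let b := (stdOrthonormalBasis ℝ L)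
  have hb : ∀ i j, g (b.toBasis i) (b.toBasis j) = if i = j then 1 else 0 := fun i j => by
    simp only [OrthonormalBasis.coe_toBasis]
    exact orthonormal_iff_ite.mp b.orthonormal i j
  have had : ∀ y z : L, g ⁅x, y⁆ z = -g y ⁅θ x, z⁆ := fun y z => by
    rw [hg, hg, LieEquiv.map_lie, hθ, inv]
  have h1 : killingForm ℝ L x (θ x) = -∑ i, g ⁅θ x, b.toBasis i⁆ ⁅θ x, b.toBasis i⁆ := by
    rw [killingForm_apply_apply, trace_eq_sum_of_orthogonal g b.toBasis
      (fun i j h => by rw [hb, if_neg h]) (fun i => by rw [hb, if_pos rfl]; exact one_ne_zero),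
      ← Finset.sum_neg_distrib]
    refine Finset.sum_congr rfl fun i _ => ?_
    rw [hb, if_pos rfl, div_one]
    exact had _ _
  have gnn : ∀ z, 0 ≤ g z z := fun z => by
    by_cases h : z = 0
    · simp [h]
    · exact (gpos z h).le
  rw [h1, neg_neg]
  refine (Finset.sum_nonneg fun i _ => gnn _).lt_of_ne fun h0 => hx ?_
  have h2 := (Finset.sum_eq_zero_iff_of_nonneg (fun i _ => gnn ⁅θ x, b.toBasis i⁆)).mp h0.symm
  have h3 : ∀ i, ⁅θ x, b.toBasis i⁆ = 0 := fun i => by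
    by_contra h
    exact (gpos _ h).ne' (h2 i (Finset.mem_univ i))
  have h4 : (LieAlgebra.ad ℝ L (θ x)) = 0 := b.toBasis.ext fun i => by simpa using h3 i
  have h5 : θ x = 0 := center _ fun y => by
    have := LinearMap.congr_fun h4 y
    simpa using this
  rw [← hθ x, h5, map_zero]

/-! ### Conjugacy of Cartan involutions -/

lemma killingForm_lieEquiv (φ : L ≃ₗ⁅ℝ⁆ L) (x y : L) :
    killingForm ℝ L (φ x) (φ y) = killingForm ℝ L x y :=
  LieAlgebra.killingForm_of_equiv_apply φ x y

namespace IsCartanInvolution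

variable {θ θ' : L ≃ₗ⁅ℝ⁆ L}

/-- The inner product defined by a Cartan involution. -/
noncomputable def form (θ : L ≃ₗ⁅ℝ⁆ L) : LinearMap.BilinForm ℝ L :=
  -((killingForm ℝ L).compl₂ (θ : L →ₗ[ℝ] L))

lemma form_apply (x y : L) : form θ x y = -killingForm ℝ L x (θ y) := rfl

lemma killingForm_symm (x y : L) : killingForm ℝ L x y = killingForm ℝ L y x :=
  LieModule.traceForm_comm ℝ L L x y

lemma killingForm_lie (x y z : L) : killingForm ℝ L ⁅x, y⁆ z = -killingForm ℝ L y ⁅x, z⁆ := by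
  rw [← lie_skew, map_neg, LinearMap.neg_apply]
  exact congrArg _ (LieModule.traceForm_apply_lie_apply ℝ L L y x z)

lemma form_symm (h : IsCartanInvolution θ) (x y : L) : form θ x y = form θ y x := by
  rw [form_apply, form_apply, ← killingForm_lieEquiv θ x, h.involutive, killingForm_symm]

lemma form_pos (h : IsCartanInvolution θ) (x : L) (hx : x ≠ 0) : 0 < form θ x x := h.pos x hx

lemma form_lie (h : IsCartanInvolution θ) (x y z : L) :
    form θ ⁅x, y⁆ z = -form θ y ⁅θ x, z⁆ := by
  rw [form_apply, form_apply, LieEquiv.map_lie, h.involutive, killingForm_lie]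

/-- Any two Cartan involutions are conjugate. -/
theorem conjugate (h : IsCartanInvolution θ) (h' : IsCartanInvolution θ') :
    ∃ φ : L ≃ₗ⁅ℝ⁆ L, ∀ x, θ (φ x) = φ (θ' x) := by
  let N : End ℝ L := (θ : L →ₗ[ℝ] L) ∘ₗ (θ' : L →ₗ[ℝ] L)
  have hN : ∀ x, N x = θ (θ' x) := fun _ => rfl
  have e1 : ∀ x y, form θ (N x) y = -killingForm ℝ L (θ' x) y := fun x y => by
    rw [form_apply, hN, killingForm_lieEquiv]
  obtain ⟨b, c, hb⟩ := exists_basis_eigenvectors (form θ) h.form_symm h.form_pos N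
    (fun x y => by
      rw [e1, h.form_symm, e1, killingForm_symm, ← killingForm_lieEquiv θ', h'.involutive])
  have hc : ∀ i, 0 < c i := fun i => by
    have h1 : 0 < form θ (N (b i)) (b i) := by
      rw [e1, killingForm_symm]; exact h'.pos _ (b.ne_zero i)
    rw [hb, map_smul, LinearMap.smul_apply, smul_eq_mul] at h1
    exact pos_of_mul_pos_left h1 (h.form_pos _ (b.ne_zero i)).le
  let P : End ℝ L := b.constr ℝ fun i => Real.sqrt (c i) • b i
  have hPb : ∀ i, P (b i) = Real.sqrt (c i) • b i := fun i => b.constr_basis _ _ _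
  have hP : ∀ (x : L) (m : ℝ), N x = m • x → P x = Real.sqrt m • x := by
    intro x m hx
    have hr : ∀ i, c i * b.repr x i = m * b.repr x i := fun i => by
      have h1 : N x = ∑ i, (b.repr x i * c i) • b i := by
        conv_lhs => rw [← b.sum_repr x]
        simp only [map_sum, map_smul, hb, smul_smul]
      have h2 := congrArg (fun z => b.repr z i) (h1.symm.trans hx)
      simp only [b.repr_sum_self, map_smul, Finsupp.smul_apply, smul_eq_mul] at h2
      linarith
    conv_lhs => rw [← b.sum_repr x]
    conv_rhs => rw [← b.sum_repr x]
    simp only [map_sum, map_smul, hPb, smul_smul, Finset.smul_sum]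
    refine Finset.sum_congr rfl fun i _ => ?_
    by_cases h0 : b.repr x i = 0
    · simp [h0]
    · rw [mul_right_cancel₀ h0 (hr i), mul_comm]
  have hNlie : ∀ x y : L, N ⁅x, y⁆ = ⁅N x, N y⁆ := fun x y => by
    simp only [hN, LieEquiv.map_lie]
  have hPlie : ∀ x y : L, P ⁅x, y⁆ = ⁅P x, P y⁆ := by
    have key : (LieModule.toEnd ℝ L L : L →ₗ[ℝ] End ℝ L).compr₂ P =
        (LieModule.toEnd ℝ L L : L →ₗ[ℝ] End ℝ L).compl₁₂ P P := by
      refine b.ext fun i => b.ext fun j => ?_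
      change P ⁅b i, b j⁆ = ⁅P (b i), P (b j)⁆
      rw [hP ⁅b i, b j⁆ (c i * c j) (by rw [hNlie, hb, hb]; simp [smul_smul, mul_comm]), hPb, hPb,
        Real.sqrt_mul (hc i).le]
      simp [smul_smul, mul_comm]
    exact fun x y => LinearMap.congr_fun (LinearMap.congr_fun key x) y
  have hinj : Function.Injective P := by
    rw [← LinearMap.ker_eq_bot, LinearMap.ker_eq_bot']
    intro x hx
    have h1 := congrArg b.repr hx
    have h2 : P x = ∑ i, (b.repr x i * Real.sqrt (c i)) • b i := by
      conv_lhs => rw [← b.sum_repr x]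
      simp only [map_sum, map_smul, hPb, smul_smul]
    refine b.ext_elem fun i => ?_
    rw [h2] at h1
    have h3 := DFunLike.congr_fun h1 i
    simp only [b.repr_sum_self, map_zero, Finsupp.coe_zero, Pi.zero_apply, mul_eq_zero] at h3
    rcases h3 with h3 | h3
    · simpa using h3
    · exact absurd h3 (Real.sqrt_pos.mpr (hc i)).ne'
  let φ : L ≃ₗ⁅ℝ⁆ L :=
    LieEquiv.ofBijective { P with map_lie' := fun {x y} => hPlie x y }
      ⟨hinj, LinearMap.surjective_of_injective hinj⟩
  refine ⟨φ, ?_⟩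
  have key : (θ : L →ₗ[ℝ] L) ∘ₗ P = P ∘ₗ (θ' : L →ₗ[ℝ] L) := by
    refine b.ext fun i => ?_
    change θ (P (b i)) = P (θ' (b i))
    have h1 : θ' (b i) = c i • θ (b i) := by
      rw [← map_smul, ← hb, hN, h.involutive]
    have h2 : N (θ (b i)) = (c i)⁻¹ • θ (b i) := by
      have h3 : θ (b i) = (c i)⁻¹ • θ' (b i) := by
        rw [h1, smul_smul, inv_mul_cancel₀ (hc i).ne', one_smul]
      rw [hN]
      nth_rewrite 1 [h3]
      rw [map_smul, map_smul, h'.involutive]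
    rw [h1, map_smul, hP _ _ h2, hPb, map_smul, smul_smul]
    congr 1
    rw [Real.sqrt_inv]
    nth_rewrite 2 [← Real.mul_self_sqrt (hc i).le]
    rw [mul_assoc, mul_inv_cancel₀ (Real.sqrt_pos.mpr (hc i)).ne', mul_one]
  exact fun x => LinearMap.congr_fun key x

end IsCartanInvolution

end CartanInvolution

namespace IwasawaDatum

variable {L : Type*} [LieRing L] [LieAlgebra ℝ L]

lemma lie_mem_restrictedRootSpace {𝔞 : Submodule ℝ L} {l m : Dual ℝ 𝔞} {x y : L}
    (hx : x ∈ restrictedRootSpace 𝔞 l) (hy : y ∈ restrictedRootSpace 𝔞 m) :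
    ⁅x, y⁆ ∈ restrictedRootSpace 𝔞 (l + m) := fun h => by
  rw [leibniz_lie, hx h, hy h, smul_lie, lie_smul, LinearMap.add_apply, add_smul]

variable (D : IwasawaDatum L)

lemma theta_apply_of_mem {x : L} (hx : x ∈ D.𝔞) : D.θ x = -x := D.maximal.prop.1 hx

lemma lie_eq_zero_of_mem {x y : L} (hx : x ∈ D.𝔞) (hy : y ∈ D.𝔞) : ⁅x, y⁆ = 0 :=
  D.maximal.prop.2 x hx y hy

lemma le_restrictedRootSpace_zero : D.𝔞 ≤ restrictedRootSpace D.𝔞 0 := fun x hx h => by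
  rw [D.lie_eq_zero_of_mem h.2 hx]; simp

lemma theta_mem_restrictedRootSpace {l : Dual ℝ D.𝔞} {x : L} (hx : x ∈ restrictedRootSpace D.𝔞 l) :
    D.θ x ∈ restrictedRootSpace D.𝔞 (-l) := fun h => by
  have h1 := congrArg D.θ (hx h)
  rw [LieEquiv.map_lie, D.theta_apply_of_mem h.2, map_smul, neg_lie] at h1
  rw [LinearMap.neg_apply, neg_smul, ← h1, neg_neg]

lemma mem_of_commute {x : L} (hx : D.θ x = -x) (hc : ∀ h ∈ D.𝔞, ⁅h, x⁆ = 0) : x ∈ D.𝔞 := by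
  have hle : D.𝔞 ≤ D.𝔞 ⊔ Submodule.span ℝ {x} := le_sup_left
  have hmem : x ∈ D.𝔞 ⊔ Submodule.span ℝ {x} :=
    Submodule.mem_sup_right (Submodule.mem_span_singleton_self x)
  refine D.maximal.le_of_ge ⟨?_, ?_⟩ hle hmem
  · refine sup_le D.maximal.prop.1 ?_
    rw [Submodule.span_singleton_le_iff_mem]
    exact hx
  · intro u hu v hv
    obtain ⟨a, ha, b, hb, rfl⟩ := Submodule.mem_sup.mp hu
    obtain ⟨a', ha', b', hb', rfl⟩ := Submodule.mem_sup.mp hv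
    obtain ⟨r, rfl⟩ := Submodule.mem_span_singleton.mp hb
    obtain ⟨s, rfl⟩ := Submodule.mem_span_singleton.mp hb'
    have h1 : ⁅x, a'⁆ = 0 := by rw [← lie_skew, hc _ ha', neg_zero]
    simp [D.lie_eq_zero_of_mem ha ha', hc _ ha, h1]

lemma mem_of_mem_zero {x : L} (hx : D.θ x = -x) (h0 : x ∈ restrictedRootSpace D.𝔞 0) : x ∈ D.𝔞 :=
  D.mem_of_commute hx fun h hh => by simpa using h0 ⟨h, hh⟩

variable [FiniteDimensional ℝ L]

/-- The inner product on `L`. -/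
noncomputable abbrev form : LinearMap.BilinForm ℝ L := IsCartanInvolution.form D.θ

lemma eq_zero_of_central (D : IwasawaDatum L) {x : L} (hx : ∀ y : L, ⁅x, y⁆ = 0) : x = 0 := by
  by_contra h
  have h1 := D.isCartanInvolution.pos x h
  have h2 : LieAlgebra.ad ℝ L x = 0 := by ext y; simpa using hx y
  rw [killingForm_apply_apply, h2] at h1
  simp at h1

lemma form_lie_of_mem {h : L} (hh : h ∈ D.𝔞) (x y : L) : D.form ⁅h, x⁆ y = D.form x ⁅h, y⁆ := by
  rw [IsCartanInvolution.form_lie D.isCartanInvolution, D.theta_apply_of_mem hh, neg_lie, map_neg,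
    neg_neg]

lemma iSup_restrictedRootSpace : ⨆ l, restrictedRootSpace D.𝔞 l = ⊤ := by
  have h := iSup_iInf_eigenspace_eq_top_of_form D.form D.isCartanInvolution.form_symm
    D.isCartanInvolution.form_pos (fun h : D.𝔞 => LieAlgebra.ad ℝ L (h : L))
    (fun h x y => D.form_lie_of_mem h.2 x y) (fun h h' => by
      have : ⁅LieAlgebra.ad ℝ L (h : L), LieAlgebra.ad ℝ L (h' : L)⁆ = 0 := by
        rw [← LieHom.map_lie, D.lie_eq_zero_of_mem h.2 h'.2, map_zero]
      exact sub_eq_zero.mp this)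
  rw [eq_top_iff, ← h]
  refine iSup_le fun χ => ?_
  by_cases hχ : (⨅ h : D.𝔞, End.eigenspace (LieAlgebra.ad ℝ L (h : L)) (χ h)) = ⊥
  · rw [hχ]; exact bot_le
  obtain ⟨x, hx, hx0⟩ := Submodule.exists_mem_ne_zero_of_ne_bot hχ
  have hx' : ∀ h : D.𝔞, ⁅(h : L), x⁆ = χ h • x := fun h => by
    simpa [End.mem_eigenspace_iff] using (Submodule.mem_iInf _).mp hx h
  let l : Dual ℝ D.𝔞 :=
    { toFun := χ
      map_add' := fun a b => smul_left_injective ℝ hx0 (by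
        change χ (a + b) • x = (χ a + χ b) • x
        rw [← hx', add_smul, ← hx', ← hx', Submodule.coe_add, add_lie])
      map_smul' := fun r a => smul_left_injective ℝ hx0 (by
        change χ (r • a) • x = (r * χ a) • x
        rw [← hx', mul_smul, ← hx', Submodule.coe_smul, smul_lie]) }
  refine le_trans ?_ (le_iSup _ l)
  intro y hy h
  have h1 := (Submodule.mem_iInf _).mp hy h
  rwa [End.mem_eigenspace_iff] at h1

lemma iSupIndep_restrictedRootSpace : iSupIndep (restrictedRootSpace D.𝔞) := by
  have h1 := End.independent_iInf_maxGenEigenspace_of_forall_mapsTo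
    (fun h : D.𝔞 => LieAlgebra.ad ℝ L (h : L)) (fun i j φ => by
      refine End.mapsTo_maxGenEigenspace_of_comm ?_ φ
      have : ⁅LieAlgebra.ad ℝ L (j : L), LieAlgebra.ad ℝ L (i : L)⁆ = 0 := by
        rw [← LieHom.map_lie, D.lie_eq_zero_of_mem j.2 i.2, map_zero]
      exact sub_eq_zero.mp this)
  have h2 := h1.comp (f := fun l : Dual ℝ D.𝔞 => (l : D.𝔞 → ℝ)) DFunLike.coe_injective
  refine h2.mono fun l x hx => (Submodule.mem_iInf _).mpr fun h => ?_
  exact End.mem_maxGenEigenspace _ _ _ |>.mpr ⟨1, by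
    rw [pow_one, LinearMap.sub_apply, sub_eq_zero]
    exact hx h⟩

lemma finite_roots : D.roots.Finite := by
  refine (WellFoundedGT.finite_ne_bot_of_iSupIndep D.iSupIndep_restrictedRootSpace).subset ?_
  exact fun l hl => hl.2

open Classical in
lemma isInternal : DirectSum.IsInternal (restrictedRootSpace D.𝔞) :=
  DirectSum.isInternal_submodule_of_iSupIndep_of_iSup_eq_top D.iSupIndep_restrictedRootSpace
    D.iSup_restrictedRootSpace

open Classical in
/-- The projection to the simultaneous eigenspace with eigenvalue `l`. -/
noncomputable def proj (l : Dual ℝ D.𝔞) : L →ₗ[ℝ] L :=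
  (restrictedRootSpace D.𝔞 l).subtype ∘ₗ DirectSum.component ℝ _ (fun l => restrictedRootSpace D.𝔞 l) l ∘ₗ
    (LinearEquiv.ofBijective (DirectSum.coeLinearMap (restrictedRootSpace D.𝔞)) D.isInternal).symm.toLinearMap

lemma proj_mem (l : Dual ℝ D.𝔞) (x : L) : D.proj l x ∈ restrictedRootSpace D.𝔞 l := Submodule.coe_mem _

open Classical in
lemma proj_of_mem' {l m : Dual ℝ D.𝔞} {x : L} (hx : x ∈ restrictedRootSpace D.𝔞 l) :
    D.proj m x = if l = m then x else 0 := by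
  have h : (LinearEquiv.ofBijective (DirectSum.coeLinearMap (restrictedRootSpace D.𝔞)) D.isInternal).symm x =
      DirectSum.lof ℝ _ (fun l => restrictedRootSpace D.𝔞 l) l ⟨x, hx⟩ := by
    rw [LinearEquiv.symm_apply_eq]
    exact (DirectSum.coeLinearMap_lof (restrictedRootSpace D.𝔞) l ⟨x, hx⟩).symm
  simp only [proj, LinearMap.comp_apply, LinearEquiv.coe_coe, h]
  rw [Submodule.subtype_apply, DirectSum.component.of]
  split_ifs with h1
  · subst h1; rfl
  · rfl

lemma proj_of_mem {l : Dual ℝ D.𝔞} {x : L} (hx : x ∈ restrictedRootSpace D.𝔞 l) :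
    D.proj l x = x := by simp [D.proj_of_mem' hx]

lemma proj_of_mem_of_ne {l m : Dual ℝ D.𝔞} {x : L} (hx : x ∈ restrictedRootSpace D.𝔞 l) (h : l ≠ m) :
    D.proj m x = 0 := by simp [D.proj_of_mem' hx, h]

lemma eq_zero_or_mem_roots {l : Dual ℝ D.𝔞} {x : L} (hx : x ∈ restrictedRootSpace D.𝔞 l) (h0 : x ≠ 0) :
    l = 0 ∨ l ∈ D.roots := by
  by_cases h : l = 0
  · exact Or.inl h
  · exact Or.inr ⟨h, fun hb => h0 ((Submodule.eq_bot_iff _).mp hb x hx)⟩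

/-- Induction on the decomposition into simultaneous eigenspaces. -/
lemma restrictedRootSpace_induction {p : L → Prop} (hadd : ∀ x y, p x → p y → p (x + y))
    (h : ∀ l, ∀ x ∈ restrictedRootSpace D.𝔞 l, p x) (x : L) : p x := by
  have hx : x ∈ ⨆ l, restrictedRootSpace D.𝔞 l := by rw [D.iSup_restrictedRootSpace]; trivial
  exact Submodule.iSup_induction (p := restrictedRootSpace D.𝔞) (motive := p) hx h
    (h 0 0 (zero_mem _)) hadd

lemma eq_zero_of_roots_eq_zero {h : D.𝔞} (hh : ∀ l ∈ D.roots, l h = 0) : h = 0 := by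
  refine Subtype.ext (D.eq_zero_of_central fun y : L => ?_)
  induction y using D.restrictedRootSpace_induction with
  | hadd x y hx hy => rw [lie_add, hx, hy, add_zero]
  | h l x hx =>
    by_cases h0 : x = 0
    · simp [h0]
    rw [hx h]
    rcases D.eq_zero_or_mem_roots hx h0 with rfl | hl
    · simp
    · rw [hh l hl, zero_smul]

lemma span_roots : Submodule.span ℝ D.roots = ⊤ := by
  rw [← Subspace.dualCoannihilator_dualAnnihilator_eq (W := Submodule.span ℝ D.roots)]
  have : (Submodule.span ℝ D.roots).dualCoannihilator = ⊥ := by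
    rw [Submodule.eq_bot_iff]
    intro h hh
    exact D.eq_zero_of_roots_eq_zero fun l hl =>
      (Submodule.mem_dualCoannihilator h).mp hh l (Submodule.subset_span hl)
  rw [this, Submodule.dualAnnihilator_bot]

lemma exists_regular : ∃ h : D.𝔞, ∀ l ∈ D.roots, l h ≠ 0 := by
  have := D.finite_roots.to_subtype
  obtain ⟨h, hh⟩ := Module.Dual.exists_forall_ne_zero_of_forall_exists (K := ℝ)
    (fun l : D.roots => (l : Dual ℝ D.𝔞)) (fun l => by
      by_contra hc
      push Not at hc
      exact l.2.1 (LinearMap.ext hc))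
  exact ⟨h, fun l hl => hh ⟨l, hl⟩⟩

lemma mem_zero_of_lie_regular {h : D.𝔞} (hh : ∀ l ∈ D.roots, l h ≠ 0) {x : L} (hx : ⁅(h : L), x⁆ = 0) :
    x ∈ restrictedRootSpace D.𝔞 0 := by
  have hcomm : ∀ l y, D.proj l ⁅(h : L), y⁆ = l h • D.proj l y := fun l y => by
    induction y using D.restrictedRootSpace_induction with
    | hadd x y hx hy => rw [lie_add, map_add, hx, hy, map_add, smul_add]
    | h m x hx =>
      rw [hx h, map_smul]
      by_cases hm : m = l
      · rw [hm]
      · rw [D.proj_of_mem_of_ne hx hm, smul_zero, smul_zero]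
  have hz : ∀ l ∈ D.roots, D.proj l x = 0 := fun l hl => by
    have := hcomm l x
    rw [hx, map_zero] at this
    exact (smul_eq_zero.mp this.symm).resolve_left (hh l hl)
  have hp : ∀ l, l ≠ 0 → D.proj l x = 0 := fun l hl => by
    by_contra hc
    exact hc (hz l ((D.eq_zero_or_mem_roots (D.proj_mem l x) hc).resolve_left hl))
  have key : ∀ y, y ∈ ⨆ l, Submodule.span ℝ {D.proj l y} := fun y => by
    classical
    set e := (LinearEquiv.ofBijective (DirectSum.coeLinearMap (restrictedRootSpace D.𝔞)) D.isInternal)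
    have h1 : y = e (e.symm y) := (e.apply_symm_apply y).symm
    have h2 : e (e.symm y) = ∑ l ∈ (e.symm y).support, ((e.symm y l : restrictedRootSpace D.𝔞 l) : L) := by
      conv_lhs => rw [← DirectSum.sum_support_of (e.symm y)]
      rw [map_sum]
      exact Finset.sum_congr rfl fun l _ => DirectSum.coeLinearMap_of (restrictedRootSpace D.𝔞) l (e.symm y l)
    rw [h2] at h1
    have h3 : ∑ l ∈ (e.symm y).support, ((e.symm y l : restrictedRootSpace D.𝔞 l) : L) ∈
        ⨆ l, Submodule.span ℝ {D.proj l y} := by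
      refine Submodule.sum_mem (⨆ l, Submodule.span ℝ {D.proj l y}) fun l _ => ?_
      refine Submodule.mem_iSup_of_mem l ?_
      exact Submodule.mem_span_singleton_self (D.proj l y)
    rwa [← h1] at h3
  have h3 : ⨆ l, Submodule.span ℝ {D.proj l x} ≤ restrictedRootSpace D.𝔞 0 := by
    refine iSup_le fun l => ?_
    rw [Submodule.span_singleton_le_iff_mem]
    by_cases hl : l = 0
    · subst hl; exact D.proj_mem _ _
    · rw [hp l hl]; exact zero_mem _
  exact h3 (key x)

lemma mem_of_lie_regular {h : D.𝔞} (hh : ∀ l ∈ D.roots, l h ≠ 0) {x : L} (hx : ⁅(h : L), x⁆ = 0)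
    (hθ : D.θ x = -x) : x ∈ D.𝔞 :=
  D.mem_of_mem_zero hθ (D.mem_zero_of_lie_regular hh hx)

end IwasawaDatum

section AbelianConjugacy

variable {L : Type*} [LieRing L] [LieAlgebra ℝ L] [FiniteDimensional ℝ L]

namespace IsCartanInvolution

variable {θ : L ≃ₗ⁅ℝ⁆ L}

/-- There is an automorphism `k` commuting with `θ` such that the derivative of
`⟪exp (t ad z) k x, y⟫` at `t = 0` vanishes for all `z` fixed by `θ`. -/
lemma exists_critical (hθ : IsCartanInvolution θ) (x y : L) :
    ∃ k : L ≃ₗ⁅ℝ⁆ L, (∀ z, θ (k z) = k (θ z)) ∧ ∀ z, θ z = z → form θ ⁅z, k x⁆ y = 0 := by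
  let core := coreOfForm (form θ) hθ.form_symm hθ.form_pos
  let _ := core.toNormedAddCommGroup
  let _ : InnerProductSpace ℝ L := InnerProductSpace.ofCore core.toCore
  have hinner : ∀ u v : L, inner ℝ u v = form θ u v := fun _ _ => rfl
  have : ProperSpace (L →L[ℝ] L) := FiniteDimensional.proper_real _
  have : CompleteSpace L := FiniteDimensional.complete ℝ L
  let θc : L →L[ℝ] L := LinearMap.toContinuousLinearMap (θ : L →ₗ[ℝ] L)
  have hθc : ∀ u, θc u = θ u := fun _ => rfl
  let adc : L →ₗ[ℝ] (L →L[ℝ] L) :=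
    (LinearMap.toContinuousLinearMap : (L →ₗ[ℝ] L) ≃ₗ[ℝ] (L →L[ℝ] L)).toLinearMap ∘ₗ
      (LieAlgebra.ad ℝ L : L →ₗ[ℝ] End ℝ L)
  have hadc : ∀ u v, adc u v = ⁅u, v⁆ := fun _ _ => rfl
  let adcc : L →L[ℝ] L →L[ℝ] L := LinearMap.toContinuousLinearMap adc
  have hadcc : ∀ u v, adcc u v = ⁅u, v⁆ := fun _ _ => rfl
  let K : Set (L →L[ℝ] L) := {f | (∀ u v, f ⁅u, v⁆ = ⁅f u, f v⁆) ∧ (∀ u, θ (f u) = f (θ u)) ∧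
    ∀ u, ‖f u‖ = ‖u‖}
  have hclosed : IsClosed K := by
    have h1 : K = (⋂ u, ⋂ v, {f : L →L[ℝ] L | f ⁅u, v⁆ = adcc (f u) (f v)}) ∩
        ((⋂ u, {f : L →L[ℝ] L | θc (f u) = f (θ u)}) ∩ ⋂ u, {f : L →L[ℝ] L | ‖f u‖ = ‖u‖}) := by
      ext f
      simp [K, hadcc, hθc]
    rw [h1]
    refine (isClosed_iInter fun u => isClosed_iInter fun v => ?_).inter
      ((isClosed_iInter fun u => ?_).inter (isClosed_iInter fun u => ?_))
    · exact isClosed_eq (by fun_prop) (by fun_prop)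
    · exact isClosed_eq (by fun_prop) (by fun_prop)
    · exact isClosed_eq (by fun_prop) (by fun_prop)
  have hcompact : IsCompact K := by
    refine Metric.isCompact_of_isClosed_isBounded hclosed ?_
    refine (Metric.isBounded_closedBall (x := (0 : L →L[ℝ] L)) (r := 1)).subset fun f hf => ?_
    rw [mem_closedBall_zero_iff]
    exact f.opNorm_le_bound zero_le_one fun u => by rw [hf.2.2 u, one_mul]
  obtain ⟨k, hkK, hk⟩ := hcompact.exists_isMaxOn (f := fun f : L →L[ℝ] L => inner ℝ (f x) y)
    ⟨ContinuousLinearMap.id ℝ L, by simp [K]⟩ (by fun_prop)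
  have hinj : Function.Injective (k : L →ₗ[ℝ] L) := by
    rw [← LinearMap.ker_eq_bot, LinearMap.ker_eq_bot']
    intro u hu
    rw [← norm_eq_zero, ← hkK.2.2 u]
    exact norm_eq_zero.mpr hu
  let φ : L ≃ₗ⁅ℝ⁆ L :=
    LieEquiv.ofBijective { (k : L →ₗ[ℝ] L) with map_lie' := fun {u v} => hkK.1 u v }
      ⟨hinj, LinearMap.surjective_of_injective hinj⟩
  refine ⟨φ, hkK.2.1, fun z hz => ?_⟩
  let E : ℝ → (L →L[ℝ] L) := fun t => NormedSpace.exp (t • adc z)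
  have hE0 : E 0 = 1 := by simp [E, NormedSpace.exp_zero]
  have hE : ∀ t, HasDerivAt E (adc z * E t) t := fun t => hasDerivAt_exp_smul_const' (adc z) t
  have hEu : ∀ u t, HasDerivAt (fun t => E t u) ⁅z, E t u⁆ t := fun u t =>
    ((ContinuousLinearMap.apply ℝ L u).hasFDerivAt.comp_hasDerivAt t (hE t))
  have hEn : ∀ t u, ‖E t u‖ = ‖u‖ := fun t u => by
    have hskew : ∀ v, inner ℝ v ⁅z, v⁆ = 0 := fun v => by
      have h1 := hθ.form_lie z v v
      rw [hz, hθ.form_symm] at h1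
      rw [hinner]; linarith
    have hd : ∀ t, HasDerivAt (fun t => inner ℝ (E t u) (E t u)) 0 t := fun t => by
      have := (hEu u t).inner ℝ (hEu u t)
      rwa [hskew, real_inner_comm, hskew, add_zero] at this
    have hconst := is_const_of_deriv_eq_zero (fun t => (hd t).differentiableAt)
      (fun t => (hd t).deriv) t 0
    simp only [hE0, one_apply_eq_self] at hconst
    rw [@norm_eq_sqrt_real_inner L, @norm_eq_sqrt_real_inner L, hconst]
  have hEθ : ∀ t u, θ (E t u) = E t (θ u) := fun t u => by
    have hc : Commute θc (t • adc z) := by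
      refine Commute.smul_right ?_ t
      ext v
      change θ ⁅z, v⁆ = ⁅z, θ v⁆
      rw [LieEquiv.map_lie, hz]
    exact DFunLike.congr_fun (hc.exp_right.eq) u
  let _ : NormedAlgebra ℚ (L →L[ℝ] L) := NormedAlgebra.restrictScalars ℚ ℝ (L →L[ℝ] L)
  have hinv : ∀ t, E (-t) * E t = 1 ∧ E t * E (-t) = 1 := fun t => by
    have hcm : ∀ a b : ℝ, E a * E b = E (a + b) := fun a b => by
      simp only [E, add_smul]
      rw [NormedSpace.exp_add_of_commute (((Commute.refl (adc z)).smul_left a).smul_right b)]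
    rw [hcm, hcm]
    simp [hE0]
  have hElie : ∀ t u v, E t ⁅u, v⁆ = ⁅E t u, E t v⁆ := fun t u v => by
    have hEneg : ∀ t, HasDerivAt (fun t => E (-t)) (-(E (-t) * adc z)) t := fun t => by
      have h1 : HasDerivAt E (E (-t) * adc z) (-t) := hasDerivAt_exp_smul_const (adc z) (-t)
      have h2 := h1.scomp t (hasDerivAt_neg t)
      simp only [neg_smul, one_smul] at h2
      exact h2
    have hd : ∀ t, HasDerivAt (fun t => E (-t) ⁅E t u, E t v⁆) 0 t := fun t => by
      have h1 : HasDerivAt (fun t => adcc (E t u) (E t v))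
          (adcc ⁅z, E t u⁆ (E t v) + adcc (E t u) ⁅z, E t v⁆) t :=
        (adcc.hasFDerivAt.comp_hasDerivAt t (hEu u t)).clm_apply (hEu v t)
      have h2 := (hEneg t).clm_apply h1
      have h3 : (-(E (-t) * adc z)) (adcc (E t u) (E t v)) +
          E (-t) (adcc ⁅z, E t u⁆ (E t v) + adcc (E t u) ⁅z, E t v⁆) = 0 := by
        change -(E (-t) ⁅z, ⁅E t u, E t v⁆⁆) + E (-t) (⁅⁅z, E t u⁆, E t v⁆ + ⁅E t u, ⁅z, E t v⁆⁆) = 0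
        rw [leibniz_lie z, neg_add_cancel]
      rw [h3] at h2
      exact h2
    have hconst := is_const_of_deriv_eq_zero (fun t => (hd t).differentiableAt)
      (fun t => (hd t).deriv) t 0
    simp only [neg_zero, hE0, one_apply_eq_self] at hconst
    rw [← hconst]
    exact DFunLike.congr_fun (hinv t).2 _
  have hmem : ∀ t, E t * k ∈ K := fun t => by
    refine ⟨fun u v => ?_, fun u => ?_, fun u => ?_⟩
    · change E t (k ⁅u, v⁆) = ⁅E t (k u), E t (k v)⁆
      rw [hkK.1, hElie]
    · change θ (E t (k u)) = E t (k (θ u))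
      rw [hEθ, hkK.2.1]
    · change ‖E t (k u)‖ = ‖u‖
      rw [hEn, hkK.2.2]
  have hmax : IsLocalMax (fun t => (inner ℝ (E t (k x)) y : ℝ)) 0 := by
    refine Filter.Eventually.of_forall fun t => ?_
    have := hk (hmem t)
    simpa [hE0] using this
  have hd := ((hEu (k x) 0).inner ℝ (hasDerivAt_const (0 : ℝ) y))
  have h0 := hmax.hasDerivAt_eq_zero hd
  change form θ ⁅z, k x⁆ y = 0
  simpa [hE0, hinner] using h0

end IsCartanInvolution

namespace IwasawaDatum

/-- Any two choices of a Cartan involution and a maximal abelian subspace are conjugate. -/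
theorem conjugate (D D' : IwasawaDatum L) :
    ∃ φ : L ≃ₗ⁅ℝ⁆ L, (∀ x, D.θ (φ x) = φ (D'.θ x)) ∧ ∀ x, φ x ∈ D.𝔞 ↔ x ∈ D'.𝔞 := by
  obtain ⟨ψ, hψ⟩ := D.isCartanInvolution.conjugate D'.isCartanInvolution
  obtain ⟨h, hh⟩ := D'.exists_regular
  obtain ⟨h', hh'⟩ := D.exists_regular
  obtain ⟨k, hk, hcrit⟩ := D.isCartanInvolution.exists_critical (ψ (h : L)) (h' : L)
  have hθ : ∀ x, D.θ (k (ψ x)) = k (ψ (D'.θ x)) := fun x => by rw [hk, hψ]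
  set u := k (ψ (h : L)) with hu
  have hup : D.θ u = -u := by rw [hu, hθ, D'.theta_apply_of_mem h.2, map_neg, map_neg]
  have hcomm : ⁅u, (h' : L)⁆ = 0 := by
    by_contra hne
    have hz : D.θ ⁅u, (h' : L)⁆ = ⁅u, (h' : L)⁆ := by
      rw [LieEquiv.map_lie, hup, D.theta_apply_of_mem h'.2, neg_lie, lie_neg, neg_neg]
    have h1 := hcrit _ hz
    have h2 := D.isCartanInvolution.form_pos _ hne
    rw [← lie_skew, map_neg, LinearMap.neg_apply, neg_eq_zero,
      D.isCartanInvolution.form_lie, hup, neg_lie, map_neg, neg_neg] at h1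
    rw [h1] at h2
    exact lt_irrefl _ h2
  have hua : u ∈ D.𝔞 := D.mem_of_lie_regular hh' (by rw [← lie_skew, hcomm, neg_zero]) hup
  let φ : L ≃ₗ⁅ℝ⁆ L := ψ.trans k
  have hφ : ∀ x, φ x = k (ψ x) := fun _ => rfl
  have hφi : Function.Injective φ := φ.injective
  have hφs : Function.Surjective φ := φ.surjective
  have hle : ∀ x, φ x ∈ D.𝔞 → x ∈ D'.𝔞 := fun x hx => by
    refine D'.mem_of_lie_regular hh ?_ ?_
    · refine hφi ?_
      rw [LieEquiv.map_lie, map_zero]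
      exact D.lie_eq_zero_of_mem hua hx
    · refine hφi ?_
      rw [hφ, ← hθ, ← hφ, D.theta_apply_of_mem hx, map_neg]
  refine ⟨φ, hθ, fun x => ⟨hle x, fun hx => ?_⟩⟩
  refine D.mem_of_commute ?_ fun y hy => ?_
  · rw [hφ, hθ, D'.theta_apply_of_mem hx, map_neg, map_neg]
  · obtain ⟨y, rfl⟩ := hφs y
    rw [← LieEquiv.map_lie, D'.lie_eq_zero_of_mem (hle y hy) hx, map_zero]

end IwasawaDatum

end AbelianConjugacy

section AdExp

variable {K L : Type*} [Field K] [CharZero K] [LieRing L] [LieAlgebra K L]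

/-- The inner derivation `ad e`. -/
def adDerivation (e : L) : LieDerivation K L L where
  toLinearMap := LieAlgebra.ad K L e
  leibniz' a b := by
    change ⁅e, ⁅a, b⁆⁆ = ⁅a, ⁅e, b⁆⁆ - ⁅b, ⁅e, a⁆⁆
    rw [leibniz_lie e a b, ← lie_skew b]; abel

/-- The automorphism `exp (ad e)` for `ad`-nilpotent `e`. -/
noncomputable def adExp (e : L) (he : IsNilpotent (LieAlgebra.ad K L e)) : L ≃ₗ⁅K⁆ L :=
  letI : Module ℚ L := Module.compHom L (algebraMap ℚ K)
  letI : LieAlgebra ℚ L := { lie_smul := fun t x y => lie_smul (algebraMap ℚ K t) x y }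
  LieDerivation.exp (adDerivation (K := K) e) he

lemma adExp_apply {e : L} (he : IsNilpotent (LieAlgebra.ad K L e)) {x : L} {n : ℕ}
    (hn : ((LieAlgebra.ad K L e) ^ n) x = 0) :
    adExp e he x = ∑ i ∈ Finset.range n, (i.factorial : K)⁻¹ • ((LieAlgebra.ad K L e) ^ i) x := by
  let _ : Module ℚ L := Module.compHom L (algebraMap ℚ K)
  let _ : LieAlgebra ℚ L := { lie_smul := fun t x y => lie_smul (algebraMap ℚ K t) x y }
  have h1 : adExp e he x = IsNilpotent.exp (LieAlgebra.ad K L e) x :=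
    LieDerivation.exp_map_apply (adDerivation (K := K) e) he x
  rw [h1]
  refine (IsNilpotent.exp_smul_eq_sum (M := L) (a := LieAlgebra.ad K L e) (m := x) hn he).trans ?_
  refine Finset.sum_congr rfl fun i _ => ?_
  change (algebraMap ℚ K (i.factorial : ℚ)⁻¹) • (((LieAlgebra.ad K L e) ^ i) x) = _
  rw [map_inv₀, map_natCast]

lemma adExp_apply_of_lie_eq_zero {e : L} (he : IsNilpotent (LieAlgebra.ad K L e)) {x : L}
    (h : ⁅e, x⁆ = 0) : adExp e he x = x := by
  rw [adExp_apply he (n := 1) (by simpa using h)]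
  simp

lemma adExp_apply_of_lie_lie_eq_zero {e : L} (he : IsNilpotent (LieAlgebra.ad K L e)) {x : L}
    (h : ⁅e, ⁅e, x⁆⁆ = 0) : adExp e he x = x + ⁅e, x⁆ := by
  rw [adExp_apply he (n := 2) (by simpa [pow_two] using h)]
  simp [Finset.sum_range_succ]

lemma adExp_apply_of_lie_lie_lie_eq_zero {e : L} (he : IsNilpotent (LieAlgebra.ad K L e)) {x : L}
    (h : ⁅e, ⁅e, ⁅e, x⁆⁆⁆ = 0) : adExp e he x = x + ⁅e, x⁆ + (2 : K)⁻¹ • ⁅e, ⁅e, x⁆⁆ := by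
  rw [adExp_apply he (n := 3) (by simpa [pow_succ] using h)]
  simp [Finset.sum_range_succ, pow_two]

lemma adExp_mem {e : L} (he : IsNilpotent (LieAlgebra.ad K L e)) {M : Submodule K L}
    (hM : ∀ x ∈ M, ⁅e, x⁆ ∈ M) {x : L} (hx : x ∈ M) : adExp e he x ∈ M := by
  obtain ⟨n, hn⟩ := he
  rw [adExp_apply ⟨n, hn⟩ (n := n) (by rw [hn]; rfl)]
  have hi : ∀ i, ((LieAlgebra.ad K L e) ^ i) x ∈ M := fun i => by
    induction i with
    | zero => simpa using hx
    | succ i ih => rw [pow_succ']; exact hM _ ih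
  exact Submodule.sum_mem M fun i _ => M.smul_mem _ (hi i)

end AdExp

namespace IwasawaDatum

variable {L : Type*} [LieRing L] [LieAlgebra ℝ L] [FiniteDimensional ℝ L] (D : IwasawaDatum L)

lemma isNilpotent_ad {l : Dual ℝ D.𝔞} (hl : l ≠ 0) {e : L} (he : e ∈ restrictedRootSpace D.𝔞 l) :
    IsNilpotent (LieAlgebra.ad ℝ L e) := by
  have hpow : ∀ (m : Dual ℝ D.𝔞) (x : L), x ∈ restrictedRootSpace D.𝔞 m → ∀ n : ℕ,
      ((LieAlgebra.ad ℝ L e) ^ n) x ∈ restrictedRootSpace D.𝔞 (n • l + m) := fun m x hx n => by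
    induction n with
    | zero => simpa using hx
    | succ n ih =>
      rw [pow_succ', succ_nsmul', add_assoc]
      exact lie_mem_restrictedRootSpace he ih
  refine Module.End.isNilpotent_iff_of_finite.mpr fun x => ?_
  induction x using D.restrictedRootSpace_induction with
  | hadd x y hx hy =>
    obtain ⟨n, hn⟩ := hx
    obtain ⟨m, hm⟩ := hy
    have h1 : ((LieAlgebra.ad ℝ L e) ^ (n + m)) y = 0 := by
      rw [pow_add, Module.End.mul_apply, hm, map_zero]
    have h2 : ((LieAlgebra.ad ℝ L e) ^ (n + m)) x = 0 := by
      rw [add_comm, pow_add, Module.End.mul_apply, hn, map_zero]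
    exact ⟨n + m, by rw [map_add, h1, h2, add_zero]⟩
  | h m x hx =>
    by_contra hc
    push Not at hc
    have hmem : ∀ n : ℕ, n • l + m ∈ insert 0 D.roots := fun n =>
      D.eq_zero_or_mem_roots (hpow m x hx n) (hc n)
    have hinj : Function.Injective fun n : ℕ => n • l + m := fun a b hab => by
      have h1 : a • l = b • l := add_right_cancel hab
      rw [← Nat.cast_smul_eq_nsmul ℝ, ← Nat.cast_smul_eq_nsmul ℝ b] at h1
      exact_mod_cast smul_left_injective ℝ hl h1
    exact (Set.infinite_of_injective_forall_mem hinj hmem) (D.finite_roots.insert 0)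

/-! ### The scalar product on the dual of `𝔞` -/

/-- The element of `𝔞` that corresponds to a linear form. -/
noncomputable def tvec (m : Dual ℝ D.𝔞) : D.𝔞 :=
  (D.killingOn.toDual D.killingOn_nondegenerate).symm m

lemma dualForm_eq (l m : Dual ℝ D.𝔞) : D.dualForm l m = l (D.tvec m) := rfl

lemma killingOn_tvec (m : Dual ℝ D.𝔞) (h : D.𝔞) : D.killingOn (D.tvec m) h = m h :=
  LinearMap.BilinForm.apply_toDual_symm_apply _ _

lemma killingOn_comm (x y : D.𝔞) : D.killingOn x y = D.killingOn y x :=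
  IsCartanInvolution.killingForm_symm (x : L) (y : L)

lemma dualForm_eq_killingOn (l m : Dual ℝ D.𝔞) :
    D.dualForm l m = D.killingOn (D.tvec l) (D.tvec m) := by
  rw [killingOn_tvec, dualForm_eq]

lemma dualForm_comm (l m : Dual ℝ D.𝔞) : D.dualForm l m = D.dualForm m l := by
  rw [dualForm_eq_killingOn, killingOn_comm, dualForm_eq_killingOn]

lemma dualForm_pos {l : Dual ℝ D.𝔞} (hl : l ≠ 0) : 0 < D.dualForm l l := by
  rw [dualForm_eq_killingOn]
  refine D.killingOn_pos _ fun h => hl ?_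
  ext x
  rw [← killingOn_tvec, h]; simp

lemma dualForm_add_left (l m n : Dual ℝ D.𝔞) :
    D.dualForm (l + m) n = D.dualForm l n + D.dualForm m n := rfl

lemma dualForm_smul_left (c : ℝ) (l n : Dual ℝ D.𝔞) :
    D.dualForm (c • l) n = c * D.dualForm l n := rfl

lemma dualForm_add_right (l m n : Dual ℝ D.𝔞) :
    D.dualForm n (l + m) = D.dualForm n l + D.dualForm n m := by
  rw [dualForm_comm, dualForm_add_left, dualForm_comm, D.dualForm_comm m]

lemma dualForm_smul_right (c : ℝ) (l n : Dual ℝ D.𝔞) :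
    D.dualForm n (c • l) = c * D.dualForm n l := by
  rw [dualForm_comm, dualForm_smul_left, dualForm_comm]

/-- The scalar product on the dual of `𝔞` as a bilinear form. -/
noncomputable def dualBilin : LinearMap.BilinForm ℝ (Dual ℝ D.𝔞) :=
  LinearMap.mk₂ ℝ D.dualForm D.dualForm_add_left D.dualForm_smul_left
    (fun n l m => D.dualForm_add_right l m n) (fun c n l => D.dualForm_smul_right c l n)

lemma dualBilin_apply (l m : Dual ℝ D.𝔞) : D.dualBilin l m = D.dualForm l m := rfl

/-- The coroot. -/
noncomputable def coroot (l : Dual ℝ D.𝔞) : D.𝔞 := (2 / D.dualForm l l) • D.tvec l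

lemma apply_coroot (l m : Dual ℝ D.𝔞) : m (D.coroot l) = 2 * D.dualForm l m / D.dualForm l l := by
  rw [coroot, map_smul, ← dualForm_eq, D.dualForm_comm m]; simp only [smul_eq_mul]; ring

lemma self_apply_coroot {l : Dual ℝ D.𝔞} (hl : l ≠ 0) : l (D.coroot l) = 2 := by
  rw [apply_coroot, mul_div_assoc, div_self (D.dualForm_pos hl).ne', mul_one]

/-- The reflection in the root `l`. -/
noncomputable def refl (l m : Dual ℝ D.𝔞) : Dual ℝ D.𝔞 := m - m (D.coroot l) • l

lemma refl_apply (l m : Dual ℝ D.𝔞) : D.refl l m = m - m (D.coroot l) • l := rfl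

lemma refl_refl {l : Dual ℝ D.𝔞} (hl : l ≠ 0) (m : Dual ℝ D.𝔞) : D.refl l (D.refl l m) = m := by
  simp only [refl, LinearMap.sub_apply, LinearMap.smul_apply, smul_eq_mul, D.self_apply_coroot hl]
  module

lemma dualForm_refl {l : Dual ℝ D.𝔞} (hl : l ≠ 0) (m n : Dual ℝ D.𝔞) :
    D.dualForm (D.refl l m) (D.refl l n) = D.dualForm m n := by
  have h0 := (D.dualForm_pos hl).ne'
  simp only [← dualBilin_apply, refl, apply_coroot, map_sub, map_smul, LinearMap.sub_apply,
    LinearMap.smul_apply, smul_eq_mul]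
  simp only [dualBilin_apply, D.dualForm_comm m l]
  field_simp
  ring

/-! ### The `sl₂`-triples -/

variable {D} in
/-- The opposite root vector, normalized so that the bracket is the coroot. -/
noncomputable def opp (D : IwasawaDatum L) (l : Dual ℝ D.𝔞) (e : L) : L :=
  -(2 / (D.form e e * D.dualForm l l)) • D.θ e

section Triple

variable {l : Dual ℝ D.𝔞} {e : L} (he : e ∈ restrictedRootSpace D.𝔞 l)

include he

lemma opp_mem : D.opp l e ∈ restrictedRootSpace D.𝔞 (-l) :=
  Submodule.smul_mem _ _ (D.theta_mem_restrictedRootSpace he)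

lemma lie_theta_mem : ⁅e, D.θ e⁆ ∈ D.𝔞 := by
  refine D.mem_of_mem_zero ?_ ?_
  · rw [LieEquiv.map_lie, D.isCartanInvolution.involutive, lie_skew]
  · have := lie_mem_restrictedRootSpace he (D.theta_mem_restrictedRootSpace he)
    rwa [add_neg_cancel] at this

lemma lie_theta : ⁅e, D.θ e⁆ = -(D.form e e) • (D.tvec l : L) := by
  have h1 : (⟨⁅e, D.θ e⁆, D.lie_theta_mem he⟩ : D.𝔞) = -(D.form e e) • D.tvec l := by
    refine (D.killingOn.toDual D.killingOn_nondegenerate).injective (LinearMap.ext fun h => ?_)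
    rw [LinearMap.BilinForm.toDual_def, LinearMap.BilinForm.toDual_def, map_smul,
      LinearMap.smul_apply, killingOn_tvec, killingOn_comm]
    change killingForm ℝ L h ⁅e, D.θ e⁆ = _
    rw [IsCartanInvolution.killingForm_symm, IsCartanInvolution.killingForm_lie, ← lie_skew e, map_neg,
      neg_neg, he h, map_smul, IsCartanInvolution.killingForm_symm]
    simp [IsCartanInvolution.form_apply, mul_comm]
  exact congrArg Subtype.val h1

lemma lie_opp (he0 : e ≠ 0) : ⁅e, D.opp l e⁆ = (D.coroot l : L) := by
  rw [opp, lie_smul, D.lie_theta he, smul_smul, coroot, Submodule.coe_smul]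
  congr 1
  have := (D.isCartanInvolution.form_pos e he0).ne'
  by_cases h : D.dualForm l l = 0
  · simp [h]
  · field_simp

/-- There is an automorphism that acts on `𝔞` as the reflection and preserves all subspaces that are
stable under the `sl₂`-triple. -/
lemma exists_reflection (hl : l ≠ 0) (he0 : e ≠ 0) : ∃ τ : L ≃ₗ⁅ℝ⁆ L,
    (∀ h : D.𝔞, τ h = h - l h • (D.coroot l : L)) ∧
    ∀ M : Submodule ℝ L, (∀ x ∈ M, ⁅e, x⁆ ∈ M) → (∀ x ∈ M, ⁅D.opp l e, x⁆ ∈ M) →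
      ∀ x ∈ M, τ x ∈ M := by
  set f := D.opp l e with hf
  have hfm : f ∈ restrictedRootSpace D.𝔞 (-l) := D.opp_mem he
  have hl' : -l ≠ 0 := neg_ne_zero.mpr hl
  have ne : IsNilpotent (LieAlgebra.ad ℝ L e) := D.isNilpotent_ad hl he
  have nf : IsNilpotent (LieAlgebra.ad ℝ L (-f)) := D.isNilpotent_ad hl' (neg_mem hfm)
  have hef : ⁅e, f⁆ = (D.coroot l : L) := D.lie_opp he he0
  have hfe : ⁅f, e⁆ = -(D.coroot l : L) := by rw [← lie_skew, hef]
  have heh : ∀ h : D.𝔞, ⁅e, (h : L)⁆ = -(l h • e) := fun h => by rw [← lie_skew, he]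
  have hfh : ∀ h : D.𝔞, ⁅f, (h : L)⁆ = l h • f := fun h => by
    rw [← lie_skew, hfm, LinearMap.neg_apply, neg_smul, neg_neg]
  have s1 : ∀ h : D.𝔞, adExp e ne h = h - l h • e := fun h => by
    rw [adExp_apply_of_lie_lie_eq_zero ne (by rw [heh, lie_neg, lie_smul]; simp), heh, sub_eq_add_neg]
  have s2 : ∀ h : D.𝔞, adExp (-f) nf h = h - l h • f := fun h => by
    have h1 : ⁅-f, (h : L)⁆ = -(l h • f) := by rw [neg_lie, hfh]
    rw [adExp_apply_of_lie_lie_eq_zero nf (by rw [h1, lie_neg, lie_smul, neg_lie]; simp), h1,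
      sub_eq_add_neg]
  have s3 : adExp (-f) nf e = e + (D.coroot l : L) - f := by
    have h1 : ⁅-f, e⁆ = (D.coroot l : L) := by rw [neg_lie, hfe, neg_neg]
    have h2 : ⁅-f, (D.coroot l : L)⁆ = -((2 : ℝ) • f) := by
      rw [neg_lie, hfh, D.self_apply_coroot hl]
    have h3 : ⁅-f, -((2 : ℝ) • f)⁆ = 0 := by simp
    rw [adExp_apply_of_lie_lie_lie_eq_zero nf (by rw [h1, h2, h3]), h1, h2]
    module
  have s4 : adExp e ne e = e := adExp_apply_of_lie_eq_zero ne (lie_self e)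
  refine ⟨(adExp e ne).trans ((adExp (-f) nf).trans (adExp e ne)), fun h => ?_, fun M h1 h2 x hx => ?_⟩
  · change adExp e ne (adExp (-f) nf (adExp e ne h)) = _
    rw [s1, map_sub, map_smul, s2, s3]
    have : (h : L) - l h • f - l h • (e + (D.coroot l : L) - f) =
        h - l h • e - l h • (D.coroot l : L) := by module
    rw [this, map_sub, map_sub, map_smul, map_smul, s1, s1, s4, D.self_apply_coroot hl]
    module
  · refine adExp_mem ne h1 (adExp_mem nf (fun y hy => ?_) (adExp_mem ne h1 hx))
    rw [neg_lie]
    exact M.neg_mem (h2 y hy)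

end Triple

lemma map_restrictedRootSpace_of_reflection {l : Dual ℝ D.𝔞} (hl : l ≠ 0) {τ : L ≃ₗ⁅ℝ⁆ L}
    (hτ : ∀ h : D.𝔞, τ h = h - l h • (D.coroot l : L)) {m : Dual ℝ D.𝔞} {x : L}
    (hx : x ∈ restrictedRootSpace D.𝔞 m) : τ x ∈ restrictedRootSpace D.𝔞 (D.refl l m) := fun h => by
  have h1 : (h : L) = τ ((h - l h • D.coroot l : D.𝔞) : L) := by
    rw [hτ]
    simp only [Submodule.coe_sub, Submodule.coe_smul, map_sub, map_smul, smul_eq_mul,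
      D.self_apply_coroot hl]
    module
  conv_lhs => rw [h1]
  rw [← LieEquiv.map_lie, hx, map_smul, refl_apply]
  congr 1
  simp only [map_sub, map_smul, LinearMap.sub_apply, LinearMap.smul_apply, smul_eq_mul]
  ring

lemma refl_mem_roots {l m : Dual ℝ D.𝔞} (hl : l ∈ D.roots) (hm : m ∈ D.roots) :
    D.refl l m ∈ D.roots := by
  obtain ⟨e, he, he0⟩ := Submodule.exists_mem_ne_zero_of_ne_bot hl.2
  obtain ⟨x, hx, hx0⟩ := Submodule.exists_mem_ne_zero_of_ne_bot hm.2
  obtain ⟨τ, hτ, -⟩ := D.exists_reflection he hl.1 he0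
  have h1 := D.map_restrictedRootSpace_of_reflection hl.1 hτ hx
  refine ⟨fun h0 => hm.1 ?_, fun hb => hx0 ?_⟩
  · rw [← D.refl_refl hl.1 m, h0]; simp [refl]
  · have hinj : Function.Injective τ := τ.injective
    refine hinj ?_
    rw [(Submodule.eq_bot_iff _).mp hb _ h1, map_zero]

end IwasawaDatum

section WeylClosureLemmas

variable {ι : Type*} [Fintype ι] [DecidableEq ι] {X : Matrix ι ι ℤ}

lemma sub_single_reflect (hX : ∀ i, X i i = 2) (v : ι → ℤ) (i : ι) :
    (v - Pi.single i (∑ j, X i j * v j)) -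
      Pi.single i (∑ j, X i j * (v - (Pi.single i (∑ j, X i j * v j) : ι → ℤ)) j) = v := by
  ext k
  by_cases hk : k = i
  · subst hk
    have h1 : ∀ m : ℤ, ∑ j, X k j * (Pi.single k m : ι → ℤ) j = 2 * m := fun m => by
      rw [Finset.sum_eq_single k]
      · simp [hX]
      · intro j _ hj; simp [hj]
      · simp
    simp only [Pi.sub_apply, Pi.single_eq_same, mul_sub, Finset.sum_sub_distrib, h1]
    ring
  · simp [hk]

lemma WeylClosure.neg {S : Set (ι → ℤ)} (hX : ∀ i, X i i = 2)
    (hS : ∀ v ∈ S, ∃ i m, v = Pi.single i m) {v : ι → ℤ} (hv : WeylClosure X S v) :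
    WeylClosure X S (-v) := by
  induction hv with
  | base v hv =>
    obtain ⟨i, m, rfl⟩ := hS v hv
    have := WeylClosure.reflect (X := X) _ i (WeylClosure.base _ hv)
    convert this using 1
    ext k
    rw [Finset.sum_eq_single i]
    · by_cases hk : k = i
      · subst hk; simp [hX]; ring
      · simp [hk]
    · intro j _ hj; simp [hj]
    · simp
  | reflect v i hv ih =>
    have := WeylClosure.reflect (X := X) _ i ih
    convert this using 1
    ext k
    simp only [Pi.neg_apply, Pi.sub_apply, mul_neg, Finset.sum_neg_distrib, Pi.single_neg]
    ring

lemma WeylClosure.mem_of_stable {S T : Set (ι → ℤ)} (hST : S ⊆ T)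
    (hT : ∀ c ∈ T, ∀ i, c - Pi.single i (∑ j, X i j * c j) ∈ T) {v : ι → ℤ}
    (hv : WeylClosure X S v) : v ∈ T := by
  induction hv with
  | base v hv => exact hST hv
  | reflect v i _ ih => exact hT v ih i

/-- A sign-coherent set stable under the simple reflections is contained in the closure of the
multiples of simple roots that it contains. -/
lemma weylClosure_of_sign {S G : Set (ι → ℤ)} (hX : ∀ i, X i i = 2)
    (hrefl : ∀ c ∈ S, ∀ i, c - Pi.single i (∑ j, X i j * c j) ∈ S)
    (hneg : ∀ c ∈ S, -c ∈ S)
    (hsign : ∀ c ∈ S, (∀ i, 0 ≤ c i) ∨ ∀ i, c i ≤ 0)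
    (hpos : ∀ c ∈ S, (∀ i, 0 ≤ c i) → ∃ i, 0 < c i ∧ 0 < ∑ j, X i j * c j)
    (hG : ∀ i m, 0 < m → Pi.single i m ∈ S → Pi.single i m ∈ G)
    (hG' : ∀ v ∈ G, ∃ i m, v = Pi.single i m) {c : ι → ℤ} (hc : c ∈ S) : WeylClosure X G c := by
  have key : ∀ n : ℕ, ∀ c ∈ S, (∀ i, 0 ≤ c i) → ∑ i, c i ≤ n → WeylClosure X G c := by
    intro n
    induction n with
    | zero =>
      intro c hc h0 hn
      obtain ⟨i, hi, -⟩ := hpos c hc h0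
      have := Finset.single_le_sum (f := c) (fun j _ => h0 j) (Finset.mem_univ i)
      simp only [Nat.cast_zero] at hn
      omega
    | succ n ih =>
      intro c hc h0 hn
      obtain ⟨i, hi, hi'⟩ := hpos c hc h0
      set c' := c - Pi.single i (∑ j, X i j * c j) with hc'
      rcases hsign c' (hrefl c hc i) with h1 | h1
      · have h2 : ∑ j, c' j = ∑ j, c j - ∑ j, X i j * c j := by
          simp [hc', Finset.sum_sub_distrib]
        have h3 := WeylClosure.reflect (X := X) _ i (ih c' (hrefl c hc i) h1 (by
          push_cast at hn; omega))
        rwa [hc', sub_single_reflect hX] at h3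
      · have h2 : c = Pi.single i (c i) := by
          ext k
          by_cases hk : k = i
          · subst hk; simp
          · have h3 := h1 k
            have h4 := h0 k
            simp only [hc', Pi.sub_apply, Pi.single_apply, hk, if_false] at h3
            simp only [Pi.single_apply, hk, if_false]; omega
        rw [h2]
        exact WeylClosure.base _ (hG i _ hi (h2 ▸ hc))
  have key' : ∀ c ∈ S, (∀ i, 0 ≤ c i) → WeylClosure X G c := fun c hc h0 =>
    key (∑ i, c i).toNat c hc h0 (by rw [Int.toNat_of_nonneg (Finset.sum_nonneg fun i _ => h0 i)])
  rcases hsign c hc with h | h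
  · exact key' c hc h
  · have := (key' (-c) (hneg c hc) fun i => by simpa using h i).neg hX hG'
    rwa [neg_neg] at this

end WeylClosureLemmas

namespace IwasawaDatum

variable {L : Type*} [LieRing L] [LieAlgebra ℝ L] [FiniteDimensional ℝ L] (D : IwasawaDatum L)

lemma neg_mem_roots {l : Dual ℝ D.𝔞} (hl : l ∈ D.roots) : -l ∈ D.roots := by
  have := D.refl_mem_roots hl hl
  rw [refl, D.self_apply_coroot hl.1] at this
  convert this using 1
  module

/-! ### Simple systems -/

section Simple

variable {D} {Δ : Set (Dual ℝ D.𝔞)} (hΔ : IsSimpleSystem D.roots Δ)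

include hΔ

lemma span_simple : Submodule.span ℝ Δ = ⊤ := by
  rw [eq_top_iff, ← D.span_roots, Submodule.span_le]
  have h : ∀ v ∈ AddSubmonoid.closure Δ, v ∈ Submodule.span ℝ Δ := fun v hv =>
    (AddSubmonoid.closure_le (S := (Submodule.span ℝ Δ).toAddSubmonoid)).mpr
      Submodule.subset_span hv
  intro v hv
  rcases hΔ.pos_or_neg v hv with h1 | h1
  · exact h _ h1
  · exact neg_neg v ▸ Submodule.neg_mem _ (h _ h1)

/-- The basis of simple roots. -/
noncomputable def simpleBasis : Basis Δ ℝ (Dual ℝ D.𝔞) :=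
  Basis.mk (v := fun σ : Δ => (σ : Dual ℝ D.𝔞)) hΔ.independent
    (by rw [Subtype.range_coe, span_simple hΔ])

lemma simpleBasis_apply (σ : Δ) : simpleBasis hΔ σ = σ := Basis.mk_apply _ _ _

lemma repr_nat {v : Dual ℝ D.𝔞} (hv : v ∈ AddSubmonoid.closure Δ) (σ : Δ) :
    ∃ n : ℕ, (simpleBasis hΔ).repr v σ = n := by
  induction hv using AddSubmonoid.closure_induction with
  | mem x hx =>
    classical
    have h1 : x = simpleBasis hΔ ⟨x, hx⟩ := (simpleBasis_apply hΔ ⟨x, hx⟩).symm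
    rw [h1, Basis.repr_self, Finsupp.single_apply]
    split_ifs
    · exact ⟨1, by simp⟩
    · exact ⟨0, by simp⟩
  | zero => exact ⟨0, by simp⟩
  | add x y _ _ hx hy =>
    obtain ⟨a, ha⟩ := hx
    obtain ⟨b, hb⟩ := hy
    exact ⟨a + b, by simp [ha, hb]⟩

lemma repr_nonneg {v : Dual ℝ D.𝔞} (hv : v ∈ AddSubmonoid.closure Δ) (σ : Δ) :
    0 ≤ (simpleBasis hΔ).repr v σ := by
  obtain ⟨n, hn⟩ := repr_nat hΔ hv σ
  rw [hn]; positivity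

lemma eq_zero_of_mem_neg_mem {v : Dual ℝ D.𝔞} (hv : v ∈ AddSubmonoid.closure Δ)
    (hv' : -v ∈ AddSubmonoid.closure Δ) : v = 0 := by
  refine (simpleBasis hΔ).ext_elem fun σ => ?_
  have h1 := repr_nonneg hΔ hv σ
  have h2 := repr_nonneg hΔ hv' σ
  simp only [map_neg, Finsupp.neg_apply, map_zero, Finsupp.coe_zero, Pi.zero_apply] at h2 ⊢
  linarith

lemma exists_height : ∃ f : Dual ℝ (Dual ℝ D.𝔞), (∀ σ ∈ Δ, f σ = 1) ∧
    ∀ v ∈ AddSubmonoid.closure Δ, v ≠ 0 → 1 ≤ f v := by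
  let f := (simpleBasis hΔ).constr ℝ (fun _ => (1 : ℝ))
  have hf : ∀ σ ∈ Δ, f σ = 1 := fun σ hσ => by
    have := (simpleBasis hΔ).constr_basis ℝ (fun _ => (1 : ℝ)) ⟨σ, hσ⟩
    rwa [simpleBasis_apply] at this
  refine ⟨f, hf, fun v hv h0 => ?_⟩
  have : v = 0 ∨ 1 ≤ f v := by
    induction hv using AddSubmonoid.closure_induction with
    | mem x hx => exact Or.inr (hf x hx).ge
    | zero => exact Or.inl rfl
    | add x y hx hy ihx ihy =>
      by_cases hx0 : x = 0
      · subst hx0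
        by_cases hy0 : y = 0
        · left; simp [hy0]
        · right; rw [zero_add]; exact (ihy hy0).resolve_left hy0
      · have h1 := (ihx hx0).resolve_left hx0
        by_cases hy0 : y = 0
        · right; rw [hy0, add_zero]; exact h1
        · have h2 := (ihy hy0).resolve_left hy0
          right; rw [map_add]; linarith
  exact this.resolve_left h0

lemma refl_mem_closure {α v : Dual ℝ D.𝔞} (hα : α ∈ Δ) (hv : v ∈ D.roots)
    (hv' : v ∈ AddSubmonoid.closure Δ) (hne : ∀ c : ℝ, v ≠ c • α) :
    D.refl α v ∈ AddSubmonoid.closure Δ := by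
  have hα' := hΔ.subset hα
  refine (hΔ.pos_or_neg _ (D.refl_mem_roots hα' hv)).resolve_right fun hn => ?_
  have h1 : ∀ σ : Δ, (σ : Dual ℝ D.𝔞) ≠ α → (simpleBasis hΔ).repr v σ = 0 := fun σ hσ => by
    have h2 := repr_nonneg hΔ hn σ
    have h3 := repr_nonneg hΔ hv' σ
    have h4 : (simpleBasis hΔ).repr α σ = 0 := by
      have h5 : α = simpleBasis hΔ ⟨α, hα⟩ := (simpleBasis_apply hΔ ⟨α, hα⟩).symm
      rw [h5, Basis.repr_self, Finsupp.single_eq_of_ne]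
      intro h; exact hσ (by rw [h])
    simp only [refl, map_neg, map_sub, map_smul, Finsupp.neg_apply, Finsupp.sub_apply,
      Finsupp.smul_apply, h4, smul_zero, sub_zero] at h2
    linarith
  have hr : (simpleBasis hΔ).repr α = Finsupp.single ⟨α, hα⟩ 1 := by
    have := (simpleBasis hΔ).repr_self ⟨α, hα⟩
    rwa [simpleBasis_apply] at this
  refine hne ((simpleBasis hΔ).repr v ⟨α, hα⟩) ((simpleBasis hΔ).ext_elem fun σ => ?_)
  rw [map_smul, hr]
  by_cases hσ : (σ : Dual ℝ D.𝔞) = α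
  · have : σ = ⟨α, hα⟩ := Subtype.ext hσ
    subst this
    simp
  · rw [h1 σ hσ, Finsupp.smul_apply, Finsupp.single_eq_of_ne, smul_zero]
    intro h; exact hσ (by rw [h])

lemma simple_subset_of_closure_eq {Δ' : Set (Dual ℝ D.𝔞)}
    (h : AddSubmonoid.closure Δ = AddSubmonoid.closure Δ') : Δ ⊆ Δ' := by
  obtain ⟨f, hf, hf'⟩ := exists_height hΔ
  intro α hα
  have key : ∀ x ∈ AddSubmonoid.closure Δ', x = 0 ∨ x ∈ Δ' ∨ 2 ≤ f x := by
    intro x hx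
    induction hx using AddSubmonoid.closure_induction with
    | mem x hx => exact Or.inr (Or.inl hx)
    | zero => exact Or.inl rfl
    | add x y hx hy ihx ihy =>
      by_cases hx0 : x = 0
      · rwa [hx0, zero_add]
      by_cases hy0 : y = 0
      · rwa [hy0, add_zero]
      have h1 := hf' x (h ▸ hx) hx0
      have h2 := hf' y (h ▸ hy) hy0
      right; right; rw [map_add]; linarith
  rcases key α (h ▸ AddSubmonoid.subset_closure hα) with h1 | h1 | h1
  · exact absurd h1 (hΔ.subset hα).1
  · exact h1
  · rw [hf α hα] at h1; norm_num at h1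

end Simple

/-- The reflection as a linear automorphism. -/
noncomputable def reflEquiv {l : Dual ℝ D.𝔞} (hl : l ≠ 0) : Dual ℝ D.𝔞 ≃ₗ[ℝ] Dual ℝ D.𝔞 where
  toFun := D.refl l
  invFun := D.refl l
  left_inv := D.refl_refl hl
  right_inv := D.refl_refl hl
  map_add' a b := by simp only [refl, LinearMap.add_apply]; module
  map_smul' c a := by simp only [refl, LinearMap.smul_apply, RingHom.id_apply, smul_eq_mul]; module

lemma reflEquiv_apply {l : Dual ℝ D.𝔞} (hl : l ≠ 0) (m) : D.reflEquiv hl m = D.refl l m := rfl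

end IwasawaDatum

lemma image_linearEquiv_trans {U V W : Type*} [AddCommGroup U] [Module ℝ U] [AddCommGroup V]
    [Module ℝ V] [AddCommGroup W] [Module ℝ W] (f : U ≃ₗ[ℝ] V) (g : V ≃ₗ[ℝ] W) (S : Set U) :
    (f.trans g) '' S = g '' (f '' S) := (Set.image_image g f S).symm

lemma image_image_of_inverse {α β : Type*} {f : α → β} {g : β → α} (h : ∀ x, g (f x) = x)
    (S : Set α) : g '' (f '' S) = S := by
  rw [Set.image_image]; simp [h]

lemma mem_closure_image_iff {V W : Type*} [AddCommGroup V] [Module ℝ V] [AddCommGroup W] [Module ℝ W]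
    (f : V ≃ₗ[ℝ] W) (Δ : Set V) (v : V) :
    f v ∈ AddSubmonoid.closure (f '' Δ) ↔ v ∈ AddSubmonoid.closure Δ := by
  have h := AddMonoidHom.map_mclosure (f : V →+ W) Δ
  have h1 : AddSubmonoid.closure (f '' Δ) = (AddSubmonoid.closure Δ).map (f : V →+ W) := h.symm
  rw [h1, AddSubmonoid.mem_map]
  constructor
  · rintro ⟨x, hx, hx'⟩
    rwa [← f.injective hx']
  · exact fun hv => ⟨v, hv, rfl⟩

lemma IsSimpleSystem.image {V W : Type*} [AddCommGroup V] [Module ℝ V] [AddCommGroup W] [Module ℝ W]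
    {Φ Δ : Set V} (h : IsSimpleSystem Φ Δ) (f : V ≃ₗ[ℝ] W) : IsSimpleSystem (f '' Φ) (f '' Δ) where
  subset := Set.image_mono h.subset
  independent := by
    have h1 : LinearIndepOn ℝ (f : V → W) Δ :=
      h.independent.map_injOn (f : V →ₗ[ℝ] W) f.injective.injOn
    exact h1.id_image
  pos_or_neg := by
    rintro _ ⟨v, hv, rfl⟩
    rw [← map_neg, mem_closure_image_iff, mem_closure_image_iff]
    exact h.pos_or_neg v hv

namespace IwasawaDatum

variable {L : Type*} [LieRing L] [LieAlgebra ℝ L] [FiniteDimensional ℝ L] (D : IwasawaDatum L)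

/-- Any two simple systems of the restricted roots are conjugate. -/
theorem exists_isometry_simple {Δ' : Set (Dual ℝ D.𝔞)} (hΔ' : IsSimpleSystem D.roots Δ') :
    ∃ w : Dual ℝ D.𝔞 ≃ₗ[ℝ] Dual ℝ D.𝔞, (∀ l m, D.dualForm (w l) (w m) = D.dualForm l m) ∧
      w '' D.roots = D.roots ∧ w '' D.simple = Δ' := by
  have hΔ : IsSimpleSystem D.roots D.simple := D.isSimpleSystem
  let N : Set (Dual ℝ D.𝔞) → Set (Dual ℝ D.𝔞) := fun Δ' =>
    {v ∈ D.roots | v ∈ AddSubmonoid.closure D.simple ∧ -v ∈ AddSubmonoid.closure Δ'}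
  have hfin : ∀ Δ', (N Δ').Finite := fun Δ' => D.finite_roots.subset fun v hv => hv.1
  induction hn : (N Δ').ncard using Nat.strong_induction_on generalizing Δ' with
  | _ n ih =>
  by_cases hex : ∃ α ∈ D.simple, -α ∈ AddSubmonoid.closure Δ'
  · obtain ⟨α, hα, hαn⟩ := hex
    have hαr := hΔ.subset hα
    have himg : D.reflEquiv hαr.1 '' D.roots = D.roots := by
      ext v
      constructor
      · rintro ⟨u, hu, rfl⟩; exact D.refl_mem_roots hαr hu
      · exact fun hv => ⟨D.refl α v, D.refl_mem_roots hαr hv, D.refl_refl hαr.1 v⟩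
    have hΔ'' : IsSimpleSystem D.roots (D.reflEquiv hαr.1 '' Δ') := by
      have := hΔ'.image (D.reflEquiv hαr.1)
      rwa [himg] at this
    have hcl : ∀ v, v ∈ AddSubmonoid.closure (D.reflEquiv hαr.1 '' Δ') ↔
        D.refl α v ∈ AddSubmonoid.closure Δ' := fun v => by
      rw [← mem_closure_image_iff (D.reflEquiv hαr.1) Δ' (D.refl α v), reflEquiv_apply,
        D.refl_refl hαr.1]
    have hrneg : ∀ v, D.refl α (-v) = -D.refl α v := fun v => (D.reflEquiv hαr.1).map_neg v
    have hsub : D.refl α '' N (D.reflEquiv hαr.1 '' Δ') ⊂ N Δ' := by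
      rw [Set.ssubset_iff_of_subset]
      · refine ⟨α, ⟨hαr, AddSubmonoid.subset_closure hα, hαn⟩, ?_⟩
        rintro ⟨v, hv, hv'⟩
        have h1 : v = -α := by
          rw [← D.refl_refl hαr.1 v, hv', refl, D.self_apply_coroot hαr.1]; module
        have h2 := eq_zero_of_mem_neg_mem hΔ (AddSubmonoid.subset_closure hα) (h1 ▸ hv.2.1)
        exact hαr.1 h2
      · rintro _ ⟨v, ⟨hv, hv1, hv2⟩, rfl⟩
        rw [hcl, hrneg] at hv2
        refine ⟨D.refl_mem_roots hαr hv, refl_mem_closure hΔ hα hv hv1 ?_, hv2⟩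
        rintro c rfl
        obtain ⟨f, hf, hf'⟩ := exists_height hΔ
        obtain ⟨f', -, hf''⟩ := exists_height hΔ'
        have h1 := hf' _ hv1 hv.1
        rw [map_smul, hf α hα, smul_eq_mul, mul_one] at h1
        have h2 := hf'' _ hαn (neg_ne_zero.mpr hαr.1)
        have h3 : -D.refl α (c • α) = c • α := by
          simp only [refl, LinearMap.smul_apply, D.self_apply_coroot hαr.1, smul_eq_mul]; module
        rw [h3] at hv2
        have h4 := hf'' _ hv2 hv.1
        rw [map_smul, smul_eq_mul] at h4
        rw [map_neg] at h2
        nlinarith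
    have hlt : (N (D.reflEquiv hαr.1 '' Δ')).ncard < n := by
      rw [← hn, ← Set.ncard_image_of_injective _ (D.reflEquiv hαr.1).injective]
      exact Set.ncard_lt_ncard hsub (hfin _)
    obtain ⟨w, hw1, hw2, hw3⟩ := ih _ hlt hΔ'' rfl
    refine ⟨w.trans (D.reflEquiv hαr.1), fun l m => ?_, ?_, ?_⟩
    · rw [LinearEquiv.trans_apply, LinearEquiv.trans_apply, reflEquiv_apply, reflEquiv_apply,
        D.dualForm_refl hαr.1, hw1]
    · exact (image_linearEquiv_trans _ _ _).trans (by rw [hw2, himg])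
    · exact (image_linearEquiv_trans _ _ _).trans
        (by rw [hw3]; exact image_image_of_inverse (D.refl_refl hαr.1) Δ')
  · push Not at hex
    have hle : AddSubmonoid.closure D.simple ≤ AddSubmonoid.closure Δ' :=
      (AddSubmonoid.closure_le).mpr fun α hα =>
        (hΔ'.pos_or_neg α (hΔ.subset hα)).resolve_right (hex α hα)
    have hge : AddSubmonoid.closure Δ' ≤ AddSubmonoid.closure D.simple := by
      refine (AddSubmonoid.closure_le).mpr fun β hβ =>
        (hΔ.pos_or_neg β (hΔ'.subset hβ)).resolve_right fun h => ?_
      exact (hΔ'.subset hβ).1 (eq_zero_of_mem_neg_mem hΔ' (AddSubmonoid.subset_closure hβ) (hle h))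
    have heq := le_antisymm hle hge
    refine ⟨LinearEquiv.refl ℝ _, fun _ _ => rfl, Set.image_id _, (Set.image_id _).trans ?_⟩
    exact (simple_subset_of_closure_eq hΔ heq).antisymm
      (simple_subset_of_closure_eq hΔ' heq.symm)

/-! ### Transfer of the type -/

lemma HasType.transfer {D D' : IwasawaDatum L} {ι : Type*} [Fintype ι] {X : Matrix ι ι ℤ}
    {R : Set (ι → ℤ)} {Φ' : Set (Dual ℝ D'.𝔞)} (h : D'.HasType Φ' X R)
    (f : Dual ℝ D'.𝔞 ≃ₗ[ℝ] Dual ℝ D.𝔞) (hf : ∀ l m, D.dualForm (f l) (f m) = D'.dualForm l m)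
    (hs : f '' D'.simple = D.simple) : D.HasType (f '' Φ') X R := by
  obtain ⟨σ, h1, h2⟩ := h
  let e : D'.simple ≃ D.simple := (f.toEquiv.image D'.simple).trans (Equiv.setCongr hs)
  have he : ∀ i, ((e (σ i) : D.simple) : Dual ℝ D.𝔞) = f (σ i) := fun i => rfl
  refine ⟨σ.trans e, fun i j => ?_, ?_⟩
  · simp only [Equiv.trans_apply, he, hf]
    exact h1 i j
  · simp only [Equiv.trans_apply, he]
    ext l
    rw [h2]
    constructor
    · rintro ⟨_, ⟨c, hc, rfl⟩, rfl⟩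
      exact ⟨c, hc, by simp [map_sum, map_zsmul]⟩
    · rintro ⟨c, hc, rfl⟩
      exact ⟨_, ⟨c, hc, rfl⟩, by simp [map_sum, map_zsmul]⟩

/-- The type of the restricted root system does not depend on the choices. -/
theorem hasType_of_hasType (D D' : IwasawaDatum L) {ι : Type*} [Fintype ι] {X : Matrix ι ι ℤ}
    {R : Set (ι → ℤ)} (h : D'.HasType D'.roots X R) : D.HasType D.roots X R := by
  obtain ⟨φ, hφ, hφ'⟩ := D.conjugate D'
  let ψ : D'.𝔞 ≃ₗ[ℝ] D.𝔞 := LinearEquiv.ofSubmodules φ.toLinearEquiv D'.𝔞 D.𝔞 (by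
    ext x
    rw [Submodule.mem_map]
    constructor
    · rintro ⟨y, hy, rfl⟩; exact (hφ' y).mpr hy
    · intro hx
      obtain ⟨y, rfl⟩ := φ.toLinearEquiv.surjective x
      exact ⟨y, (hφ' y).mp hx, rfl⟩)
  have hψ : ∀ x, (ψ x : L) = φ x := fun _ => rfl
  have hψ' : ∀ x, φ (ψ.symm x : L) = x := fun x => by rw [← hψ, LinearEquiv.apply_symm_apply]
  let f : Dual ℝ D'.𝔞 ≃ₗ[ℝ] Dual ℝ D.𝔞 := ψ.symm.dualMap
  have hf : ∀ l x, f l x = l (ψ.symm x) := fun _ _ => rfl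
  have htv : ∀ m, ψ (D'.tvec m) = D.tvec (f m) := fun m => by
    refine (D.killingOn.toDual D.killingOn_nondegenerate).injective (LinearMap.ext fun h => ?_)
    rw [LinearMap.BilinForm.toDual_def, LinearMap.BilinForm.toDual_def, killingOn_tvec, hf,
      ← D'.killingOn_tvec]
    change killingForm ℝ L (ψ (D'.tvec m) : L) (h : L) =
      killingForm ℝ L (D'.tvec m : L) (ψ.symm h : L)
    rw [hψ, ← hψ' h, killingForm_lieEquiv]
  have hform : ∀ l m, D.dualForm (f l) (f m) = D'.dualForm l m := fun l m => by
    rw [dualForm_eq, dualForm_eq, ← htv, hf, LinearEquiv.symm_apply_apply]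
  have hroots : f '' D'.roots = D.roots := by
    have hmem : ∀ l x, x ∈ restrictedRootSpace D'.𝔞 l ↔ φ x ∈ restrictedRootSpace D.𝔞 (f l) := by
      intro l x
      constructor
      · intro hx h
        rw [← hψ' h, ← LieEquiv.map_lie, hx, map_smul, hf]
      · intro hx h
        have hinj : Function.Injective φ := φ.injective
        refine hinj ?_
        rw [LieEquiv.map_lie, map_smul, ← hψ, hx, hf, LinearEquiv.symm_apply_apply]
    ext l
    constructor
    · rintro ⟨m, hm, rfl⟩
      refine ⟨fun h0 => hm.1 (f.injective (by rw [h0, map_zero])), fun hb => hm.2 ?_⟩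
      rw [Submodule.eq_bot_iff] at hb ⊢
      intro x hx
      have hinj : Function.Injective φ := φ.injective
      exact hinj (by rw [hb _ ((hmem m x).mp hx), map_zero])
    · intro hl
      refine ⟨f.symm l, ⟨fun h0 => hl.1 (f.symm.injective (by rw [h0, map_zero])), fun hb => hl.2 ?_⟩,
        f.apply_symm_apply l⟩
      rw [Submodule.eq_bot_iff] at hb ⊢
      intro x hx
      have hsurj : Function.Surjective φ := φ.surjective
      obtain ⟨y, rfl⟩ := hsurj x
      rw [hb y ((hmem _ y).mpr (by rwa [f.apply_symm_apply])), map_zero]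
  have hΔ' : IsSimpleSystem D'.roots (f.symm '' D.simple) := by
    have := D.isSimpleSystem.image f.symm
    have h2 : f.symm '' restrictedRoots D.𝔞 = D'.roots := by
      rw [show restrictedRoots D.𝔞 = D.roots from rfl, ← hroots]
      exact image_image_of_inverse f.symm_apply_apply _
    rwa [h2] at this
  obtain ⟨w, hw1, hw2, hw3⟩ := D'.exists_isometry_simple hΔ'
  have := h.transfer (D := D) (w.trans f)
    (fun l m => by rw [LinearEquiv.trans_apply, LinearEquiv.trans_apply, hform, hw1]) (by
      rw [image_linearEquiv_trans, hw3]
      exact image_image_of_inverse f.apply_symm_apply _)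
  rwa [image_linearEquiv_trans, hw2, hroots] at this

/-! ### Determination of the type -/

/-- The roots are determined by their coefficient vectors: the Cartan integers are given by `X` if the
simple reflections defined by `X` preserve the set of coefficient vectors. -/
theorem hasType_of_coeff {ι : Type*} [Fintype ι] [DecidableEq ι] {X : Matrix ι ι ℤ}
    {S G : Set (ι → ℤ)} (σ : ι ≃ D.simple) (hX : ∀ i, X i i = 2)
    (hS : D.roots = {l | ∃ c ∈ S, l = ∑ i, c i • (σ i : Dual ℝ D.𝔞)})
    (hrefl : ∀ c ∈ S, ∀ i, c - Pi.single i (∑ j, X i j * c j) ∈ S)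
    (hGS : G ⊆ S) (hG : ∀ i m, 0 < m → Pi.single i m ∈ S → Pi.single i m ∈ G)
    (hG' : ∀ v ∈ G, ∃ i m, v = Pi.single i m) :
    D.HasType D.roots X {v | WeylClosure X G v} := by
  let b := (simpleBasis D.isSimpleSystem).reindex σ.symm
  have hb : ∀ i, b i = (σ i : Dual ℝ D.𝔞) := fun i => by
    simp only [b, Basis.reindex_apply, Equiv.symm_symm]
    exact simpleBasis_apply D.isSimpleSystem (σ i)
  have hrepr : ∀ (c : ι → ℤ) i, b.repr (∑ i, c i • (σ i : Dual ℝ D.𝔞)) i = c i := fun c i => by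
    simp only [← hb, ← Int.cast_smul_eq_zsmul ℝ]
    rw [b.repr_sum_self]
  have hmem : ∀ c : ι → ℤ, ∑ i, c i • (σ i : Dual ℝ D.𝔞) ∈ D.roots ↔ c ∈ S := fun c => by
    rw [hS]
    constructor
    · rintro ⟨c', hc', h⟩
      have : c = c' := by
        ext i
        have := congrArg (fun v => b.repr v i) h
        simp only [hrepr] at this
        exact_mod_cast this
      rwa [this]
    · exact fun hc => ⟨c, hc, rfl⟩
  have hsr : ∀ i, (σ i : Dual ℝ D.𝔞) ∈ D.roots := fun i => D.isSimpleSystem.subset (σ i).2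
  have hC : ∀ i j, 2 * D.dualForm (σ i) (σ j) / D.dualForm (σ i) (σ i) = X i j := by
    intro i j
    let g : Dual ℝ (Dual ℝ D.𝔞) := ∑ k, (X i k : ℝ) • b.coord k
    have hgσ : ∀ k, g (σ k) = X i k := fun k => by
      simp only [g, LinearMap.sum_apply, LinearMap.smul_apply, Basis.coord_apply, ← hb,
        Basis.repr_self, smul_eq_mul, Finsupp.single_apply, mul_ite, mul_one, mul_zero]
      simp
    let g' : Dual ℝ (Dual ℝ D.𝔞) := Dual.eval ℝ D.𝔞 (D.coroot (σ i))
    have hgg : g' = g := by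
      refine Module.Dual.eq_of_preReflection_mapsTo (x := (σ i : Dual ℝ D.𝔞)) D.finite_roots D.span_roots ?_ ?_ ?_ ?_
      · exact D.self_apply_coroot (hsr i).1
      · intro l hl
        exact D.refl_mem_roots (hsr i) hl
      · rw [hgσ, hX]; norm_num
      · intro l hl
        rw [hS] at hl
        obtain ⟨c, hc, rfl⟩ := hl
        have h1 := (hmem _).mpr (hrefl c hc i)
        convert h1 using 1
        rw [preReflection_apply]
        have h2 : g (∑ k, c k • (σ k : Dual ℝ D.𝔞)) = ((∑ k, X i k * c k : ℤ) : ℝ) := by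
          simp only [map_sum, map_zsmul, hgσ]
          push_cast
          exact Finset.sum_congr rfl fun k _ => by simp [mul_comm]
        rw [h2, Int.cast_smul_eq_zsmul]
        simp only [Pi.sub_apply, sub_smul, Finset.sum_sub_distrib]
        congr 1
        symm
        rw [Finset.sum_eq_single i]
        · simp
        · intro k _ hk; simp [hk]
        · simp
    rw [← apply_coroot, ← hgσ, ← hgg]
    rfl
  refine ⟨σ, hC, ?_⟩
  have hneg : ∀ c ∈ S, -c ∈ S := fun c hc => by
    have := D.neg_mem_roots ((hmem c).mpr hc)
    rw [← hmem]
    convert this using 1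
    simp
  have hsign : ∀ c ∈ S, (∀ i, 0 ≤ c i) ∨ ∀ i, c i ≤ 0 := by
    have h1 : ∀ (v : Dual ℝ D.𝔞) (i : ι), v ∈ AddSubmonoid.closure D.simple → 0 ≤ b.repr v i :=
      fun v i hv => by
        simp only [b, Basis.repr_reindex_apply]
        exact repr_nonneg D.isSimpleSystem hv _
    intro c hc
    rcases D.isSimpleSystem.pos_or_neg _ ((hmem c).mpr hc) with h | h
    · left; intro i
      have := h1 _ i h
      rw [hrepr] at this
      exact_mod_cast this
    · right; intro i
      have := h1 _ i h
      rw [map_neg, Finsupp.neg_apply, hrepr] at this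
      have h2 : (c i : ℝ) ≤ 0 := by linarith
      exact_mod_cast h2
  have hpos : ∀ c ∈ S, (∀ i, 0 ≤ c i) → ∃ i, 0 < c i ∧ 0 < ∑ j, X i j * c j := by
    intro c hc h0
    set l := ∑ i, c i • (σ i : Dual ℝ D.𝔞) with hl
    have h1 := D.dualForm_pos ((hmem c).mpr hc).1
    rw [← hl] at h1
    have h2 : D.dualForm l l = ∑ i, c i * D.dualForm (σ i) l := by
      rw [← dualBilin_apply]
      nth_rewrite 1 [hl]
      simp [map_sum, LinearMap.sum_apply, dualBilin_apply]
    rw [h2] at h1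
    obtain ⟨i, -, hi⟩ := Finset.exists_lt_of_sum_lt (f := fun _ : ι => (0 : ℝ)) (by simpa using h1)
    have hci : (0 : ℝ) ≤ c i := by exact_mod_cast h0 i
    have h3 : (0 : ℝ) < c i := lt_of_le_of_ne hci fun h => by simp [← h] at hi
    have h4 := pos_of_mul_pos_right hi hci
    refine ⟨i, by exact_mod_cast h3, ?_⟩
    have h5 : ((∑ j, X i j * c j : ℤ) : ℝ) = 2 * D.dualForm (σ i) l / D.dualForm (σ i) (σ i) := by
      have h6 : D.dualForm (σ i) l = ∑ j, c j * D.dualForm (σ i) (σ j) := by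
        rw [← dualBilin_apply, hl]
        simp [map_sum, dualBilin_apply]
      rw [h6, Finset.mul_sum, Finset.sum_div]
      push_cast
      refine Finset.sum_congr rfl fun j _ => ?_
      rw [← hC]; ring
    have h7 : (0 : ℝ) < ((∑ j, X i j * c j : ℤ) : ℝ) := by
      rw [h5]
      exact div_pos (by linarith) (D.dualForm_pos (hsr i).1)
    exact_mod_cast h7
  have hSG : S = {v | WeylClosure X G v} := by
    ext c
    exact ⟨fun hc => weylClosure_of_sign hX hrefl hneg hsign hpos hG hG' hc,
      fun hc => WeylClosure.mem_of_stable hGS hrefl hc⟩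
  rw [hS, hSG]

/-- Construction of the choices in the Iwasawa decomposition such that the restricted root system has
a given type. -/
theorem exists_hasType {ι : Type*} [Fintype ι] [DecidableEq ι] {X : Matrix ι ι ℤ}
    {S G : Set (ι → ℤ)} {θ : L ≃ₗ⁅ℝ⁆ L} (hθ : IsCartanInvolution θ) {𝔞 : Submodule ℝ L}
    (h𝔞 : Maximal (fun U : Submodule ℝ L =>
      U ≤ noncompactPart θ ∧ ∀ x ∈ U, ∀ y ∈ U, ⁅x, y⁆ = 0) 𝔞)
    (σ : ι → Dual ℝ 𝔞) (hσ : LinearIndependent ℝ σ)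
    (hS : restrictedRoots 𝔞 = {l | ∃ c ∈ S, l = ∑ i, c i • σ i})
    (hsign : ∀ c ∈ S, (∀ i, 0 ≤ c i) ∨ ∀ i, c i ≤ 0) (h1 : ∀ i, Pi.single i 1 ∈ S)
    (hX : ∀ i, X i i = 2)
    (hrefl : ∀ c ∈ S, ∀ i, c - Pi.single i (∑ j, X i j * c j) ∈ S)
    (hGS : G ⊆ S) (hG : ∀ i m, 0 < m → Pi.single i m ∈ S → Pi.single i m ∈ G)
    (hG' : ∀ v ∈ G, ∃ i m, v = Pi.single i m) :
    ∃ D : IwasawaDatum L, D.HasType D.roots X {v | WeylClosure X G v} := by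
  have hcl : ∀ c : ι → ℤ, (∀ i, 0 ≤ c i) → ∑ i, c i • σ i ∈ AddSubmonoid.closure (Set.range σ) := by
    intro c hc
    refine AddSubmonoid.sum_mem _ fun i _ => ?_
    rw [← Int.toNat_of_nonneg (hc i), natCast_zsmul]
    exact AddSubmonoid.nsmul_mem _ (AddSubmonoid.subset_closure (Set.mem_range_self i)) _
  have hss : IsSimpleSystem (restrictedRoots 𝔞) (Set.range σ) := by
    refine ⟨?_, ?_, ?_⟩
    · rintro _ ⟨i, rfl⟩
      rw [hS]
      refine ⟨Pi.single i 1, h1 i, ?_⟩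
      rw [Finset.sum_eq_single i]
      · simp
      · intro j _ hj; simp [hj]
      · simp
    · exact hσ.linearIndepOn_id
    · intro v hv
      rw [hS] at hv
      obtain ⟨c, hc, rfl⟩ := hv
      rcases hsign c hc with h | h
      · exact Or.inl (hcl c h)
      · right
        have := hcl (-c) (fun i => by simpa using h i)
        convert this using 1
        simp
  let D : IwasawaDatum L := ⟨θ, hθ, 𝔞, h𝔞, Set.range σ, hss⟩
  exact ⟨D, D.hasType_of_coeff (Equiv.ofInjective σ hσ.injective) hX hS hrefl hGS hG hG'⟩

end IwasawaDatum

namespace IwasawaDatum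

variable {L : Type*} [LieRing L] [LieAlgebra ℝ L] [FiniteDimensional ℝ L] (D : IwasawaDatum L)

/-! ### The maximal split subalgebra -/

lemma exists_simpleVector (σ : D.simple) : ∃ e ∈ restrictedRootSpace D.𝔞 (σ : Dual ℝ D.𝔞), e ≠ 0 :=
  Submodule.exists_mem_ne_zero_of_ne_bot (D.isSimpleSystem.subset σ.2).2

/-- A chosen root vector for a simple root. -/
noncomputable def simpleVector (σ : D.simple) : L := (D.exists_simpleVector σ).choose

lemma simpleVector_mem (σ : D.simple) : D.simpleVector σ ∈ restrictedRootSpace D.𝔞 (σ : Dual ℝ D.𝔞) :=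
  (D.exists_simpleVector σ).choose_spec.1

lemma simpleVector_ne_zero (σ : D.simple) : D.simpleVector σ ≠ 0 := (D.exists_simpleVector σ).choose_spec.2

/-- The iterated brackets of the chosen root vectors, with their weights. -/
inductive IsIteratedBracket : Dual ℝ D.𝔞 → L → Prop
  | base (σ : D.simple) : IsIteratedBracket σ (D.simpleVector σ)
  | step (σ : D.simple) (l : Dual ℝ D.𝔞) (x : L) (hx : IsIteratedBracket l x) :
      IsIteratedBracket (σ + l) ⁅D.simpleVector σ, x⁆

/-- The span of the iterated brackets. -/
def nilpotentPart : Submodule ℝ L := Submodule.span ℝ {x | ∃ l, D.IsIteratedBracket l x}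

lemma IsIteratedBracket.mem {l : Dual ℝ D.𝔞} {x : L} (h : D.IsIteratedBracket l x) :
    x ∈ restrictedRootSpace D.𝔞 l := by
  induction h with
  | base σ => exact D.simpleVector_mem σ
  | step σ l x _ ih => exact lie_mem_restrictedRootSpace (D.simpleVector_mem σ) ih

lemma IsIteratedBracket.mem_nilpotentPart {l : Dual ℝ D.𝔞} {x : L} (h : D.IsIteratedBracket l x) :
    x ∈ D.nilpotentPart := Submodule.subset_span ⟨l, h⟩

lemma nilpotentPart_le {P : Submodule ℝ L} (h : ∀ l x, D.IsIteratedBracket l x → x ∈ P) :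
    D.nilpotentPart ≤ P := Submodule.span_le.mpr fun x ⟨l, hx⟩ => h l x hx

lemma lie_mem_nilpotentPart_of_mem {h x : L} (hh : h ∈ D.𝔞) (hx : x ∈ D.nilpotentPart) :
    ⁅h, x⁆ ∈ D.nilpotentPart :=
  D.nilpotentPart_le (P := D.nilpotentPart.comap (LieAlgebra.ad ℝ L h)) (fun l y hy => by
    change ⁅h, y⁆ ∈ D.nilpotentPart
    have hm : y ∈ restrictedRootSpace D.𝔞 l := hy.mem
    have h1 : ⁅h, y⁆ = l ⟨h, hh⟩ • y := hm ⟨h, hh⟩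
    rw [h1]
    exact Submodule.smul_mem _ _ hy.mem_nilpotentPart) hx

lemma simpleVector_lie_mem_nilpotentPart (σ : D.simple) {x : L} (hx : x ∈ D.nilpotentPart) :
    ⁅D.simpleVector σ, x⁆ ∈ D.nilpotentPart :=
  D.nilpotentPart_le (P := D.nilpotentPart.comap (LieAlgebra.ad ℝ L (D.simpleVector σ)))
    (fun l y hy => (IsIteratedBracket.step σ l y hy).mem_nilpotentPart) hx

lemma sub_notMem_roots {σ τ : D.simple} (h : σ ≠ τ) :
    ((τ : Dual ℝ D.𝔞) - σ) ∉ insert 0 D.roots := by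
  set b := simpleBasis D.isSimpleSystem with hb
  have h1 : b.repr ((τ : Dual ℝ D.𝔞) - σ) σ = -1 := by
    rw [map_sub, ← simpleBasis_apply D.isSimpleSystem τ, ← simpleBasis_apply D.isSimpleSystem σ]
    simp [← hb, Finsupp.single_eq_of_ne h]
  have h2 : b.repr ((τ : Dual ℝ D.𝔞) - σ) τ = 1 := by
    rw [map_sub, ← simpleBasis_apply D.isSimpleSystem τ, ← simpleBasis_apply D.isSimpleSystem σ]
    simp [← hb, Finsupp.single_eq_of_ne h.symm]
  rintro (h0 | h0)
  · rw [h0] at h1; simp at h1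
  · rcases D.isSimpleSystem.pos_or_neg _ h0 with h3 | h3
    · have := repr_nonneg D.isSimpleSystem h3 σ
      rw [← hb, h1] at this; norm_num at this
    · have := repr_nonneg D.isSimpleSystem h3 τ
      rw [map_neg, Finsupp.neg_apply, ← hb, h2] at this; norm_num at this

lemma theta_simpleVector_lie_mem (σ τ : D.simple) : ⁅D.θ (D.simpleVector σ), D.simpleVector τ⁆ ∈ D.𝔞 := by
  by_cases h : σ = τ
  · subst h
    rw [← lie_skew]
    exact D.𝔞.neg_mem (D.lie_theta_mem (D.simpleVector_mem σ))
  · have h1 := lie_mem_restrictedRootSpace (D.theta_mem_restrictedRootSpace (D.simpleVector_mem σ))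
      (D.simpleVector_mem τ)
    rw [neg_add_eq_sub] at h1
    have h2 : ⁅D.θ (D.simpleVector σ), D.simpleVector τ⁆ = 0 := by
      by_contra h0
      exact D.sub_notMem_roots h (D.eq_zero_or_mem_roots h1 h0)
    rw [h2]; exact zero_mem _

lemma theta_simpleVector_lie_mem_sup (σ : D.simple) {x : L} (hx : x ∈ D.nilpotentPart) :
    ⁅D.θ (D.simpleVector σ), x⁆ ∈ D.nilpotentPart ⊔ D.𝔞 := by
  refine D.nilpotentPart_le
    (P := (D.nilpotentPart ⊔ D.𝔞).comap (LieAlgebra.ad ℝ L (D.θ (D.simpleVector σ))))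
    (fun l y hy => ?_) hx
  change ⁅D.θ (D.simpleVector σ), y⁆ ∈ D.nilpotentPart ⊔ D.𝔞
  induction hy with
  | base τ => exact Submodule.mem_sup_right (D.theta_simpleVector_lie_mem σ τ)
  | step τ l y hy ih =>
    refine Submodule.mem_sup_left ?_
    rw [leibniz_lie]
    refine add_mem (D.lie_mem_nilpotentPart_of_mem (D.theta_simpleVector_lie_mem σ τ)
      hy.mem_nilpotentPart) ?_
    obtain ⟨a, ha, h, hh, hah⟩ := Submodule.mem_sup.mp ih
    rw [← hah, lie_add]
    refine add_mem (D.simpleVector_lie_mem_nilpotentPart τ ha) ?_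
    rw [← lie_skew, D.simpleVector_mem τ ⟨h, hh⟩]
    exact neg_mem (Submodule.smul_mem _ _ (IsIteratedBracket.base τ).mem_nilpotentPart)

/-- The subspace underlying the maximal split subalgebra. -/
def splitPart : Submodule ℝ L :=
  D.nilpotentPart ⊔ D.𝔞 ⊔ D.nilpotentPart.map (D.θ : L →ₗ[ℝ] L)

lemma splitPart_le {P : Submodule ℝ L} (h1 : ∀ l x, D.IsIteratedBracket l x → x ∈ P)
    (h2 : ∀ x ∈ D.𝔞, x ∈ P) (h3 : ∀ l x, D.IsIteratedBracket l x → D.θ x ∈ P) : D.splitPart ≤ P := by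
  refine sup_le (sup_le (D.nilpotentPart_le h1) h2) ?_
  rw [Submodule.map_le_iff_le_comap]
  exact D.nilpotentPart_le h3

lemma nilpotentPart_le_splitPart : D.nilpotentPart ≤ D.splitPart := le_sup_left.trans le_sup_left

lemma le_splitPart : D.𝔞 ≤ D.splitPart := le_sup_right.trans le_sup_left

lemma theta_mem_splitPart_of_mem {x : L} (hx : x ∈ D.nilpotentPart) : D.θ x ∈ D.splitPart :=
  Submodule.mem_sup_right (Submodule.mem_map_of_mem (f := (D.θ : L →ₗ[ℝ] L)) hx)

lemma theta_mem_splitPart {x : L} (hx : x ∈ D.splitPart) : D.θ x ∈ D.splitPart := by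
  refine D.splitPart_le (P := D.splitPart.comap (D.θ : L →ₗ[ℝ] L)) (fun l y hy => ?_) (fun y hy => ?_)
    (fun l y hy => ?_) hx
  · exact D.theta_mem_splitPart_of_mem hy.mem_nilpotentPart
  · change D.θ y ∈ D.splitPart
    rw [D.theta_apply_of_mem hy]; exact neg_mem (D.le_splitPart hy)
  · change D.θ (D.θ y) ∈ D.splitPart
    rw [D.isCartanInvolution.involutive]; exact D.nilpotentPart_le_splitPart hy.mem_nilpotentPart

lemma simpleVector_lie_mem_splitPart (σ : D.simple) {x : L} (hx : x ∈ D.splitPart) :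
    ⁅D.simpleVector σ, x⁆ ∈ D.splitPart := by
  refine D.splitPart_le (P := D.splitPart.comap (LieAlgebra.ad ℝ L (D.simpleVector σ)))
    (fun l y hy => ?_) (fun y hy => ?_) (fun l y hy => ?_) hx
  · exact D.nilpotentPart_le_splitPart (D.simpleVector_lie_mem_nilpotentPart σ hy.mem_nilpotentPart)
  · change ⁅D.simpleVector σ, y⁆ ∈ D.splitPart
    rw [← lie_skew, D.simpleVector_mem σ ⟨y, hy⟩]
    exact neg_mem (Submodule.smul_mem _ _
      (D.nilpotentPart_le_splitPart (IsIteratedBracket.base σ).mem_nilpotentPart))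
  · change ⁅D.simpleVector σ, D.θ y⁆ ∈ D.splitPart
    have h1 : ⁅D.simpleVector σ, D.θ y⁆ = D.θ ⁅D.θ (D.simpleVector σ), y⁆ := by
      rw [LieEquiv.map_lie, D.isCartanInvolution.involutive]
    rw [h1]
    exact D.theta_mem_splitPart ((le_sup_left : D.nilpotentPart ⊔ D.𝔞 ≤ D.splitPart)
      (D.theta_simpleVector_lie_mem_sup σ hy.mem_nilpotentPart))

lemma theta_simpleVector_lie_mem_splitPart (σ : D.simple) {x : L} (hx : x ∈ D.splitPart) :
    ⁅D.θ (D.simpleVector σ), x⁆ ∈ D.splitPart := by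
  rw [← D.isCartanInvolution.involutive x, ← LieEquiv.map_lie]
  exact D.theta_mem_splitPart (D.simpleVector_lie_mem_splitPart σ (D.theta_mem_splitPart hx))

lemma lie_mem_splitPart {x y : L} (hx : x ∈ D.splitPart) (hy : y ∈ D.splitPart) :
    ⁅x, y⁆ ∈ D.splitPart := by
  let T : Submodule ℝ L :=
    { carrier := {x | ∀ y ∈ D.splitPart, ⁅x, y⁆ ∈ D.splitPart}
      add_mem' := fun {a b} ha hb y hy => by rw [add_lie]; exact add_mem (ha y hy) (hb y hy)
      zero_mem' := fun y _ => by rw [zero_lie]; exact zero_mem _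
      smul_mem' := fun c a ha y hy => by rw [smul_lie]; exact Submodule.smul_mem _ _ (ha y hy) }
  have hθ : ∀ x ∈ T, D.θ x ∈ T := fun x hx y hy => by
    rw [← D.isCartanInvolution.involutive y, ← LieEquiv.map_lie]
    exact D.theta_mem_splitPart (hx _ (D.theta_mem_splitPart hy))
  have hT : ∀ l x, D.IsIteratedBracket l x → x ∈ T := fun l x h => by
    induction h with
    | base σ => exact fun y hy => D.simpleVector_lie_mem_splitPart σ hy
    | step σ l x _ ih =>
      intro y hy
      rw [lie_lie]
      exact sub_mem (D.simpleVector_lie_mem_splitPart σ (ih y hy))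
        (ih _ (D.simpleVector_lie_mem_splitPart σ hy))
  have h𝔞 : ∀ x ∈ D.𝔞, x ∈ T := fun h hh y hy => by
    refine D.splitPart_le (P := D.splitPart.comap (LieAlgebra.ad ℝ L h))
      (fun l y hy => ?_) (fun y hy => ?_) (fun l y hy => ?_) hy
    · exact D.nilpotentPart_le_splitPart (D.lie_mem_nilpotentPart_of_mem hh hy.mem_nilpotentPart)
    · change ⁅h, y⁆ ∈ D.splitPart
      rw [D.lie_eq_zero_of_mem hh hy]; exact zero_mem _
    · change ⁅h, D.θ y⁆ ∈ D.splitPart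
      rw [D.theta_mem_restrictedRootSpace hy.mem ⟨h, hh⟩]
      exact Submodule.smul_mem _ _ (D.theta_mem_splitPart_of_mem hy.mem_nilpotentPart)
  exact D.splitPart_le (P := T) hT h𝔞 (fun l x h => hθ x (hT l x h)) hx y hy

/-- The maximal split subalgebra. -/
def splitSubalgebra : LieSubalgebra ℝ L :=
  { D.splitPart with lie_mem' := fun hx hy => D.lie_mem_splitPart hx hy }

/-! #### Weights of the iterated brackets -/

lemma IsIteratedBracket.cases_weight {l : Dual ℝ D.𝔞} {x : L} (h : D.IsIteratedBracket l x) :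
    x = 0 ∨ (∃ σ : D.simple, l = σ ∧ x = D.simpleVector σ) ∨
      ((∀ σ, 0 ≤ (simpleBasis D.isSimpleSystem).repr l σ) ∧ ∃ σ τ, σ ≠ τ ∧
        0 < (simpleBasis D.isSimpleSystem).repr l σ ∧ 0 < (simpleBasis D.isSimpleSystem).repr l τ) := by
  set b := simpleBasis D.isSimpleSystem with hb
  have hbs : ∀ σ τ : D.simple, b.repr (σ : Dual ℝ D.𝔞) τ = Finsupp.single σ 1 τ := fun σ τ => by
    rw [← simpleBasis_apply D.isSimpleSystem σ, ← hb, Basis.repr_self]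
  have hbn : ∀ σ τ : D.simple, 0 ≤ b.repr (σ : Dual ℝ D.𝔞) τ := fun σ τ => by
    classical
    rw [hbs, Finsupp.single_apply]; split_ifs <;> norm_num
  induction h with
  | base σ => exact Or.inr (Or.inl ⟨σ, rfl, rfl⟩)
  | step σ l x hx ih =>
    rcases ih with rfl | ⟨τ, rfl, rfl⟩ | ⟨h1, τ, ρ, hne, h2, h3⟩
    · left; rw [lie_zero]
    · by_cases h : σ = τ
      · left; rw [h, lie_self]
      · right; right
        refine ⟨fun ρ => ?_, σ, τ, h, ?_, ?_⟩
        · rw [map_add, Finsupp.add_apply]; exact add_nonneg (hbn _ _) (hbn _ _)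
        · rw [map_add, Finsupp.add_apply, hbs σ, Finsupp.single_eq_same]
          linarith [hbn τ σ]
        · rw [map_add, Finsupp.add_apply, hbs τ, Finsupp.single_eq_same]
          linarith [hbn σ τ]
    · right; right
      refine ⟨fun ρ => ?_, τ, ρ, hne, ?_, ?_⟩
      · rw [map_add, Finsupp.add_apply]; exact add_nonneg (hbn _ _) (h1 _)
      · rw [map_add, Finsupp.add_apply]; linarith [hbn σ τ]
      · rw [map_add, Finsupp.add_apply]; linarith [hbn σ ρ]

lemma proj_splitPart {x : L} (hx : x ∈ D.splitPart) : D.proj 0 x ∈ D.𝔞 ∧ ∀ σ : D.simple,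
    D.proj (σ : Dual ℝ D.𝔞) x ∈ Submodule.span ℝ {D.simpleVector σ} ∧
      D.proj ((2 : ℝ) • (σ : Dual ℝ D.𝔞)) x = 0 := by
  set b := simpleBasis D.isSimpleSystem with hb
  have hbs : ∀ σ τ : D.simple, b.repr (σ : Dual ℝ D.𝔞) τ = Finsupp.single σ 1 τ := fun σ τ => by
    rw [← simpleBasis_apply D.isSimpleSystem σ, ← hb, Basis.repr_self]
  let P : Submodule ℝ L := D.𝔞.comap (D.proj 0) ⊓ ⨅ σ : D.simple,
    (Submodule.span ℝ {D.simpleVector σ}).comap (D.proj (σ : Dual ℝ D.𝔞)) ⊓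
      (LinearMap.ker (D.proj ((2 : ℝ) • (σ : Dual ℝ D.𝔞))))
  have hP : ∀ y, y ∈ P ↔ D.proj 0 y ∈ D.𝔞 ∧ ∀ σ : D.simple,
    D.proj (σ : Dual ℝ D.𝔞) y ∈ Submodule.span ℝ {D.simpleVector σ} ∧
      D.proj ((2 : ℝ) • (σ : Dual ℝ D.𝔞)) y = 0 := fun y => by
    simp only [P, Submodule.mem_inf, Submodule.mem_comap, Submodule.mem_iInf, LinearMap.mem_ker]
  have hP' : ∀ (m : Dual ℝ D.𝔞) (y : L), y ∈ restrictedRootSpace D.𝔞 m → m ≠ 0 →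
      (∀ σ : D.simple, m ≠ σ) → (∀ σ : D.simple, m ≠ (2 : ℝ) • (σ : Dual ℝ D.𝔞)) → y ∈ P := by
    intro m y hy h0 h1 h2
    rw [hP, D.proj_of_mem_of_ne hy h0]
    refine ⟨zero_mem _, fun σ => ?_⟩
    rw [D.proj_of_mem_of_ne hy (h1 σ), D.proj_of_mem_of_ne hy (h2 σ)]
    exact ⟨zero_mem _, rfl⟩
  have hs0 : ∀ σ : D.simple, (σ : Dual ℝ D.𝔞) ≠ 0 := fun σ => (D.isSimpleSystem.subset σ.2).1
  have hs2 : ∀ σ τ : D.simple, (σ : Dual ℝ D.𝔞) ≠ (2 : ℝ) • (τ : Dual ℝ D.𝔞) := fun σ τ h => by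
    classical
    have h1 := congrArg (fun v => b.repr v σ) h
    simp only [map_smul, Finsupp.smul_apply, hbs, Finsupp.single_apply] at h1
    split_ifs at h1 <;> simp at h1
  refine (hP x).mp (D.splitPart_le (P := P) (fun l y hy => ?_) (fun y hy => ?_) (fun l y hy => ?_) hx)
  · rcases hy.cases_weight with rfl | ⟨τ, rfl, rfl⟩ | ⟨h1, τ, ρ, hne, h2, h3⟩
    · exact zero_mem _
    · rw [hP, D.proj_of_mem_of_ne hy.mem (hs0 τ)]
      refine ⟨zero_mem _, fun σ => ⟨?_, D.proj_of_mem_of_ne hy.mem (hs2 τ σ)⟩⟩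
      by_cases h : τ = σ
      · subst h
        rw [D.proj_of_mem hy.mem]; exact Submodule.mem_span_singleton_self _
      · rw [D.proj_of_mem_of_ne hy.mem (fun h' => h (Subtype.ext h'))]; exact zero_mem _
    · rw [← hb] at h2 h3
      have hm : ∀ (c : ℝ) (σ : D.simple), l ≠ c • (σ : Dual ℝ D.𝔞) := by
        rintro c σ rfl
        simp only [map_smul, Finsupp.smul_apply, hbs] at h2 h3
        by_cases hτ : σ = τ
        · rw [hτ, Finsupp.single_eq_of_ne hne.symm] at h3; simp at h3
        · rw [Finsupp.single_eq_of_ne (Ne.symm hτ)] at h2; simp at h2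
      refine hP' l y hy.mem (fun h => ?_) (fun σ h => hm 1 σ (by rw [one_smul, h])) (fun σ => hm 2 σ)
      exact hm 0 τ (by rw [zero_smul, h])
  · have hy0 := D.le_restrictedRootSpace_zero hy
    rw [hP, D.proj_of_mem hy0]
    refine ⟨hy, fun σ => ?_⟩
    rw [D.proj_of_mem_of_ne hy0 (hs0 σ).symm,
      D.proj_of_mem_of_ne hy0 (smul_ne_zero two_ne_zero (hs0 σ)).symm]
    exact ⟨zero_mem _, rfl⟩
  · have hθ := D.theta_mem_restrictedRootSpace hy.mem
    have key : y ≠ 0 → ∃ τ : D.simple, 0 < b.repr l τ := fun hy0 => by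
      rcases hy.cases_weight with h | ⟨τ, rfl, rfl⟩ | ⟨h1, τ, ρ, hne, h2, h3⟩
      · exact absurd h hy0
      · exact ⟨τ, by rw [hbs, Finsupp.single_eq_same]; norm_num⟩
      · exact ⟨τ, h2⟩
    by_cases hy0 : y = 0
    · rw [hy0, map_zero]; exact zero_mem _
    obtain ⟨τ, hτ⟩ := key hy0
    have hnn : ∀ (σ : D.simple), 0 ≤ b.repr (σ : Dual ℝ D.𝔞) τ := fun σ => by
      classical
      rw [hbs, Finsupp.single_apply]; split_ifs <;> norm_num
    refine hP' (-l) _ hθ (fun h => ?_) (fun σ h => ?_) (fun σ h => ?_)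
    · rw [neg_eq_zero] at h; rw [h] at hτ; simp at hτ
    · have := hnn σ
      rw [← h, map_neg, Finsupp.neg_apply] at this; linarith
    · have := hnn σ
      have h' : l = -((2 : ℝ) • (σ : Dual ℝ D.𝔞)) := by rw [← h, neg_neg]
      rw [h', map_neg, map_smul, Finsupp.neg_apply, Finsupp.smul_apply, smul_eq_mul] at hτ
      linarith

lemma splitPart_inf_zero : D.splitPart ⊓ restrictedRootSpace D.𝔞 0 = D.𝔞 := by
  refine le_antisymm (fun x hx => ?_) (le_inf D.le_splitPart D.le_restrictedRootSpace_zero)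
  have := (D.proj_splitPart hx.1).1
  rwa [D.proj_of_mem hx.2] at this

lemma finrank_splitPart_simple (σ : D.simple) :
    finrank ℝ ↥(D.splitPart ⊓ restrictedRootSpace D.𝔞 (σ : Dual ℝ D.𝔞)) = 1 := by
  have : D.splitPart ⊓ restrictedRootSpace D.𝔞 (σ : Dual ℝ D.𝔞) =
      Submodule.span ℝ {D.simpleVector σ} := by
    refine le_antisymm (fun x hx => ?_) ?_
    · have := ((D.proj_splitPart hx.1).2 σ).1
      rwa [D.proj_of_mem hx.2] at this
    · rw [Submodule.span_singleton_le_iff_mem]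
      exact ⟨D.nilpotentPart_le_splitPart (IsIteratedBracket.base σ).mem_nilpotentPart,
        D.simpleVector_mem σ⟩
  rw [this, finrank_span_singleton (D.simpleVector_ne_zero σ)]

lemma finrank_splitPart_two_smul (σ : D.simple) :
    finrank ℝ ↥(D.splitPart ⊓ restrictedRootSpace D.𝔞 ((2 : ℝ) • (σ : Dual ℝ D.𝔞))) = 0 := by
  have : D.splitPart ⊓ restrictedRootSpace D.𝔞 ((2 : ℝ) • (σ : Dual ℝ D.𝔞)) = ⊥ := by
    rw [Submodule.eq_bot_iff]
    intro x hx
    have := ((D.proj_splitPart hx.1).2 σ).2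
    rwa [D.proj_of_mem hx.2] at this
  rw [this, finrank_bot]

lemma finrank_splitPart_refl (σ : D.simple) (l : Dual ℝ D.𝔞) :
    finrank ℝ ↥(D.splitPart ⊓ restrictedRootSpace D.𝔞 (D.refl σ l)) =
      finrank ℝ ↥(D.splitPart ⊓ restrictedRootSpace D.𝔞 l) := by
  have hσ := D.isSimpleSystem.subset σ.2
  obtain ⟨τ, hτ, hM⟩ := D.exists_reflection (D.simpleVector_mem σ) hσ.1 (D.simpleVector_ne_zero σ)
  have hM' := hM D.splitPart (fun x hx => D.simpleVector_lie_mem_splitPart σ hx) (fun x hx => by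
    rw [opp, smul_lie]
    exact Submodule.smul_mem _ _ (D.theta_simpleVector_lie_mem_splitPart σ hx))
  have hle : ∀ m, finrank ℝ ↥(D.splitPart ⊓ restrictedRootSpace D.𝔞 m) ≤
      finrank ℝ ↥(D.splitPart ⊓ restrictedRootSpace D.𝔞 (D.refl σ m)) := fun m => by
    have hinj : Function.Injective τ := τ.injective
    let f : ↥(D.splitPart ⊓ restrictedRootSpace D.𝔞 m) →ₗ[ℝ]
        ↥(D.splitPart ⊓ restrictedRootSpace D.𝔞 (D.refl σ m)) :=
      LinearMap.restrict (τ : L →ₗ[ℝ] L) (fun x hx =>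
        ⟨hM' x hx.1, D.map_restrictedRootSpace_of_reflection hσ.1 hτ hx.2⟩)
    refine LinearMap.finrank_le_finrank_of_injective (f := f) fun x y hxy => Subtype.ext ?_
    exact hinj (congrArg Subtype.val hxy)
  refine le_antisymm ?_ (hle l)
  have := hle (D.refl σ l)
  rwa [D.refl_refl hσ.1] at this

lemma isKilling_splitSubalgebra : LieAlgebra.IsKilling ℝ D.splitSubalgebra := by
  let θ' : D.splitSubalgebra ≃ₗ⁅ℝ⁆ D.splitSubalgebra :=
    { toFun := fun x => ⟨D.θ x, D.theta_mem_splitPart x.2⟩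
      map_add' := fun x y => Subtype.ext (map_add D.θ (x : L) y)
      map_smul' := fun c x => Subtype.ext (map_smul D.θ c (x : L))
      map_lie' := fun {x y} => Subtype.ext (LieEquiv.map_lie D.θ (x : L) y)
      invFun := fun x => ⟨D.θ x, D.theta_mem_splitPart x.2⟩
      left_inv := fun x => Subtype.ext (D.isCartanInvolution.involutive x)
      right_inv := fun x => Subtype.ext (D.isCartanInvolution.involutive x) }
  have hθ' : IsCartanInvolution θ' := by
    refine isCartanInvolution_of_form θ' (fun x => Subtype.ext (D.isCartanInvolution.involutive x))
      ((killingForm ℝ L).restrict D.splitSubalgebra.toSubmodule)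
      (fun x y => IsCartanInvolution.killingForm_symm (x : L) (y : L))
      (fun x y z => IsCartanInvolution.killingForm_lie (x : L) (y : L) (z : L))
      (fun x y => killingForm_lieEquiv D.θ (x : L) (y : L))
      (fun x hx => D.isCartanInvolution.pos x (by simpa using hx)) (fun x hx => ?_)
    have hx' : ∀ y ∈ D.splitPart, ⁅(x : L), y⁆ = 0 := fun y hy => congrArg Subtype.val (hx ⟨y, hy⟩)
    have h0 : (x : L) ∈ D.𝔞 := by
      rw [← D.splitPart_inf_zero]
      refine ⟨x.2, fun h => ?_⟩
      rw [← lie_skew, hx' h (D.le_splitPart h.2)]; simp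
    have h1 : ∀ σ ∈ D.simple, (σ : Dual ℝ D.𝔞) ⟨x, h0⟩ = 0 := fun σ hσ => by
      have h2 := D.simpleVector_mem ⟨σ, hσ⟩ ⟨x, h0⟩
      rw [hx' _ (D.nilpotentPart_le_splitPart (IsIteratedBracket.base ⟨σ, hσ⟩).mem_nilpotentPart)] at h2
      exact (smul_eq_zero.mp h2.symm).resolve_right (D.simpleVector_ne_zero _)
    have h3 : ∀ l : Dual ℝ D.𝔞, l ⟨x, h0⟩ = 0 := fun l => by
      have hl : l ∈ Submodule.span ℝ D.simple := by rw [span_simple D.isSimpleSystem]; trivial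
      induction hl using Submodule.span_induction with
      | mem l hl => exact h1 l hl
      | zero => rfl
      | add l m _ _ hl hm => rw [LinearMap.add_apply, hl, hm, add_zero]
      | smul c l _ hl => rw [LinearMap.smul_apply, hl, smul_zero]
    have h2 : (⟨x, h0⟩ : D.𝔞) = 0 := D.eq_zero_of_roots_eq_zero fun l _ => h3 l
    exact Subtype.ext (congrArg (fun a : D.𝔞 => (a : L)) h2)
  refine ⟨?_⟩
  rw [LieSubmodule.eq_bot_iff]
  intro x hx
  by_contra h0
  rw [LieIdeal.mem_killingCompl] at hx
  have h1 := hθ'.pos x h0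
  rw [IsCartanInvolution.killingForm_symm, hx _ trivial] at h1
  simp at h1

section SplitType

variable {D} {ι : Type*} [Fintype ι] [DecidableEq ι] {X : Matrix ι ι ℤ} {σ : ι ≃ D.simple}
  (hσ : ∀ i j, 2 * D.dualForm (σ i) (σ j) / D.dualForm (σ i) (σ i) = X i j)

include hσ

lemma refl_sum (i : ι) (c : ι → ℤ) : D.refl (σ i) (∑ j, c j • (σ j : Dual ℝ D.𝔞)) =
    ∑ j, (c - Pi.single i (∑ k, X i k * c k) : ι → ℤ) j • (σ j : Dual ℝ D.𝔞) := by
  have h1 : (∑ j, c j • (σ j : Dual ℝ D.𝔞)) (D.coroot (σ i)) = ((∑ k, X i k * c k : ℤ) : ℝ) := by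
    rw [LinearMap.sum_apply]
    push_cast
    refine Finset.sum_congr rfl fun k _ => ?_
    rw [LinearMap.smul_apply, apply_coroot, hσ]; simp [mul_comm]
  rw [refl_apply, h1]
  refine (congrArg _ (Int.cast_smul_eq_zsmul ℝ (∑ k, X i k * c k) (σ i : Dual ℝ D.𝔞))).trans ?_
  simp only [Pi.sub_apply, sub_smul, Finset.sum_sub_distrib]
  congr 1
  symm
  rw [Finset.sum_eq_single i]
  · simp
  · intro k _ hk; simp [hk]
  · simp

lemma refl_half_sum (i : ι) (r : ℝ) (c : ι → ℤ) : D.refl (σ i) (r • ∑ j, c j • (σ j : Dual ℝ D.𝔞)) =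
    r • ∑ j, (c - Pi.single i (∑ k, X i k * c k) : ι → ℤ) j • (σ j : Dual ℝ D.𝔞) := by
  rw [← refl_sum hσ]
  exact (D.reflEquiv (D.isSimpleSystem.subset (σ i).2).1).map_smul r _

lemma sum_single (i : ι) (m : ℤ) :
    ∑ j, (Pi.single i m : ι → ℤ) j • (σ j : Dual ℝ D.𝔞) = m • (σ i : Dual ℝ D.𝔞) := by
  rw [Finset.sum_eq_single i]
  · simp
  · intro k _ hk; simp [hk]
  · simp

end SplitType

/-- The existence of a maximal split subalgebra. -/
theorem exists_isMaximalSplitSubalgebra {ι : Type*} [Fintype ι] [DecidableEq ι] {X : Matrix ι ι ℤ}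
    {G : Set (ι → ℤ)} (h : D.HasType D.roots X {v | WeylClosure X G v})
    (hG1 : ∀ i, Pi.single i 1 ∈ G)
    (hG : ∀ v ∈ G, ∃ i, v = Pi.single i 1 ∨ v = Pi.single i 2) :
    ∃ 𝔣, D.IsMaximalSplitSubalgebra 𝔣 ∧ D.HasType (D.rootsOf 𝔣) X (finiteRoots X) := by
  obtain ⟨σ, hσ, hΦ⟩ := h
  let s : (ι → ℤ) → Dual ℝ D.𝔞 := fun c => ∑ j, c j • (σ j : Dual ℝ D.𝔞)
  have hroot : ∀ l, l ∈ D.roots ↔ ∃ c, WeylClosure X G c ∧ l = s c := fun l => by rw [hΦ]; rfl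
  have hsr : ∀ i, (σ i : Dual ℝ D.𝔞) ∈ D.roots := fun i => D.isSimpleSystem.subset (σ i).2
  have hs : ∀ i m, s (Pi.single i m) = (m : ℝ) • (σ i : Dual ℝ D.𝔞) := fun i m =>
    (sum_single hσ i m).trans (Int.cast_smul_eq_zsmul ℝ m (σ i : Dual ℝ D.𝔞)).symm
  have hmono : ∀ c, c ∈ finiteRoots X → WeylClosure X G c := fun c hc => by
    induction hc with
    | base v hv => obtain ⟨i, rfl⟩ := hv; exact .base _ (hG1 i)
    | reflect v i _ ih => exact .reflect v i ih
  have hcases : ∀ c, WeylClosure X G c → c ∈ finiteRoots X ∨ ∃ c' ∈ finiteRoots X, c = 2 * c' := by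
    intro c hc
    induction hc with
    | base v hv =>
      obtain ⟨i, rfl | rfl⟩ := hG v hv
      · exact Or.inl (.base _ ⟨i, rfl⟩)
      · refine Or.inr ⟨Pi.single i 1, .base _ ⟨i, rfl⟩, ?_⟩
        ext k
        by_cases hk : k = i
        · subst hk; simp
        · simp [hk]
    | reflect v i _ ih =>
      rcases ih with ih | ⟨c', hc', rfl⟩
      · exact Or.inl (.reflect v i ih)
      · refine Or.inr ⟨_, .reflect c' i hc', ?_⟩
        have : ∑ j, X i j * (2 * c') j = 2 * ∑ j, X i j * c' j := by
          rw [Finset.mul_sum]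
          exact Finset.sum_congr rfl fun j _ => by simp; ring
        rw [this]
        ext k
        by_cases hk : k = i
        · subst hk; simp; ring
        · simp [hk]
  have hs2 : ∀ c : ι → ℤ, s (2 * c) = (2 : ℝ) • s c := fun c => by
    simp only [s, Finset.smul_sum]
    refine Finset.sum_congr rfl fun j _ => ?_
    rw [← Int.cast_smul_eq_zsmul ℝ, ← Int.cast_smul_eq_zsmul ℝ (c j), smul_smul]; simp
  have hs1 : ∀ i, s (Pi.single i 1) = (σ i : Dual ℝ D.𝔞) := fun i => by
    rw [hs, Int.cast_one, one_smul]
  let d : Dual ℝ D.𝔞 → ℕ := fun l => finrank ℝ ↥(D.splitPart ⊓ restrictedRootSpace D.𝔞 l)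
  have hd1 : ∀ c ∈ finiteRoots X, finrank ℝ ↥(D.splitPart ⊓ restrictedRootSpace D.𝔞 (s c)) = 1 := by
    intro c hc
    induction hc with
    | base v hv =>
      obtain ⟨i, rfl⟩ := hv
      exact (congrArg d (hs1 i)).trans (D.finrank_splitPart_simple (σ i))
    | reflect v i _ ih =>
      exact (congrArg d (refl_sum hσ i v).symm).trans ((D.finrank_splitPart_refl (σ i) _).trans ih)
  have hd2 : ∀ c ∈ finiteRoots X,
      finrank ℝ ↥(D.splitPart ⊓ restrictedRootSpace D.𝔞 ((2 : ℝ) • s c)) = 0 := by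
    intro c hc
    induction hc with
    | base v hv =>
      obtain ⟨i, rfl⟩ := hv
      exact (congrArg d (congrArg ((2 : ℝ) • ·) (hs1 i))).trans (D.finrank_splitPart_two_smul (σ i))
    | reflect v i _ ih =>
      exact (congrArg d (refl_half_sum hσ i 2 v).symm).trans
        ((D.finrank_splitPart_refl (σ i) _).trans ih)
  have hhalf : ∀ c ∈ finiteRoots X, (1 / 2 : ℝ) • s c ∉ D.roots := by
    intro c hc
    induction hc with
    | base v hv =>
      obtain ⟨i, rfl⟩ := hv
      rw [hs, Int.cast_one, one_smul]
      intro hmem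
      have hnat : ∃ n : ℕ, (1 / 2 : ℝ) = n ∨ (1 / 2 : ℝ) = -n := by
        have hr : (simpleBasis D.isSimpleSystem).repr ((1 / 2 : ℝ) • (σ i : Dual ℝ D.𝔞)) (σ i) = 1 / 2 := by
          rw [map_smul, ← simpleBasis_apply D.isSimpleSystem (σ i), Basis.repr_self]; simp
        rcases D.isSimpleSystem.pos_or_neg _ hmem with h1 | h1
        · obtain ⟨n, hn⟩ := repr_nat D.isSimpleSystem h1 (σ i)
          exact ⟨n, Or.inl (by rw [← hn, hr])⟩
        · obtain ⟨n, hn⟩ := repr_nat D.isSimpleSystem h1 (σ i)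
          rw [map_neg, Finsupp.neg_apply, hr] at hn
          exact ⟨n, Or.inr (by rw [← hn, neg_neg])⟩
      obtain ⟨n, hn | hn⟩ := hnat
      · have h2 : (1 : ℝ) = ((2 * n : ℕ) : ℝ) := by push_cast; linarith
        have h3 : 1 = 2 * n := by exact_mod_cast h2
        omega
      · have : (0 : ℝ) ≤ n := n.cast_nonneg
        linarith
    | reflect v i _ ih =>
      intro hmem
      refine ih ?_
      have := D.refl_mem_roots (hsr i) hmem
      simp only [s] at this
      rw [← refl_half_sum hσ, D.refl_refl (hsr i).1] at this
      exact this
  refine ⟨D.splitSubalgebra, ⟨D.isKilling_splitSubalgebra, fun x hx => D.theta_mem_splitPart hx,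
    D.splitPart_inf_zero, fun l hl hl2 => ?_, fun l hl hl2 => ?_⟩, σ, hσ, ?_⟩
  · obtain ⟨c, hc, rfl⟩ := (hroot l).mp hl
    rcases hcases c hc with hc | ⟨c', hc', rfl⟩
    · exact hd1 c hc
    · refine absurd ((hroot _).mpr ⟨c', hmono c' hc', ?_⟩) hl2
      rw [hs2, smul_smul]; norm_num
  · obtain ⟨c, hc, rfl⟩ := (hroot l).mp hl
    rcases hcases c hc with hc | ⟨c', hc', rfl⟩
    · exact absurd hl2 (hhalf c hc)
    · rw [hs2]
      exact Submodule.finrank_eq_zero.mp (hd2 c' hc')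
  · ext l
    constructor
    · rintro ⟨h0, hl⟩
      have hl' : l ∈ D.roots := ⟨h0, fun hb => hl (by rw [hb, inf_bot_eq])⟩
      obtain ⟨c, hc, rfl⟩ := (hroot l).mp hl'
      rcases hcases c hc with hc | ⟨c', hc', rfl⟩
      · exact ⟨c, hc, rfl⟩
      · rw [hs2] at hl
        exact absurd (Submodule.finrank_eq_zero.mp (hd2 c' hc')) hl
    · rintro ⟨c, hc, rfl⟩
      refine ⟨((hroot _).mpr ⟨c, hmono c hc, rfl⟩).1, fun hb => ?_⟩
      have h1 := hd1 c hc
      have h2 : finrank ℝ ↥(D.splitPart ⊓ restrictedRootSpace D.𝔞 (s c)) = 0 := by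
        rw [Submodule.finrank_eq_zero]; exact hb
      omega

end IwasawaDatum

/-! ### The billiard -/

/-- `E` is the extension of the Cartan matrix `X`, symmetrized by `d`, by a root which has the same
scalar products with the simple roots as the negative of the root `ϑ`. -/
structure IsAffineExtensionBy {ι : Type*} [Fintype ι] (X : Matrix ι ι ℤ) (d ϑ : ι → ℤ)
    (E : Matrix (Option ι) (Option ι) ℤ) : Prop where
  pos : ∀ i, 0 < d i
  symm : ∀ i j, d i * X i j = d j * X j i
  some_some : ∀ i j, E (some i) (some j) = X i j
  none_none : E none none = 2
  some_none : ∀ i, E (some i) none = -∑ j, X i j * ϑ j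
  none_some : ∀ i, (∑ k, ∑ j, ϑ k * (d k * X k j) * ϑ j) * E none (some i) =
      -2 * ∑ k, ϑ k * (d k * X k i)

/-- The diagram of `X` is connected to the vertex `r`, by a parent function. -/
def IsRootedBy {ι : Type*} (X : Matrix ι ι ℤ) (p : ι → ι) (r : ι) : Prop :=
  (∀ i, p i = i ∨ X i (p i) ≠ 0) ∧ ∀ i, ∃ m, p^[m] i = r

lemma IsRootedBy.induction {ι : Type*} {X : Matrix ι ι ℤ} {p : ι → ι} {r : ι} (h : IsRootedBy X p r)
    {P : ι → Prop} (hr : P r) (hP : ∀ i j, X i j ≠ 0 → P j → P i) (i : ι) : P i := by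
  obtain ⟨m, hm⟩ := h.2 i
  induction m generalizing i with
  | zero => exact (show i = r from hm) ▸ hr
  | succ m ih =>
    have h1 := ih (p i) hm
    rcases h.1 i with h2 | h2
    · rwa [h2] at h1
    · exact hP i _ h2 h1

namespace IwasawaDatum

variable {L : Type*} [LieRing L] [LieAlgebra ℝ L] [FiniteDimensional ℝ L] (D : IwasawaDatum L)

@[simp] lemma dil_apply (l : Dual ℝ D.𝔞) (x : D.ScaleSpace) : D.dil l x = l x.2 := rfl

@[simp] lemma β_apply (i : Fin 2) (x : D.ScaleSpace) : D.β i x = x.1 i := rfl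

@[simp] lemma derivβ_add (f g : Dual ℝ D.ScaleSpace) (i : Fin 2) :
    D.derivβ (f + g) i = D.derivβ f i + D.derivβ g i := rfl

@[simp] lemma derivβ_sub (f g : Dual ℝ D.ScaleSpace) (i : Fin 2) :
    D.derivβ (f - g) i = D.derivβ f i - D.derivβ g i := rfl

@[simp] lemma derivβ_smul (c : ℝ) (f : Dual ℝ D.ScaleSpace) (i : Fin 2) :
    D.derivβ (c • f) i = c * D.derivβ f i := rfl

@[simp] lemma derivβ_dil (l : Dual ℝ D.𝔞) (i : Fin 2) : D.derivβ (D.dil l) i = 0 := l.map_zero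

@[simp] lemma derivβ_β (i j : Fin 2) : D.derivβ (D.β i) j = if i = j then 1 else 0 := by
  simp [derivβ, Pi.single_apply]

@[simp] lemma derivφ_sub (f g : Dual ℝ D.ScaleSpace) : D.derivφ (f - g) = D.derivφ f - D.derivφ g := rfl

@[simp] lemma derivφ_dil (l : Dual ℝ D.𝔞) : D.derivφ (D.dil l) = l := rfl

@[simp] lemma derivφ_β (i : Fin 2) : D.derivφ (D.β i) = 0 := rfl

/-- The vector dual to a linear form on the space of scale factors. -/
noncomputable def metricVec (ϑ : Dual ℝ D.𝔞) : Dual ℝ D.ScaleSpace →ₗ[ℝ] D.ScaleSpace where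
  toFun g := (fun i => D.derivβ g i - ∑ j, D.derivβ g j, (2 / D.dualForm ϑ ϑ) • D.tvec (D.derivφ g))
  map_add' f g := by
    refine Prod.ext (funext fun i => ?_) ?_
    · simp [Finset.sum_add_distrib]; ring
    · have : D.tvec (D.derivφ (f + g)) = D.tvec (D.derivφ f) + D.tvec (D.derivφ g) :=
        map_add (D.killingOn.toDual D.killingOn_nondegenerate).symm (D.derivφ f) (D.derivφ g)
      simp [this]
  map_smul' c g := by
    refine Prod.ext (funext fun i => ?_) ?_
    · simp; ring
    · have : D.tvec (D.derivφ (c • g)) = c • D.tvec (D.derivφ g) :=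
        map_smul (D.killingOn.toDual D.killingOn_nondegenerate).symm c (D.derivφ g)
      simp only [this, Prod.smul_snd, RingHom.id_apply]
      rw [smul_comm]

lemma apply_metricVec (ϑ : Dual ℝ D.𝔞) (f g : Dual ℝ D.ScaleSpace) :
    f (D.metricVec ϑ g) = D.inverseMetric ϑ f g := by
  set w := D.metricVec ϑ g with hw
  have h1 : w = w.1 0 • ((Pi.single 0 1, 0) : D.ScaleSpace) + w.1 1 • ((Pi.single 1 1, 0) : D.ScaleSpace)
      + (0, w.2) := by
    refine Prod.ext (funext fun i => ?_) ?_
    · fin_cases i <;> simp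
    · simp
  rw [h1, map_add, map_add, map_smul, map_smul]
  have h2 : f (0, w.2) = 2 / D.dualForm ϑ ϑ * D.dualForm (D.derivφ f) (D.derivφ g) := by
    change D.derivφ f w.2 = _
    rw [D.dualForm_eq (D.derivφ f), hw]
    change D.derivφ f ((2 / D.dualForm ϑ ϑ) • D.tvec (D.derivφ g)) = _
    rw [map_smul, smul_eq_mul]
  have h3 : ∀ i, w.1 i = D.derivβ g i - ∑ j, D.derivβ g j := fun i => rfl
  rw [h2, h3, h3]
  simp only [inverseMetric, derivβ, Fin.sum_univ_two, smul_eq_mul]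
  ring

lemma metricVec_injective {ϑ : Dual ℝ D.𝔞} (hϑ : ϑ ≠ 0) : Function.Injective (D.metricVec ϑ) := by
  refine (injective_iff_map_eq_zero _).mpr fun g hg => ?_
  have h1 : ∀ i, D.derivβ g i - ∑ j, D.derivβ g j = 0 := fun i => congrFun (congrArg Prod.fst hg) i
  have h2 : (2 / D.dualForm ϑ ϑ) • D.tvec (D.derivφ g) = 0 := congrArg Prod.snd hg
  have h3 : D.tvec (D.derivφ g) = 0 :=
    (smul_eq_zero.mp h2).resolve_left (div_pos two_pos (D.dualForm_pos hϑ)).ne'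
  have h4 : D.derivφ g = 0 :=
    (LinearEquiv.map_eq_zero_iff (D.killingOn.toDual D.killingOn_nondegenerate).symm).mp h3
  have h5 := h1 0
  have h6 := h1 1
  simp only [Fin.sum_univ_two] at h5 h6
  have h7 : D.derivβ g 0 = 0 := by linarith
  have h8 : D.derivβ g 1 = 0 := by linarith
  refine LinearMap.prod_ext (LinearMap.pi_ext' fun i => LinearMap.ext_ring ?_) h4
  fin_cases i
  · exact h7
  · exact h8

section Chamber

variable {D} {ι : Type*} [Fintype ι] [DecidableEq ι]

/-- The dominant walls. -/
def walls (σ : ι → Dual ℝ D.𝔞) (ϑ : Dual ℝ D.𝔞) : Option (Option ι) → Dual ℝ D.ScaleSpace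
  | none => D.β 1 - D.β 0
  | some none => D.β 0 - D.dil ϑ
  | some (some i) => D.dil (σ i)

lemma linearIndependent_walls {σ : ι → Dual ℝ D.𝔞} (hσ : LinearIndependent ℝ σ) (ϑ : Dual ℝ D.𝔞) :
    LinearIndependent ℝ (walls σ ϑ) := by
  rw [Fintype.linearIndependent_iff] at hσ ⊢
  intro c hc
  rw [Fintype.sum_option, Fintype.sum_option] at hc
  have h0 : c none = 0 := by
    have := LinearMap.congr_fun hc ((Pi.single 1 1, 0) : D.ScaleSpace)
    simpa [walls, LinearMap.sum_apply] using this
  have h1 : c (some none) = 0 := by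
    have := LinearMap.congr_fun hc ((Pi.single 0 1, 0) : D.ScaleSpace)
    simpa [walls, LinearMap.sum_apply, h0] using this
  have h2 : ∀ i, c (some (some i)) = 0 := hσ (fun i => c (some (some i))) (by
    ext h
    have := LinearMap.congr_fun hc ((0, h) : D.ScaleSpace)
    simpa [walls, LinearMap.sum_apply, h0, h1] using this)
  rintro (_ | _ | i)
  exacts [h0, h1, h2 i]

variable {X : Matrix ι ι ℤ} {R : Set (ι → ℤ)} {d ϑ : ι → ℤ} {E : Matrix (Option ι) (Option ι) ℤ}
  {p : ι → ι} {r : ι}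

theorem billiardIsWeylChamber (h : D.HasType D.roots X R) (hE : IsAffineExtensionBy X d ϑ E)
    (hp : IsRootedBy X p r) (hϑ : ϑ ∈ R) (hmax : ∀ v ∈ R, ∀ i, v i ≤ ϑ i) :
    D.BilliardIsWeylChamber (lorentzianExtension E none) := by
  obtain ⟨σ, hσ, hΦ⟩ := h
  let s : ι → Dual ℝ D.𝔞 := fun i => σ i
  let t : Dual ℝ D.𝔞 := ∑ i, ϑ i • s i
  have hs0 : ∀ i, s i ≠ 0 := fun i => (D.isSimpleSystem.subset (σ i).2).1
  have ht : t ∈ D.roots := by rw [hΦ]; exact ⟨ϑ, hϑ, rfl⟩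
  have hhigh : ∀ v ∈ D.roots, t - v ∈ AddSubmonoid.closure D.simple := by
    intro v hv
    rw [hΦ] at hv
    obtain ⟨c, hc, rfl⟩ := hv
    rw [← Finset.sum_sub_distrib]
    refine sum_mem fun i _ => ?_
    rw [← sub_smul]
    obtain ⟨n, hn⟩ := Int.eq_ofNat_of_zero_le (sub_nonneg.mpr (hmax c hc i))
    rw [hn, natCast_zsmul]
    exact AddSubmonoid.nsmul_mem _ (AddSubmonoid.subset_closure (σ i).2) n
  -- the scalar products
  let q : ι → ℝ := fun i => D.dualForm (s i) (s i)
  have hq : ∀ i, 0 < q i := fun i => D.dualForm_pos (hs0 i)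
  have hqX : ∀ i j, D.dualForm (s i) (s j) = q i * X i j / 2 := fun i j => by
    have := hσ i j
    rw [div_eq_iff (hq i).ne'] at this
    simp only [q, s] at *; linarith
  have hd : ∀ i, (0 : ℝ) < d i := fun i => by exact_mod_cast hE.pos i
  have hqd : ∀ i, q i * d r = q r * d i := fun i => by
    refine hp.induction (P := fun i => q i * d r = q r * d i) rfl (fun i j hij hj => ?_) i
    have h1 : q i * X i j = q j * X j i := by
      have := D.dualForm_comm (s i) (s j)
      rw [hqX, hqX] at this; linarith
    have h2 : (d i : ℝ) * X i j = d j * X j i := by exact_mod_cast hE.symm i j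
    have h3 : (X i j : ℝ) ≠ 0 := by exact_mod_cast hij
    refine mul_left_cancel₀ (mul_ne_zero h3 (hd j).ne') ?_
    linear_combination (d r : ℝ) * d j * h1 + (X j i : ℝ) * d j * hj - q r * d j * h2
  have hc : ∀ i j, D.dualForm (s i) (s j) = q r / (2 * d r) * (d i * X i j) := fun i j => by
    rw [hqX, eq_comm, div_mul_eq_mul_div, div_eq_div_iff (mul_pos two_pos (hd r)).ne' two_ne_zero]
    linear_combination (-2 * (X i j : ℝ)) * hqd i
  have hts : ∀ i, D.dualForm t (s i) = q r / (2 * d r) * (∑ k, ϑ k * (d k * X k i) : ℤ) := fun i => by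
    have : D.dualForm t (s i) = ∑ k, (ϑ k : ℝ) * D.dualForm (s k) (s i) := by
      rw [dualForm_eq, LinearMap.sum_apply]
      refine Finset.sum_congr rfl fun k _ => ?_
      rw [LinearMap.smul_apply, zsmul_eq_mul, ← dualForm_eq]
    rw [this]
    push_cast
    rw [Finset.mul_sum]
    exact Finset.sum_congr rfl fun k _ => by rw [hc]; ring
  have htt : D.dualForm t t = q r / (2 * d r) * (∑ k, ∑ j, ϑ k * (d k * X k j) * ϑ j : ℤ) := by
    have : D.dualForm t t = ∑ k, (ϑ k : ℝ) * D.dualForm t (s k) := by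
      conv_lhs => rw [dualForm_comm, dualForm_eq, LinearMap.sum_apply]
      refine Finset.sum_congr rfl fun k _ => ?_
      rw [LinearMap.smul_apply, zsmul_eq_mul, ← dualForm_eq, dualForm_comm]
    rw [this, Finset.sum_comm]
    push_cast
    rw [Finset.mul_sum]
    refine Finset.sum_congr rfl fun k _ => ?_
    rw [hts, ← Finset.sum_mul]; push_cast; ring
  have htt0 : 0 < D.dualForm t t := D.dualForm_pos ht.1
  have htsi : ∀ i, D.dualForm t (s i) = q i / 2 * (∑ j, X i j * ϑ j : ℤ) := fun i => by
    rw [dualForm_eq, LinearMap.sum_apply]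
    push_cast
    rw [Finset.mul_sum]
    refine Finset.sum_congr rfl fun k _ => ?_
    rw [LinearMap.smul_apply, zsmul_eq_mul, ← dualForm_eq, dualForm_comm, hqX]; ring
  -- the Gram matrix of the walls
  let α := walls s t
  have g00 : D.inverseMetric t (α none) (α none) = 2 := by
    simp [inverseMetric, α, walls, dualForm_eq]; norm_num
  have g01 : D.inverseMetric t (α none) (α (some none)) = -1 := by
    simp [inverseMetric, α, walls, dualForm_eq]
  have g02 : ∀ i, D.inverseMetric t (α none) (α (some (some i))) = 0 := fun i => by
    simp [inverseMetric, α, walls, dualForm_eq]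
  have hneg : ∀ l m, D.dualForm (-l) m = -D.dualForm l m := fun l m => rfl
  have hneg' : ∀ l m, D.dualForm l (-m) = -D.dualForm l m := fun l m => by
    rw [dualForm_comm, hneg, dualForm_comm]
  have g11 : D.inverseMetric t (α (some none)) (α (some none)) = 2 := by
    simp [inverseMetric, α, walls, hneg, hneg']
    field_simp
  have g12 : ∀ i, D.inverseMetric t (α (some none)) (α (some (some i))) =
      -(2 / D.dualForm t t * D.dualForm t (s i)) := fun i => by
    simp [inverseMetric, α, walls, hneg]
  have g22 : ∀ i j, D.inverseMetric t (α (some (some i))) (α (some (some j))) =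
      2 / D.dualForm t t * D.dualForm (s i) (s j) := fun i j => by
    simp [inverseMetric, α, walls]
  have gcomm : ∀ f g, D.inverseMetric t f g = D.inverseMetric t g f := fun f g => by
    simp only [inverseMetric, D.dualForm_comm (D.derivφ f), mul_comm]
  have gpos : ∀ a, 0 < D.inverseMetric t (α a) (α a) := by
    rintro (_ | _ | i)
    · rw [g00]; norm_num
    · rw [g11]; norm_num
    · rw [g22]; exact mul_pos (div_pos two_pos htt0) (hq i)
  let αv : Option (Option ι) → D.ScaleSpace := fun a =>
    (2 / D.inverseMetric t (α a) (α a)) • D.metricVec t (α a)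
  have hαv : ∀ a f, f (αv a) = 2 * D.inverseMetric t f (α a) / D.inverseMetric t (α a) (α a) :=
    fun a f => by
      simp only [αv]
      rw [map_smul, apply_metricVec, smul_eq_mul]; ring
  have hs : LinearIndependent ℝ s := by
    have := (simpleBasis D.isSimpleSystem).linearIndependent.comp σ σ.injective
    convert this using 1
    exact funext fun i => (simpleBasis_apply D.isSimpleSystem (σ i)).symm
  have hα : LinearIndependent ℝ α := linearIndependent_walls hs t
  have hαvi : LinearIndependent ℝ αv := by
    have h1 := hα.map' (D.metricVec t) (LinearMap.ker_eq_bot.mpr (D.metricVec_injective ht.1))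
    exact h1.units_smul fun a => Units.mk0 _ (div_pos two_pos (gpos a)).ne'
  have hA : ∀ a b, α b (αv a) = lorentzianExtension E none a b := by
    intro a b
    rw [hαv]
    rcases a with _ | _ | i <;> rcases b with _ | _ | j
    · rw [g00]; simp [lorentzianExtension]
    · rw [g00, gcomm, g01]; simp [lorentzianExtension]
    · rw [g00, gcomm, g02]; simp [lorentzianExtension]
    · rw [g11, g01]; simp [lorentzianExtension]
    · rw [g11]; simp [lorentzianExtension, hE.none_none]
    · rw [g11, gcomm, g12]
      have h1 := hE.none_some j
      have h2 : ((∑ k, ∑ j, ϑ k * (d k * X k j) * ϑ j : ℤ) : ℝ) * E none (some j) =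
        -2 * (∑ k, ϑ k * (d k * X k j) : ℤ) := by exact_mod_cast h1
      simp only [lorentzianExtension]
      have h3 : D.dualForm t t * E none (some j) = -2 * D.dualForm t (s j) := by
        rw [htt, hts]; linear_combination (q r / (2 * d r)) * h2
      field_simp
      linarith
    · rw [g02]; simp [lorentzianExtension]
    · rw [g12, g22, htsi]
      simp only [lorentzianExtension, hE.some_none]
      change _ / (2 / D.dualForm t t * q i) = _
      have := hq i
      field_simp
      push_cast; ring
    · rw [gcomm, g22, g22, hqX]
      simp only [lorentzianExtension, hE.some_some]
      change _ / (2 / D.dualForm t t * q i) = _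
      have := hq i
      field_simp
  have hfr : finrank ℝ D.ScaleSpace = Fintype.card (Option (Option ι)) := by
    have h1 : finrank ℝ D.𝔞 = Fintype.card ι := by
      have : Fintype D.simple := Fintype.ofEquiv ι σ
      rw [← Subspace.dual_finrank_eq, finrank_eq_card_basis (simpleBasis D.isSimpleSystem),
        Fintype.card_congr σ]
    rw [finrank_prod, h1, finrank_fintype_fun_eq_card, Fintype.card_option, Fintype.card_option,
      Fintype.card_fin]
    ring
  have hrank : ((lorentzianExtension E none).map (Int.cast : ℤ → ℝ)).rank =
      Fintype.card (Option (Option ι)) := by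
    refine Matrix.rank_of_isUnit _ (Matrix.mulVec_injective_iff_isUnit.mp ?_)
    refine (injective_iff_map_eq_zero (Matrix.mulVecLin _)).mpr fun c hc => ?_
    have h1 : ∀ a, (∑ b, c b • α b) (αv a) = 0 := fun a => by
      have := congrFun hc a
      rw [← show _ = (0 : ℝ) from this, Matrix.mulVecLin_apply, LinearMap.sum_apply]
      simp only [mulVec, dotProduct, Matrix.map_apply, LinearMap.smul_apply, hA, smul_eq_mul]
      exact Finset.sum_congr rfl fun b _ => mul_comm _ _
    have h2 : (∑ b, c b • α b) = 0 :=
      (basisOfLinearIndependentOfCardEqFinrank hαvi hfr.symm).ext fun a => by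
        rw [coe_basisOfLinearIndependentOfCardEqFinrank, h1]; rfl
    exact funext (Fintype.linearIndependent_iff.mp hα c h2)
  have hrange : Set.range α = D.dominantWalls t := by
    ext w
    constructor
    · rintro ⟨_ | _ | i, rfl⟩
      · exact Or.inr (Or.inr rfl)
      · exact Or.inr (Or.inl rfl)
      · exact Or.inl ⟨_, (σ i).2, rfl⟩
    · rintro (⟨l, hl, rfl⟩ | rfl | rfl)
      · exact ⟨some (some (σ.symm ⟨l, hl⟩)), by simp [α, walls, s]⟩
      · exact ⟨some none, rfl⟩
      · exact ⟨none, rfl⟩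
  have hdil : ∀ l ∈ AddSubmonoid.closure D.simple, D.dil l ∈ AddSubmonoid.closure (Set.range α) := by
    intro l hl
    induction hl using AddSubmonoid.closure_induction with
    | mem l hl =>
      refine AddSubmonoid.subset_closure ?_
      rw [hrange]; exact Or.inl ⟨l, hl, rfl⟩
    | zero => exact zero_mem _
    | add l m _ _ h1 h2 => exact add_mem h1 h2
  have hwall : ∀ a, D.IsWallForm (α a) := by
    rintro (_ | _ | i)
    · exact .symmetry
    · refine .magnetic t ⟨ht, ?_⟩ 0
      rcases D.isSimpleSystem.pos_or_neg t ht with h1 | h1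
      · exact h1
      · have h2 := hhigh (s r) (D.isSimpleSystem.subset (σ r).2)
        have h3 : s r ∈ AddSubmonoid.closure D.simple := AddSubmonoid.subset_closure (σ r).2
        have h4 := add_mem h2 h3
        rwa [sub_add_cancel] at h4
    · exact .electric _ ⟨D.isSimpleSystem.subset (σ i).2, AddSubmonoid.subset_closure (σ i).2⟩
  have hclosure : ∀ w, D.IsWallForm w → w ∈ AddSubmonoid.closure (Set.range α) := by
    intro w hw
    have h1 : D.β 1 - D.β 0 ∈ AddSubmonoid.closure (Set.range α) :=
      AddSubmonoid.subset_closure ⟨none, rfl⟩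
    have h2 : D.β 0 - D.dil t ∈ AddSubmonoid.closure (Set.range α) :=
      AddSubmonoid.subset_closure ⟨some none, rfl⟩
    cases hw with
    | electric l hl => exact hdil l hl.2
    | magnetic l hl i =>
      have h3 := hdil _ (hhigh l hl.1)
      have h4 : D.β 0 - D.dil l = (D.β 0 - D.dil t) + D.dil (t - l) := by
        refine LinearMap.ext fun x => ?_
        simp
      have h5 : D.β 1 - D.dil l = (D.β 1 - D.β 0) + ((D.β 0 - D.dil t) + D.dil (t - l)) := by
        rw [← h4]; abel
      fin_cases i
      · change D.β 0 - D.dil l ∈ _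
        rw [h4]; exact add_mem h2 h3
      · change D.β 1 - D.dil l ∈ _
        rw [h5]; exact add_mem h1 (add_mem h2 h3)
    | symmetry => exact h1
  refine ⟨t, ⟨ht, hhigh⟩, α, αv, hrange, hwall, hclosure, hαv, ⟨hα, hαvi, hA, ?_⟩, ?_⟩
  · rw [hfr, hrank]; ring
  · ext x
    refine ⟨fun hx a => hx _ (hwall a), fun hx w hw => ?_⟩
    have := hclosure w hw
    clear hw
    induction this using AddSubmonoid.closure_induction with
    | mem w hw => obtain ⟨a, rfl⟩ := hw; exact hx a
    | zero => exact le_refl (0 : ℝ)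
    | add v w _ _ h1 h2 => exact add_nonneg h1 h2

end Chamber

section Reindex

variable {D} {ι ι' : Type*} [Fintype ι] [Fintype ι'] [DecidableEq ι] [DecidableEq ι']

lemma BilliardIsWeylChamber.submatrix {A : Matrix ι ι ℤ} (h : D.BilliardIsWeylChamber A) (e : ι' ≃ ι) :
    D.BilliardIsWeylChamber (A.submatrix e e) := by
  obtain ⟨ϑ, hϑ, α, αv, h1, h2, h3, h4, h5, h6⟩ := h
  have hr : Set.range (α ∘ e) = Set.range α := e.surjective.range_comp α
  refine ⟨ϑ, hϑ, α ∘ e, αv ∘ e, hr.trans h1, fun i => h2 _, fun w hw => ?_, fun i f => h4 _ f,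
    ⟨h5.independent_roots.comp e e.injective, h5.independent_coroots.comp e e.injective,
      fun i j => h5.apply_coroot _ _, ?_⟩, ?_⟩
  · rw [hr]; exact h3 w hw
  · rw [← Matrix.submatrix_map, Matrix.rank_submatrix, h5.dim, Fintype.card_congr e]
  · rw [h6]
    ext x
    exact ⟨fun hx i => hx (e i), fun hx i => by simpa using hx (e.symm i)⟩

lemma HasType.submatrix {Φ : Set (Dual ℝ D.𝔞)} {X : Matrix ι ι ℤ} {R : Set (ι → ℤ)}
    (h : D.HasType Φ X R) (e : ι' ≃ ι) : D.HasType Φ (X.submatrix e e) {v | v ∘ e.symm ∈ R} := by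
  obtain ⟨σ, hσ, hΦ⟩ := h
  refine ⟨e.trans σ, fun i j => hσ _ _, ?_⟩
  rw [hΦ]
  ext l
  constructor
  · rintro ⟨c, hc, rfl⟩
    refine ⟨c ∘ e, by simpa [Function.comp_assoc] using hc, ?_⟩
    exact (e.sum_comp fun i => c i • (σ i : Dual ℝ D.𝔞)).symm
  · rintro ⟨c, hc, rfl⟩
    refine ⟨c ∘ e.symm, hc, ?_⟩
    rw [← e.sum_comp]
    simp

end Reindex

end IwasawaDatum

lemma WeylClosure.submatrix {ι ι' : Type*} [Fintype ι] [Fintype ι'] [DecidableEq ι] [DecidableEq ι']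
    {X : Matrix ι ι ℤ} {G : Set (ι → ℤ)} {v : ι → ℤ} (h : WeylClosure X G v) (e : ι' ≃ ι) :
    WeylClosure (X.submatrix e e) {w | w ∘ e.symm ∈ G} (v ∘ e) := by
  induction h with
  | base v hv => exact .base _ (by simpa [Function.comp_assoc] using hv)
  | reflect v i _ ih =>
    have := WeylClosure.reflect _ (e.symm i) ih
    convert this using 1
    ext j
    have h1 : ∑ k, X.submatrix e e (e.symm i) k * (v ∘ e) k = ∑ k, X i k * v k := by
      rw [← e.sum_comp fun k => X i k * v k]; simp
    rw [h1]
    by_cases hj : e j = i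
    · subst hj; simp
    · have : j ≠ e.symm i := fun h => hj (by rw [h, e.apply_symm_apply])
      simp [hj, this]

lemma comp_mem_finiteRoots {ι ι' : Type*} [Fintype ι] [Fintype ι'] [DecidableEq ι] [DecidableEq ι']
    {X : Matrix ι ι ℤ} (e : ι' ≃ ι) {v : ι → ℤ} (hv : v ∈ finiteRoots X) :
    v ∘ e ∈ finiteRoots (X.submatrix e e) := by
  have h1 : WeylClosure (X.submatrix e e) _ (v ∘ e) := WeylClosure.submatrix hv e
  have h2 : {w : ι' → ℤ | w ∘ e.symm ∈ {w : ι → ℤ | ∃ i, w = Pi.single i 1}} =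
      {w | ∃ i, w = Pi.single i 1} := by
    ext w
    constructor
    · rintro ⟨i, hi⟩
      refine ⟨e.symm i, ?_⟩
      ext j
      have := congrFun hi (e j)
      simp only [Function.comp_apply, Equiv.symm_apply_apply] at this
      rw [this]; simp [Pi.single_apply, Equiv.eq_symm_apply]
    · rintro ⟨i, rfl⟩
      refine ⟨e i, ?_⟩
      ext j; simp [Pi.single_apply, Equiv.symm_apply_eq]
  rw [h2] at h1
  exact h1

lemma finiteRoots_submatrix {ι ι' : Type*} [Fintype ι] [Fintype ι'] [DecidableEq ι] [DecidableEq ι']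
    (X : Matrix ι ι ℤ) (e : ι' ≃ ι) :
    finiteRoots (X.submatrix e e) = {v | v ∘ e.symm ∈ finiteRoots X} := by
  ext v
  constructor
  · intro hv
    have := comp_mem_finiteRoots e.symm hv
    simpa using this
  · intro hv
    have hv' : v ∘ e.symm ∈ finiteRoots X := hv
    have := comp_mem_finiteRoots e hv'
    simpa [Function.comp_assoc] using this

/-! ### The lines of the table -/

section TableLine

variable {L : Type*} [LieRing L] [LieAlgebra ℝ L] [FiniteDimensional ℝ L] {ι : Type*} [Fintype ι]
  [DecidableEq ι] {X : Matrix ι ι ℤ} {G : Set (ι → ℤ)} {d ϑ : ι → ℤ}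
  {E : Matrix (Option ι) (Option ι) ℤ} {p : ι → ι} {r : ι}

theorem isTableLine_of_datum (hD : ∃ D : IwasawaDatum L, D.HasType D.roots X {v | WeylClosure X G v})
    (hG1 : ∀ i, Pi.single i 1 ∈ G) (hG : ∀ v ∈ G, ∃ i, v = Pi.single i 1 ∨ v = Pi.single i 2)
    (hE : IsAffineExtensionBy X d ϑ E) (hp : IsRootedBy X p r) (hϑ : WeylClosure X G ϑ)
    (hmax : ∀ v, WeylClosure X G v → ∀ i, v i ≤ ϑ i)
    {ι' κ : Type*} [Fintype ι'] [DecidableEq ι'] [Fintype κ] [DecidableEq κ]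
    (e : ι' ≃ ι) (f : κ ≃ Option (Option ι))
    (hA : IsHyperbolicGCM ((lorentzianExtension E none).submatrix f f)) :
    IsTableLine L X {v | WeylClosure X G v} (X.submatrix e e)
      ((lorentzianExtension E none).submatrix f f) := by
  obtain ⟨D₀, hD₀⟩ := hD
  have key : ∀ D : IwasawaDatum L, D.HasType D.roots X {v | WeylClosure X G v} := fun D =>
    IwasawaDatum.hasType_of_hasType D D₀ hD₀
  refine ⟨⟨D₀⟩, key, fun D => ?_, fun D => ?_, hA⟩
  · obtain ⟨𝔣, h1, h2⟩ := D.exists_isMaximalSplitSubalgebra (key D) hG1 hG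
    refine ⟨𝔣, h1, ?_⟩
    rw [finiteRoots_submatrix]
    exact h2.submatrix e
  · exact (IwasawaDatum.billiardIsWeylChamber (key D) hE hp hϑ hmax).submatrix f

theorem isUntwistedTableLine_of_datum
    (hD : ∃ D : IwasawaDatum L, D.HasType D.roots X (finiteRoots X))
    (hE : IsAffineExtensionBy X d ϑ E) (hp : IsRootedBy X p r) (hϑ : ϑ ∈ finiteRoots X)
    (hmax : ∀ v ∈ finiteRoots X, ∀ i, v i ≤ ϑ i)
    (hA : IsHyperbolicGCM (lorentzianExtension E none)) : IsUntwistedTableLine L X :=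
  ⟨lorentzianExtension E none, ⟨E, ⟨d, ϑ, hE.pos, hE.symm, hϑ, hmax, hE.some_some, hE.none_none,
    hE.some_none, hE.none_some⟩, rfl⟩,
    isTableLine_of_datum hD (fun i => ⟨i, rfl⟩) (fun _ ⟨i, hi⟩ => ⟨i, Or.inl hi⟩) hE hp hϑ hmax
      (Equiv.refl _) (Equiv.refl _) hA⟩

end TableLine

/-! ### Highest roots -/

section HighestRoot

variable {ι : Type*} [Fintype ι] [DecidableEq ι] {X : Matrix ι ι ℤ} {G : Set (ι → ℤ)} {d : ι → ℤ}

/-- The invariant quadratic form. -/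
def rootNorm (X : Matrix ι ι ℤ) (d : ι → ℤ) (v : ι → ℤ) : ℤ := ∑ i, d i * v i * ∑ j, X i j * v j

lemma rootNorm_reflect (h2 : ∀ i, X i i = 2) (hs : ∀ i j, d i * X i j = d j * X j i) (v : ι → ℤ)
    (k : ι) : rootNorm X d (v - Pi.single k (∑ j, X k j * v j)) = rootNorm X d v := by
  set t := ∑ j, X k j * v j with ht
  have h1 : ∀ i, ∑ j, X i j * (v - Pi.single k t : ι → ℤ) j = ∑ j, X i j * v j - X i k * t := fun i => by
    simp only [Pi.sub_apply, mul_sub, Finset.sum_sub_distrib]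
    congr 1
    rw [Finset.sum_eq_single k]
    · simp
    · intro j _ hj; simp [hj]
    · simp
  have h3 : ∀ f : ι → ℤ, ∑ i, d i * (v - Pi.single k t : ι → ℤ) i * f i =
      ∑ i, d i * v i * f i - d k * t * f k := fun f => by
    simp only [Pi.sub_apply, mul_sub, sub_mul, Finset.sum_sub_distrib]
    congr 1
    rw [Finset.sum_eq_single k]
    · simp
    · intro j _ hj; simp [hj]
    · simp
  have h4 : ∑ i, d i * v i * (X i k * t) = d k * t * t := by
    conv_rhs => rw [ht, Finset.mul_sum]
    refine Finset.sum_congr rfl fun i _ => ?_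
    rw [← ht]; linear_combination (v i * t) * hs i k
  have h5 : rootNorm X d (v - Pi.single k t) =
      ∑ i, d i * v i * (∑ j, X i j * v j - X i k * t) - d k * t * (t - X k k * t) := by
    rw [rootNorm, Finset.sum_congr rfl fun i _ => by rw [h1]]
    exact h3 _
  rw [h5, h2, rootNorm]
  simp only [mul_sub, Finset.sum_sub_distrib, h4]
  ring

lemma exists_dominant (hR : {v | WeylClosure X G v}.Finite) {v : ι → ℤ} (hv : WeylClosure X G v) :
    ∃ w, WeylClosure X G w ∧ v ≤ w ∧ ∀ i, 0 ≤ ∑ j, X i j * w j := by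
  obtain ⟨w, hvw, hw⟩ := hR.exists_le_maximal hv
  refine ⟨w, hw.prop, hvw, fun i => ?_⟩
  by_contra! hneg
  have h1 : w ≤ w - Pi.single i (∑ j, X i j * w j) := by
    rw [le_sub_self_iff]
    intro j
    by_cases hj : j = i
    · subst hj; simpa using hneg.le
    · simp [hj]
  have h2 := hw.le_of_ge (WeylClosure.reflect w i hw.prop) h1 i
  simp at h2
  omega

/-- A criterion for `ϑ` to be the highest root, given the inverse `c⁻¹ M` of the Cartan matrix. -/
theorem isHighest_of_inverse {M : Matrix ι ι ℤ} {c K : ℤ} {b : ℕ} {ϑ g : ι → ℤ}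
    (hR : {v | WeylClosure X G v}.Finite) (h2 : ∀ i, X i i = 2) (hd : ∀ i, 0 < d i)
    (hs : ∀ i j, d i * X i j = d j * X j i) (hc : 0 < c) (hM : M * X = c • (1 : Matrix ι ι ℤ))
    (hdM : ∀ i j, 0 ≤ d i * M i j) (hG : ∀ v ∈ G, rootNorm X d v ≤ K) (hg : g ∈ G)
    (hgK : rootNorm X d g = K) (hb : ∀ i, c * K < d i * M i i * ((b : ℤ) + 1) ^ 2)
    (check : ∀ m : ι → Fin (b + 1), (∀ k, c ∣ ∑ j, M k j * ((m j : ℕ) : ℤ)) →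
      (∑ i, d i * ((m i : ℕ) : ℤ) * ∑ j, M i j * ((m j : ℕ) : ℤ) ≤ c * K →
        ∀ k, ∑ j, M k j * ((m j : ℕ) : ℤ) ≤ c * ϑ k) ∧
      (∑ i, d i * ((m i : ℕ) : ℤ) * ∑ j, M i j * ((m j : ℕ) : ℤ) = c * K →
        ∀ k, ∑ j, M k j * ((m j : ℕ) : ℤ) = c * ϑ k)) :
    WeylClosure X G ϑ ∧ ∀ v, WeylClosure X G v → ∀ i, v i ≤ ϑ i := by
  have hM0 : ∀ i j, 0 ≤ M i j := fun i j => nonneg_of_mul_nonneg_right (hdM i j) (hd i)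
  have hnorm : ∀ v, WeylClosure X G v → rootNorm X d v ≤ K := fun v hv => by
    induction hv with
    | base v hv => exact hG v hv
    | reflect v i _ ih => rwa [rootNorm_reflect h2 hs]
  have key : ∀ w, WeylClosure X G w → (∀ i, 0 ≤ ∑ j, X i j * w j) →
      (∀ k, w k ≤ ϑ k) ∧ (rootNorm X d w = K → w = ϑ) := by
    intro w hw hpos
    set m : ι → ℤ := fun i => ∑ j, X i j * w j with hm
    have hMm : ∀ k, ∑ j, M k j * m j = c * w k := fun k => by
      have h1 : (M * X) *ᵥ w = c • w := by rw [hM, smul_mulVec, one_mulVec]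
      have h3 := congrFun h1 k
      rw [← mulVec_mulVec] at h3
      exact h3
    have hN : ∑ i, d i * m i * ∑ j, M i j * m j = c * rootNorm X d w := by
      rw [rootNorm, Finset.mul_sum]
      refine Finset.sum_congr rfl fun i _ => ?_
      rw [hMm]; ring
    have hle : ∀ i, m i < b + 1 := fun i => by
      have h1 : d i * m i * (M i i * m i) ≤ ∑ i, d i * m i * ∑ j, M i j * m j := by
        refine le_trans (mul_le_mul_of_nonneg_left ?_ (mul_nonneg (hd i).le (hpos i)))
          (Finset.single_le_sum (f := fun i => d i * m i * ∑ j, M i j * m j)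
            (fun j _ => mul_nonneg (mul_nonneg (hd j).le (hpos j))
              (Finset.sum_nonneg fun k _ => mul_nonneg (hM0 _ _) (hpos k))) (Finset.mem_univ i))
        exact Finset.single_le_sum (f := fun j => M i j * m j)
          (fun k _ => mul_nonneg (hM0 _ _) (hpos k)) (Finset.mem_univ i)
      have h3 : d i * m i * (M i i * m i) ≤ c * K := by
        rw [hN] at h1
        exact h1.trans (mul_le_mul_of_nonneg_left (hnorm w hw) hc.le)
      by_contra! h4
      have h5 := hb i
      have h6 : 0 ≤ d i * M i i := mul_nonneg (hd i).le (hM0 _ _)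
      have h7 : ((b : ℤ) + 1) ^ 2 ≤ m i ^ 2 := by gcongr
      nlinarith [mul_le_mul_of_nonneg_left h7 h6]
    choose f hf using fun i => Int.eq_ofNat_of_zero_le (hpos i)
    have hf' : ∀ i, m i = f i := hf
    let m' : ι → Fin (b + 1) := fun i => ⟨f i, by have := hle i; rw [hf'] at this; omega⟩
    have hm' : ∀ i, (((m' i : Fin (b + 1)) : ℕ) : ℤ) = m i := fun i => (hf' i).symm
    have := check m'
    simp only [hm', hMm] at this
    have h8 := this fun k => dvd_mul_right c _
    refine ⟨fun k => ?_, fun h9 => ?_⟩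
    · have h9 := h8.1 (by
        have : ∑ i, d i * m i * (c * w i) = c * rootNorm X d w := by
          rw [← hN]; exact Finset.sum_congr rfl fun i _ => by rw [hMm]
        rw [this]; exact mul_le_mul_of_nonneg_left (hnorm w hw) hc.le) k
      exact le_of_mul_le_mul_left h9 hc
    · ext k
      have h10 := h8.2 (by
        have : ∑ i, d i * m i * (c * w i) = c * rootNorm X d w := by
          rw [← hN]; exact Finset.sum_congr rfl fun i _ => by rw [hMm]
        rw [this, h9]) k
      exact mul_left_cancel₀ hc.ne' h10
  refine ⟨?_, fun v hv i => ?_⟩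
  · have hK : ∀ v, WeylClosure X {g} v → WeylClosure X G v ∧ rootNorm X d v = K := fun v hv => by
      induction hv with
      | base v hv => rw [Set.mem_singleton_iff.mp hv]; exact ⟨.base _ hg, hgK⟩
      | reflect v i _ ih => exact ⟨.reflect _ _ ih.1, by rw [rootNorm_reflect h2 hs]; exact ih.2⟩
    obtain ⟨w, hw, -, hpos⟩ := exists_dominant (G := {g}) (hR.subset fun v hv => (hK v hv).1)
      (.base g rfl)
    have := hK w hw
    rw [← (key w this.1 hpos).2 this.2]
    exact this.1
  · obtain ⟨w, hw, hvw, hpos⟩ := exists_dominant hR hv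
    exact (hvw i).trans ((key w hw hpos).1 i)

end HighestRoot

lemma IwasawaDatum.HasType.finite {L : Type*} [LieRing L] [LieAlgebra ℝ L] [FiniteDimensional ℝ L]
    {D : IwasawaDatum L} {ι : Type*} [Fintype ι] {X : Matrix ι ι ℤ} {R : Set (ι → ℤ)}
    (h : D.HasType D.roots X R) : R.Finite := by
  obtain ⟨σ, -, hΦ⟩ := h
  have hs : LinearIndependent ℝ fun i => (σ i : Dual ℝ D.𝔞) := by
    have := (simpleBasis D.isSimpleSystem).linearIndependent.comp σ σ.injective
    convert this using 1
    exact funext fun i => (simpleBasis_apply D.isSimpleSystem (σ i)).symm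
  refine Set.Finite.of_injOn (f := fun c : ι → ℤ => ∑ i, c i • (σ i : Dual ℝ D.𝔞)) (t := D.roots)
    (fun c hc => by rw [hΦ]; exact ⟨c, hc, rfl⟩) (fun c _ c' _ h => ?_) D.finite_roots
  have h1 : ∑ i, ((c i - c' i : ℤ) : ℝ) • (σ i : Dual ℝ D.𝔞) = 0 := by
    have h2 : ∑ i, c i • (σ i : Dual ℝ D.𝔞) = ∑ i, c' i • (σ i : Dual ℝ D.𝔞) := h
    rw [← sub_eq_zero.mpr h2, ← Finset.sum_sub_distrib]
    refine Finset.sum_congr rfl fun i _ => ?_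
    rw [← sub_smul]
    exact Int.cast_smul_eq_zsmul ℝ (c i - c' i) (σ i : Dual ℝ D.𝔞)
  ext i
  have := Fintype.linearIndependent_iff.mp hs _ h1 i
  have h3 : c i - c' i = 0 := by exact_mod_cast this
  omega

/-! ### Hyperbolic Cartan matrices -/

theorem isHyperbolicGCM_of_vectors {ι : Type*} [Fintype ι] [DecidableEq ι] {A : Matrix ι ι ℤ}
    {d u : ι → ℤ} {U : ι → ι → ℤ} {p : ι → ι} {r : ι} (diag : ∀ i, A i i = 2)
    (hneg : ∀ i j, i ≠ j → d i * A i j ≤ 0)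
    (hd : (∀ i, 0 < d i) ∧ ∀ i j, d i * A i j = d j * A j i) (hp : IsRootedBy A p r)
    (hu : ∀ i, 0 < u i ∧ ∑ j, A i j * u j < 0)
    (hU : ∀ k i, i ≠ k → 0 < U k i ∧ 0 ≤ ∑ j, A i j * U k j - A i k * U k k) :
    IsHyperbolicGCM A := by
  have nonpos : ∀ i j, i ≠ j → A i j ≤ 0 := fun i j hij =>
    nonpos_of_mul_nonpos_right (hneg i j hij) (hd.1 i)
  have zero_symm : ∀ i j, A i j = 0 → A j i = 0 := fun i j hij => by
    have h1 := hd.2 i j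
    rw [hij, mul_zero] at h1
    exact (mul_eq_zero.mp h1.symm).resolve_left (hd.1 j).ne'
  exact {
  diag := diag
  nonpos := nonpos
  zero_symm := zero_symm
  symmetrizable := ⟨fun i => d i, fun i => by beta_reduce; exact_mod_cast hd.1 i, fun i j => by
    beta_reduce; exact_mod_cast hd.2 i j⟩
  indecomposable S hS hS' := by
    by_contra! hcon
    have hclosed : ∀ i j, A i j ≠ 0 → (i ∈ S ↔ j ∈ S) := fun i j hij => by
      constructor
      · intro hi; by_contra hj; exact hij (hcon i hi j hj)
      · intro hj; by_contra hi; exact hij (zero_symm _ _ (hcon j hj i hi))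
    have key : ∀ i, i ∈ S ↔ r ∈ S := hp.induction (P := fun i => i ∈ S ↔ r ∈ S) Iff.rfl
      fun i j hij hj => (hclosed i j hij).trans hj
    obtain ⟨i, hi⟩ := hS
    exact hS' (Finset.eq_univ_of_forall fun j => (key j).mpr ((key i).mp hi))
  indefinite := ⟨fun i => u i, fun i => by beta_reduce; exact_mod_cast (hu i).1, fun i => by
    beta_reduce; exact_mod_cast (hu i).2⟩
  proper S hS := by
    obtain ⟨k, hk⟩ : ∃ k, k ∉ S := by
      by_contra! h; exact hS (Finset.eq_univ_of_forall h)
    have hik : ∀ i ∈ S, i ≠ k := fun i hi h => hk (h ▸ hi)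
    refine ⟨fun i => U k i, fun i hi => by beta_reduce; exact_mod_cast (hU k i (hik i hi)).1, fun i hi => ?_⟩
    have h1 : 0 ≤ ∑ j ∈ S, A i j * U k j := by
      refine (hU k i (hik i hi)).2.trans ?_
      rw [sub_le_iff_le_add, ← Finset.sum_erase_add _ _ (Finset.mem_univ k), add_le_add_iff_right]
      have hsub : S ⊆ Finset.univ.erase k := fun j hj => Finset.mem_erase.mpr ⟨hik j hj, Finset.mem_univ _⟩
      rw [← Finset.sum_sdiff hsub]
      refine add_le_of_nonpos_left (Finset.sum_nonpos fun j hj => ?_)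
      obtain ⟨h2, h3⟩ := Finset.mem_sdiff.mp hj
      exact mul_nonpos_of_nonpos_of_nonneg (nonpos i j fun h => h3 (h ▸ hi))
        (hU k j (Finset.ne_of_mem_erase h2)).1.le
    beta_reduce; exact_mod_cast h1 }

/-- The vector with the given components, the first two of which belong to the additional roots. -/
def extendedVec {n : ℕ} {T : Type*} (v : Fin (n + 2) → T) : Option (Option (Fin n)) → T
  | none => v 0
  | some none => v 1
  | some (some i) => v i.succ.succ

/-! ### The affine extension -/

section Inverse

/-- The affine extension of the Cartan matrix `X`, symmetrized by `d`, by the negative of `ϑ`. -/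
def affineExtension {ι : Type*} [Fintype ι] (X : Matrix ι ι ℤ) (d ϑ : ι → ℤ) :
    Matrix (Option ι) (Option ι) ℤ
  | some i, some j => X i j
  | none, none => 2
  | some i, none => -∑ j, X i j * ϑ j
  | none, some i => (-2 * ∑ k, ϑ k * (d k * X k i)) / ∑ k, ∑ j, ϑ k * (d k * X k j) * ϑ j

variable {L : Type*} [LieRing L] [LieAlgebra ℝ L] [FiniteDimensional ℝ L] {ι : Type*} [Fintype ι]
  [DecidableEq ι] {X : Matrix ι ι ℤ} {G : Set (ι → ℤ)} {d ϑ g : ι → ℤ} {M : Matrix ι ι ℤ} {c K : ℤ}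
  {b : ℕ} {p : ι → ι} {r : ι}

lemma isAffineExtensionBy_affineExtension (hd : (∀ i, 0 < d i) ∧ ∀ i j, d i * X i j = d j * X j i)
    (hdvd : ∀ i, (∑ k, ∑ j, ϑ k * (d k * X k j) * ϑ j) ∣ -2 * ∑ k, ϑ k * (d k * X k i)) :
    IsAffineExtensionBy X d ϑ (affineExtension X d ϑ) :=
  ⟨hd.1, hd.2, fun _ _ => rfl, rfl, fun _ => rfl, fun i => Int.mul_ediv_cancel' (hdvd i)⟩

/-- The decidable conditions under which `ϑ` is the highest root. -/
abbrev HighestRootCriterion (M : Matrix ι ι ℤ) (d ϑ : ι → ℤ) (c K : ℤ) (b : ℕ) : Prop :=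
  ∀ m : ι → Fin (b + 1), (∀ k, c ∣ ∑ j, M k j * ((m j : ℕ) : ℤ)) →
      (∑ i, d i * ((m i : ℕ) : ℤ) * ∑ j, M i j * ((m j : ℕ) : ℤ) ≤ c * K →
        ∀ k, ∑ j, M k j * ((m j : ℕ) : ℤ) ≤ c * ϑ k) ∧
      (∑ i, d i * ((m i : ℕ) : ℤ) * ∑ j, M i j * ((m j : ℕ) : ℤ) = c * K →
        ∀ k, ∑ j, M k j * ((m j : ℕ) : ℤ) = c * ϑ k)

theorem isTableLine_of_inverse
    (hD : ∃ D : IwasawaDatum L, D.HasType D.roots X {v | WeylClosure X G v})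
    (hG1 : ∀ i, Pi.single i 1 ∈ G) (hG : ∀ v ∈ G, ∃ i, v = Pi.single i 1 ∨ v = Pi.single i 2)
    (h2 : ∀ i, X i i = 2) (hd : (∀ i, 0 < d i) ∧ ∀ i j, d i * X i j = d j * X j i)
    (hdvd : ∀ i, (∑ k, ∑ j, ϑ k * (d k * X k j) * ϑ j) ∣ -2 * ∑ k, ϑ k * (d k * X k i))
    (hp : IsRootedBy X p r) (hc : 0 < c) (hM : M * X = c • (1 : Matrix ι ι ℤ))
    (hM0 : ∀ i j, 0 ≤ d i * M i j) (hGK : ∀ v ∈ G, rootNorm X d v ≤ K) (hg : g ∈ G)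
    (hgK : rootNorm X d g = K) (hb : ∀ i, c * K < d i * M i i * ((b : ℤ) + 1) ^ 2)
    (hcrit : HighestRootCriterion M d ϑ c K b)
    {ι' κ : Type*} [Fintype ι'] [DecidableEq ι'] [Fintype κ] [DecidableEq κ] (e : ι' ≃ ι)
    (f : κ ≃ Option (Option ι)) {F : Matrix ι' ι' ℤ} (hF : F = X.submatrix e e)
    {A : Matrix κ κ ℤ} (hA : A = (lorentzianExtension (affineExtension X d ϑ) none).submatrix f f)
    (hyp : IsHyperbolicGCM A) : IsTableLine L X {v | WeylClosure X G v} F A := by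
  have hR : {v | WeylClosure X G v}.Finite := by
    obtain ⟨D, h⟩ := hD
    exact h.finite
  obtain ⟨h3, h4⟩ := isHighest_of_inverse hR h2 hd.1 hd.2 hc hM hM0 hGK hg hgK hb hcrit
  subst hF hA
  exact isTableLine_of_datum hD hG1 hG (isAffineExtensionBy_affineExtension hd hdvd) hp h3 h4 e f hyp

theorem isUntwistedTableLine_of_inverse
    (hD : ∃ D : IwasawaDatum L, D.HasType D.roots X (finiteRoots X))
    (h2 : ∀ i, X i i = 2) (hd : (∀ i, 0 < d i) ∧ ∀ i j, d i * X i j = d j * X j i)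
    (hdvd : ∀ i, (∑ k, ∑ j, ϑ k * (d k * X k j) * ϑ j) ∣ -2 * ∑ k, ϑ k * (d k * X k i))
    (hp : IsRootedBy X p r) (hc : 0 < c) (hM : M * X = c • (1 : Matrix ι ι ℤ))
    (hM0 : ∀ i j, 0 ≤ d i * M i j) (hGK : ∀ i, rootNorm X d (Pi.single i 1) ≤ K) (i₀ : ι)
    (hgK : rootNorm X d (Pi.single i₀ 1) = K) (hb : ∀ i, c * K < d i * M i i * ((b : ℤ) + 1) ^ 2)
    (hcrit : HighestRootCriterion M d ϑ c K b)
    (hyp : IsHyperbolicGCM (lorentzianExtension (affineExtension X d ϑ) none)) :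
    IsUntwistedTableLine L X := by
  have hR : (finiteRoots X).Finite := by
    obtain ⟨D, h⟩ := hD
    exact h.finite
  obtain ⟨h3, h4⟩ := isHighest_of_inverse (G := {w | ∃ i, w = Pi.single i 1}) hR h2 hd.1 hd.2 hc hM
    hM0 (by rintro _ ⟨i, rfl⟩; exact hGK i) ⟨i₀, rfl⟩ hgK hb hcrit
  exact isUntwistedTableLine_of_datum hD (isAffineExtensionBy_affineExtension hd hdvd) hp h3 h4 hyp

end Inverse

/-! ### The individual types -/

section Types

variable {L : Type*} [LieRing L] [LieAlgebra ℝ L] [FiniteDimensional ℝ L]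

set_option maxRecDepth 100000

theorem isHyperbolicGCM_A₁ :
    IsHyperbolicGCM (lorentzianExtension (affineExtension (CartanMatrix.A 1)ᵀ ![1] ![1]) none) :=
  isHyperbolicGCM_of_vectors (d := extendedVec ![1, 1, 1])
    (u := extendedVec ![3, 7, 6])
    (U := fun k => extendedVec (extendedVec (n := 1) ![![0, 1, 1], ![1, 0, 1], ![1, 1, 0]] k))
    (p := extendedVec ![none, none, some none]) (r := none)
    (by decide +kernel) (by decide +kernel) (by decide +kernel)
    ⟨by decide +kernel, fun i => ⟨3, by revert i; decide +kernel⟩⟩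
    (by decide +kernel) (by decide +kernel)

theorem isUntwistedTableLine_A₁
    (hD : ∃ D : IwasawaDatum L, D.HasType D.roots (CartanMatrix.A 1)ᵀ (finiteRoots (CartanMatrix.A 1)ᵀ)) :
    IsUntwistedTableLine L (CartanMatrix.A 1)ᵀ :=
  isUntwistedTableLine_of_inverse (d := ![1]) (ϑ := ![1])
    (M := !![1])
    (c := 2) (K := 2) (b := 2) (p := ![0]) (r := 0) hD
    (by decide +kernel) (by decide +kernel) (by decide +kernel)
    ⟨by decide +kernel, fun i => ⟨1, by revert i; decide +kernel⟩⟩ (by decide +kernel)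
    (by decide +kernel) (by decide +kernel) (by decide +kernel) 0 (by decide +kernel)
    (by decide +kernel) (by decide +kernel) isHyperbolicGCM_A₁

theorem isHyperbolicGCM_C₂ :
    IsHyperbolicGCM (lorentzianExtension (affineExtension (CartanMatrix.C 2)ᵀ ![1, 2] ![2, 1]) none) :=
  isHyperbolicGCM_of_vectors (d := extendedVec ![2, 2, 1, 2])
    (u := extendedVec ![4, 9, 15, 7])
    (U := fun k => extendedVec (extendedVec (n := 2) ![![0, 1, 2, 1], ![1, 0, 1, 1], ![1, 1, 0,
      1], ![1, 1, 1, 0]] k))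
    (p := extendedVec ![none, none, some none, some (some 0)]) (r := none)
    (by decide +kernel) (by decide +kernel) (by decide +kernel)
    ⟨by decide +kernel, fun i => ⟨4, by revert i; decide +kernel⟩⟩
    (by decide +kernel) (by decide +kernel)

theorem isUntwistedTableLine_C₂
    (hD : ∃ D : IwasawaDatum L, D.HasType D.roots (CartanMatrix.C 2)ᵀ (finiteRoots (CartanMatrix.C 2)ᵀ)) :
    IsUntwistedTableLine L (CartanMatrix.C 2)ᵀ :=
  isUntwistedTableLine_of_inverse (d := ![1, 2]) (ϑ := ![2, 1])
    (M := !![2, 2; 1, 2])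
    (c := 2) (K := 4) (b := 2) (p := ![0, 0]) (r := 0) hD
    (by decide +kernel) (by decide +kernel) (by decide +kernel)
    ⟨by decide +kernel, fun i => ⟨2, by revert i; decide +kernel⟩⟩ (by decide +kernel)
    (by decide +kernel) (by decide +kernel) (by decide +kernel) 1 (by decide +kernel)
    (by decide +kernel) (by decide +kernel) isHyperbolicGCM_C₂

theorem isHyperbolicGCM_F₄ :
    IsHyperbolicGCM (lorentzianExtension (affineExtension CartanMatrix.F₄ᵀ ![2, 2, 1, 1] ![2, 3, 4, 2]) none) :=
  isHyperbolicGCM_of_vectors (d := extendedVec ![2, 2, 2, 2, 1, 1])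
    (u := extendedVec ![9, 19, 30, 42, 55, 27])
    (U := fun k => extendedVec (extendedVec (n := 4) ![![0, 1, 2, 3, 4, 2], ![1, 0, 1, 2, 3, 2],
      ![1, 1, 0, 1, 2, 1], ![1, 1, 1, 0, 1, 1], ![1, 1, 1, 1, 0, 1], ![1, 1, 1, 1, 1, 0]] k))
    (p := extendedVec ![none, none, some none, some (some 0), some (some 1), some (some 2)]) (r := none)
    (by decide +kernel) (by decide +kernel) (by decide +kernel)
    ⟨by decide +kernel, fun i => ⟨6, by revert i; decide +kernel⟩⟩
    (by decide +kernel) (by decide +kernel)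

theorem isUntwistedTableLine_F₄
    (hD : ∃ D : IwasawaDatum L, D.HasType D.roots CartanMatrix.F₄ᵀ (finiteRoots CartanMatrix.F₄ᵀ)) :
    IsUntwistedTableLine L CartanMatrix.F₄ᵀ :=
  isUntwistedTableLine_of_inverse (d := ![2, 2, 1, 1]) (ϑ := ![2, 3, 4, 2])
    (M := !![2, 3, 2, 1; 3, 6, 4, 2; 4, 8, 6, 3; 2, 4, 3, 2])
    (c := 1) (K := 4) (b := 1) (p := ![0, 0, 1, 2]) (r := 0) hD
    (by decide +kernel) (by decide +kernel) (by decide +kernel)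
    ⟨by decide +kernel, fun i => ⟨4, by revert i; decide +kernel⟩⟩ (by decide +kernel)
    (by decide +kernel) (by decide +kernel) (by decide +kernel) 0 (by decide +kernel)
    (by decide +kernel) (by decide +kernel) isHyperbolicGCM_F₄

theorem isHyperbolicGCM_E₈ :
    IsHyperbolicGCM (lorentzianExtension (affineExtension CartanMatrix.E₈ᵀ ![1, 1, 1, 1, 1, 1, 1, 1] ![2, 3, 4, 6, 5, 4, 3, 2]) none) :=
  isHyperbolicGCM_of_vectors (d := extendedVec ![1, 1, 1, 1, 1, 1, 1, 1, 1, 1])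
    (u := extendedVec ![30, 61, 76, 115, 153, 231, 195, 160, 126, 93])
    (U := fun k => extendedVec (extendedVec (n := 8) ![![0, 1, 2, 3, 4, 6, 5, 4, 3, 2], ![1, 0, 2,
      3, 4, 6, 5, 4, 3, 2], ![1, 2, 0, 1, 1, 2, 2, 2, 2, 2], ![1, 1, 1, 0, 1, 1, 1, 1, 1, 1], ![1,
      1, 1, 1, 0, 1, 1, 1, 1, 1], ![1, 1, 1, 1, 1, 0, 1, 1, 1, 1], ![1, 1, 1, 1, 1, 1, 0, 1, 1,
      1], ![1, 1, 1, 1, 2, 2, 1, 0, 1, 1], ![1, 1, 1, 2, 2, 3, 2, 1, 0, 1], ![1, 1, 2, 2, 3, 4, 3,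
      2, 1, 0]] k))
    (p := extendedVec ![none, none, some (some 2), some (some 3), some (some 3), some (some 4),
      some (some 5), some (some 6), some (some 7), some none]) (r := none)
    (by decide +kernel) (by decide +kernel) (by decide +kernel)
    ⟨by decide +kernel, fun i => ⟨10, by revert i; decide +kernel⟩⟩
    (by decide +kernel) (by decide +kernel)

theorem isUntwistedTableLine_E₈
    (hD : ∃ D : IwasawaDatum L, D.HasType D.roots CartanMatrix.E₈ᵀ (finiteRoots CartanMatrix.E₈ᵀ)) :
    IsUntwistedTableLine L CartanMatrix.E₈ᵀ :=
  isUntwistedTableLine_of_inverse (d := ![1, 1, 1, 1, 1, 1, 1, 1]) (ϑ := ![2, 3, 4, 6, 5, 4, 3, 2])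
    (M := !![4, 5, 7, 10, 8, 6, 4, 2; 5, 8, 10, 15, 12, 9, 6, 3; 7, 10, 14, 20, 16, 12, 8, 4; 10,
      15, 20, 30, 24, 18, 12, 6; 8, 12, 16, 24, 20, 15, 10, 5; 6, 9, 12, 18, 15, 12, 8, 4; 4, 6,
      8, 12, 10, 8, 6, 3; 2, 3, 4, 6, 5, 4, 3, 2])
    (c := 1) (K := 2) (b := 1) (p := ![0, 3, 0, 2, 3, 4, 5, 6]) (r := 0) hD
    (by decide +kernel) (by decide +kernel) (by decide +kernel)
    ⟨by decide +kernel, fun i => ⟨8, by revert i; decide +kernel⟩⟩ (by decide +kernel)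
    (by decide +kernel) (by decide +kernel) (by decide +kernel) 0 (by decide +kernel)
    (by decide +kernel) (by decide +kernel) isHyperbolicGCM_E₈

theorem isHyperbolicGCM_D₈ :
    IsHyperbolicGCM (lorentzianExtension (affineExtension (CartanMatrix.D 8)ᵀ ![1, 1, 1, 1, 1, 1, 1, 1] ![1, 2, 2, 2, 2, 2, 1, 1]) none) :=
  isHyperbolicGCM_of_vectors (d := extendedVec ![1, 1, 1, 1, 1, 1, 1, 1, 1, 1])
    (u := extendedVec ![14, 29, 22, 45, 40, 36, 33, 31, 15, 15])
    (U := fun k => extendedVec (extendedVec (n := 8) ![![0, 1, 1, 2, 2, 2, 2, 2, 1, 1], ![1, 0, 1,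
      2, 2, 2, 2, 2, 1, 1], ![1, 2, 0, 2, 2, 2, 2, 2, 1, 1], ![1, 1, 1, 0, 1, 2, 2, 2, 1, 1], ![1,
      1, 1, 1, 0, 1, 2, 2, 1, 1], ![1, 2, 1, 2, 1, 0, 1, 2, 1, 1], ![1, 2, 2, 3, 2, 1, 0, 1, 1,
      1], ![2, 3, 2, 4, 3, 2, 1, 0, 1, 1], ![2, 4, 3, 6, 5, 4, 3, 2, 0, 1], ![2, 4, 3, 6, 5, 4, 3,
      2, 1, 0]] k))
    (p := extendedVec ![none, none, some (some 1), some none, some (some 1), some (some 2), some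
      (some 3), some (some 4), some (some 5), some (some 5)]) (r := none)
    (by decide +kernel) (by decide +kernel) (by decide +kernel)
    ⟨by decide +kernel, fun i => ⟨10, by revert i; decide +kernel⟩⟩
    (by decide +kernel) (by decide +kernel)

theorem isUntwistedTableLine_D₈
    (hD : ∃ D : IwasawaDatum L, D.HasType D.roots (CartanMatrix.D 8)ᵀ (finiteRoots (CartanMatrix.D 8)ᵀ)) :
    IsUntwistedTableLine L (CartanMatrix.D 8)ᵀ :=
  isUntwistedTableLine_of_inverse (d := ![1, 1, 1, 1, 1, 1, 1, 1]) (ϑ := ![1, 2, 2, 2, 2, 2, 1, 1])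
    (M := !![2, 2, 2, 2, 2, 2, 1, 1; 2, 4, 4, 4, 4, 4, 2, 2; 2, 4, 6, 6, 6, 6, 3, 3; 2, 4, 6, 8,
      8, 8, 4, 4; 2, 4, 6, 8, 10, 10, 5, 5; 2, 4, 6, 8, 10, 12, 6, 6; 1, 2, 3, 4, 5, 6, 4, 3; 1,
      2, 3, 4, 5, 6, 3, 4])
    (c := 2) (K := 2) (b := 1) (p := ![0, 0, 1, 2, 3, 4, 5, 5]) (r := 0) hD
    (by decide +kernel) (by decide +kernel) (by decide +kernel)
    ⟨by decide +kernel, fun i => ⟨8, by revert i; decide +kernel⟩⟩ (by decide +kernel)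
    (by decide +kernel) (by decide +kernel) (by decide +kernel) 0 (by decide +kernel)
    (by decide +kernel) (by decide +kernel) isHyperbolicGCM_D₈

theorem isHyperbolicGCM_B₂ :
    IsHyperbolicGCM (lorentzianExtension (affineExtension (CartanMatrix.B 2)ᵀ ![2, 1] ![1, 2]) none) :=
  isHyperbolicGCM_of_vectors (d := extendedVec ![2, 2, 2, 1])
    (u := extendedVec ![4, 9, 7, 15])
    (U := fun k => extendedVec (extendedVec (n := 2) ![![0, 1, 1, 2], ![1, 0, 1, 1], ![1, 1, 0,
      1], ![1, 1, 1, 0]] k))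
    (p := extendedVec ![none, none, some (some 1), some none]) (r := none)
    (by decide +kernel) (by decide +kernel) (by decide +kernel)
    ⟨by decide +kernel, fun i => ⟨4, by revert i; decide +kernel⟩⟩
    (by decide +kernel) (by decide +kernel)

theorem isUntwistedTableLine_B₂
    (hD : ∃ D : IwasawaDatum L, D.HasType D.roots (CartanMatrix.B 2)ᵀ (finiteRoots (CartanMatrix.B 2)ᵀ)) :
    IsUntwistedTableLine L (CartanMatrix.B 2)ᵀ :=
  isUntwistedTableLine_of_inverse (d := ![2, 1]) (ϑ := ![1, 2])
    (M := !![2, 1; 2, 2])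
    (c := 2) (K := 4) (b := 2) (p := ![0, 0]) (r := 0) hD
    (by decide +kernel) (by decide +kernel) (by decide +kernel)
    ⟨by decide +kernel, fun i => ⟨2, by revert i; decide +kernel⟩⟩ (by decide +kernel)
    (by decide +kernel) (by decide +kernel) (by decide +kernel) 0 (by decide +kernel)
    (by decide +kernel) (by decide +kernel) isHyperbolicGCM_B₂

theorem isHyperbolicGCM_B₃ :
    IsHyperbolicGCM (lorentzianExtension (affineExtension (CartanMatrix.B 3)ᵀ ![2, 2, 1] ![1, 2, 2]) none) :=
  isHyperbolicGCM_of_vectors (d := extendedVec ![2, 2, 2, 2, 1])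
    (u := extendedVec ![6, 13, 10, 21, 20])
    (U := fun k => extendedVec (extendedVec (n := 3) ![![0, 1, 1, 2, 2], ![1, 0, 1, 1, 1], ![1, 1,
      0, 1, 1], ![1, 1, 1, 0, 1], ![1, 1, 1, 1, 0]] k))
    (p := extendedVec ![none, none, some (some 1), some none, some (some 1)]) (r := none)
    (by decide +kernel) (by decide +kernel) (by decide +kernel)
    ⟨by decide +kernel, fun i => ⟨5, by revert i; decide +kernel⟩⟩
    (by decide +kernel) (by decide +kernel)

theorem isUntwistedTableLine_B₃
    (hD : ∃ D : IwasawaDatum L, D.HasType D.roots (CartanMatrix.B 3)ᵀ (finiteRoots (CartanMatrix.B 3)ᵀ)) :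
    IsUntwistedTableLine L (CartanMatrix.B 3)ᵀ :=
  isUntwistedTableLine_of_inverse (d := ![2, 2, 1]) (ϑ := ![1, 2, 2])
    (M := !![2, 2, 1; 2, 4, 2; 2, 4, 3])
    (c := 2) (K := 4) (b := 1) (p := ![0, 0, 1]) (r := 0) hD
    (by decide +kernel) (by decide +kernel) (by decide +kernel)
    ⟨by decide +kernel, fun i => ⟨3, by revert i; decide +kernel⟩⟩ (by decide +kernel)
    (by decide +kernel) (by decide +kernel) (by decide +kernel) 0 (by decide +kernel)
    (by decide +kernel) (by decide +kernel) isHyperbolicGCM_B₃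

theorem isHyperbolicGCM_B₄ :
    IsHyperbolicGCM (lorentzianExtension (affineExtension (CartanMatrix.B 4)ᵀ ![2, 2, 2, 1] ![1, 2, 2, 2]) none) :=
  isHyperbolicGCM_of_vectors (d := extendedVec ![2, 2, 2, 2, 2, 1])
    (u := extendedVec ![8, 17, 13, 27, 25, 24])
    (U := fun k => extendedVec (extendedVec (n := 4) ![![0, 1, 1, 2, 2, 2], ![1, 0, 1, 1, 1, 1],
      ![1, 1, 0, 1, 1, 1], ![1, 1, 1, 0, 1, 1], ![1, 1, 1, 1, 0, 1], ![1, 2, 1, 2, 1, 0]] k))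
    (p := extendedVec ![none, none, some (some 1), some none, some (some 1), some (some 2)]) (r := none)
    (by decide +kernel) (by decide +kernel) (by decide +kernel)
    ⟨by decide +kernel, fun i => ⟨6, by revert i; decide +kernel⟩⟩
    (by decide +kernel) (by decide +kernel)

theorem isUntwistedTableLine_B₄
    (hD : ∃ D : IwasawaDatum L, D.HasType D.roots (CartanMatrix.B 4)ᵀ (finiteRoots (CartanMatrix.B 4)ᵀ)) :
    IsUntwistedTableLine L (CartanMatrix.B 4)ᵀ :=
  isUntwistedTableLine_of_inverse (d := ![2, 2, 2, 1]) (ϑ := ![1, 2, 2, 2])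
    (M := !![2, 2, 2, 1; 2, 4, 4, 2; 2, 4, 6, 3; 2, 4, 6, 4])
    (c := 2) (K := 4) (b := 1) (p := ![0, 0, 1, 2]) (r := 0) hD
    (by decide +kernel) (by decide +kernel) (by decide +kernel)
    ⟨by decide +kernel, fun i => ⟨4, by revert i; decide +kernel⟩⟩ (by decide +kernel)
    (by decide +kernel) (by decide +kernel) (by decide +kernel) 0 (by decide +kernel)
    (by decide +kernel) (by decide +kernel) isHyperbolicGCM_B₄

theorem isHyperbolicGCM_B₅ :
    IsHyperbolicGCM (lorentzianExtension (affineExtension (CartanMatrix.B 5)ᵀ ![2, 2, 2, 2, 1] ![1, 2, 2, 2, 2]) none) :=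
  isHyperbolicGCM_of_vectors (d := extendedVec ![2, 2, 2, 2, 2, 2, 1])
    (u := extendedVec ![10, 21, 16, 33, 30, 28, 27])
    (U := fun k => extendedVec (extendedVec (n := 5) ![![0, 1, 1, 2, 2, 2, 2], ![1, 0, 1, 1, 1, 1,
      1], ![1, 1, 0, 1, 1, 1, 1], ![1, 1, 1, 0, 1, 1, 1], ![1, 1, 1, 1, 0, 1, 1], ![1, 2, 1, 2, 1,
      0, 1], ![1, 2, 2, 3, 2, 1, 0]] k))
    (p := extendedVec ![none, none, some (some 1), some none, some (some 1), some (some 2), some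
      (some 3)]) (r := none)
    (by decide +kernel) (by decide +kernel) (by decide +kernel)
    ⟨by decide +kernel, fun i => ⟨7, by revert i; decide +kernel⟩⟩
    (by decide +kernel) (by decide +kernel)

theorem isUntwistedTableLine_B₅
    (hD : ∃ D : IwasawaDatum L, D.HasType D.roots (CartanMatrix.B 5)ᵀ (finiteRoots (CartanMatrix.B 5)ᵀ)) :
    IsUntwistedTableLine L (CartanMatrix.B 5)ᵀ :=
  isUntwistedTableLine_of_inverse (d := ![2, 2, 2, 2, 1]) (ϑ := ![1, 2, 2, 2, 2])
    (M := !![2, 2, 2, 2, 1; 2, 4, 4, 4, 2; 2, 4, 6, 6, 3; 2, 4, 6, 8, 4; 2, 4, 6, 8, 5])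
    (c := 2) (K := 4) (b := 1) (p := ![0, 0, 1, 2, 3]) (r := 0) hD
    (by decide +kernel) (by decide +kernel) (by decide +kernel)
    ⟨by decide +kernel, fun i => ⟨5, by revert i; decide +kernel⟩⟩ (by decide +kernel)
    (by decide +kernel) (by decide +kernel) (by decide +kernel) 0 (by decide +kernel)
    (by decide +kernel) (by decide +kernel) isHyperbolicGCM_B₅

theorem isHyperbolicGCM_B₆ :
    IsHyperbolicGCM (lorentzianExtension (affineExtension (CartanMatrix.B 6)ᵀ ![2, 2, 2, 2, 2, 1] ![1, 2, 2, 2, 2, 2]) none) :=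
  isHyperbolicGCM_of_vectors (d := extendedVec ![2, 2, 2, 2, 2, 2, 2, 1])
    (u := extendedVec ![12, 25, 19, 39, 35, 32, 30, 29])
    (U := fun k => extendedVec (extendedVec (n := 6) ![![0, 1, 1, 2, 2, 2, 2, 2], ![1, 0, 1, 1, 1,
      1, 1, 1], ![1, 1, 0, 1, 1, 1, 1, 1], ![1, 1, 1, 0, 1, 1, 1, 1], ![1, 1, 1, 1, 0, 1, 1, 1],
      ![1, 2, 1, 2, 1, 0, 1, 1], ![1, 2, 2, 3, 2, 1, 0, 1], ![2, 3, 2, 4, 3, 2, 1, 0]] k))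
    (p := extendedVec ![none, none, some (some 1), some none, some (some 1), some (some 2), some
      (some 3), some (some 4)]) (r := none)
    (by decide +kernel) (by decide +kernel) (by decide +kernel)
    ⟨by decide +kernel, fun i => ⟨8, by revert i; decide +kernel⟩⟩
    (by decide +kernel) (by decide +kernel)

theorem isUntwistedTableLine_B₆
    (hD : ∃ D : IwasawaDatum L, D.HasType D.roots (CartanMatrix.B 6)ᵀ (finiteRoots (CartanMatrix.B 6)ᵀ)) :
    IsUntwistedTableLine L (CartanMatrix.B 6)ᵀ :=
  isUntwistedTableLine_of_inverse (d := ![2, 2, 2, 2, 2, 1]) (ϑ := ![1, 2, 2, 2, 2, 2])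
    (M := !![2, 2, 2, 2, 2, 1; 2, 4, 4, 4, 4, 2; 2, 4, 6, 6, 6, 3; 2, 4, 6, 8, 8, 4; 2, 4, 6, 8,
      10, 5; 2, 4, 6, 8, 10, 6])
    (c := 2) (K := 4) (b := 1) (p := ![0, 0, 1, 2, 3, 4]) (r := 0) hD
    (by decide +kernel) (by decide +kernel) (by decide +kernel)
    ⟨by decide +kernel, fun i => ⟨6, by revert i; decide +kernel⟩⟩ (by decide +kernel)
    (by decide +kernel) (by decide +kernel) (by decide +kernel) 0 (by decide +kernel)
    (by decide +kernel) (by decide +kernel) isHyperbolicGCM_B₆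

theorem isHyperbolicGCM_B₇ :
    IsHyperbolicGCM (lorentzianExtension (affineExtension (CartanMatrix.B 7)ᵀ ![2, 2, 2, 2, 2, 2, 1] ![1, 2, 2, 2, 2, 2, 2]) none) :=
  isHyperbolicGCM_of_vectors (d := extendedVec ![2, 2, 2, 2, 2, 2, 2, 2, 1])
    (u := extendedVec ![14, 29, 22, 45, 40, 36, 33, 31, 30])
    (U := fun k => extendedVec (extendedVec (n := 7) ![![0, 1, 1, 2, 2, 2, 2, 2, 2], ![1, 0, 1, 1,
      1, 1, 1, 1, 1], ![1, 1, 0, 1, 1, 1, 1, 1, 1], ![1, 1, 1, 0, 1, 1, 1, 1, 1], ![1, 1, 1, 1, 0,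
      1, 1, 1, 1], ![1, 2, 1, 2, 1, 0, 1, 1, 1], ![1, 2, 2, 3, 2, 1, 0, 1, 1], ![2, 3, 2, 4, 3, 2,
      1, 0, 1], ![2, 4, 3, 6, 5, 4, 3, 2, 0]] k))
    (p := extendedVec ![none, none, some (some 1), some none, some (some 1), some (some 2), some
      (some 3), some (some 4), some (some 5)]) (r := none)
    (by decide +kernel) (by decide +kernel) (by decide +kernel)
    ⟨by decide +kernel, fun i => ⟨9, by revert i; decide +kernel⟩⟩
    (by decide +kernel) (by decide +kernel)

theorem isUntwistedTableLine_B₇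
    (hD : ∃ D : IwasawaDatum L, D.HasType D.roots (CartanMatrix.B 7)ᵀ (finiteRoots (CartanMatrix.B 7)ᵀ)) :
    IsUntwistedTableLine L (CartanMatrix.B 7)ᵀ :=
  isUntwistedTableLine_of_inverse (d := ![2, 2, 2, 2, 2, 2, 1]) (ϑ := ![1, 2, 2, 2, 2, 2, 2])
    (M := !![2, 2, 2, 2, 2, 2, 1; 2, 4, 4, 4, 4, 4, 2; 2, 4, 6, 6, 6, 6, 3; 2, 4, 6, 8, 8, 8, 4;
      2, 4, 6, 8, 10, 10, 5; 2, 4, 6, 8, 10, 12, 6; 2, 4, 6, 8, 10, 12, 7])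
    (c := 2) (K := 4) (b := 1) (p := ![0, 0, 1, 2, 3, 4, 5]) (r := 0) hD
    (by decide +kernel) (by decide +kernel) (by decide +kernel)
    ⟨by decide +kernel, fun i => ⟨7, by revert i; decide +kernel⟩⟩ (by decide +kernel)
    (by decide +kernel) (by decide +kernel) (by decide +kernel) 0 (by decide +kernel)
    (by decide +kernel) (by decide +kernel) isHyperbolicGCM_B₇

theorem isHyperbolicGCM_B₈ :
    IsHyperbolicGCM (lorentzianExtension (affineExtension (CartanMatrix.B 8)ᵀ ![2, 2, 2, 2, 2, 2, 2, 1] ![1, 2, 2, 2, 2, 2, 2, 2]) none) :=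
  isHyperbolicGCM_of_vectors (d := extendedVec ![2, 2, 2, 2, 2, 2, 2, 2, 2, 1])
    (u := extendedVec ![16, 33, 25, 51, 45, 40, 36, 33, 31, 30])
    (U := fun k => extendedVec (extendedVec (n := 8) ![![0, 1, 1, 2, 2, 2, 2, 2, 2, 2], ![1, 0, 1,
      1, 1, 1, 1, 1, 1, 1], ![1, 1, 0, 1, 1, 1, 1, 1, 1, 1], ![1, 1, 1, 0, 1, 1, 1, 1, 1, 1], ![1,
      1, 1, 1, 0, 1, 1, 1, 1, 1], ![1, 2, 1, 2, 1, 0, 1, 1, 1, 1], ![1, 2, 2, 3, 2, 1, 0, 1, 1,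
      1], ![2, 3, 2, 4, 3, 2, 1, 0, 1, 1], ![2, 4, 3, 6, 5, 4, 3, 2, 0, 1], ![2, 4, 3, 6, 5, 4, 3,
      2, 1, 0]] k))
    (p := extendedVec ![none, none, some (some 1), some none, some (some 1), some (some 2), some
      (some 3), some (some 4), some (some 5), some (some 6)]) (r := none)
    (by decide +kernel) (by decide +kernel) (by decide +kernel)
    ⟨by decide +kernel, fun i => ⟨10, by revert i; decide +kernel⟩⟩
    (by decide +kernel) (by decide +kernel)

theorem isUntwistedTableLine_B₈
    (hD : ∃ D : IwasawaDatum L, D.HasType D.roots (CartanMatrix.B 8)ᵀ (finiteRoots (CartanMatrix.B 8)ᵀ)) :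
    IsUntwistedTableLine L (CartanMatrix.B 8)ᵀ :=
  isUntwistedTableLine_of_inverse (d := ![2, 2, 2, 2, 2, 2, 2, 1]) (ϑ := ![1, 2, 2, 2, 2, 2, 2, 2])
    (M := !![2, 2, 2, 2, 2, 2, 2, 1; 2, 4, 4, 4, 4, 4, 4, 2; 2, 4, 6, 6, 6, 6, 6, 3; 2, 4, 6, 8,
      8, 8, 8, 4; 2, 4, 6, 8, 10, 10, 10, 5; 2, 4, 6, 8, 10, 12, 12, 6; 2, 4, 6, 8, 10, 12, 14, 7;
      2, 4, 6, 8, 10, 12, 14, 8])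
    (c := 2) (K := 4) (b := 1) (p := ![0, 0, 1, 2, 3, 4, 5, 6]) (r := 0) hD
    (by decide +kernel) (by decide +kernel) (by decide +kernel)
    ⟨by decide +kernel, fun i => ⟨8, by revert i; decide +kernel⟩⟩ (by decide +kernel)
    (by decide +kernel) (by decide +kernel) (by decide +kernel) 0 (by decide +kernel)
    (by decide +kernel) (by decide +kernel) isHyperbolicGCM_B₈

theorem isUntwistedTableLine_B {n : ℕ} (h2 : 2 ≤ n) (h8 : n ≤ 8)
    (hD : ∃ D : IwasawaDatum L, D.HasType D.roots (CartanMatrix.B n)ᵀ (finiteRoots (CartanMatrix.B n)ᵀ)) :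
    IsUntwistedTableLine L (CartanMatrix.B n)ᵀ := by
  interval_cases n
  · exact isUntwistedTableLine_B₂ hD
  · exact isUntwistedTableLine_B₃ hD
  · exact isUntwistedTableLine_B₄ hD
  · exact isUntwistedTableLine_B₅ hD
  · exact isUntwistedTableLine_B₆ hD
  · exact isUntwistedTableLine_B₇ hD
  · exact isUntwistedTableLine_B₈ hD
/-- The identification of the vertices of the twisted diagram with the dominant walls. -/
def twistedEquiv₁ : Option (Fin 2) ≃ Option (Option (Fin 1)) where
  toFun x := x.elim none ![some (some 0), some none]
  invFun := extendedVec ![none, some 1, some 0]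
  left_inv := by unfold Function.LeftInverse; decide
  right_inv := by unfold Function.RightInverse Function.LeftInverse; decide

theorem isHyperbolicGCM_twistedA2Ext : IsHyperbolicGCM twistedA2Ext :=
  isHyperbolicGCM_of_vectors (d := extendedVec ![4, 4, 1] ∘ twistedEquiv₁)
    (u := extendedVec ![2, 5, 9] ∘ twistedEquiv₁)
    (U := fun k => extendedVec (extendedVec (n := 1) ![![0, 1, 2], ![1, 0, 1], ![1, 1, 0]]
      (twistedEquiv₁ k)) ∘ twistedEquiv₁)
    (p := twistedEquiv₁.symm ∘ extendedVec ![none, none, some none] ∘ twistedEquiv₁) (r := none)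
    (by decide +kernel) (by decide +kernel) (by decide +kernel)
    ⟨by decide +kernel, fun i => ⟨3, by revert i; decide +kernel⟩⟩
    (by decide +kernel) (by decide +kernel)

theorem isTableLine_BC₁
    (hD : ∃ D : IwasawaDatum L, D.HasType D.roots (CartanMatrix.B 1)ᵀ (bcRoots 1)) :
    IsTableLine L (CartanMatrix.B 1)ᵀ (bcRoots 1) (CartanMatrix.A 1)ᵀ twistedA2Ext :=
  isTableLine_of_inverse (d := ![1]) (ϑ := ![2]) (g := Pi.single 0 2)
    (M := !![1]) (c := 2) (K := 8) (b := 4) (p := ![0]) (r := 0) hD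
    (fun i => Or.inl ⟨i, rfl⟩)
    (by rintro v (⟨i, rfl⟩ | ⟨i, -, rfl⟩); exacts [⟨i, Or.inl rfl⟩, ⟨i, Or.inr rfl⟩])
    (by decide +kernel) (by decide +kernel) (by decide +kernel)
    ⟨by decide +kernel, fun i => ⟨1, by revert i; decide +kernel⟩⟩ (by decide +kernel)
    (by decide +kernel) (by decide +kernel)
    (by
      rintro v (⟨i, rfl⟩ | ⟨i, hi, rfl⟩)
      · revert i; decide +kernel
      · revert i; decide +kernel)
    (Or.inr ⟨0, rfl, rfl⟩) (by decide +kernel)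
    (by decide +kernel) (by decide +kernel) (Equiv.refl _) twistedEquiv₁ (by decide +kernel) (by decide +kernel)
    isHyperbolicGCM_twistedA2Ext

/-- The identification of the vertices of the twisted diagram with the dominant walls. -/
def twistedEquiv₂ : Option (Fin 3) ≃ Option (Option (Fin 2)) where
  toFun x := x.elim none ![some (some 1), some (some 0), some none]
  invFun := extendedVec ![none, some 2, some 1, some 0]
  left_inv := by unfold Function.LeftInverse; decide
  right_inv := by unfold Function.RightInverse Function.LeftInverse; decide

theorem isHyperbolicGCM_twistedA4Ext : IsHyperbolicGCM twistedA4Ext :=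
  isHyperbolicGCM_of_vectors (d := extendedVec ![4, 4, 2, 1] ∘ twistedEquiv₂)
    (u := extendedVec ![3, 7, 12, 11] ∘ twistedEquiv₂)
    (U := fun k => extendedVec (extendedVec (n := 2) ![![0, 1, 2, 2], ![1, 0, 1, 1], ![1, 1, 0,
      1], ![1, 1, 1, 0]] (twistedEquiv₂ k)) ∘ twistedEquiv₂)
    (p := twistedEquiv₂.symm ∘ extendedVec ![none, none, some none, some (some 0)] ∘
      twistedEquiv₂) (r := none)
    (by decide +kernel) (by decide +kernel) (by decide +kernel)
    ⟨by decide +kernel, fun i => ⟨4, by revert i; decide +kernel⟩⟩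
    (by decide +kernel) (by decide +kernel)

theorem isTableLine_BC₂
    (hD : ∃ D : IwasawaDatum L, D.HasType D.roots (CartanMatrix.B 2)ᵀ (bcRoots 2)) :
    IsTableLine L (CartanMatrix.B 2)ᵀ (bcRoots 2) (CartanMatrix.C 2)ᵀ twistedA4Ext :=
  isTableLine_of_inverse (d := ![2, 1]) (ϑ := ![2, 2]) (g := Pi.single 1 2)
    (M := !![2, 1; 2, 2]) (c := 2) (K := 8) (b := 2) (p := ![0, 0]) (r := 0) hD
    (fun i => Or.inl ⟨i, rfl⟩)
    (by rintro v (⟨i, rfl⟩ | ⟨i, -, rfl⟩); exacts [⟨i, Or.inl rfl⟩, ⟨i, Or.inr rfl⟩])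
    (by decide +kernel) (by decide +kernel) (by decide +kernel)
    ⟨by decide +kernel, fun i => ⟨2, by revert i; decide +kernel⟩⟩ (by decide +kernel)
    (by decide +kernel) (by decide +kernel)
    (by
      rintro v (⟨i, rfl⟩ | ⟨i, hi, rfl⟩)
      · revert i; decide +kernel
      · revert i; decide +kernel)
    (Or.inr ⟨1, rfl, rfl⟩) (by decide +kernel)
    (by decide +kernel) (by decide +kernel) (Equiv.swap 0 1) twistedEquiv₂ (by decide +kernel) (by decide +kernel)
    isHyperbolicGCM_twistedA4Ext

theorem hasType_C₂ {D : IwasawaDatum L}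
    (hD : D.HasType D.roots (CartanMatrix.B 2)ᵀ (finiteRoots (CartanMatrix.B 2)ᵀ)) :
    D.HasType D.roots (CartanMatrix.C 2)ᵀ (finiteRoots (CartanMatrix.C 2)ᵀ) := by
  have h1 : (CartanMatrix.C 2)ᵀ = (CartanMatrix.B 2)ᵀ.submatrix (Equiv.swap 0 1) (Equiv.swap 0 1) := by
    decide +kernel
  rw [h1, finiteRoots_submatrix]
  exact hD.submatrix _

end Types

/-! ### Matrix Lie algebras -/

section MatrixInvolution

variable {𝕜 : Type*} [RCLike 𝕜] {n : Type*} [Fintype n] [DecidableEq n]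

lemma neg_conjTranspose_lie (A B : Matrix n n 𝕜) : -⁅A, B⁆ᴴ = ⁅-Aᴴ, -Bᴴ⁆ := by
  rw [Ring.lie_def, Ring.lie_def, conjTranspose_sub, conjTranspose_mul, conjTranspose_mul]
  simp

/-- The involution `X ↦ -Xᴴ` of a Lie algebra of matrices. -/
def conjTransposeInvolution (𝔤 : LieSubalgebra ℝ (Matrix n n 𝕜)) (h : ∀ A ∈ 𝔤, -Aᴴ ∈ 𝔤) : 𝔤 ≃ₗ⁅ℝ⁆ 𝔤 where
  toFun A := ⟨-(A : Matrix n n 𝕜)ᴴ, h A A.2⟩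
  map_add' A B := Subtype.ext (by simp [add_comm])
  map_smul' c A := Subtype.ext (by simp)
  map_lie' {A B} := Subtype.ext (neg_conjTranspose_lie (A : Matrix n n 𝕜) B)
  invFun A := ⟨-(A : Matrix n n 𝕜)ᴴ, h A A.2⟩
  left_inv A := Subtype.ext (by simp)
  right_inv A := Subtype.ext (by simp)

variable {𝔤 : LieSubalgebra ℝ (Matrix n n 𝕜)} (h : ∀ A ∈ 𝔤, -Aᴴ ∈ 𝔤)

lemma coe_conjTransposeInvolution (A : 𝔤) :
    (conjTransposeInvolution 𝔤 h A : Matrix n n 𝕜) = -(A : Matrix n n 𝕜)ᴴ := rfl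

lemma mem_noncompactPart_conjTransposeInvolution {A : 𝔤} :
    A ∈ noncompactPart (conjTransposeInvolution 𝔤 h) ↔ (A : Matrix n n 𝕜)ᴴ = A := by
  constructor
  · intro hA
    have h1 := congrArg (Subtype.val : 𝔤 → Matrix n n 𝕜) hA
    exact neg_injective h1
  · intro hA
    exact Subtype.ext (congrArg Neg.neg hA)

theorem isCartanInvolution_conjTransposeInvolution (hc : ∀ A : 𝔤, (∀ B : 𝔤, ⁅A, B⁆ = 0) → A = 0) :
    IsCartanInvolution (conjTransposeInvolution 𝔤 h) := by
  let β : LinearMap.BilinForm ℝ 𝔤 := LinearMap.mk₂ ℝ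
    (fun A B => RCLike.re ((A : Matrix n n 𝕜) * (B : Matrix n n 𝕜)).trace)
    (fun A B C => by simp [add_mul]) (fun c A B => by simp [RCLike.smul_re])
    (fun A B C => by simp [mul_add]) (fun c A B => by simp [RCLike.smul_re])
  have hβ : ∀ A B : 𝔤, β A B = RCLike.re ((A : Matrix n n 𝕜) * (B : Matrix n n 𝕜)).trace :=
    fun _ _ => rfl
  refine isCartanInvolution_of_form _ (fun A => (conjTransposeInvolution 𝔤 h).left_inv A) β
    (fun A B => by rw [hβ, hβ, trace_mul_comm]) (fun A B C => ?_) (fun A B => ?_) (fun A hA => ?_) hc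
  · rw [hβ, hβ, ← map_neg]
    congr 1
    change ((⁅(A : Matrix n n 𝕜), (B : Matrix n n 𝕜)⁆) * (C : Matrix n n 𝕜)).trace =
      -((B : Matrix n n 𝕜) * ⁅(A : Matrix n n 𝕜), (C : Matrix n n 𝕜)⁆).trace
    rw [Ring.lie_def, Ring.lie_def, sub_mul, mul_sub, trace_sub, trace_sub, neg_sub,
      ← mul_assoc, ← mul_assoc, mul_assoc (A : Matrix n n 𝕜), trace_mul_comm (A : Matrix n n 𝕜)]
  · rw [hβ, hβ, coe_conjTransposeInvolution, coe_conjTransposeInvolution, neg_mul_neg,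
      ← conjTranspose_mul, trace_conjTranspose, RCLike.star_def, RCLike.conj_re, trace_mul_comm]
  · rw [hβ, coe_conjTransposeInvolution, mul_neg, trace_neg, map_neg, neg_neg]
    have h1 : RCLike.re ((A : Matrix n n 𝕜) * (A : Matrix n n 𝕜)ᴴ).trace =
        ∑ i, ∑ j, ‖(A : Matrix n n 𝕜) i j‖ ^ 2 := by
      simp only [trace, diag_apply, mul_apply, conjTranspose_apply, map_sum]
      refine Finset.sum_congr rfl fun i _ => Finset.sum_congr rfl fun j _ => ?_
      rw [RCLike.star_def, RCLike.mul_conj]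
      norm_cast
    rw [h1]
    have h2 : (A : Matrix n n 𝕜) ≠ 0 := fun h0 => hA (Subtype.ext h0)
    obtain ⟨i, j, hij⟩ : ∃ i j, (A : Matrix n n 𝕜) i j ≠ 0 := by
      by_contra! h0; exact h2 (Matrix.ext h0)
    refine Finset.sum_pos' (fun i _ => Finset.sum_nonneg fun j _ => by positivity)
      ⟨i, Finset.mem_univ _, Finset.sum_pos' (fun j _ => by positivity) ⟨j, Finset.mem_univ _, ?_⟩⟩
    exact pow_pos (norm_pos_iff.mpr hij) 2

end MatrixInvolution

/-! ### Rank one -/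

section RankOne

variable {L : Type*} [LieRing L] [LieAlgebra ℝ L] [FiniteDimensional ℝ L]

theorem exists_hasType_of_rank_one {θ : L ≃ₗ⁅ℝ⁆ L} (hθ : IsCartanInvolution θ) {h : L} (h0 : h ≠ 0)
    (hh : θ h = -h) (hmax : ∀ x, θ x = -x → ⁅h, x⁆ = 0 → ∃ c : ℝ, x = c • h) {T : Set ℤ} {s : ℝ}
    (hs : s ≠ 0) (hT0 : (0 : ℤ) ∉ T) (hT1 : (1 : ℤ) ∈ T) (hTneg : ∀ m ∈ T, -m ∈ T)
    (hT : ∀ (l : ℝ) (x : L), x ≠ 0 → l ≠ 0 → ⁅h, x⁆ = l • x → ∃ m ∈ T, l = s * m)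
    (hT' : ∀ m ∈ T, 0 < m → ∃ x : L, x ≠ 0 ∧ ⁅h, x⁆ = (s * m) • x) {X : Matrix (Fin 1) (Fin 1) ℤ}
    (hX : X 0 0 = 2) {G : Set (Fin 1 → ℤ)} (hGT : ∀ v ∈ G, v 0 ∈ T)
    (hG : ∀ m ∈ T, 0 < m → Pi.single 0 m ∈ G) :
    ∃ D : IwasawaDatum L, D.HasType D.roots X {v | WeylClosure X G v} := by
  have hT'' : ∀ m ∈ T, ∃ x : L, x ≠ 0 ∧ ⁅h, x⁆ = (s * m) • x := by
    intro m hm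
    rcases lt_trichotomy 0 m with h1 | rfl | h1
    · exact hT' m hm h1
    · exact absurd hm hT0
    · obtain ⟨x, hx0, hx⟩ := hT' (-m) (hTneg m hm) (by omega)
      refine ⟨θ x, fun h2 => hx0 (θ.injective (h2.trans (map_zero θ).symm)), ?_⟩
      have h2 := congrArg θ hx
      rw [LieEquiv.map_lie, hh, neg_lie, map_smul] at h2
      rw [neg_eq_iff_eq_neg.mp h2, ← neg_smul]
      push_cast
      rw [mul_neg, neg_neg]
  let 𝔞 : Submodule ℝ L := Submodule.span ℝ {h}
  have hmem : h ∈ 𝔞 := Submodule.mem_span_singleton_self h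
  have h𝔞 : Maximal (fun U : Submodule ℝ L =>
      U ≤ noncompactPart θ ∧ ∀ x ∈ U, ∀ y ∈ U, ⁅x, y⁆ = 0) 𝔞 := by
    refine ⟨⟨?_, ?_⟩, fun U hU hle x hx => ?_⟩
    · rw [Submodule.span_singleton_le_iff_mem]; exact hh
    · rintro x hx y hy
      obtain ⟨a, rfl⟩ := Submodule.mem_span_singleton.mp hx
      obtain ⟨b, rfl⟩ := Submodule.mem_span_singleton.mp hy
      rw [smul_lie, lie_smul, lie_self, smul_zero, smul_zero]
    · obtain ⟨c, rfl⟩ := hmax x (hU.1 hx) (hU.2 h (hle hmem) x hx)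
      exact Submodule.smul_mem _ _ hmem
  let f : 𝔞 ≃ₗ[ℝ] ℝ := (LinearEquiv.toSpanNonzeroSingleton ℝ L h h0).symm
  have hf : f ⟨h, hmem⟩ = 1 := LinearEquiv.symm_apply_eq _ |>.mpr (Subtype.ext (one_smul ℝ h).symm)
  let σ : Fin 1 → Dual ℝ 𝔞 := fun _ => s • (f : 𝔞 →ₗ[ℝ] ℝ)
  have hσ1 : ∀ c : ℝ, (c • (f : 𝔞 →ₗ[ℝ] ℝ)) ⟨h, hmem⟩ = c := fun c => by
    rw [LinearMap.smul_apply, LinearEquiv.coe_coe, hf, smul_eq_mul, mul_one]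
  have hspace : ∀ (l : Dual ℝ 𝔞) (x : L), x ∈ restrictedRootSpace 𝔞 l ↔ ⁅h, x⁆ = l ⟨h, hmem⟩ • x := by
    refine fun l x => ⟨fun hx => hx ⟨h, hmem⟩, fun hx => ?_⟩
    rintro ⟨y, hy⟩
    obtain ⟨c, rfl⟩ := Submodule.mem_span_singleton.mp hy
    have h1 : (⟨c • h, hy⟩ : 𝔞) = c • ⟨h, hmem⟩ := rfl
    rw [h1, map_smul, smul_assoc, ← hx]
    exact smul_lie c h x
  have hext : ∀ l m : Dual ℝ 𝔞, l ⟨h, hmem⟩ = m ⟨h, hmem⟩ → l = m := fun l m hlm => by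
    ext ⟨y, hy⟩
    obtain ⟨c, rfl⟩ := Submodule.mem_span_singleton.mp hy
    have h1 : (⟨c • h, hy⟩ : 𝔞) = c • ⟨h, hmem⟩ := rfl
    rw [h1, map_smul, map_smul, hlm]
  have hsum : ∀ c : Fin 1 → ℤ, (∑ i, c i • σ i) = (s * c 0) • (f : 𝔞 →ₗ[ℝ] ℝ) := fun c => by
    rw [Fin.sum_univ_one]
    refine hext _ _ ?_
    rw [hσ1, LinearMap.smul_apply, hσ1, zsmul_eq_mul, mul_comm]
  refine IwasawaDatum.exists_hasType hθ h𝔞 σ ?_ (S := {v | v 0 ∈ T}) ?_ ?_ (fun i => ?_) (fun i => ?_) ?_ hGT ?_ ?_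
  · refine (linearIndependent_unique_iff (v := σ)).mpr fun h1 => hs ?_
    rw [← hσ1 s]
    exact congrArg (fun l : Dual ℝ 𝔞 => l ⟨h, hmem⟩) h1
  · ext l
    constructor
    · rintro ⟨hl, hl'⟩
      obtain ⟨x, hx, hx0⟩ := Submodule.exists_mem_ne_zero_of_ne_bot hl'
      obtain ⟨m, hm, hlm⟩ := hT _ x hx0 (fun h1 => hl (hext _ _ h1)) ((hspace l x).mp hx)
      refine ⟨fun _ => m, hm, hext _ _ ?_⟩
      rw [hsum, hσ1, hlm]
    · rintro ⟨c, hc, rfl⟩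
      rw [hsum]
      obtain ⟨x, hx0, hx⟩ := hT'' _ hc
      refine ⟨fun h1 => ?_, fun h1 => hx0 ?_⟩
      · have := congrArg (fun l : Dual ℝ 𝔞 => l ⟨h, hmem⟩) h1
        rw [hσ1] at this
        rcases mul_eq_zero.mp (this : s * (c 0 : ℝ) = 0) with h2 | h2
        · exact hs h2
        · have h3 : c 0 ∈ T := hc
          rw [show c 0 = 0 by exact_mod_cast h2] at h3
          exact hT0 h3
      · rw [← Submodule.mem_bot ℝ, ← h1, hspace, hσ1, hx]
  · intro c _
    rcases le_total 0 (c 0) with h1 | h1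
    · exact Or.inl fun i => by rwa [Subsingleton.elim i 0]
    · exact Or.inr fun i => by rwa [Subsingleton.elim i 0]
  · rw [Subsingleton.elim i 0]; simpa using hT1
  · rw [Subsingleton.elim i 0, hX]
  · intro c hc i
    rw [Subsingleton.elim i 0]
    have : (c - Pi.single 0 (∑ j, X 0 j * c j) : Fin 1 → ℤ) 0 = -c 0 := by
      simp [hX]; ring
    change _ ∈ T
    rw [this]; exact hTneg _ hc
  · intro i m hm h1
    rw [Subsingleton.elim i 0] at h1 ⊢
    exact hG m (by simpa using h1) hm
  · intro v _
    exact ⟨0, v 0, funext fun i => by rw [Subsingleton.elim i 0]; simp⟩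

end RankOne

/-! ### The Lie algebra `sl(2, ℝ)` -/

section SL2

lemma lie_sl2_apply (A B : U3_N1) : ((⁅A, B⁆ : U3_N1) : Matrix (Fin 2) (Fin 2) ℝ) =
    (A : Matrix (Fin 2) (Fin 2) ℝ) * B - (B : Matrix (Fin 2) (Fin 2) ℝ) * A := rfl

lemma exists_hasType_sl2 : ∃ D : IwasawaDatum U3_N1,
    D.HasType D.roots (CartanMatrix.A 1)ᵀ (finiteRoots (CartanMatrix.A 1)ᵀ) := by
  have htr : ∀ A : U3_N1, (A : Matrix (Fin 2) (Fin 2) ℝ) 1 1 = -(A : Matrix (Fin 2) (Fin 2) ℝ) 0 0 :=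
    fun A => by
      have h1 : (A : Matrix (Fin 2) (Fin 2) ℝ).trace = 0 := A.2
      rw [trace_fin_two] at h1; linarith
  have hmem : ∀ A ∈ U3_N1, -Aᴴ ∈ U3_N1 := fun A hA => by
    have : A.trace = 0 := hA
    change (-Aᴴ).trace = 0
    rw [trace_neg, trace_conjTranspose, this]; simp
  let h : U3_N1 := ⟨!![1, 0; 0, -1],
    show Matrix.trace (!![1, 0; 0, -1] : Matrix (Fin 2) (Fin 2) ℝ) = 0 by simp [trace_fin_two]⟩
  let e : U3_N1 := ⟨!![0, 1; 0, 0],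
    show Matrix.trace (!![0, 1; 0, 0] : Matrix (Fin 2) (Fin 2) ℝ) = 0 by simp [trace_fin_two]⟩
  have hh : ∀ A : U3_N1, ((⁅h, A⁆ : U3_N1) : Matrix (Fin 2) (Fin 2) ℝ) =
      !![0, 2 * (A : Matrix (Fin 2) (Fin 2) ℝ) 0 1; -2 * (A : Matrix (Fin 2) (Fin 2) ℝ) 1 0, 0] := by
    intro A
    rw [lie_sl2_apply]
    ext i j
    fin_cases i <;> fin_cases j <;> simp [h, mul_apply, vecMul, dotProduct,
      Fin.sum_univ_two, htr] <;> ring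
  have hee : ∀ A : U3_N1, ((⁅A, e⁆ : U3_N1) : Matrix (Fin 2) (Fin 2) ℝ) 0 1 =
      2 * (A : Matrix (Fin 2) (Fin 2) ℝ) 0 0 := by
    intro A
    rw [lie_sl2_apply]
    simp [e, mul_apply, vecMul, dotProduct, Fin.sum_univ_two, htr]; ring
  have hext : ∀ A : U3_N1, (A : Matrix (Fin 2) (Fin 2) ℝ) 0 0 = 0 →
      (A : Matrix (Fin 2) (Fin 2) ℝ) 0 1 = 0 → (A : Matrix (Fin 2) (Fin 2) ℝ) 1 0 = 0 → A = 0 := by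
    intro A h1 h2 h3
    refine Subtype.ext (Matrix.ext fun i j => ?_)
    have := htr A
    fin_cases i <;> fin_cases j <;> simp [h1, h2, h3, this]
  have hθ : IsCartanInvolution (conjTransposeInvolution (𝕜 := ℝ) U3_N1 hmem) := by
    refine isCartanInvolution_conjTransposeInvolution hmem fun A hA => ?_
    have h1 := hh A
    rw [← lie_skew, hA] at h1
    have h2 := congrFun (congrFun h1 0) 1
    have h3 := congrFun (congrFun h1 1) 0
    have h4 := hee A
    rw [hA] at h4
    simp at h2 h3 h4
    exact hext A h4 h2 h3
  refine exists_hasType_of_rank_one hθ (h := h) (fun h0 => ?_) ?_ (fun A hA hA' => ?_)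
    (T := {1, -1}) (s := 2) two_ne_zero (by simp) (by simp) (by simp) (fun l A hA hl hA' => ?_)
    (fun m hm hm0 => ?_) (by decide) (by rintro _ ⟨i, rfl⟩; rw [Subsingleton.elim i 0]; simp) ?_
  · have := congrFun (congrFun (congrArg Subtype.val h0) 0) 0
    simp [h] at this
  · refine Subtype.ext ?_
    rw [coe_conjTransposeInvolution]
    ext i j
    fin_cases i <;> fin_cases j <;> simp [h]
  · refine ⟨(A : Matrix (Fin 2) (Fin 2) ℝ) 0 0, ?_⟩
    have h1 := hh A
    rw [hA'] at h1
    have h2 := congrFun (congrFun h1 0) 1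
    have h3 := congrFun (congrFun h1 1) 0
    simp at h2 h3
    refine sub_eq_zero.mp (hext _ ?_ ?_ ?_) <;> simp [h, h2, h3]
  · have h1 := hh A
    rw [hA'] at h1
    have h2 := congrFun (congrFun h1 0) 1
    have h3 := congrFun (congrFun h1 1) 0
    have h4 := congrFun (congrFun h1 0) 0
    simp at h2 h3 h4
    have h5 := h4.resolve_left hl
    by_cases h6 : (A : Matrix (Fin 2) (Fin 2) ℝ) 0 1 = 0
    · have h7 : (A : Matrix (Fin 2) (Fin 2) ℝ) 1 0 ≠ 0 := fun h7 => hA (hext A h5 h6 h7)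
      refine ⟨-1, by simp, ?_⟩
      refine mul_right_cancel₀ h7 ?_
      push_cast; linarith
    · exact ⟨1, by simp, by rw [h2.resolve_right h6]; norm_num⟩
  · rcases hm with rfl | hm
    · refine ⟨e, fun h0 => ?_, Subtype.ext ?_⟩
      · have := congrFun (congrFun (congrArg Subtype.val h0) 0) 1
        simp [e] at this
      · rw [hh]
        ext i j
        fin_cases i <;> fin_cases j <;> simp [e]
    · rw [Set.mem_singleton_iff.mp hm] at hm0; omega
  · rintro m (rfl | hm) hm0
    · exact ⟨0, rfl⟩
    · rw [Set.mem_singleton_iff.mp hm] at hm0; omega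

end SL2

/-! ### Matrices that are skew with respect to an indefinite form -/

section SkewMatrices

variable {𝕜 : Type*} [RCLike 𝕜] {n : Type*} [Fintype n] [DecidableEq n]

/-- `A` is skew-Hermitian with respect to the diagonal form with entries `s`. -/
def IsFormSkew (s : n → ℤ) (A : Matrix n n 𝕜) : Prop :=
  ∀ i j, star (A j i) * (s j : 𝕜) = -((s i : 𝕜) * A i j)

/-- The elementary matrices that are skew-Hermitian with respect to the diagonal form with entries
`s`. -/
def skewUnit (s : n → ℤ) (c : 𝕜) (a b : n) : Matrix n n 𝕜 :=
  of fun i j => (if i = a ∧ j = b then c * (s b : 𝕜) else 0) -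
    if i = b ∧ j = a then star c * (s a : 𝕜) else 0

lemma isFormSkew_skewUnit (s : n → ℤ) (c : 𝕜) (a b : n) : IsFormSkew s (skewUnit s c a b) := by
  intro i j
  simp only [skewUnit, of_apply, and_comm (a := j = a), and_comm (a := j = b)]
  by_cases h1 : i = b ∧ j = a <;> by_cases h2 : i = a ∧ j = b
  · obtain rfl : a = b := h2.1.symm.trans h1.1
    rw [if_pos h1, if_pos h1, h1.1, h1.2]
    simp; ring
  · rw [if_pos h1, if_neg h2, if_pos h1, if_neg h2, h1.1, h1.2]
    simp; ring
  · rw [if_pos h2, if_neg h1, if_pos h2, if_neg h1, h2.1, h2.2]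
    simp; ring
  · simp [h1, h2]

lemma IsFormSkew.neg_conjTranspose {s : n → ℤ} (hs : ∀ i, s i = 1 ∨ s i = -1) {A : Matrix n n 𝕜}
    (hA : IsFormSkew s A) : IsFormSkew s (-Aᴴ) := by
  have hs2 : ∀ i, (s i : 𝕜) * s i = 1 := fun i => by rcases hs i with h | h <;> simp [h]
  intro i j
  have := hA i j
  change star (-star (A i j)) * _ = -(_ * -star (A j i))
  rw [star_neg, star_star]
  have h1 : A i j = -(s i * star (A j i) * s j) := by
    linear_combination (s i : 𝕜) * this + (-A i j) * hs2 i
  rw [h1]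
  linear_combination (s i * star (A j i)) * hs2 j

lemma mul_skewUnit_apply (s : n → ℤ) (A : Matrix n n 𝕜) (c : 𝕜) (a b i j : n) :
    (A * skewUnit s c a b) i j = (if j = b then A i a * (c * s b) else 0) -
      if j = a then A i b * (star c * s a) else 0 := by
  simp only [mul_apply, skewUnit, of_apply, mul_sub, Finset.sum_sub_distrib, ite_and, mul_ite, mul_zero,
    Finset.sum_ite_eq', Finset.mem_univ, if_true]

lemma skewUnit_mul_apply (s : n → ℤ) (A : Matrix n n 𝕜) (c : 𝕜) (a b i j : n) :
    (skewUnit s c a b * A) i j = (if i = a then c * s b * A b j else 0) -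
      if i = b then star c * s a * A a j else 0 := by
  simp only [mul_apply, skewUnit, of_apply, sub_mul, Finset.sum_sub_distrib, ite_and, ite_mul, zero_mul]
  congr 1
  · split_ifs <;> simp
  · split_ifs <;> simp

/-- A matrix commuting with all elementary skew-Hermitian matrices is scalar. -/
lemma exists_scalar_of_commute_skewUnit {s : n → ℤ} (hs : ∀ i, s i = 1 ∨ s i = -1)
    (h3 : ∀ a b : n, ∃ c, c ≠ a ∧ c ≠ b) {A : Matrix n n 𝕜}
    (hA : ∀ a b, a ≠ b → ⁅A, skewUnit s (1 : 𝕜) a b⁆ = 0) :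
    (∀ a b, a ≠ b → A a b = 0) ∧ ∀ a b, A a a = A b b := by
  have hs0 : ∀ i, (s i : 𝕜) ≠ 0 := fun i => by rcases hs i with h | h <;> simp [h]
  have key : ∀ a b, a ≠ b → ∀ i j, (A * skewUnit s (1 : 𝕜) a b) i j = (skewUnit s (1 : 𝕜) a b * A) i j :=
    fun a b hab i j => by
      have := hA a b hab
      rw [Ring.lie_def, sub_eq_zero] at this
      rw [this]
  have h1 : ∀ a b, a ≠ b → A a b = 0 := by
    intro a b hab
    obtain ⟨c, hca, hcb⟩ := h3 a b
    have := key b c hcb.symm a c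
    rw [mul_skewUnit_apply, skewUnit_mul_apply] at this
    simpa [hca, hca.symm, hab, hcb, hs0] using this
  refine ⟨h1, fun a b => ?_⟩
  by_cases hab : a = b
  · rw [hab]
  have := key a b hab a b
  rw [mul_skewUnit_apply, skewUnit_mul_apply] at this
  simp only [hab, Ne.symm hab, if_true, if_false, sub_zero, one_mul] at this
  exact mul_right_cancel₀ (hs0 b) (this.trans (mul_comm _ _))

/-- The signs of the standard form of signature `(p, q)`. -/
def signs (p q : ℕ) : Fin p ⊕ Fin q → ℤ := Sum.elim (fun _ => 1) (fun _ => -1)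

lemma signs_eq (p q : ℕ) (i) : signs p q i = 1 ∨ signs p q i = -1 := by
  rcases i with i | i <;> simp [signs]

lemma indefiniteDiagonal_eq (p q : ℕ) :
    LieAlgebra.Orthogonal.indefiniteDiagonal (Fin p) (Fin q) 𝕜 =
      diagonal fun i => (signs p q i : 𝕜) := by
  unfold LieAlgebra.Orthogonal.indefiniteDiagonal
  congr 1
  ext i
  rcases i with i | i <;> simp [signs]

lemma mem_su_iff {p q : ℕ} {A : Matrix (Fin p ⊕ Fin q) (Fin p ⊕ Fin q) ℂ} :
    A ∈ su p q ↔ IsFormSkew (signs p q) A ∧ A.trace = 0 := by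
  change Aᴴ * _ = -(_ * A) ∧ _ ↔ _
  rw [indefiniteDiagonal_eq, ← Matrix.ext_iff]
  simp [IsFormSkew, mul_diagonal, diagonal_mul]

lemma mem_soReal_iff {p q : ℕ} {A : Matrix (Fin p ⊕ Fin q) (Fin p ⊕ Fin q) ℝ} :
    A ∈ soReal p q ↔ IsFormSkew (signs p q) A := by
  have h : A ∈ soReal p q ↔ Aᵀ * LieAlgebra.Orthogonal.indefiniteDiagonal (Fin p) (Fin q) ℝ =
      LieAlgebra.Orthogonal.indefiniteDiagonal (Fin p) (Fin q) ℝ * -A :=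
    (mem_skewAdjointMatricesLieSubalgebra _ _).trans (mem_skewAdjointMatricesSubmodule _ _)
  rw [h, indefiniteDiagonal_eq, ← Matrix.ext_iff]
  simp [IsFormSkew, mul_diagonal, diagonal_mul]

end SkewMatrices

/-! ### The Lie algebras `su(p, 1)` -/

section SU

variable {n : Type*} [Fintype n] [DecidableEq n]

lemma lie_skewUnit_neg_one_apply {s : n → ℤ} {a b : n} (ha : s a = 1) (hb : s b = -1)
    (A : Matrix n n ℂ) (i j : n) :
    ⁅skewUnit s (-1 : ℂ) a b, A⁆ i j = (if i = a then A b j else 0) + (if i = b then A a j else 0) -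
      (if j = b then A i a else 0) - if j = a then A i b else 0 := by
  rw [Ring.lie_def, Matrix.sub_apply, mul_skewUnit_apply, skewUnit_mul_apply]
  simp only [ha, hb]
  split_ifs <;> simp <;> ring

lemma eigenvalue_lie_skewUnit {s : n → ℤ} {a b : n} (hab : a ≠ b) (ha : s a = 1) (hb : s b = -1)
    {A : Matrix n n ℂ} (hA : A ≠ 0) {l : ℝ} (hl : l ≠ 0) (h : ⁅skewUnit s (-1 : ℂ) a b, A⁆ = l • A) :
    ∃ m ∈ ({1, -1, 2, -2} : Set ℤ), l = 1 * m := by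
  by_contra! hcon
  have hl1 : (l : ℂ) ^ 2 - 1 ≠ 0 := by
    intro h0
    have h0 : l ^ 2 - 1 = 0 := by exact_mod_cast h0
    rcases mul_eq_zero.mp (show (l - 1) * (l + 1) = 0 by linarith) with h1 | h1
    · exact hcon 1 (by simp) (by push_cast; linarith)
    · exact hcon (-1) (by simp) (by push_cast; linarith)
  have hl2 : (l : ℂ) ^ 2 - 4 ≠ 0 := by
    intro h0
    have h0 : l ^ 2 - 4 = 0 := by exact_mod_cast h0
    rcases mul_eq_zero.mp (show (l - 2) * (l + 2) = 0 by linarith) with h1 | h1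
    · exact hcon 2 (by simp) (by push_cast; linarith)
    · exact hcon (-2) (by simp) (by push_cast; linarith)
  have hl0 : (l : ℂ) ≠ 0 := by exact_mod_cast hl
  have key : ∀ i j, (if i = a then A b j else 0) + (if i = b then A a j else 0) -
      (if j = b then A i a else 0) - (if j = a then A i b else 0) = l * A i j := fun i j => by
    rw [← lie_skewUnit_neg_one_apply ha hb, h]; simp
  have hba := hab.symm
  have h1 : ∀ i, i ≠ a → i ≠ b → A i a = 0 ∧ A i b = 0 := by
    intro i hia hib
    have e1 := key i a
    have e2 := key i b
    simp only [hia, hib, hab, hba, if_true, if_false] at e1 e2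
    constructor
    · refine (mul_eq_zero.mp (show ((l : ℂ) ^ 2 - 1) * A i a = 0 from ?_)).resolve_left hl1
      linear_combination (-(l : ℂ)) * e1 + e2
    · refine (mul_eq_zero.mp (show ((l : ℂ) ^ 2 - 1) * A i b = 0 from ?_)).resolve_left hl1
      linear_combination (-(l : ℂ)) * e2 + e1
  have h2 : ∀ i, i ≠ a → i ≠ b → A a i = 0 ∧ A b i = 0 := by
    intro i hia hib
    have e1 := key a i
    have e2 := key b i
    simp only [hia, hib, hab, hba, if_true, if_false] at e1 e2
    constructor
    · refine (mul_eq_zero.mp (show ((l : ℂ) ^ 2 - 1) * A a i = 0 from ?_)).resolve_left hl1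
      linear_combination (-(l : ℂ)) * e1 - e2
    · refine (mul_eq_zero.mp (show ((l : ℂ) ^ 2 - 1) * A b i = 0 from ?_)).resolve_left hl1
      linear_combination (-(l : ℂ)) * e2 - e1
  have e1 := key a a
  have e2 := key a b
  have e3 := key b a
  have e4 := key b b
  simp only [hab, hba, if_true, if_false] at e1 e2 e3 e4
  have f1 : A b b = -A a a := mul_left_cancel₀ hl0 (by linear_combination -e1 - e4)
  have f2 : A b a = -A a b := mul_left_cancel₀ hl0 (by linear_combination -e2 - e3)
  rw [f1] at e2
  rw [f2] at e1
  have g1 : A a a = 0 := by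
    refine (mul_eq_zero.mp (show ((l : ℂ) ^ 2 - 4) * A a a = 0 from ?_)).resolve_left hl2
    linear_combination (-(l : ℂ)) * e1 + 2 * e2
  have g2 : A a b = 0 := by
    refine (mul_eq_zero.mp (show ((l : ℂ) ^ 2 - 4) * A a b = 0 from ?_)).resolve_left hl2
    linear_combination (-(l : ℂ)) * e2 + 2 * e1
  rw [g1, neg_zero] at f1
  rw [g2, neg_zero] at f2
  refine hA (Matrix.ext fun i j => ?_)
  by_cases hia : i = a
  · subst hia
    by_cases hja : j = i
    · rw [hja]; exact g1
    by_cases hjb : j = b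
    · rw [hjb]; exact g2
    exact (h2 j hja hjb).1
  by_cases hib : i = b
  · subst hib
    by_cases hja : j = a
    · rw [hja]; exact f2
    by_cases hjb : j = i
    · rw [hjb]; exact f1
    exact (h2 j hja hjb).2
  by_cases hja : j = a
  · rw [hja]; exact (h1 i hia hib).1
  by_cases hjb : j = b
  · rw [hjb]; exact (h1 i hia hib).2
  have := key i j
  simp only [hia, hib, hja, hjb, if_false] at this
  exact (mul_eq_zero.mp (show (l : ℂ) * A i j = 0 by rw [← this]; ring)).resolve_left hl0

lemma trace_skewUnit {s : n → ℤ} {a b : n} (hab : a ≠ b) (c : ℂ) : (skewUnit s c a b).trace = 0 := by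
  refine Finset.sum_eq_zero fun i _ => ?_
  by_cases h : i = a
  · subst h; simp [skewUnit, hab]
  · simp [skewUnit, h]

theorem exists_hasType_su (p : ℕ) : ∃ D : IwasawaDatum (su (p + 2) 1),
    D.HasType D.roots (CartanMatrix.B 1)ᵀ (bcRoots 1) := by
  let N := Fin (p + 2) ⊕ Fin 1
  let s := signs (p + 2) 1
  have hs := signs_eq (p + 2) 1
  have hmem : ∀ A ∈ su (p + 2) 1, -Aᴴ ∈ su (p + 2) 1 := fun A hA => by
    rw [mem_su_iff] at hA ⊢
    exact ⟨hA.1.neg_conjTranspose hs, by rw [trace_neg, trace_conjTranspose, hA.2]; simp⟩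
  let a : N := Sum.inl 0
  let b : N := Sum.inr 0
  let d : N := Sum.inl 1
  have hab : a ≠ b := by simp [a, b]
  have had : a ≠ d := fun h => absurd (Sum.inl_injective h) (by simp)
  have hbd : b ≠ d := by simp [b, d]
  have ha : s a = 1 := rfl
  have hb : s b = -1 := rfl
  have hd : s d = 1 := rfl
  have hW : ∀ (c : ℂ) (x y : N), x ≠ y → skewUnit s c x y ∈ su (p + 2) 1 := fun c x y hxy =>
    mem_su_iff.mpr ⟨isFormSkew_skewUnit s c x y, trace_skewUnit hxy c⟩
  let h : su (p + 2) 1 := ⟨skewUnit s (-1) a b, hW _ _ _ hab⟩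
  have hlie : ∀ (A : su (p + 2) 1) (i j : N), ((⁅h, A⁆ : su (p + 2) 1) : Matrix N N ℂ) i j =
      (if i = a then (A : Matrix N N ℂ) b j else 0) + (if i = b then (A : Matrix N N ℂ) a j else 0) -
      (if j = b then (A : Matrix N N ℂ) i a else 0) -
      if j = a then (A : Matrix N N ℂ) i b else 0 :=
    fun A i j => lie_skewUnit_neg_one_apply ha hb (A : Matrix N N ℂ) i j
  have hh : (h : Matrix N N ℂ)ᴴ = h := by
    ext i j
    simp only [h, skewUnit, ha, hb, conjTranspose_apply, of_apply]
    by_cases h1 : i = a ∧ j = b <;> by_cases h2 : i = b ∧ j = a <;>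
      simp [h1, h2, hab, and_comm (a := j = a), and_comm (a := j = b)]
  have hθ : IsCartanInvolution (conjTransposeInvolution (𝕜 := ℂ) (su (p + 2) 1) hmem) := by
    refine isCartanInvolution_conjTransposeInvolution hmem fun A hA => ?_
    have hthird : ∀ x y : N, ∃ c, c ≠ x ∧ c ≠ y := fun x y => by
      by_contra! hcon
      by_cases h1 : a = x
      · have h2 := hcon b (fun h => hab (h1.trans h.symm))
        exact hbd (h2.trans (hcon d fun h => had (h1.trans h.symm)).symm)
      · have h2 := hcon a h1
        by_cases h3 : b = x
        · exact had (h2.trans (hcon d fun h => hbd (h3.trans h.symm)).symm)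
        · exact hab (h2.trans (hcon b h3).symm)
    obtain ⟨h1, h2⟩ := exists_scalar_of_commute_skewUnit (A := (A : Matrix N N ℂ)) hs
      hthird (fun x y hxy => congrArg Subtype.val (hA ⟨_, hW 1 x y hxy⟩))
    have h3 := (mem_su_iff.mp A.2).2
    have h4 : (A : Matrix N N ℂ).trace = Fintype.card N • (A : Matrix N N ℂ) a a :=
      (Finset.sum_congr rfl fun i _ => h2 i a).trans (Finset.sum_const _)
    rw [h3, eq_comm, nsmul_eq_mul, mul_eq_zero] at h4
    replace h4 := h4.resolve_left (Nat.cast_ne_zero.mpr Fintype.card_ne_zero)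
    refine Subtype.ext (Matrix.ext fun i j => ?_)
    by_cases hij : i = j
    · rw [hij, h2 j a]; exact h4
    · exact h1 i j hij
  refine exists_hasType_of_rank_one hθ (h := h) (fun h0 => ?_)
    ((mem_noncompactPart_conjTransposeInvolution hmem).mpr hh) (fun A hA hA' => ?_)
    (T := {1, -1, 2, -2}) (s := 1) one_ne_zero (by simp) (by simp) (by simp) (fun l A hA hl hA' => ?_)
    (fun m hm hm0 => ?_) (by decide) ?_ ?_
  · have := congrFun (congrFun (congrArg Subtype.val h0) a) b
    simp [h, skewUnit, hab, hb] at this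
  · have h1 : (A : Matrix N N ℂ)ᴴ = A := (mem_noncompactPart_conjTransposeInvolution hmem).mp hA
    have h2 : ∀ i j, star ((A : Matrix N N ℂ) j i) = (A : Matrix N N ℂ) i j := fun i j =>
      congrFun (congrFun h1 i) j
    have h3 : ∀ i j, s i = s j → (A : Matrix N N ℂ) i j = 0 := fun i j hij => by
      have h4 := (mem_su_iff.mp A.2).1 i j
      change _ * (s j : ℂ) = -((s i : ℂ) * _) at h4
      rw [h2, hij] at h4
      rcases hs j with h5 | h5 <;> rw [show s j = _ from h5] at h4 <;> push_cast at h4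
      · linear_combination (1 / 2) * h4
      · linear_combination (-1 / 2) * h4
    have hz : ∀ i j, ((⁅h, A⁆ : su (p + 2) 1) : Matrix N N ℂ) i j = 0 := fun i j => by rw [hA']; rfl
    have h4 : ∀ i, i ≠ a → i ≠ b → (A : Matrix N N ℂ) i b = 0 := fun i hia hib => by
      have h5 := hz i a
      rw [hlie] at h5
      simpa [hia, hib, hab] using h5
    have h5 : (A : Matrix N N ℂ) b a = (A : Matrix N N ℂ) a b := by
      have h6 := hz a a
      rw [hlie] at h6
      simp only [hab, if_true, if_false] at h6
      linear_combination h6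
    have h6 : (((A : Matrix N N ℂ) a b).re : ℂ) = (A : Matrix N N ℂ) a b := by
      rw [← Complex.conj_eq_iff_re, ← h5]
      exact (h2 a b).trans h5.symm
    have hsb : ∀ i j, i ≠ b → j ≠ b → s i = s j := by
      intro i j hi hj
      rcases i with i | i
      · rcases j with j | j
        · rfl
        · exact absurd (congrArg Sum.inr (Subsingleton.elim j 0)) hj
      · exact absurd (congrArg Sum.inr (Subsingleton.elim i 0)) hi
    refine ⟨((A : Matrix N N ℂ) a b).re, Subtype.ext (Matrix.ext fun i j => ?_)⟩
    change _ = ((((A : Matrix N N ℂ) a b).re : ℝ) • (h : Matrix N N ℂ)) i j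
    rw [Matrix.smul_apply, Complex.real_smul, h6]
    simp only [h, skewUnit, of_apply, ha, hb]
    by_cases hib : i = b
    · by_cases hjb : j = b
      · subst hib hjb
        simp [h3 _ _ rfl, hab.symm]
      · by_cases hja : j = a
        · subst hib hja
          simp [h5, hab.symm]
        · rw [hib, ← h2, h4 j hja hjb]
          simp [hja, hjb]
    · by_cases hjb : j = b
      · by_cases hia : i = a
        · subst hia hjb
          simp [hab]
        · rw [hjb, h4 i hia hib]
          simp [hia, hib]
      · rw [h3 i j (hsb i j hib hjb)]
        simp [hib, hjb]
  · refine eigenvalue_lie_skewUnit hab ha hb (fun h0 => hA (Subtype.ext h0)) hl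
      (congrArg Subtype.val hA')
  · have heig : ∀ (X : Matrix N N ℂ) (hX : X ∈ su (p + 2) 1) (c : ℝ), (∀ i j,
        (if i = a then X b j else 0) + (if i = b then X a j else 0) -
          (if j = b then X i a else 0) - (if j = a then X i b else 0) = c * X i j) →
        ⁅h, (⟨X, hX⟩ : su (p + 2) 1)⁆ = c • (⟨X, hX⟩ : su (p + 2) 1) := fun X hX c hc => by
      refine Subtype.ext (Matrix.ext fun i j => ?_)
      rw [hlie]
      exact (hc i j).trans (Complex.real_smul).symm
    rcases hm with rfl | rfl | rfl | hm
    · refine ⟨⟨skewUnit s 1 a d + skewUnit s 1 b d,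
        add_mem (hW _ _ _ had) (hW _ _ _ hbd)⟩, fun h0 => ?_, heig _ _ _ fun i j => ?_⟩
      · have := congrFun (congrFun (congrArg Subtype.val h0) a) d
        simp [skewUnit, had, hab, hd] at this
      · simp only [skewUnit, Matrix.add_apply, of_apply, ha, hb, hd]
        by_cases hia : i = a <;> by_cases hib : i = b <;> by_cases hja : j = a <;>
          by_cases hjb : j = b <;> simp [hia, hib, hja, hjb, hab, hab.symm, had, hbd] <;>
          split_ifs <;> simp
    · omega
    · refine ⟨⟨of fun i j => Complex.I * ((if i = a ∨ i = b then 1 else 0) *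
        ((if j = a then 1 else 0) - if j = b then 1 else 0)), ?_⟩, fun h0 => ?_,
        heig _ _ _ fun i j => ?_⟩
      · refine mem_su_iff.mpr ⟨fun i j => ?_, ?_⟩
        · change _ * (s j : ℂ) = -((s i : ℂ) * _)
          simp only [of_apply]
          by_cases hia : i = a <;> by_cases hib : i = b <;> by_cases hja : j = a <;>
            by_cases hjb : j = b <;> simp [hia, hib, hja, hjb, hab, hab.symm, ha, hb]
        · have h1 : ∀ i : N, Complex.I * ((if i = a ∨ i = b then 1 else 0) *
              ((if i = a then 1 else 0) - if i = b then 1 else 0)) =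
              (if i = a then Complex.I else 0) - if i = b then Complex.I else 0 := fun i => by
            by_cases hia : i = a <;> by_cases hib : i = b <;> simp [hia, hib, hab]
          refine (Finset.sum_congr rfl fun i _ => h1 i).trans ?_
          rw [Finset.sum_sub_distrib]
          simp
      · have := congrFun (congrFun (congrArg Subtype.val h0) a) a
        simp [hab] at this
      · simp only [of_apply]
        by_cases hia : i = a <;> by_cases hib : i = b <;> by_cases hja : j = a <;>
          by_cases hjb : j = b <;> simp [hia, hib, hja, hjb, hab, hab.symm] <;> ring
    · rw [Set.mem_singleton_iff.mp hm] at hm0; omega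
  · rintro v (⟨i, rfl⟩ | ⟨i, -, rfl⟩) <;> rw [Subsingleton.elim i 0] <;> simp
  · rintro m hm hm0
    rcases hm with rfl | rfl | rfl | hm
    · exact Or.inl ⟨0, rfl⟩
    · omega
    · exact Or.inr ⟨0, rfl, rfl⟩
    · rw [Set.mem_singleton_iff.mp hm] at hm0; omega

end SU

/-! ### The Lie algebras `so(p, q)` -/

section SO

/-- The pairing of the first `r` basis vectors of positive norm with the first `r` basis vectors of
negative norm. -/
def partner (p q r : ℕ) (hp : r ≤ p) (hq : r ≤ q) : Fin p ⊕ Fin q → Fin p ⊕ Fin q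
  | Sum.inl i => if h : (i : ℕ) < r then Sum.inr ⟨i, h.trans_le hq⟩ else Sum.inl i
  | Sum.inr i => if h : (i : ℕ) < r then Sum.inl ⟨i, h.trans_le hp⟩ else Sum.inr i

/-- The number of the pair to which a basis vector belongs. -/
def pairIndex (p q r : ℕ) : Fin p ⊕ Fin q → Option (Fin r)
  | Sum.inl i => if h : (i : ℕ) < r then some ⟨i, h⟩ else none
  | Sum.inr i => if h : (i : ℕ) < r then some ⟨i, h⟩ else none

/-- The weight of a basis vector. -/
def pairWeight {p q r : ℕ} (t : Fin r → ℝ) (x : Fin p ⊕ Fin q) : ℝ := (pairIndex p q r x).elim 0 t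

variable {p q r : ℕ} (hp : r ≤ p) (hq : r ≤ q)

lemma partner_partner (x) : partner p q r hp hq (partner p q r hp hq x) = x := by
  rcases x with i | i <;> by_cases h : (i : ℕ) < r <;> simp [partner, h]

lemma pairIndex_partner (x) : pairIndex p q r (partner p q r hp hq x) = pairIndex p q r x := by
  rcases x with i | i <;> by_cases h : (i : ℕ) < r <;> simp [partner, pairIndex, h]

lemma pairIndex_inl (i : Fin r) : pairIndex p q r (Sum.inl (Fin.castLE hp i)) = some i := by
  simp [pairIndex]

lemma partner_inl (i : Fin r) :
    partner p q r hp hq (Sum.inl (Fin.castLE hp i)) = Sum.inr (Fin.castLE hq i) := by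
  simp [partner, Fin.castLE]

lemma partner_inr (i : Fin r) :
    partner p q r hp hq (Sum.inr (Fin.castLE hq i)) = Sum.inl (Fin.castLE hp i) := by
  simp [partner, Fin.castLE]

lemma eq_of_pairIndex_eq_some {x : Fin p ⊕ Fin q} {i : Fin r} (h : pairIndex p q r x = some i) :
    x = Sum.inl (Fin.castLE hp i) ∨ x = Sum.inr (Fin.castLE hq i) := by
  rcases x with j | j <;> by_cases hj : (j : ℕ) < r <;> simp [pairIndex, hj] at h <;> subst h <;>
    simp [Fin.castLE]

lemma pairIndex_ne_none_of_eq {x : Fin p ⊕ Fin q} (h : pairIndex p q r x = none) :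
    ¬(r = p ∧ r = q) := by
  rintro ⟨rfl, rfl⟩
  rcases x with j | j <;> simp [pairIndex] at h

lemma signs_eq_of_pairIndex_eq_none (hr : r = p ∨ r = q) {x y : Fin p ⊕ Fin q}
    (hx : pairIndex p q r x = none) (hy : pairIndex p q r y = none) :
    signs p q x = signs p q y := by
  rcases hr with rfl | rfl <;> rcases x with x | x <;> rcases y with y | y <;>
    simp [pairIndex, signs] at hx hy ⊢

/-- The elements of the maximal abelian subspace. -/
def soDiagMatrix (t : Fin r → ℝ) : Matrix (Fin p ⊕ Fin q) (Fin p ⊕ Fin q) ℝ :=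
  of fun x y => if y = partner p q r hp hq x then pairWeight t x else 0

lemma pairWeight_partner (t : Fin r → ℝ) (x) :
    pairWeight t (partner p q r hp hq x) = pairWeight t x := by
  rw [pairWeight, pairIndex_partner, pairWeight]

lemma signs_partner {x} (h : pairIndex p q r x ≠ none) :
    signs p q (partner p q r hp hq x) = -signs p q x := by
  rcases x with j | j <;> by_cases hj : (j : ℕ) < r <;> simp [pairIndex, partner, hj, signs] at h ⊢

lemma partner_injective : Function.Injective (partner p q r hp hq) :=
  Function.Involutive.injective (partner_partner hp hq)

lemma eq_partner_iff (x y) : y = partner p q r hp hq x ↔ x = partner p q r hp hq y := by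
  constructor <;> rintro rfl <;> rw [partner_partner]

lemma soDiagMatrix_transpose (t : Fin r → ℝ) :
    (soDiagMatrix (p := p) (q := q) hp hq t)ᵀ = soDiagMatrix hp hq t := by
  ext x y
  simp only [transpose_apply, soDiagMatrix, of_apply, eq_partner_iff hp hq y x]
  split_ifs with h
  · rw [h, pairWeight_partner]
  · rfl

lemma isFormSkew_soDiagMatrix (t : Fin r → ℝ) :
    IsFormSkew (signs p q) (soDiagMatrix (p := p) (q := q) hp hq t) := by
  intro x y
  have h1 : soDiagMatrix hp hq t y x = soDiagMatrix (p := p) (q := q) hp hq t x y :=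
    congrFun (congrFun (soDiagMatrix_transpose hp hq t) x) y
  rw [h1, star_trivial]
  by_cases h : y = partner p q r hp hq x
  · by_cases hx : pairIndex p q r x = none
    · simp [soDiagMatrix, h, pairWeight, hx]
    · rw [h, signs_partner hp hq hx]
      push_cast; ring
  · simp [soDiagMatrix, h]

/-- The maximal abelian subspace of the noncompact part of `so(p, q)`. -/
def soDiag : (Fin r → ℝ) →ₗ[ℝ] soReal p q where
  toFun t := ⟨soDiagMatrix hp hq t, mem_soReal_iff.mpr (isFormSkew_soDiagMatrix hp hq t)⟩
  map_add' t u := by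
    refine Subtype.ext (Matrix.ext fun x y => ?_)
    change soDiagMatrix hp hq (t + u) x y = soDiagMatrix hp hq t x y + soDiagMatrix hp hq u x y
    simp only [soDiagMatrix, of_apply, pairWeight]
    split_ifs
    · cases pairIndex p q r x <;> simp
    · simp
  map_smul' c t := by
    refine Subtype.ext (Matrix.ext fun x y => ?_)
    change soDiagMatrix hp hq (c • t) x y = c * soDiagMatrix hp hq t x y
    simp only [soDiagMatrix, of_apply, pairWeight]
    split_ifs
    · cases pairIndex p q r x <;> simp
    · simp

lemma soDiag_injective : Function.Injective (soDiag (p := p) (q := q) hp hq) := fun t u h => by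
  ext i
  have h1 := congrFun (congrFun (congrArg Subtype.val h) (Sum.inl (Fin.castLE hp i)))
    (Sum.inr (Fin.castLE hq i))
  change soDiagMatrix hp hq t _ _ = soDiagMatrix hp hq u _ _ at h1
  simpa [soDiagMatrix, partner_inl, pairWeight, pairIndex_inl] using h1

lemma lie_soDiag_apply (t : Fin r → ℝ) (A : soReal p q) (x y) :
    ((⁅soDiag hp hq t, A⁆ : soReal p q) : Matrix (Fin p ⊕ Fin q) (Fin p ⊕ Fin q) ℝ) x y =
      pairWeight t x * (A : Matrix (Fin p ⊕ Fin q) (Fin p ⊕ Fin q) ℝ) (partner p q r hp hq x) y -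
      pairWeight t y * (A : Matrix (Fin p ⊕ Fin q) (Fin p ⊕ Fin q) ℝ) x (partner p q r hp hq y) := by
  change (⁅soDiagMatrix hp hq t, (A : Matrix (Fin p ⊕ Fin q) (Fin p ⊕ Fin q) ℝ)⁆) x y = _
  rw [Ring.lie_def, Matrix.sub_apply, mul_apply, mul_apply]
  congr 1
  · simp [soDiagMatrix]
  · simp [soDiagMatrix, eq_partner_iff hp hq _ y, pairWeight_partner, mul_comm]

lemma soReal_apply (A : soReal p q) (x y) :
    (A : Matrix (Fin p ⊕ Fin q) (Fin p ⊕ Fin q) ℝ) y x * signs p q y =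
      -(signs p q x * (A : Matrix (Fin p ⊕ Fin q) (Fin p ⊕ Fin q) ℝ) x y) :=
  mem_soReal_iff.mp A.2 x y

lemma soReal_apply_of_eq {A : soReal p q} {x y} (h : signs p q x = signs p q y) :
    (A : Matrix (Fin p ⊕ Fin q) (Fin p ⊕ Fin q) ℝ) y x =
      -(A : Matrix (Fin p ⊕ Fin q) (Fin p ⊕ Fin q) ℝ) x y := by
  have := soReal_apply A x y
  rw [h] at this
  rcases signs_eq p q y with h1 | h1 <;> rw [h1] at this <;> push_cast at this <;> linarith

lemma soReal_apply_of_eq_neg {A : soReal p q} {x y} (h : signs p q x = -signs p q y) :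
    (A : Matrix (Fin p ⊕ Fin q) (Fin p ⊕ Fin q) ℝ) y x =
      (A : Matrix (Fin p ⊕ Fin q) (Fin p ⊕ Fin q) ℝ) x y := by
  have := soReal_apply A x y
  rw [h] at this
  rcases signs_eq p q y with h1 | h1 <;> rw [h1] at this <;> push_cast at this <;> linarith

lemma isCartanInvolution_soReal (h3 : 3 ≤ p + q) (hmem : ∀ A ∈ soReal p q, -Aᴴ ∈ soReal p q) :
    IsCartanInvolution (conjTransposeInvolution (𝕜 := ℝ) (soReal p q) hmem) := by
  refine isCartanInvolution_conjTransposeInvolution hmem fun A hA => ?_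
  have hthird : ∀ x y : Fin p ⊕ Fin q, ∃ c, c ≠ x ∧ c ≠ y := fun x y => by
    have h1 : ({x, y} : Finset (Fin p ⊕ Fin q)).card < Fintype.card (Fin p ⊕ Fin q) := by
      refine (Finset.card_le_two).trans_lt ?_
      simpa using Nat.lt_of_succ_le h3
    obtain ⟨c, -, hc⟩ := Finset.exists_mem_notMem_of_card_lt_card
      (s := {x, y}) (t := Finset.univ) (by simpa using h1)
    exact ⟨c, by simpa using hc⟩
  obtain ⟨h1, -⟩ := exists_scalar_of_commute_skewUnit (𝕜 := ℝ)
    (A := (A : Matrix (Fin p ⊕ Fin q) (Fin p ⊕ Fin q) ℝ)) (signs_eq p q)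
    hthird (fun x y _ => congrArg Subtype.val
      (hA ⟨_, mem_soReal_iff.mpr (isFormSkew_skewUnit (signs p q) 1 x y)⟩))
  refine Subtype.ext (Matrix.ext fun i j => ?_)
  by_cases hij : i = j
  · subst hij
    have := soReal_apply_of_eq (A := A) (x := i) (y := i) rfl
    change (A : Matrix (Fin p ⊕ Fin q) (Fin p ⊕ Fin q) ℝ) i i = 0
    linarith
  · exact h1 i j hij

lemma soReal_neg_conjTranspose_mem : ∀ A ∈ soReal p q, -Aᴴ ∈ soReal p q := fun _ hA =>
  mem_soReal_iff.mpr ((mem_soReal_iff.mp hA).neg_conjTranspose (signs_eq p q))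

lemma maximal_range_soDiag (hr : r = p ∨ r = q) :
    Maximal (fun U : Submodule ℝ (soReal p q) =>
      U ≤ noncompactPart (conjTransposeInvolution (𝕜 := ℝ) (soReal p q) soReal_neg_conjTranspose_mem) ∧
        ∀ x ∈ U, ∀ y ∈ U, ⁅x, y⁆ = 0) (LinearMap.range (soDiag (p := p) (q := q) hp hq)) := by
  refine ⟨⟨?_, ?_⟩, fun U hU hle A hA => ?_⟩
  · rintro _ ⟨t, rfl⟩
    rw [mem_noncompactPart_conjTransposeInvolution, conjTranspose_eq_transpose_of_trivial]
    exact soDiagMatrix_transpose hp hq t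
  · rintro _ ⟨t, rfl⟩ _ ⟨u, rfl⟩
    refine Subtype.ext (Matrix.ext fun x y => ?_)
    rw [lie_soDiag_apply]
    change _ * soDiagMatrix hp hq u _ _ - _ * soDiagMatrix hp hq u _ _ = 0
    simp only [soDiagMatrix, of_apply, partner_partner, pairWeight_partner]
    by_cases h : x = y
    · subst h; simp
    · simp [Ne.symm h, (partner_injective hp hq).eq_iff]
  · have h1 : (A : Matrix (Fin p ⊕ Fin q) (Fin p ⊕ Fin q) ℝ)ᵀ = A := by
      have := (mem_noncompactPart_conjTransposeInvolution _).mp (hU.1 hA)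
      rwa [conjTranspose_eq_transpose_of_trivial] at this
    have h2 : ∀ x y, (A : Matrix (Fin p ⊕ Fin q) (Fin p ⊕ Fin q) ℝ) y x =
        (A : Matrix (Fin p ⊕ Fin q) (Fin p ⊕ Fin q) ℝ) x y := fun x y =>
      congrFun (congrFun h1 x) y
    have h3 : ∀ x y, signs p q x = signs p q y →
        (A : Matrix (Fin p ⊕ Fin q) (Fin p ⊕ Fin q) ℝ) x y = 0 := fun x y hxy => by
      have h4 := soReal_apply_of_eq (A := A) hxy
      rw [h2] at h4; linarith
    have h4 : ∀ i x y, pairIndex p q r x = some i → pairIndex p q r y ≠ some i →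
        (A : Matrix (Fin p ⊕ Fin q) (Fin p ⊕ Fin q) ℝ) x y = 0 := fun i x y hx hy => by
      have h5 : ⁅soDiag hp hq (Pi.single i 1), A⁆ = 0 := hU.2 _ (hle ⟨_, rfl⟩) A hA
      have h6 := lie_soDiag_apply hp hq (Pi.single i 1) A (partner p q r hp hq x) y
      rw [h5, partner_partner, pairWeight_partner] at h6
      have h7 : pairWeight (Pi.single i (1 : ℝ)) x = 1 := by simp [pairWeight, hx]
      have h8 : pairWeight (Pi.single i (1 : ℝ)) y = 0 := by
        rw [pairWeight]
        cases hy' : pairIndex p q r y with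
        | none => rfl
        | some j => exact Pi.single_eq_of_ne (fun h => hy (by rw [hy', h])) _
      rw [h7, h8, one_mul, zero_mul, sub_zero] at h6
      exact h6.symm
    refine ⟨fun i => (A : Matrix (Fin p ⊕ Fin q) (Fin p ⊕ Fin q) ℝ) (Sum.inl (Fin.castLE hp i))
      (Sum.inr (Fin.castLE hq i)), Subtype.ext (Matrix.ext fun x y => ?_)⟩
    change soDiagMatrix hp hq _ x y = _
    simp only [soDiagMatrix, of_apply]
    cases hx : pairIndex p q r x with
    | none =>
      have h5 : ∀ t : Fin r → ℝ, pairWeight t x = 0 := fun t => by rw [pairWeight, hx]; rfl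
      rw [h5, ite_self]
      cases hy : pairIndex p q r y with
      | none => exact (h3 x y (signs_eq_of_pairIndex_eq_none hr hx hy)).symm
      | some j => rw [h2, h4 j y x hy (by rw [hx]; simp)]
    | some i =>
      by_cases hy : pairIndex p q r y = some i
      · have h5 : ∀ t : Fin r → ℝ, pairWeight t x = t i := fun t => by rw [pairWeight, hx]; rfl
        rw [h5]
        rcases eq_of_pairIndex_eq_some hp hq hx with rfl | rfl <;>
          rcases eq_of_pairIndex_eq_some hp hq hy with rfl | rfl
        · rw [partner_inl, if_neg (by simp), h3 _ _ rfl]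
        · rw [partner_inl, if_pos rfl]
        · rw [partner_inr, if_pos rfl, h2]
        · rw [partner_inr, if_neg (by simp), h3 _ _ rfl]
      · rw [h4 i x y hx hy, if_neg]
        rintro rfl
        exact hy (by rw [pairIndex_partner, hx])

/-- The coordinates of the restricted roots of `so(p, q)`. -/
def soWeights (p q r : ℕ) : Set (Fin r → ℤ) :=
  {d | (∃ i j, i ≠ j ∧ ∃ ε δ : ℤ, (ε = 1 ∨ ε = -1) ∧ (δ = 1 ∨ δ = -1) ∧
      d = Pi.single i ε + Pi.single j δ) ∨
    (¬(r = p ∧ r = q) ∧ ∃ (i : Fin r) (ε : ℤ), (ε = 1 ∨ ε = -1) ∧ d = Pi.single i ε)}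

lemma exists_weight_of_eigenvector {l : (Fin r → ℝ) → ℝ} (hl : ∃ t, l t ≠ 0) {A : soReal p q}
    (hA : A ≠ 0) (h : ∀ t, ⁅soDiag hp hq t, A⁆ = l t • A) :
    ∃ d ∈ soWeights p q r, ∀ t, l t = ∑ i, d i * t i := by
  obtain ⟨x, y, hxy⟩ : ∃ x y, (A : Matrix (Fin p ⊕ Fin q) (Fin p ⊕ Fin q) ℝ) x y ≠ 0 := by
    by_contra! h0
    exact hA (Subtype.ext (Matrix.ext h0))
  let a : Fin p ⊕ Fin q → Fin p ⊕ Fin q → ℝ := (A : Matrix (Fin p ⊕ Fin q) (Fin p ⊕ Fin q) ℝ)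
  let τ := partner p q r hp hq
  have key : ∀ t x y, l t * a x y = pairWeight t x * a (τ x) y - pairWeight t y * a x (τ y) :=
    fun t x y => by rw [← lie_soDiag_apply, h]; rfl
  let P : ℝ → ℝ → ℝ := fun ε δ => a x y + ε * a (τ x) y + δ * a x (τ y) + ε * δ * a (τ x) (τ y)
  have hτ : ∀ x, τ (τ x) = x := partner_partner hp hq
  have hw : ∀ (t : Fin r → ℝ) x, pairWeight t (τ x) = pairWeight t x := pairWeight_partner hp hq
  have hP : ∀ ε δ : ℤ, (ε = 1 ∨ ε = -1) → (δ = 1 ∨ δ = -1) → P ε δ ≠ 0 →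
      ∀ t, l t = ε * pairWeight t x - δ * pairWeight t y := by
    intro ε δ hε hδ hne t
    refine mul_right_cancel₀ hne ?_
    have e1 := key t x y
    have e2 := key t (τ x) y
    have e3 := key t x (τ y)
    have e4 := key t (τ x) (τ y)
    simp only [hτ, hw] at e2 e3 e4
    have hε2 : (ε : ℝ) * ε = 1 := by rcases hε with rfl | rfl <;> norm_num
    have hδ2 : (δ : ℝ) * δ = 1 := by rcases hδ with rfl | rfl <;> norm_num
    simp only [P]
    linear_combination e1 + ε * e2 + δ * e3 + ε * δ * e4 -
      (pairWeight t x * a (τ x) y + pairWeight t x * δ * a (τ x) (τ y)) * hε2 +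
      (pairWeight t y * a x (τ y) + pairWeight t y * ε * a (τ x) (τ y)) * hδ2
  obtain ⟨ε, δ, hε, hδ, hne⟩ : ∃ ε δ : ℤ, (ε = 1 ∨ ε = -1) ∧ (δ = 1 ∨ δ = -1) ∧ P ε δ ≠ 0 := by
    by_contra! h0
    refine hxy ?_
    have e1 := h0 1 1 (by simp) (by simp)
    have e2 := h0 1 (-1) (by simp) (by simp)
    have e3 := h0 (-1) 1 (by simp) (by simp)
    have e4 := h0 (-1) (-1) (by simp) (by simp)
    simp only [P] at e1 e2 e3 e4
    push_cast at e1 e2 e3 e4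
    change a x y = 0
    linear_combination (1 / 4) * (e1 + e2 + e3 + e4)
  have hlt := hP ε δ hε hδ hne
  obtain ⟨t₀, ht₀⟩ := hl
  cases hx : pairIndex p q r x with
  | none =>
    have hx0 : ∀ t : Fin r → ℝ, pairWeight t x = 0 := fun t => by rw [pairWeight, hx]; rfl
    cases hy : pairIndex p q r y with
    | none =>
      have hy0 : ∀ t : Fin r → ℝ, pairWeight t y = 0 := fun t => by rw [pairWeight, hy]; rfl
      exact absurd (by rw [hlt, hx0, hy0]; simp) ht₀
    | some j =>
      have hy0 : ∀ t : Fin r → ℝ, pairWeight t y = t j := fun t => by rw [pairWeight, hy]; rfl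
      refine ⟨Pi.single j (-δ), Or.inr ⟨pairIndex_ne_none_of_eq hx, j, -δ, by omega, rfl⟩, fun t => ?_⟩
      rw [hlt, hx0, hy0, Finset.sum_eq_single j (fun i _ hi => by simp [hi]) (by simp)]
      simp
  | some i =>
    have hx0 : ∀ t : Fin r → ℝ, pairWeight t x = t i := fun t => by rw [pairWeight, hx]; rfl
    cases hy : pairIndex p q r y with
    | none =>
      have hy0 : ∀ t : Fin r → ℝ, pairWeight t y = 0 := fun t => by rw [pairWeight, hy]; rfl
      refine ⟨Pi.single i ε, Or.inr ⟨pairIndex_ne_none_of_eq hy, i, ε, hε, rfl⟩, fun t => ?_⟩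
      rw [hlt, hx0, hy0, Finset.sum_eq_single i (fun i _ hi => by simp [hi]) (by simp)]
      simp
    | some j =>
      have hy0 : ∀ t : Fin r → ℝ, pairWeight t y = t j := fun t => by rw [pairWeight, hy]; rfl
      by_cases hij : i = j
      · subst hij
        have hεδ : δ = -ε := by
          by_contra h0
          have h1 : δ = ε := by omega
          exact ht₀ (by rw [hlt, hx0, hy0, h1]; ring)
        refine absurd ?_ hne
        have s1 : ∀ z : Fin p ⊕ Fin q, a z z = 0 := fun z => by
          have := soReal_apply_of_eq (A := A) (x := z) (y := z) rfl
          change a z z = - a z z at this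
          linarith
        have s2 : a (τ x) x = a x (τ x) := soReal_apply_of_eq_neg
          (by rw [signs_partner hp hq (by rw [hx]; simp), neg_neg])
        have hyx : y = x ∨ y = τ x := by
          rcases eq_of_pairIndex_eq_some hp hq hx with rfl | rfl <;>
            rcases eq_of_pairIndex_eq_some hp hq hy with rfl | rfl
          · exact Or.inl rfl
          · exact Or.inr (partner_inl hp hq i).symm
          · exact Or.inr (partner_inr hp hq i).symm
          · exact Or.inl rfl
        simp only [P, hεδ]
        have hε2 : (ε : ℝ) * ε = 1 := by rcases hε with rfl | rfl <;> norm_num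
        rcases hyx with rfl | rfl
        · rw [s1, s1, s2]; push_cast; ring
        · rw [hτ, s1, s1, s2]; push_cast; linear_combination -a x (τ x) * hε2
      · refine ⟨Pi.single i ε + Pi.single j (-δ), Or.inl ⟨i, j, hij, ε, -δ, hε, by omega, rfl⟩,
          fun t => ?_⟩
        simp only [Pi.add_apply, Int.cast_add, add_mul, Finset.sum_add_distrib]
        rw [hlt, hx0, hy0, Finset.sum_eq_single i (fun i _ hi => by simp [hi]) (by simp),
          Finset.sum_eq_single j (fun i _ hi => by simp [hi]) (by simp)]
        simp; ring

/-- The wedge product of two vectors, as a matrix in `so(p, q)`. -/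
def soWedge (f g : Fin p ⊕ Fin q → ℝ) : soReal p q :=
  ⟨of fun x y => (f x * g y - g x * f y) * signs p q y, mem_soReal_iff.mpr fun x y => by
    simp only [of_apply, star_trivial]; ring⟩

lemma lie_soDiag_soWedge {f g : Fin p ⊕ Fin q → ℝ} {t : Fin r → ℝ} {c d : ℝ}
    (hf : ∀ x, pairWeight t x * f (partner p q r hp hq x) = c * f x)
    (hg : ∀ x, pairWeight t x * g (partner p q r hp hq x) = d * g x) :
    ⁅soDiag hp hq t, soWedge f g⁆ = (c + d) • soWedge f g := by
  refine Subtype.ext (Matrix.ext fun x y => ?_)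
  rw [lie_soDiag_apply]
  change _ * ((_ - _) * _) - _ * ((_ - _) * _) = (c + d) * ((_ - _) * _)
  have h1 : pairWeight t y * (signs p q (partner p q r hp hq y) : ℝ) =
      -(pairWeight t y * signs p q y) := by
    by_cases hy : pairIndex p q r y = none
    · simp [pairWeight, hy]
    · rw [signs_partner hp hq hy]; push_cast; ring
  linear_combination (g y * signs p q y) * hf x - (f y * signs p q y) * hg x -
    (f x * g (partner p q r hp hq y) - g x * f (partner p q r hp hq y)) * h1 +
    (f x * signs p q y) * hg y - (g x * signs p q y) * hf y

/-- An isotropic eigenvector. -/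
def isotropicVector (i : Fin r) (ε : ℝ) (x : Fin p ⊕ Fin q) : ℝ :=
  if pairIndex p q r x = some i then x.elim (fun _ => 1) (fun _ => ε) else 0

lemma pairWeight_mul_isotropicVector (i : Fin r) {ε : ℝ} (hε : ε * ε = 1) (t : Fin r → ℝ)
    (x : Fin p ⊕ Fin q) : pairWeight t x * isotropicVector i ε (partner p q r hp hq x) =
      (ε * t i) * isotropicVector i ε x := by
  rw [isotropicVector, isotropicVector, pairIndex_partner]
  by_cases hx : pairIndex p q r x = some i
  · rw [if_pos hx, if_pos hx, pairWeight, hx]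
    rcases eq_of_pairIndex_eq_some hp hq hx with rfl | rfl
    · rw [partner_inl]; simp [mul_comm]
    · rw [partner_inr]; simp; linear_combination -(t i) * hε
  · rw [if_neg hx, if_neg hx, mul_zero, mul_zero]

lemma exists_eigenvector_of_weight (d : Fin r → ℤ) (hd : d ∈ soWeights p q r) :
    ∃ A : soReal p q, A ≠ 0 ∧ ∀ t, ⁅soDiag hp hq t, A⁆ = (∑ i, d i * t i) • A := by
  have hsq : ∀ ε : ℤ, ε = 1 ∨ ε = -1 → (ε : ℝ) * ε = 1 := by
    rintro _ (rfl | rfl) <;> norm_num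
  have hs : ∀ x, (signs p q x : ℝ) ≠ 0 := fun x => by
    rcases signs_eq p q x with h | h <;> simp [h]
  rcases hd with ⟨i, j, hij, ε, δ, hε, hδ, rfl⟩ | ⟨hr, i, ε, hε, rfl⟩
  · refine ⟨soWedge (isotropicVector i ε) (isotropicVector j δ), fun h0 => ?_, fun t => ?_⟩
    · have h1 : (_ * _ - _ * _) * (signs p q _ : ℝ) = 0 := congrFun (congrFun (congrArg Subtype.val h0)
        (Sum.inl (Fin.castLE hp i))) (Sum.inl (Fin.castLE hp j))
      have h2 := (mul_eq_zero.mp h1).resolve_right (hs _)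
      simp [isotropicVector, pairIndex_inl, hij] at h2
    · rw [lie_soDiag_soWedge hp hq (pairWeight_mul_isotropicVector hp hq i (hsq ε hε) t)
        (pairWeight_mul_isotropicVector hp hq j (hsq δ hδ) t)]
      congr 1
      simp only [Pi.add_apply, Int.cast_add, add_mul, Finset.sum_add_distrib]
      rw [Finset.sum_eq_single i (fun i _ hi => by simp [hi]) (by simp),
        Finset.sum_eq_single j (fun i _ hi => by simp [hi]) (by simp)]
      simp
  · obtain ⟨x, hx⟩ : ∃ x : Fin p ⊕ Fin q, pairIndex p q r x = none := by
      by_cases h1 : r < p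
      · exact ⟨Sum.inl ⟨r, h1⟩, by simp [pairIndex]⟩
      · have h2 : r < q := by omega
        exact ⟨Sum.inr ⟨r, h2⟩, by simp [pairIndex]⟩
    have hix : pairIndex p q r x ≠ some i := by rw [hx]; simp
    refine ⟨soWedge (isotropicVector i ε) (Pi.single x 1), fun h0 => ?_, fun t => ?_⟩
    · have h1 : (_ * _ - _ * _) * (signs p q _ : ℝ) = 0 := congrFun (congrFun (congrArg Subtype.val h0)
        (Sum.inl (Fin.castLE hp i))) x
      have h2 := (mul_eq_zero.mp h1).resolve_right (hs _)
      simp [isotropicVector, pairIndex_inl, hx] at h2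
    · rw [lie_soDiag_soWedge hp hq (pairWeight_mul_isotropicVector hp hq i (hsq ε hε) t)
        (d := 0) fun y => ?_]
      · rw [Finset.sum_eq_single i (fun i _ hi => by simp [hi]) (by simp)]
        simp
      · by_cases hy : pairIndex p q r y = none
        · simp [pairWeight, hy]
        · rw [Pi.single_eq_of_ne, mul_zero, zero_mul]
          rintro rfl
          exact hy (by rw [← hx, pairIndex_partner])

end SO

section SOTypes

lemma eq_single_of_sum_sq_eq_one {ι : Type*} [Fintype ι] [DecidableEq ι] {d : ι → ℤ}
    (h : d ⬝ᵥ d = 1) : ∃ i ε, (ε = 1 ∨ ε = -1) ∧ d = Pi.single i ε := by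
  obtain ⟨i, hi⟩ : ∃ i, d i ≠ 0 := by
    by_contra! h0
    simp [dotProduct, h0] at h
  have h1 : d i * d i + ∑ j ∈ Finset.univ.erase i, d j * d j = 1 := by
    rw [Finset.add_sum_erase _ (fun j => d j * d j) (Finset.mem_univ i)]; exact h
  have h2 : ∀ j ∈ Finset.univ.erase i, 0 ≤ d j * d j := fun j _ => mul_self_nonneg _
  have h3 : 0 < d i * d i := mul_self_pos.mpr hi
  have h4 := Finset.sum_nonneg h2
  have h5 := (Finset.sum_eq_zero_iff_of_nonneg h2).mp (by omega)
  refine ⟨i, d i, ?_, ?_⟩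
  · exact mul_self_eq_one_iff.mp (by omega)
  · ext j
    by_cases hj : j = i
    · subst hj; simp
    · rw [Pi.single_eq_of_ne hj]
      exact mul_self_eq_zero.mp (h5 j (by simp [hj]))

lemma eq_single_add_single_of_sum_sq_eq_two {ι : Type*} [Fintype ι] [DecidableEq ι] {d : ι → ℤ}
    (h : d ⬝ᵥ d = 2) : ∃ i j, i ≠ j ∧ ∃ ε δ : ℤ, (ε = 1 ∨ ε = -1) ∧ (δ = 1 ∨ δ = -1) ∧
      d = Pi.single i ε + Pi.single j δ := by
  obtain ⟨i, hi⟩ : ∃ i, d i ≠ 0 := by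
    by_contra! h0
    simp [dotProduct, h0] at h
  have h1 : d i * d i + ∑ j ∈ Finset.univ.erase i, d j * d j = 2 := by
    rw [Finset.add_sum_erase _ (fun j => d j * d j) (Finset.mem_univ i)]; exact h
  have h4 : 0 ≤ ∑ j ∈ Finset.univ.erase i, d j * d j := Finset.sum_nonneg fun j _ => mul_self_nonneg _
  have h5 : d i = 1 ∨ d i = -1 := by
    have h6 : d i ≤ 1 := by nlinarith
    have h7 : -1 ≤ d i := by nlinarith
    omega
  have h6 : d i * d i = 1 := mul_self_eq_one_iff.mpr h5
  have h7 : (d - Pi.single i (d i)) ⬝ᵥ (d - Pi.single i (d i)) = 1 := by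
    rw [dotProduct, ← Finset.add_sum_erase _ _ (Finset.mem_univ i)]
    rw [Finset.sum_congr rfl fun j hj => by
      rw [Pi.sub_apply, Pi.single_eq_of_ne (Finset.ne_of_mem_erase hj), sub_zero]]
    rw [Pi.sub_apply, Pi.single_eq_same, sub_self, zero_mul, zero_add]
    omega
  obtain ⟨j, δ, hδ, hd⟩ := eq_single_of_sum_sq_eq_one h7
  refine ⟨i, j, ?_, d i, δ, h5, hδ, by rw [← hd]; abel⟩
  rintro rfl
  have := congrFun hd i
  simp at this
  omega

lemma mem_soWeights_iff {p q r : ℕ} {d : Fin r → ℤ} : d ∈ soWeights p q r ↔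
    d ⬝ᵥ d = 2 ∨ (¬(r = p ∧ r = q) ∧ d ⬝ᵥ d = 1) := by
  have hsq : ∀ ε : ℤ, ε = 1 ∨ ε = -1 → ε * ε = 1 := by
    rintro _ (rfl | rfl) <;> norm_num
  constructor
  · rintro (⟨i, j, hij, ε, δ, hε, hδ, rfl⟩ | ⟨hr, i, ε, hε, rfl⟩)
    · refine Or.inl ?_
      simp [hij, hij.symm, hsq ε hε, hsq δ hδ]
    · exact Or.inr ⟨hr, by simp [hsq ε hε]⟩
  · rintro (h | ⟨hr, h⟩)
    · exact Or.inl (eq_single_add_single_of_sum_sq_eq_two h)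
    · exact Or.inr ⟨hr, eq_single_of_sum_sq_eq_one h⟩

theorem exists_hasType_of_coordinates {L : Type*} [LieRing L] [LieAlgebra ℝ L] [FiniteDimensional ℝ L]
    {θ : L ≃ₗ⁅ℝ⁆ L} (hθ : IsCartanInvolution θ) {𝔞 : Submodule ℝ L}
    (h𝔞 : Maximal (fun U : Submodule ℝ L =>
      U ≤ noncompactPart θ ∧ ∀ x ∈ U, ∀ y ∈ U, ⁅x, y⁆ = 0) 𝔞) {r : ℕ} (E : (Fin r → ℝ) ≃ₗ[ℝ] 𝔞)
    {R : Set (Fin r → ℤ)} (hroots : ∀ l : Dual ℝ 𝔞, l ∈ restrictedRoots 𝔞 ↔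
      ∃ d ∈ R, ∀ t, l (E t) = ∑ i, d i * t i) {N : Set ℤ} (hRN : ∀ d, d ∈ R ↔ d ⬝ᵥ d ∈ N)
    {X P Q : Matrix (Fin r) (Fin r) ℤ} {m : ℤ} (hm : m ≠ 0) (hPQ : P * Q = m • 1)
    (hX : ∀ i, X i i = 2) (hP : ∀ i, P i ∈ R)
    (hXP : ∀ i j, X i j * (P i ⬝ᵥ P i) = 2 * (P i ⬝ᵥ P j)) (hsurj : ∀ d ∈ R, ∃ c, d = c ᵥ* P)
    (hsign : ∀ c, c ᵥ* P ∈ R → (∀ i, 0 ≤ c i) ∨ ∀ i, c i ≤ 0) {G : Set (Fin r → ℤ)}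
    (hGR : ∀ v ∈ G, v ᵥ* P ∈ R) (hG : ∀ i n, 0 < n → n • P i ∈ R → Pi.single i n ∈ G)
    (hG' : ∀ v ∈ G, ∃ i n, v = Pi.single i n) :
    ∃ D : IwasawaDatum L, D.HasType D.roots X {v | WeylClosure X G v} := by
  let W : (Fin r → ℤ) → Dual ℝ 𝔞 := fun d =>
    (∑ i, (d i : ℝ) • (LinearMap.proj i : (Fin r → ℝ) →ₗ[ℝ] ℝ)) ∘ₗ (E.symm : _ →ₗ[ℝ] _)
  have hW : ∀ d t, W d (E t) = ∑ i, d i * t i := fun d t => by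
    simp [W]
  have hext : ∀ l l' : Dual ℝ 𝔞, (∀ t, l (E t) = l' (E t)) → l = l' := fun l l' h => by
    ext a
    obtain ⟨t, rfl⟩ := E.surjective a
    exact h t
  have hsum : ∀ c : Fin r → ℤ, W (c ᵥ* P) = ∑ i, c i • W (P i) := fun c => hext _ _ fun t => by
    rw [hW, LinearMap.sum_apply]
    simp only [LinearMap.smul_apply, hW, zsmul_eq_mul, vecMul, dotProduct, Int.cast_sum, Int.cast_mul,
      Finset.sum_mul, Finset.mul_sum]
    rw [Finset.sum_comm]
    exact Finset.sum_congr rfl fun i _ => Finset.sum_congr rfl fun j _ => by ring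
  have hnorm : ∀ c : Fin r → ℤ, ∀ i, (c - Pi.single i (∑ j, X i j * c j)) ᵥ* P =
      c ᵥ* P - (∑ j, X i j * c j) • P i := fun c i => by
    rw [sub_vecMul, single_vecMul]; rfl
  have hrefl : ∀ c : Fin r → ℤ, ∀ i,
      ((c - Pi.single i (∑ j, X i j * c j)) ᵥ* P) ⬝ᵥ ((c - Pi.single i (∑ j, X i j * c j)) ᵥ* P) =
      (c ᵥ* P) ⬝ᵥ (c ᵥ* P) := fun c i => by
    rw [hnorm]
    have h1 : (∑ j, X i j * c j) * (P i ⬝ᵥ P i) = 2 * (P i ⬝ᵥ (c ᵥ* P)) := by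
      have h2 : c ᵥ* P = ∑ j, c j • P j := by
        ext k; simp [vecMul, dotProduct, Finset.sum_apply]
      rw [h2, dotProduct_sum, Finset.sum_mul, Finset.mul_sum]
      refine Finset.sum_congr rfl fun j _ => ?_
      rw [dotProduct_smul, smul_eq_mul]
      linear_combination c j * hXP i j
    simp only [sub_dotProduct, dotProduct_sub, smul_dotProduct, dotProduct_smul, smul_eq_mul,
      dotProduct_comm (c ᵥ* P) (P i)]
    linear_combination (∑ j, X i j * c j) * h1
  refine IwasawaDatum.exists_hasType hθ h𝔞 (fun i => W (P i)) ?_ (S := {c | c ᵥ* P ∈ R}) ?_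
    hsign (fun i => ?_) hX ?_ hGR (fun i n hn h1 => hG i n hn ?_) hG'
  · rw [Fintype.linearIndependent_iff]
    intro g hg
    have h1 : ∀ k, ∑ i, g i * P i k = 0 := fun k => by
      have h2 := congrArg (fun l => l (E (Pi.single k 1))) hg
      simp only [LinearMap.sum_apply, LinearMap.smul_apply, hW, smul_eq_mul] at h2
      simpa [Pi.single_apply] using h2
    intro i
    have h2 : ∑ k, (∑ j, g j * P j k) * (Q k i : ℝ) = m * g i := by
      simp only [Finset.sum_mul]
      rw [Finset.sum_comm]
      have h3 : ∀ j, ∑ k, g j * (P j k : ℝ) * (Q k i : ℝ) =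
          g j * ((m • (1 : Matrix (Fin r) (Fin r) ℤ)) j i : ℤ) := fun j => by
        rw [← hPQ, mul_apply, Int.cast_sum, Finset.mul_sum]
        exact Finset.sum_congr rfl fun k _ => by push_cast; ring
      simp only [h3, Matrix.smul_apply, one_apply, smul_eq_mul]
      simp [mul_comm]
    simp only [h1, zero_mul, Finset.sum_const_zero] at h2
    exact (mul_eq_zero.mp h2.symm).resolve_left (by exact_mod_cast hm)
  · ext l
    rw [hroots]
    constructor
    · rintro ⟨d, hd, hl⟩
      obtain ⟨c, rfl⟩ := hsurj d hd
      exact ⟨c, hd, by rw [← hsum]; exact hext _ _ fun t => by rw [hW, hl]⟩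
    · rintro ⟨c, hc, rfl⟩
      exact ⟨_, hc, fun t => by rw [← hsum, hW]⟩
  · change _ ∈ R
    rw [single_one_vecMul]; exact hP i
  · intro c hc i
    change _ ∈ R
    rw [hRN, hrefl, ← hRN]
    exact hc
  · have : Pi.single i n ᵥ* P ∈ R := h1
    rwa [single_vecMul] at this

theorem exists_hasType_so {p q r : ℕ} (hp : r ≤ p) (hq : r ≤ q) (hr : r = p ∨ r = q) (h3 : 3 ≤ p + q)
    {X P Q : Matrix (Fin r) (Fin r) ℤ} {m : ℤ} (hm : m ≠ 0) (hPQ : P * Q = m • 1)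
    (hX : ∀ i, X i i = 2) (hP : ∀ i, P i ∈ soWeights p q r)
    (hXP : ∀ i j, X i j * (P i ⬝ᵥ P i) = 2 * (P i ⬝ᵥ P j))
    (hsurj : ∀ d ∈ soWeights p q r, ∃ c, d = c ᵥ* P)
    (hsign : ∀ c, c ᵥ* P ∈ soWeights p q r → (∀ i, 0 ≤ c i) ∨ ∀ i, c i ≤ 0) :
    ∃ D : IwasawaDatum (soReal p q), D.HasType D.roots X (finiteRoots X) := by
  let E := LinearEquiv.ofInjective (soDiag (p := p) (q := q) hp hq) (soDiag_injective hp hq)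
  have hspace : ∀ l A, A ∈ restrictedRootSpace (LinearMap.range (soDiag (p := p) (q := q) hp hq)) l ↔
      ∀ t, ⁅soDiag hp hq t, A⁆ = l (E t) • A := fun l A => by
    refine ⟨fun h t => h (E t), fun h a => ?_⟩
    obtain ⟨t, rfl⟩ := E.surjective a
    exact h t
  refine exists_hasType_of_coordinates (isCartanInvolution_soReal h3 soReal_neg_conjTranspose_mem)
    (maximal_range_soDiag hp hq hr) E (R := soWeights p q r) (fun l => ⟨?_, ?_⟩)
    (N := {n | n = 2 ∨ (¬(r = p ∧ r = q) ∧ n = 1)}) (fun d => mem_soWeights_iff) hm hPQ hX hP hXP hsurj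
    hsign ?_ ?_ ?_
  · rintro ⟨hl, hl'⟩
    obtain ⟨A, hA, hA0⟩ := Submodule.exists_mem_ne_zero_of_ne_bot hl'
    refine exists_weight_of_eigenvector hp hq ?_ hA0 ((hspace l A).mp hA)
    by_contra! h0
    refine hl (LinearMap.ext fun a => ?_)
    obtain ⟨t, rfl⟩ := E.surjective a
    exact h0 t
  · rintro ⟨d, hd, hl⟩
    obtain ⟨A, hA0, hA⟩ := exists_eigenvector_of_weight hp hq _ hd
    refine ⟨fun h0 => ?_, fun h0 => hA0 ?_⟩
    · have h1 : d = 0 := funext fun k => by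
        have h2 := hl (Pi.single k 1)
        rw [h0] at h2
        simpa [Pi.single_apply, eq_comm] using h2
      rw [h1, mem_soWeights_iff] at hd
      simp at hd
    · rw [← Submodule.mem_bot ℝ, ← h0, hspace]
      exact fun t => by rw [hl, hA]
  · rintro _ ⟨i, rfl⟩
    rw [single_one_vecMul]; exact hP i
  · intro i n hn h2
    refine ⟨i, ?_⟩
    have h3 := hP i
    rw [mem_soWeights_iff, smul_dotProduct, dotProduct_smul, smul_eq_mul, smul_eq_mul] at h2
    rw [mem_soWeights_iff] at h3
    congr 1
    have h4 : n < 2 := by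
      by_contra! h5
      have h6 : 4 ≤ n * n := by nlinarith
      rcases h2 with h2 | ⟨-, h2⟩ <;> rcases h3 with h3 | ⟨-, h3⟩ <;> rw [h3] at h2 <;> nlinarith
    omega
  · rintro _ ⟨i, rfl⟩
    exact ⟨i, 1, rfl⟩

/-- The simple roots of `b_r` in an orthonormal basis. -/
def simpleB (r : ℕ) : Matrix (Fin r) (Fin r) ℤ :=
  of fun i k => if k = i then 1 else if (k : ℕ) = i + 1 then -1 else 0

/-- The orthonormal basis in terms of the simple roots of `b_r`. -/
def simpleBInv (r : ℕ) : Matrix (Fin r) (Fin r) ℤ := of fun i k => if i ≤ k then 1 else 0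

lemma sign_of_mem_soWeights {p q r : ℕ} {d : Fin r → ℤ} (hd : d ∈ soWeights p q r) :
    (∀ k, 0 ≤ (d ᵥ* simpleBInv r) k) ∨ ∀ k, (d ᵥ* simpleBInv r) k ≤ 0 := by
  rcases hd with ⟨i, j, hij, ε, δ, hε, hδ, rfl⟩ | ⟨-, i, ε, hε, rfl⟩
  · have h1 : ∀ k, ((Pi.single i ε + Pi.single j δ) ᵥ* simpleBInv r) k =
        (if i ≤ k then ε else 0) + if j ≤ k then δ else 0 := fun k => by
      rw [add_vecMul, single_vecMul, single_vecMul]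
      simp [simpleBInv]
    simp only [h1]
    rcases lt_or_gt_of_ne hij with h | h
    · rcases hε with rfl | rfl
      · refine Or.inl fun k => ?_
        split_ifs <;> omega
      · refine Or.inr fun k => ?_
        split_ifs <;> omega
    · rcases hδ with rfl | rfl
      · refine Or.inl fun k => ?_
        split_ifs <;> omega
      · refine Or.inr fun k => ?_
        split_ifs <;> omega
  · have h1 : ∀ k, (Pi.single i ε ᵥ* simpleBInv r) k = if i ≤ k then ε else 0 := fun k => by
      rw [single_vecMul]; simp [simpleBInv]
    simp only [h1]
    rcases hε with rfl | rfl
    · exact Or.inl fun k => by split_ifs <;> simp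
    · exact Or.inr fun k => by split_ifs <;> simp

theorem exists_hasType_so_B {p q r : ℕ} (hp : r ≤ p) (hq : r ≤ q) (hr : r = p ∨ r = q)
    (hne : ¬(r = p ∧ r = q)) (h2 : 2 ≤ r) (h8 : r ≤ 8) : ∃ D : IwasawaDatum (soReal p q),
      D.HasType D.roots (CartanMatrix.B r)ᵀ (finiteRoots (CartanMatrix.B r)ᵀ) := by
  have hPQ : simpleB r * simpleBInv r = 1 := by interval_cases r <;> decide +kernel
  have hXP : ∀ i j, (CartanMatrix.B r)ᵀ i j * (simpleB r i ⬝ᵥ simpleB r i) =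
      2 * (simpleB r i ⬝ᵥ simpleB r j) := by interval_cases r <;> decide +kernel
  have hX : ∀ i, (CartanMatrix.B r)ᵀ i i = 2 := by interval_cases r <;> decide +kernel
  have hP : ∀ i, simpleB r i ⬝ᵥ simpleB r i = 2 ∨ simpleB r i ⬝ᵥ simpleB r i = 1 := by
    interval_cases r <;> decide +kernel
  have hQP := mul_eq_one_comm.mp hPQ
  refine exists_hasType_so hp hq hr (by omega) one_ne_zero (hPQ.trans (one_smul ℤ _).symm) hX
    (fun i => mem_soWeights_iff.mpr ((hP i).imp id fun h => ⟨hne, h⟩)) hXP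
    (fun d _ => ⟨d ᵥ* simpleBInv r, by rw [vecMul_vecMul, hQP, vecMul_one]⟩) fun c hc => ?_
  have h1 := sign_of_mem_soWeights hc
  rwa [vecMul_vecMul, hPQ, vecMul_one] at h1

/-- In an even lattice, the vectors of norm `2` have coordinates of constant sign with respect to a
basis with nonpositive mutual products. -/
lemma nonneg_or_nonpos_of_form_eq_two {ι : Type*} [Fintype ι] {X : Matrix ι ι ℤ}
    (hX : ∀ i j, i ≠ j → X i j ≤ 0) (h2 : ∀ c : ι → ℤ, c ≠ 0 → 2 ≤ c ⬝ᵥ X *ᵥ c) {c : ι → ℤ}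
    (hc : c ⬝ᵥ X *ᵥ c = 2) : (∀ i, 0 ≤ c i) ∨ ∀ i, c i ≤ 0 := by
  by_contra! h
  obtain ⟨⟨i, hi⟩, j, hj⟩ := h
  have hcc : c = c ⊔ 0 - (-c) ⊔ 0 := by
    ext k; simp only [Pi.sub_apply, Pi.sup_apply, Pi.neg_apply, Pi.zero_apply]; omega
  have hmix : ∀ a b : ι → ℤ, (∀ k, 0 ≤ a k) → (∀ k, 0 ≤ b k) → (∀ k, a k * b k = 0) →
      a ⬝ᵥ X *ᵥ b ≤ 0 := fun a b ha hb hab => by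
    simp only [dotProduct, mulVec, Finset.mul_sum]
    refine Finset.sum_nonpos fun k _ => Finset.sum_nonpos fun l _ => ?_
    by_cases hkl : k = l
    · subst hkl
      rw [mul_left_comm, hab, mul_zero]
    · have := mul_nonneg (ha k) (hb l)
      nlinarith [hX k l hkl]
  have hdisj : ∀ k, (c ⊔ 0) k * ((-c) ⊔ 0) k = 0 := fun k => by
    simp only [Pi.sup_apply, Pi.neg_apply, Pi.zero_apply, mul_eq_zero]; omega
  have hp : ∀ k, 0 ≤ (c ⊔ 0) k := fun k => le_sup_right
  have hm : ∀ k, 0 ≤ ((-c) ⊔ 0) k := fun k => le_sup_right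
  have h3 := hmix _ _ hp hm hdisj
  have h4 := hmix _ _ hm hp fun k => by rw [mul_comm, hdisj]
  have h5 := h2 (c ⊔ 0) fun h0 => by
    have := congrFun h0 j
    simp only [Pi.sup_apply, Pi.zero_apply] at this; omega
  have h6 := h2 ((-c) ⊔ 0) fun h0 => by
    have := congrFun h0 i
    simp only [Pi.sup_apply, Pi.neg_apply, Pi.zero_apply] at this; omega
  rw [hcc, mulVec_sub, sub_dotProduct, dotProduct_sub, dotProduct_sub] at hc
  omega

lemma even_form_of_eq_add_transpose {ι : Type*} [Fintype ι] {X T : Matrix ι ι ℤ} (h : X = T + Tᵀ)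
    (c : ι → ℤ) : Even (c ⬝ᵥ X *ᵥ c) := by
  refine ⟨c ⬝ᵥ T *ᵥ c, ?_⟩
  rw [h, add_mulVec, dotProduct_add, mulVec_transpose, dotProduct_comm c (c ᵥ* T), dotProduct_mulVec]

/-- The simple roots of `d_8` in an orthonormal basis. -/
def simpleD : Matrix (Fin 8) (Fin 8) ℤ :=
  of fun i k => if i = 7 then (if 6 ≤ k then 1 else 0) else
    if k = i then 1 else if (k : ℕ) = i + 1 then -1 else 0

/-- Twice the orthonormal basis in terms of the simple roots of `d_8`. -/
def simpleDInv : Matrix (Fin 8) (Fin 8) ℤ :=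
  of fun i k => if k ≤ 5 then (if i ≤ k then 2 else 0) else if i = 7 then 2 * k - 13 else 1

theorem exists_hasType_so_D : ∃ D : IwasawaDatum (soReal 8 8),
    D.HasType D.roots (CartanMatrix.D 8)ᵀ (finiteRoots (CartanMatrix.D 8)ᵀ) := by
  have hPQ : simpleD * simpleDInv = (2 : ℤ) • 1 := by decide +kernel
  have hPP : simpleD * simpleDᵀ = (CartanMatrix.D 8)ᵀ := by decide +kernel
  have hXP : ∀ i j, simpleD i ⬝ᵥ simpleD j = (CartanMatrix.D 8)ᵀ i j := fun i j => by
    rw [← hPP]; rfl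
  have hX : ∀ i, (CartanMatrix.D 8)ᵀ i i = 2 := by decide +kernel
  have hX' : ∀ i j, i ≠ j → 1 * (CartanMatrix.D 8)ᵀ i j ≤ 0 := by decide +kernel
  have hdec : ∀ i j : Fin 8, i ≠ j → ∀ ε ∈ ({1, -1} : Finset ℤ), ∀ δ ∈ ({1, -1} : Finset ℤ),
      (fun k => ((Pi.single i ε + Pi.single j δ) ᵥ* simpleDInv) k / 2) ᵥ* simpleD =
        Pi.single i ε + Pi.single j δ := by decide +kernel
  have hform : ∀ c : Fin 8 → ℤ, (c ᵥ* simpleD) ⬝ᵥ (c ᵥ* simpleD) =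
      c ⬝ᵥ (CartanMatrix.D 8)ᵀ *ᵥ c := fun c => by
    rw [← hPP, ← mulVec_mulVec, mulVec_transpose, dotProduct_mulVec]
  have hhalf : (CartanMatrix.D 8)ᵀ = (of fun i j => if i = j then 1 else if i < j then (CartanMatrix.D 8)ᵀ i j else 0) +
      (of fun i j => if i = j then 1 else if i < j then (CartanMatrix.D 8)ᵀ i j else 0)ᵀ := by decide +kernel
  have hinj : ∀ c : Fin 8 → ℤ, c ᵥ* simpleD = 0 → c = 0 := fun c hc => by
    have h1 := congrArg (fun v => v ᵥ* simpleDInv) hc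
    simp only [vecMul_vecMul, hPQ, zero_vecMul, vecMul_smul, vecMul_one] at h1
    exact (smul_eq_zero.mp h1).resolve_left two_ne_zero
  refine exists_hasType_so le_rfl le_rfl (Or.inl rfl) (by norm_num) two_ne_zero hPQ hX
    (fun i => mem_soWeights_iff.mpr (Or.inl (by rw [hXP, hX]))) (fun i j => by
      rw [hXP, hXP, hX]; ring) ?_ fun c hc => ?_
  · rintro d (⟨i, j, hij, ε, δ, hε, hδ, rfl⟩ | ⟨h, -⟩)
    · exact ⟨_, (hdec i j hij ε (by simpa using hε) δ (by simpa using hδ)).symm⟩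
    · exact absurd ⟨rfl, rfl⟩ h
  · rw [mem_soWeights_iff, hform] at hc
    refine nonneg_or_nonpos_of_form_eq_two (fun i j hij => by simpa using hX' i j hij)
      (fun c hc0 => ?_) (hc.resolve_right fun h => h.1 ⟨rfl, rfl⟩)
    obtain ⟨k, hk⟩ := even_form_of_eq_add_transpose hhalf c
    have h1 : 0 < (c ᵥ* simpleD) ⬝ᵥ (c ᵥ* simpleD) := by
      refine lt_of_le_of_ne (Finset.sum_nonneg fun j _ => mul_self_nonneg _) fun h0 => hc0 (hinj c ?_)
      exact dotProduct_self_eq_zero.mp h0.symm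
    rw [hform] at h1
    omega

end SOTypes

/-! ### The simply laced Lie algebras -/

namespace LatticeLie

variable {n : ℕ} {K : Type*} [Field K] {C : Matrix (Fin n) (Fin n) ℤ} [IsSimplyLacedCartan C]

lemma even_latForm (v : Fin n → ℤ) : Even (latForm C v v) :=
  ⟨_, (latExponent_add_comm v v).symm⟩

lemma two_le_latForm {v : Fin n → ℤ} (hv : v ≠ 0) : 2 ≤ latForm C v v := by
  obtain ⟨k, hk⟩ := even_latForm (C := C) v
  have h1 := latForm_self_nonneg (C := C) v
  have h2 : latForm C v v ≠ 0 := fun h => hv (latForm_self_eq_zero h)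
  omega

lemma latForm_neg_neg (v : Fin n → ℤ) : latForm C (-v) (-v) = latForm C v v := by
  rw [latForm_neg_left, latForm_neg_right, neg_neg]

lemma coeff_root (x : LatticeLie K C) (a : LatticeRoot C) : coeff x a.1 = x.root a := by
  simp [coeff, a.2]

lemma ext_coeff {x y : LatticeLie K C} (h1 : x.cart = y.cart) (h2 : ∀ v, coeff x v = coeff y v) :
    x = y :=
  LatticeLie.ext h1 (funext fun a => by rw [← coeff_root, h2, coeff_root])

/-- The invariant symmetric form with `(e_α | e_{-α}) = -1`. -/
noncomputable def form (x y : LatticeLie K C) : K :=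
  ∑ i, ∑ j, x.cart i * C i j * y.cart j - ∑ a : LatticeRoot C, x.root a * coeff y (-a.1)

lemma form_add_left (x y z : LatticeLie K C) : form (x + y) z = form x z + form y z := by
  simp only [form, add_cart, add_root, Pi.add_apply, add_mul, Finset.sum_add_distrib]; ring

lemma form_smul_left {R : Type*} [CommRing R] [Algebra R K] (c : R) (x y : LatticeLie K C) :
    form (c • x) y = c • form x y := by
  simp only [form, smul_cart, smul_root, Pi.smul_apply, smul_sub, Finset.smul_sum, smul_mul_assoc]

lemma form_comm (x y : LatticeLie K C) : form x y = form y x := by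
  unfold form
  congr 1
  · rw [Finset.sum_comm]
    refine Finset.sum_congr rfl fun i _ => Finset.sum_congr rfl fun j _ => ?_
    rw [IsSimplyLacedCartan.symm (C := C) j i]; ring
  · rw [← Equiv.sum_comp negRoot]
    refine Finset.sum_congr rfl fun a _ => ?_
    have h1 : (negRoot a).1 = -a.1 := rfl
    rw [h1, neg_neg, coeff_root, ← h1, coeff_root]; ring

lemma form_add_right (x y z : LatticeLie K C) : form z (x + y) = form z x + form z y := by
  rw [form_comm, form_add_left, form_comm x, form_comm y]

lemma form_smul_right {R : Type*} [CommRing R] [Algebra R K] (c : R) (x y : LatticeLie K C) :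
    form x (c • y) = c • form x y := by
  rw [form_comm, form_smul_left, form_comm]

lemma form_neg_left (x y : LatticeLie K C) : form (-x) y = -form x y := by
  have := form_smul_left (R := ℤ) (-1) x y
  simpa using this

lemma form_zero_left (y : LatticeLie K C) : form 0 y = 0 := by
  have := form_smul_left (R := ℤ) 0 0 y
  simpa using this

lemma form_H_e (h : Fin n → K) (v : Fin n → ℤ) : form (H C h) (e K C v) = 0 := by
  simp [form, H, e]

lemma form_e_H (h : Fin n → K) (v : Fin n → ℤ) : form (e K C v) (H C h) = 0 := by
  rw [form_comm, form_H_e]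

lemma form_e_e {v w : Fin n → ℤ} (hv : latForm C v v = 2) (hw : latForm C w w = 2) :
    form (e K C v) (e K C w) = if v + w = 0 then -1 else 0 := by
  have h1 : form (e K C v) (e K C w) = -coeff (e K C w) (-v) := by
    simp only [form]
    rw [Finset.sum_eq_single_of_mem (⟨v, hv⟩ : LatticeRoot C) (Finset.mem_univ _)]
    · simp [e]
    · intro b _ hb
      have : b.1 ≠ v := fun h => hb (Subtype.ext h)
      simp [e, this]
  rw [h1, coeff_e _ _ hw]
  simp only [neg_eq_iff_add_eq_zero]
  split_ifs <;> simp

lemma form_H_H_intCast (h : Fin n → K) (v : Fin n → ℤ) :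
    form (H C h) (H C fun i => (v i : K)) = pair C h v := by
  simp only [form, H, pair, mulVec, dotProduct, Int.cast_sum, Int.cast_mul, Finset.mul_sum]
  simp [mul_assoc]

section Invariance

variable [CharZero K]

lemma lie_H_H (h h' : Fin n → K) : ⁅H C h, H C h'⁆ = 0 := bracket_H_H h h'

lemma lie_H_e (h : Fin n → K) (v : Fin n → ℤ) : ⁅H C h, e K C v⁆ = pair C h v • e K C v :=
  bracket_H_e h v

lemma lie_e_H (h : Fin n → K) (v : Fin n → ℤ) : ⁅e K C v, H C h⁆ = -(pair C h v • e K C v) :=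
  bracket_e_H h v

lemma lie_e_e {v w : Fin n → ℤ} (hv : latForm C v v = 2) (hw : latForm C w w = 2) :
    ⁅e K C v, e K C w⁆ =
      if v + w = 0 then -H C (fun i => (v i : K)) else (latSign C v w : K) • e K C (v + w) :=
  bracket_e_e hv hw

lemma form_lie_e_e_e {u v w : Fin n → ℤ} (hu : latForm C u u = 2) (hv : latForm C v v = 2)
    (hw : latForm C w w = 2) :
    form ⁅e K C u, e K C v⁆ (e K C w) = if u + v + w = 0 then -(latSign C u v : K) else 0 := by
  have hw0 : w ≠ 0 := by rintro rfl; simp [latForm] at hw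
  rw [lie_e_e hu hv]
  by_cases h1 : u + v = 0
  · rw [if_pos h1, form_neg_left, form_H_e, h1, zero_add, if_neg hw0, neg_zero]
  · rw [if_neg h1, form_smul_left]
    by_cases h2 : latForm C (u + v) (u + v) = 2
    · rw [form_e_e h2 hw]
      split_ifs <;> simp
    · rw [e_eq_zero h2, form_zero_left, smul_zero, if_neg]
      intro h3
      rw [eq_neg_of_add_eq_zero_left h3, latForm_neg_neg] at h2
      exact h2 hw

lemma form_lie (x y z : LatticeLie K C) : form ⁅x, y⁆ z = -form y ⁅x, z⁆ := by
  rw [← add_eq_zero_iff_eq_neg]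
  induction x using induction_gen with
  | hadd a b ha hb =>
    rw [add_lie, add_lie, form_add_left, form_add_right]
    linear_combination ha + hb
  | hsmul c a ha =>
    rw [smul_lie, smul_lie, form_smul_left, form_smul_right, ← smul_add, ha, smul_zero]
  | hH h =>
    induction y using induction_gen with
    | hadd a b ha hb => 
      rw [lie_add, form_add_left, form_add_left]
      linear_combination ha + hb
    | hsmul c a ha => rw [lie_smul, form_smul_left, form_smul_left, ← smul_add, ha, smul_zero]
    | hH h' =>
      induction z using induction_gen with
      | hadd a b ha hb =>
        rw [lie_add, form_add_right, form_add_right]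
        linear_combination ha + hb
      | hsmul c a ha => rw [lie_smul, form_smul_right, form_smul_right, ← smul_add, ha, smul_zero]
      | hH h'' => rw [lie_H_H, lie_H_H, form_comm _ 0, form_zero_left, form_zero_left, add_zero]
      | he v hv => rw [lie_H_H, lie_H_e, form_zero_left, form_smul_right, form_H_e]; simp
    | he v hv =>
      induction z using induction_gen with
      | hadd a b ha hb =>
        rw [lie_add, form_add_right, form_add_right]
        linear_combination ha + hb
      | hsmul c a ha => rw [lie_smul, form_smul_right, form_smul_right, ← smul_add, ha, smul_zero]
      | hH h'' => rw [lie_H_H, lie_H_e, form_smul_left, form_e_H, form_comm _ 0, form_zero_left]; simp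
      | he w hw =>
        rw [lie_H_e, lie_H_e, form_smul_left, form_smul_right, form_e_e hv hw, ← add_smul,
          ← pair_add_vec]
        split_ifs with h1
        · rw [h1]; simp [pair]
        · simp
  | he u hu =>
    induction y using induction_gen with
    | hadd a b ha hb =>
      rw [lie_add, form_add_left, form_add_left]
      linear_combination ha + hb
    | hsmul c a ha => rw [lie_smul, form_smul_left, form_smul_left, ← smul_add, ha, smul_zero]
    | hH h =>
      induction z using induction_gen with
      | hadd a b ha hb =>
        rw [lie_add, form_add_right, form_add_right]
        linear_combination ha + hb
      | hsmul c a ha => rw [lie_smul, form_smul_right, form_smul_right, ← smul_add, ha, smul_zero]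
      | hH h' =>
        rw [lie_e_H, lie_e_H, form_neg_left, form_smul_left, form_e_H, form_comm (H C h),
          form_neg_left, form_smul_left, form_e_H]
        simp
      | he w hw =>
        rw [lie_e_H, form_neg_left, form_smul_left, form_e_e hu hw, lie_e_e hu hw]
        split_ifs with h1
        · rw [form_comm, form_neg_left, form_comm, form_H_H_intCast]; simp
        · rw [form_smul_right, form_H_e]; simp
    | he v hv =>
      induction z using induction_gen with
      | hadd a b ha hb =>
        rw [lie_add, form_add_right, form_add_right]
        linear_combination ha + hb
      | hsmul c a ha => rw [lie_smul, form_smul_right, form_smul_right, ← smul_add, ha, smul_zero]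
      | hH h =>
        rw [lie_e_H, form_comm _ (-_), form_neg_left, form_smul_left, form_e_e hu hv, lie_e_e hu hv]
        split_ifs with h1
        · rw [form_neg_left, form_comm, form_H_H_intCast]; simp
        · rw [form_smul_left, form_e_H]; simp
      | he w hw =>
        rw [form_comm _ ⁅_, _⁆, form_lie_e_e_e hu hv hw, form_lie_e_e_e hu hw hv]
        have h1 : u + w + v = u + v + w := by abel
        rw [h1]
        split_ifs with h2
        · have h3 : w = -(u + v) := (neg_eq_of_add_eq_zero_right h2).symm
          rw [h3, latSign_neg_right, latSign_add_right, latSign_self hu]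
          push_cast; ring
        · simp

end Invariance

/-! #### Automorphisms -/

section Automorphisms

variable [CharZero K]

lemma map_lie_of_generators {M : Type*} [LieRing M] [LieAlgebra K M] (f : LatticeLie K C →ₗ[K] M)
    (hHH : ∀ h h', ⁅f (H C h), f (H C h')⁆ = 0)
    (hHe : ∀ h v, latForm C v v = 2 → ⁅f (H C h), f (e K C v)⁆ = f ⁅H C h, e K C v⁆)
    (hee : ∀ v w, latForm C v v = 2 → latForm C w w = 2 →
      ⁅f (e K C v), f (e K C w)⁆ = f ⁅e K C v, e K C w⁆) (x y : LatticeLie K C) :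
    f ⁅x, y⁆ = ⁅f x, f y⁆ := by
  induction x using induction_gen with
  | hadd a b ha hb => rw [add_lie, map_add, ha, hb, map_add, add_lie]
  | hsmul c a ha => rw [smul_lie, map_smul, ha, map_smul, smul_lie]
  | hH h =>
    induction y using induction_gen with
    | hadd a b ha hb => rw [lie_add, map_add, ha, hb, map_add, lie_add]
    | hsmul c a ha => rw [lie_smul, map_smul, ha, map_smul, lie_smul]
    | hH h' => rw [lie_H_H, map_zero, hHH]
    | he v hv => exact (hHe h v hv).symm
  | he v hv =>
    induction y using induction_gen with
    | hadd a b ha hb => rw [lie_add, map_add, ha, hb, map_add, lie_add]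
    | hsmul c a ha => rw [lie_smul, map_smul, ha, map_smul, lie_smul]
    | hH h => rw [← lie_skew, map_neg, ← hHe h v hv, lie_skew]
    | he w hw => exact (hee v w hv hw).symm

/-- The Chevalley involution, with `αᵢ ↦ -αᵢ` and `e_α ↦ e_{-α}`. -/
noncomputable def chevalleyMap : LatticeLie K C →ₗ[K] LatticeLie K C where
  toFun x := ⟨-x.cart, fun a => coeff x (-a.1)⟩
  map_add' x y := LatticeLie.ext (by simp [add_comm]) (funext fun a => coeff_add x y _)
  map_smul' c x := LatticeLie.ext (by simp) (funext fun a => coeff_smul c x _)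

lemma chevalleyMap_H (h : Fin n → K) : chevalleyMap (H C h) = H C (-h) :=
  LatticeLie.ext rfl (funext fun _ => coeff_H h _)

lemma chevalleyMap_e {v : Fin n → ℤ} (hv : latForm C v v = 2) :
    chevalleyMap (e K C v) = e K C (-v) := by
  refine LatticeLie.ext (by simp [chevalleyMap, e]) (funext fun a => ?_)
  change coeff (e K C v) (-a.1) = if a.1 = -v then 1 else 0
  rw [coeff_e _ _ hv]
  simp [neg_eq_iff_eq_neg]

lemma chevalleyMap_chevalleyMap (x : LatticeLie K C) : chevalleyMap (chevalleyMap x) = x := by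
  refine LatticeLie.ext (neg_neg _) (funext fun a => ?_)
  change coeff (chevalleyMap x) (negRoot a).1 = _
  rw [coeff_root]
  change coeff x (-(-a.1)) = _
  rw [neg_neg, coeff_root]

lemma chevalleyMap_lie (x y : LatticeLie K C) :
    chevalleyMap ⁅x, y⁆ = ⁅chevalleyMap x, chevalleyMap y⁆ := by
  refine map_lie_of_generators _ (fun h h' => ?_) (fun h v hv => ?_) (fun v w hv hw => ?_) x y
  · rw [chevalleyMap_H, chevalleyMap_H, lie_H_H]
  · rw [chevalleyMap_H, chevalleyMap_e hv, lie_H_e, lie_H_e, map_smul, chevalleyMap_e hv]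
    simp [pair, mulVec_neg]
  · rw [chevalleyMap_e hv, chevalleyMap_e hw, lie_e_e (by rwa [latForm_neg_neg])
      (by rwa [latForm_neg_neg]), lie_e_e hv hw]
    have h1 : -v + -w = -(v + w) := by abel
    simp only [h1, neg_eq_zero]
    split_ifs with h2
    · rw [map_neg, chevalleyMap_H]
      congr 2
      ext i; simp
    · rw [map_smul, latSign_neg_left, latSign_neg_right]
      by_cases h3 : latForm C (v + w) (v + w) = 2
      · rw [chevalleyMap_e h3]
      · rw [e_eq_zero h3, e_eq_zero (by rwa [latForm_neg_neg]), map_zero]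

/-- The automorphism with `αᵢ ↦ αᵢ` and `e_α ↦ (-1)^{p(α)} e_α`, where `p(α)` is the coefficient of
`α` at the simple root number `k`. -/
noncomputable def parityMap (k : Fin n) : LatticeLie K C →ₗ[K] LatticeLie K C where
  toFun x := ⟨x.cart, fun a => ((a.1 k).negOnePow : ℤ) * x.root a⟩
  map_add' x y := LatticeLie.ext rfl (funext fun _ => by simp [mul_add])
  map_smul' c x := LatticeLie.ext rfl (funext fun _ => by simp [mul_left_comm])

lemma parityMap_H (k : Fin n) (h : Fin n → K) : parityMap k (H C h) = H C h :=
  LatticeLie.ext rfl (funext fun _ => mul_zero _)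

lemma parityMap_e (k : Fin n) (v : Fin n → ℤ) :
    parityMap k (e K C v) = (((v k).negOnePow : ℤ) : K) • e K C v := by
  refine LatticeLie.ext (by simp [parityMap, e]) (funext fun a => ?_)
  change _ * (if a.1 = v then (1 : K) else 0) = _ * (if a.1 = v then (1 : K) else 0)
  split_ifs with h
  · rw [h]
  · simp

lemma negOnePow_mul_self (m : ℤ) : ((m.negOnePow : ℤ) : K) * ((m.negOnePow : ℤ) : K) = 1 := by
  rw [← Int.cast_mul, ← Units.val_mul, ← Int.negOnePow_add, Int.negOnePow_even _ ⟨_, rfl⟩]; simp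

lemma parityMap_parityMap (k : Fin n) (x : LatticeLie K C) : parityMap k (parityMap k x) = x := by
  refine LatticeLie.ext rfl (funext fun a => ?_)
  change _ * (_ * _) = _
  rw [← mul_assoc, negOnePow_mul_self, one_mul]

lemma parityMap_lie (k : Fin n) (x y : LatticeLie K C) :
    parityMap k ⁅x, y⁆ = ⁅parityMap k x, parityMap k y⁆ := by
  refine map_lie_of_generators _ (fun h h' => ?_) (fun h v hv => ?_) (fun v w hv hw => ?_) x y
  · rw [parityMap_H, parityMap_H, lie_H_H]
  · rw [parityMap_H, parityMap_e, lie_smul, lie_H_e, map_smul, parityMap_e, smul_comm]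
  · rw [parityMap_e, parityMap_e, smul_lie, lie_smul, lie_e_e hv hw, smul_smul, ← Int.cast_mul,
      ← Units.val_mul, ← Int.negOnePow_add]
    have h1 : v k + w k = (v + w) k := rfl
    rw [h1]
    split_ifs with h2
    · rw [h2, map_neg, parityMap_H]; simp
    · rw [map_smul, parityMap_e, smul_comm]

end Automorphisms

/-! #### Nondegeneracy -/

lemma det_ne_zero (C : Matrix (Fin n) (Fin n) ℤ) [IsSimplyLacedCartan C] : C.det ≠ 0 := by
  intro h
  obtain ⟨v, hv, hv'⟩ := exists_mulVec_eq_zero_iff.mpr h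
  exact hv (latForm_self_eq_zero (C := C) (by rw [latForm, hv', dotProduct_zero]))

lemma eq_zero_of_pair_eq_zero [CharZero K] {h : Fin n → K} (hh : ∀ i, pair C h (Pi.single i 1) = 0) :
    h = 0 := by
  have h1 : h ᵥ* C.map (Int.cast : ℤ → K) = 0 := by
    ext j
    have := hh j
    simpa [pair, vecMul, dotProduct] using this
  have h2 : (C.map (Int.cast : ℤ → K)).det ≠ 0 := by
    have : (C.map (Int.cast : ℤ → K)).det = (C.det : K) :=
      ((Int.castRingHom K).map_det C).symm
    rw [this]
    exact_mod_cast det_ne_zero C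
  by_contra h0
  exact h2 (exists_vecMul_eq_zero_iff.mp ⟨h, h0, h1⟩)

lemma latForm_single (i : Fin n) : latForm C (Pi.single i 1) (Pi.single i 1) = 2 := by
  simp [latForm, IsSimplyLacedCartan.diag (C := C) i]

lemma lie_H_root [CharZero K] (h : Fin n → K) (x : LatticeLie K C) (a : LatticeRoot C) :
    ⁅H C h, x⁆.root a = pair C h a.1 * x.root a := by
  rw [lie_def]
  simp [bracket, H, pair]

lemma lie_H_cart [CharZero K] (h : Fin n → K) (x : LatticeLie K C) : ⁅H C h, x⁆.cart = 0 := by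
  rw [lie_def]
  ext i
  simp [bracket, H]

lemma eq_zero_of_central [CharZero K] {x : LatticeLie K C} (hx : ∀ y : LatticeLie K C, ⁅x, y⁆ = 0) : x = 0 := by
  have h1 : x.root = 0 := by
    ext a
    have h2 := lie_H_root (fun i => (a.1 i : K)) x a
    rw [← lie_skew, hx, pair_intCast, show latForm C a.1 a.1 = 2 from a.2] at h2
    simpa using h2
  have h2 : x = H C x.cart := LatticeLie.ext rfl h1
  have h3 : x.cart = 0 := by
    refine eq_zero_of_pair_eq_zero (C := C) fun i => ?_
    have h4 := hx (e K C (Pi.single i 1))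
    rw [h2, lie_H_e] at h4
    have h5 := congrArg (fun y => coeff y (Pi.single i 1)) h4
    simp only [coeff_smul, coeff_e _ _ (latForm_single (C := C) i), if_true] at h5
    simpa [coeff] using h5
  rw [h2, h3]; rfl

lemma form_real_pos {h : Fin n → ℝ} (hh : h ≠ 0) : 0 < ∑ i, ∑ j, h i * C i j * h j := by
  obtain ⟨N, hN⟩ := IsSimplyLacedCartan.coercive (C := C)
  have hint : ∀ x : Fin n → ℤ, ∑ i, (x i : ℝ) ^ 2 ≤ N * ∑ i, ∑ j, (x i : ℝ) * C i j * x j := fun x => by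
    have h1 := hN x
    simp only [dotProduct, mulVec, Finset.mul_sum] at h1
    have h2 : ((∑ i, x i ^ 2 : ℤ) : ℝ) ≤ ((∑ i, ∑ j, N * (x i * (C i j * x j)) : ℤ) : ℝ) :=
      by exact_mod_cast h1
    push_cast at h2
    refine h2.trans_eq ?_
    simp only [Finset.mul_sum, mul_assoc]
  have hreal : ∀ h : Fin n → ℝ, ∑ i, h i ^ 2 ≤ N * ∑ i, ∑ j, h i * C i j * h j := fun h => by
    have hlim : ∀ i, Filter.Tendsto (fun m : ℕ => (⌊h i * m⌋ : ℝ) / m) Filter.atTop (nhds (h i)) :=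
      fun i => by
        have h1 : Filter.Tendsto (fun m : ℕ => h i - 1 / m) Filter.atTop (nhds (h i)) := by
          simpa using tendsto_const_nhds.sub (tendsto_one_div_atTop_nhds_zero_nat (𝕜 := ℝ))
        refine tendsto_of_tendsto_of_tendsto_of_le_of_le' h1 tendsto_const_nhds ?_ ?_
        all_goals
          filter_upwards [Filter.eventually_gt_atTop 0] with m hm
          have hm' : (0 : ℝ) < m := by exact_mod_cast hm
        · rw [le_div_iff₀ hm', sub_mul, div_mul_cancel₀ _ hm'.ne']
          exact (Int.sub_one_lt_floor _).le
        · rw [div_le_iff₀ hm']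
          exact Int.floor_le _
    refine le_of_tendsto_of_tendsto' (f := fun m : ℕ => ∑ i, ((⌊h i * m⌋ : ℝ) / m) ^ 2)
      (g := fun m : ℕ => N * ∑ i, ∑ j, (⌊h i * m⌋ : ℝ) / m * C i j * ((⌊h j * m⌋ : ℝ) / m))
      (b := Filter.atTop) ?_ ?_ fun m => ?_
    · exact tendsto_finsetSum _ fun i _ => (hlim i).pow 2
    · exact (tendsto_finsetSum _ fun i _ => tendsto_finsetSum _ fun j _ =>
        ((hlim i).mul_const _).mul (hlim j)).const_mul _
    · have h1 := mul_le_mul_of_nonneg_right (hint fun i => ⌊h i * m⌋) (sq_nonneg ((m : ℝ)⁻¹))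
      simp only [Finset.sum_mul, Finset.mul_sum] at h1 ⊢
      refine (le_of_eq ?_).trans (h1.trans (le_of_eq ?_))
      · exact Finset.sum_congr rfl fun i _ => by ring
      · exact Finset.sum_congr rfl fun i _ => Finset.sum_congr rfl fun j _ => by ring
  have h0 : 0 < ∑ i, h i ^ 2 := by
    obtain ⟨i, hi⟩ := Function.ne_iff.mp hh
    exact Finset.sum_pos' (fun _ _ => sq_nonneg _) ⟨i, Finset.mem_univ _, by
      have : h i ≠ 0 := hi
      positivity⟩
  by_contra! hcon
  by_cases hn : n = 0
  · subst hn; exact hh (Subsingleton.elim _ _)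
  have hN0 : (0 : ℝ) < N := by
    have h1 := hN (Pi.single ⟨0, Nat.pos_of_ne_zero hn⟩ 1)
    have h2 := latForm_single (C := C) ⟨0, Nat.pos_of_ne_zero hn⟩
    rw [latForm] at h2
    rw [h2] at h1
    have h3 : (0 : ℤ) < ∑ i, (Pi.single ⟨0, Nat.pos_of_ne_zero hn⟩ (1 : ℤ) : Fin n → ℤ) i ^ 2 :=
      Finset.sum_pos' (fun _ _ => sq_nonneg _)
        ⟨⟨0, Nat.pos_of_ne_zero hn⟩, Finset.mem_univ _, by simp⟩
    have h4 : 0 < N := by omega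
    exact_mod_cast h4
  have h1 := hreal h
  nlinarith

end LatticeLie

/-! ### The signature of the Killing form -/

section Signature

variable {L : Type*} [LieRing L] [LieAlgebra ℝ L] [FiniteDimensional ℝ L]

theorem IsCartanInvolution.killingSignature_eq {θ : L ≃ₗ⁅ℝ⁆ L} (hθ : IsCartanInvolution θ) :
    (killingSignature L : ℝ) = -LinearMap.trace ℝ L (θ : L →ₗ[ℝ] L) := by
  let T : L →ₗ[ℝ] L := (θ : L →ₗ[ℝ] L)
  have hT : ∀ x, T x = θ x := fun _ => rfl
  have hTT : ∀ x, T (T x) = x := hθ.involutive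
  let P : L →ₗ[ℝ] L := (2 : ℝ)⁻¹ • (LinearMap.id - T)
  let M : L →ₗ[ℝ] L := (2 : ℝ)⁻¹ • (LinearMap.id + T)
  let k : Submodule ℝ L := LinearMap.ker (LinearMap.id - T)
  have hk : ∀ x, x ∈ k ↔ θ x = x := fun x => by
    rw [LinearMap.mem_ker, LinearMap.sub_apply, sub_eq_zero, eq_comm]; rfl
  have hp : ∀ x, x ∈ noncompactPart θ ↔ θ x = -x := fun _ => Iff.rfl
  have hP : LinearMap.IsProj (noncompactPart θ) P := by
    refine ⟨fun x => ?_, fun x hx => ?_⟩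
    · rw [hp, ← hT]
      simp only [P, LinearMap.smul_apply, LinearMap.sub_apply, LinearMap.id_apply, map_smul, map_sub, hTT]
      rw [← smul_neg, neg_sub]
    · simp only [P, LinearMap.smul_apply, LinearMap.sub_apply, LinearMap.id_apply, hT, (hp x).mp hx]
      rw [sub_neg_eq_add, ← two_smul ℝ, smul_smul]; norm_num
  have hM : LinearMap.IsProj k M := by
    refine ⟨fun x => ?_, fun x hx => ?_⟩
    · rw [hk, ← hT]
      simp only [M, LinearMap.smul_apply, LinearMap.add_apply, LinearMap.id_apply, map_smul, map_add, hTT]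
      rw [add_comm]
    · simp only [M, LinearMap.smul_apply, LinearMap.add_apply, LinearMap.id_apply, hT, (hk x).mp hx]
      rw [← two_smul ℝ, smul_smul]; norm_num
  have h1 : (finrank ℝ (noncompactPart θ) : ℝ) = 2⁻¹ * (finrank ℝ L - LinearMap.trace ℝ L T) := by
    rw [← hP.trace, map_smul, map_sub, LinearMap.trace_id, smul_eq_mul]
  have h2 : (finrank ℝ k : ℝ) = 2⁻¹ * (finrank ℝ L + LinearMap.trace ℝ L T) := by
    rw [← hM.trace, map_smul, map_add, LinearMap.trace_id, smul_eq_mul]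
  have h12 : finrank ℝ (noncompactPart θ) + finrank ℝ k = finrank ℝ L := by
    have : ((finrank ℝ (noncompactPart θ) + finrank ℝ k : ℕ) : ℝ) = (finrank ℝ L : ℝ) := by
      push_cast; linarith
    exact_mod_cast this
  let Q := (killingForm ℝ L).toQuadraticMap
  have hQ : ∀ x, Q x = killingForm ℝ L x x := fun _ => rfl
  have hQp : ∀ x ∈ noncompactPart θ, x ≠ 0 → 0 < Q x := fun x hx h0 => by
    have := hθ.pos x h0
    rw [(hp x).mp hx, map_neg, neg_neg] at this
    exact this
  have hQk : ∀ x ∈ k, x ≠ 0 → Q x < 0 := fun x hx h0 => by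
    have := hθ.pos x h0
    rw [(hk x).mp hx] at this
    rw [hQ]; linarith
  have s1 := le_sigPos_of_posDef (Q := Q) (V := noncompactPart θ)
    fun x hx => hQp x x.2 (by simpa using hx)
  have s2 := le_sigNeg_of_negDef (Q := Q) (V := k)
    fun x hx => neg_pos.mpr (hQk x x.2 (by simpa using hx))
  have s3 := QuadraticForm.sigPos_add_finrank_le_of_nonpos (Q := Q) (V := k) fun x hx => by
    by_cases h0 : x = 0
    · rw [h0, map_zero]
    · exact (hQk x hx h0).le
  have s4 := QuadraticForm.sigPos_add_finrank_le_of_nonpos (Q := -Q) (V := noncompactPart θ)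
    fun x hx => by
      by_cases h0 : x = 0
      · rw [h0, map_zero]
      · exact neg_nonpos.mpr (hQp x hx h0).le
  rw [sigPos_neg] at s4
  have e1 : sigPos Q = finrank ℝ (noncompactPart θ) := by omega
  have e2 : sigNeg Q = finrank ℝ k := by omega
  change (((sigPos Q : ℤ) - sigNeg Q : ℤ) : ℝ) = -LinearMap.trace ℝ L T
  rw [e1, e2]
  push_cast
  rw [h1, h2]; ring

lemma trace_pi {ι : Type*} [Fintype ι] [DecidableEq ι] (f : (ι → ℝ) →ₗ[ℝ] ι → ℝ) :
    LinearMap.trace ℝ (ι → ℝ) f = ∑ i, f (Pi.single i 1) i := by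
  rw [LinearMap.trace_eq_matrix_trace ℝ (Pi.basisFun ℝ ι)]
  exact Finset.sum_congr rfl fun i _ => by
    simp

end Signature

namespace LatticeLie

/-! #### The split real form -/

section Split

variable {n : ℕ} {C : Matrix (Fin n) (Fin n) ℤ} [IsSimplyLacedCartan C]

/-- The Chevalley involution of the split real form. -/
noncomputable def chevalleyEquiv : LatticeLie ℝ C ≃ₗ⁅ℝ⁆ LatticeLie ℝ C where
  toLinearMap := chevalleyMap
  map_lie' := chevalleyMap_lie _ _
  invFun := chevalleyMap
  left_inv := chevalleyMap_chevalleyMap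
  right_inv := chevalleyMap_chevalleyMap

lemma isCartanInvolution_chevalleyEquiv : IsCartanInvolution (chevalleyEquiv (C := C)) := by
  let β : LinearMap.BilinForm ℝ (LatticeLie ℝ C) := LinearMap.mk₂ ℝ form form_add_left
    (fun c x y => form_smul_left c x y) (fun x y z => form_add_right y z x)
    (fun c x y => form_smul_right c x y)
  refine isCartanInvolution_of_form _ chevalleyMap_chevalleyMap β form_comm form_lie
    (fun x y => ?_) (fun x hx => ?_) fun x hx => eq_zero_of_central hx
  · change form (chevalleyMap x) (chevalleyMap y) = form x y
    unfold form
    congr 1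
    · simp [chevalleyMap]
    · rw [← Equiv.sum_comp negRoot]
      refine Finset.sum_congr rfl fun a _ => ?_
      have h1 : (negRoot a).1 = -a.1 := rfl
      rw [h1, neg_neg, coeff_root]
      change coeff x (-(negRoot a).1) * coeff y (-a.1) = _
      rw [h1, neg_neg, coeff_root]
  · change 0 < -form x (chevalleyMap x)
    have h1 : form x (chevalleyMap x) = -(∑ i, ∑ j, x.cart i * C i j * x.cart j) -
        ∑ a, x.root a * x.root a := by
      unfold form
      congr 1
      · simp [chevalleyMap]
      · refine Finset.sum_congr rfl fun a _ => ?_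
        have h2 : -a.1 = (negRoot a).1 := rfl
        rw [h2, coeff_root]
        change _ * coeff x (-(-a.1)) = _
        rw [neg_neg, coeff_root]
    rw [h1]
    have h2 : 0 ≤ ∑ a, x.root a * x.root a := Finset.sum_nonneg fun _ _ => mul_self_nonneg _
    by_cases hc : x.cart = 0
    · have h3 : x.root ≠ 0 := fun hr => hx (LatticeLie.ext hc hr)
      obtain ⟨a, ha⟩ := Function.ne_iff.mp h3
      have h4 : 0 < ∑ a, x.root a * x.root a := Finset.sum_pos' (fun _ _ => mul_self_nonneg _)
        ⟨a, Finset.mem_univ _, mul_self_pos.mpr ha⟩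
      rw [hc]; simp; linarith
    · have := form_real_pos (C := C) hc
      linarith

/-- The split Cartan subalgebra. -/
noncomputable def cartanMap : (Fin n → ℝ) →ₗ[ℝ] LatticeLie ℝ C where
  toFun h := H C h
  map_add' h h' := LatticeLie.ext rfl (by simp [H])
  map_smul' c h := LatticeLie.ext rfl (by simp [H])

lemma cartanMap_injective : Function.Injective (cartanMap (C := C)) := fun _ _ h =>
  congrArg LatticeLie.cart h

lemma maximal_range_cartanMap : Maximal (fun U : Submodule ℝ (LatticeLie ℝ C) =>
    U ≤ noncompactPart (chevalleyEquiv (C := C)) ∧ ∀ x ∈ U, ∀ y ∈ U, ⁅x, y⁆ = 0)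
    (LinearMap.range (cartanMap (C := C))) := by
  refine ⟨⟨?_, ?_⟩, fun U hU hle x hx => ⟨x.cart, LatticeLie.ext rfl ?_⟩⟩
  · rintro _ ⟨h, rfl⟩
    change chevalleyMap (H C h) = -H C h
    rw [chevalleyMap_H]
    exact LatticeLie.ext rfl (by simp [H])
  · rintro _ ⟨h, rfl⟩ _ ⟨h', rfl⟩
    exact lie_H_H h h'
  · ext a
    have h1 : ⁅H C (fun i => (a.1 i : ℝ)), x⁆ = 0 := hU.2 _ (hle ⟨_, rfl⟩) x hx
    have h2 := lie_H_root (fun i => (a.1 i : ℝ)) x a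
    rw [h1, pair_intCast, show latForm C a.1 a.1 = 2 from a.2] at h2
    have h3 : x.root a = 0 := by simpa using h2
    exact h3.symm

lemma pair_eq_sum (h : Fin n → ℝ) (v : Fin n → ℤ) :
    pair C h v = ∑ i, (v i : ℝ) * pair C h (Pi.single i 1) := by
  simp only [pair, mulVec, dotProduct, Int.cast_sum, Int.cast_mul, Finset.mul_sum]
  rw [Finset.sum_comm]
  refine Finset.sum_congr rfl fun i _ => Finset.sum_congr rfl fun j _ => ?_
  simp [Pi.single_apply]; ring

theorem exists_hasType_split (hC : ∀ i j, i ≠ j → C i j ≤ 0) :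
    ∃ D : IwasawaDatum (LatticeLie ℝ C), D.HasType D.roots C (finiteRoots C) := by
  let 𝔞 := LinearMap.range (cartanMap (C := C))
  let E : (Fin n → ℝ) ≃ₗ[ℝ] 𝔞 := LinearEquiv.ofInjective cartanMap cartanMap_injective
  let σ : Fin n → Dual ℝ 𝔞 := fun i =>
    (∑ j, (C j i : ℝ) • (LinearMap.proj j : (Fin n → ℝ) →ₗ[ℝ] ℝ)) ∘ₗ (E.symm : 𝔞 →ₗ[ℝ] _)
  have hσ : ∀ i h, σ i (E h) = pair C h (Pi.single i 1) := fun i h => by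
    simp [σ, pair, mul_comm]
  have hsum : ∀ (c : Fin n → ℤ) h, (∑ i, c i • σ i) (E h) = pair C h c := fun c h => by
    rw [pair_eq_sum]
    simp [LinearMap.sum_apply, hσ]
  have hext : ∀ l l' : Dual ℝ 𝔞, (∀ t, l (E t) = l' (E t)) → l = l' := fun l l' h => by
    ext a
    obtain ⟨t, rfl⟩ := E.surjective a
    exact h t
  have hspace : ∀ l x, x ∈ restrictedRootSpace 𝔞 l ↔ ∀ h, ⁅H C h, x⁆ = l (E h) • x := fun l x => by
    refine ⟨fun h t => h (E t), fun h a => ?_⟩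
    obtain ⟨t, rfl⟩ := E.surjective a
    exact h t
  refine IwasawaDatum.exists_hasType isCartanInvolution_chevalleyEquiv maximal_range_cartanMap σ ?_
    (S := {c | latForm C c c = 2}) ?_
    (fun c hc => nonneg_or_nonpos_of_form_eq_two hC (fun _ => two_le_latForm) hc)
    latForm_single (IsSimplyLacedCartan.diag) (fun c hc i => ?_) ?_ (fun i m hm h1 => ?_) ?_
  · rw [Fintype.linearIndependent_iff]
    intro g hg
    by_contra! h0
    have hg0 : g ≠ 0 := fun h => by
      obtain ⟨i, hi⟩ := h0
      exact hi (congrFun h i)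
    refine (form_real_pos (C := C) hg0).ne' ?_
    have h1 := congrArg (fun l => l (E g)) hg
    simp only [LinearMap.sum_apply, LinearMap.smul_apply, hσ, smul_eq_mul, LinearMap.zero_apply] at h1
    rw [← h1, Finset.sum_comm]
    refine Finset.sum_congr rfl fun j _ => ?_
    simp only [pair, Finset.mul_sum]
    refine Finset.sum_congr rfl fun i _ => ?_
    simp; ring
  · ext l
    constructor
    · rintro ⟨hl, hl'⟩
      obtain ⟨x, hx, hx0⟩ := Submodule.exists_mem_ne_zero_of_ne_bot hl'
      rw [hspace] at hx
      obtain ⟨t, ht⟩ : ∃ t, l (E t) ≠ 0 := by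
        by_contra! h0
        exact hl (hext _ _ h0)
      have hcart : x.cart = 0 := by
        have h1 := congrArg LatticeLie.cart (hx t)
        rw [lie_H_cart, smul_cart] at h1
        exact (smul_eq_zero.mp h1.symm).resolve_left ht
      obtain ⟨a, ha⟩ : ∃ a, x.root a ≠ 0 := by
        by_contra! h0
        exact hx0 (LatticeLie.ext hcart (funext h0))
      refine ⟨a.1, a.2, hext _ _ fun h => ?_⟩
      rw [hsum]
      have h1 := congrFun (congrArg LatticeLie.root (hx h)) a
      rw [lie_H_root] at h1
      exact (mul_right_cancel₀ ha h1).symm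
    · rintro ⟨c, hc, rfl⟩
      refine ⟨fun h0 => ?_, fun h0 => ?_⟩
      · have h1 := hsum c fun i => (c i : ℝ)
        rw [h0, pair_intCast, show latForm C c c = 2 from hc] at h1
        simp at h1
      · have h1 : e ℝ C c ∈ restrictedRootSpace 𝔞 (∑ i, c i • σ i) := by
          rw [hspace]
          intro h
          rw [hsum, lie_H_e]
        rw [h0, Submodule.mem_bot] at h1
        have h2 := congrArg (fun y => coeff y c) h1
        simp only [coeff_e _ _ (show latForm C c c = 2 from hc), if_true] at h2
        simp [coeff] at h2
  · have h1 : ∑ j, C i j * c j = latForm C (Pi.single i 1) c := by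
      rw [latForm, single_one_dotProduct]; rfl
    have h2 : Pi.single i (∑ j, C i j * c j) = (∑ j, C i j * c j) • (Pi.single i 1 : Fin n → ℤ) := by
      ext j; simp [Pi.single_apply]
    change latForm C _ _ = 2
    have h3 : ∀ (m : ℤ) (v w : Fin n → ℤ), latForm C (c - m • v) (c - m • v) =
        latForm C c c - 2 * m * latForm C v c + m * m * latForm C v v := fun m v w => by
      have h4 := latForm_comm (C := C) c v
      unfold latForm at h4 ⊢
      simp only [sub_dotProduct, mulVec_sub, dotProduct_sub, mulVec_smul, smul_dotProduct,
        dotProduct_smul, smul_eq_mul, h4]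
      ring
    rw [h2, h3 _ _ c, h1, latForm_single, show latForm C c c = 2 from hc]
    ring
  · rintro _ ⟨i, rfl⟩
    exact latForm_single i
  · refine ⟨i, ?_⟩
    have h2 : latForm C (Pi.single i m) (Pi.single i m) = 2 * (m * m) := by
      simp [latForm, IsSimplyLacedCartan.diag (C := C) i]; ring
    have h3 : latForm C (Pi.single i m) (Pi.single i m) = 2 := h1
    rw [h2] at h3
    congr 1
    nlinarith
  · rintro _ ⟨i, rfl⟩
    exact ⟨i, 1, rfl⟩

theorem killingSignature_split : killingSignature (LatticeLie ℝ C) = n := by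
  have h1 := (isCartanInvolution_chevalleyEquiv (C := C)).killingSignature_eq
  let Φ : LatticeLie ℝ C ≃ₗ[ℝ] (Fin n → ℝ) × (LatticeRoot C → ℝ) := equivProd.linearEquiv ℝ
  let f : (LatticeRoot C → ℝ) →ₗ[ℝ] LatticeRoot C → ℝ :=
    LinearMap.funLeft ℝ ℝ (negRoot (C := C))
  have h2 : (chevalleyEquiv (C := C) : LatticeLie ℝ C →ₗ[ℝ] LatticeLie ℝ C) =
      Φ.symm.conj ((-LinearMap.id).prodMap f) := by
    refine LinearMap.ext fun x => LatticeLie.ext rfl (funext fun a => ?_)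
    exact coeff_root x (negRoot a)
  rw [h2, LinearMap.trace_conj', LinearMap.trace_prodMap', trace_pi f, map_neg, LinearMap.trace_id,
    Finset.sum_eq_zero] at h1
  · simp at h1
    exact_mod_cast h1
  · intro a _
    refine Pi.single_eq_of_ne (fun h : negRoot a = a => ?_) _
    have h3 : -a.1 = a.1 := congrArg Subtype.val h
    have h4 : a.1 = 0 := self_eq_neg.mp h3.symm
    have h5 := a.2
    rw [h4] at h5
    simp at h5

end Split

end LatticeLie

namespace LatticeLie

/-! #### Brackets with root vectors and Cayley transforms -/

section Cayley

variable {n : ℕ} {K : Type*} [Field K] [CharZero K] {C : Matrix (Fin n) (Fin n) ℤ}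
  [IsSimplyLacedCartan C]

lemma sum_e_root_mul {v : Fin n → ℤ} (hv : latForm C v v = 2) (f : LatticeRoot C → K) :
    ∑ a : LatticeRoot C, (e K C v).root a * f a = f ⟨v, hv⟩ := by
  rw [Finset.sum_eq_single_of_mem (⟨v, hv⟩ : LatticeRoot C) (Finset.mem_univ _)]
  · simp [e]
  · intro b _ hb
    have : b.1 ≠ v := fun h => hb (Subtype.ext h)
    simp [e, this]

lemma lie_e_cart {v : Fin n → ℤ} (hv : latForm C v v = 2) (x : LatticeLie K C) (i : Fin n) :
    ⁅e K C v, x⁆.cart i = -(coeff x (-v) * v i) := by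
  rw [lie_def]
  simp only [bracket, mul_assoc]
  rw [sum_e_root_mul hv fun b => coeff x (-b.1) * (b.1 i : K)]

lemma lie_e_root {v : Fin n → ℤ} (hv : latForm C v v = 2) {x : LatticeLie K C} (hx : x.cart = 0)
    (a : LatticeRoot C) :
    ⁅e K C v, x⁆.root a = latSign C v (a.1 - v) * coeff x (a.1 - v) := by
  have h0 : ∀ u, pair C (0 : Fin n → K) u = 0 := fun u => by simp [pair]
  have h1 : (e K C v).cart = 0 := rfl
  rw [lie_def]
  simp only [bracket, hx, h1, h0, zero_mul, sub_zero, zero_add]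
  rw [← sum_e_root_mul hv fun b => (latSign C b.1 (a.1 - b.1) : K) * coeff x (a.1 - b.1)]
  exact Finset.sum_congr rfl fun _ _ => by ring

lemma isNilpotent_ad_smul_e {v : Fin n → ℤ} (hv : latForm C v v = 2) (c : K) :
    IsNilpotent (LieAlgebra.ad K (LatticeLie K C) (c • e K C v)) := by
  have h1 : (LieAlgebra.ad K (LatticeLie K C) (e K C v)) ^ 3 = 0 := by
    refine LinearMap.ext fun x => ?_
    change ⁅e K C v, ⁅e K C v, ⁅e K C v, x⁆⁆⁆ = 0
    induction x using induction_gen with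
    | hadd a b ha hb => rw [lie_add, lie_add, lie_add, ha, hb, add_zero]
    | hsmul c a ha => rw [lie_smul, lie_smul, lie_smul, ha, smul_zero]
    | hH h => rw [lie_e_H, lie_neg, lie_smul, lie_self, smul_zero, neg_zero, lie_zero]
    | he w hw =>
      have h3 : ⁅e K C v, ⁅e K C v, e K C w⁆⁆ = _ := double_bracket hv hw hv
      rw [h3]
      split_ifs with h4 h5 h6
      · rw [lie_smul, lie_self, smul_zero]
      · exfalso
        have h7 : w = -(v + v) := eq_neg_of_add_eq_zero_right (by rw [add_assoc]; exact h6)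
        rw [h7, latForm_neg_right, latForm_add_right, hv] at h5
        omega
      · rw [e_eq_zero (v := v + (v + w)), smul_zero, smul_zero, lie_zero]
        simp only [latForm_add_left, latForm_add_right, hv, hw, h5, latForm_comm w v]
        norm_num
      · rw [lie_zero]
  exact ⟨3, by rw [map_smul, smul_pow, h1, smul_zero]⟩

lemma latForm_add_of_orthogonal {v w : Fin n → ℤ} (hv : latForm C v v = 2) (hw : latForm C w w = 2)
    (h : latForm C v w = 0) : latForm C (v + w) (v + w) = 4 := by
  rw [latForm_add_self hv hw, h]; norm_num

lemma lie_e_e_of_orthogonal {v w : Fin n → ℤ} (hv : latForm C v v = 2) (hw : latForm C w w = 2)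
    (h : latForm C v w = 0) : ⁅e K C v, e K C w⁆ = 0 := by
  have h1 := latForm_add_of_orthogonal hv hw h
  rw [lie_e_e hv hw, if_neg, e_eq_zero (by rw [h1]; norm_num), smul_zero]
  intro h0
  rw [h0] at h1
  simp [latForm] at h1

variable (K C) in
/-- The element `e_v - e_{-v}`. -/
def antiRoot (v : Fin n → ℤ) : LatticeLie K C := e K C v - e K C (-v)

/-- The Cayley transform of the root `v`. -/
lemma exists_cayley {v : Fin n → ℤ} (hv : latForm C v v = 2) :
    ∃ τ : LatticeLie K C ≃ₗ⁅K⁆ LatticeLie K C, τ (H C fun i => (v i : K)) = antiRoot K C v ∧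
      ∀ w, latForm C w w = 2 → latForm C v w = 0 →
        τ (H C fun i => (w i : K)) = (H C fun i => (w i : K)) ∧ τ (antiRoot K C w) = antiRoot K C w := by
  have hv' : latForm C (-v) (-v) = 2 := by rwa [latForm_neg_neg]
  set E := (-(1 / 2) : K) • e K C v with hE
  set F := (-1 : K) • e K C (-v) with hF
  have nE : IsNilpotent (LieAlgebra.ad K (LatticeLie K C) E) := isNilpotent_ad_smul_e hv _
  have nF : IsNilpotent (LieAlgebra.ad K (LatticeLie K C) F) := isNilpotent_ad_smul_e hv' _
  refine ⟨(adExp E nE).trans (adExp F nF), ?_, fun w hw hvw => ?_⟩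
  · have h1 : ⁅E, H C fun i => (v i : K)⁆ = e K C v := by
      rw [hE, smul_lie, lie_e_H, pair_intCast, hv, smul_neg, smul_smul]
      norm_num
    have h2 : ⁅E, e K C v⁆ = 0 := by rw [hE, smul_lie, lie_self, smul_zero]
    have h3 : ⁅F, H C fun i => (v i : K)⁆ = (-2 : K) • e K C (-v) := by
      rw [hF, smul_lie, lie_e_H, pair_intCast, latForm_neg_right, hv, smul_neg, smul_smul]
      norm_num
    have h4 : ⁅F, e K C v⁆ = -H C fun i => (v i : K) := by
      rw [hF, smul_lie, lie_e_e hv' hv, if_pos (neg_add_cancel v), neg_one_smul, neg_neg]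
      exact LatticeLie.ext (by ext i; simp [H]) (by simp [H])
    have h5 : ⁅F, e K C (-v)⁆ = 0 := by rw [hF, smul_lie, lie_self, smul_zero]
    change adExp F nF (adExp E nE _) = _
    rw [adExp_apply_of_lie_lie_eq_zero nE (by rw [h1, h2]), h1,
      adExp_apply_of_lie_lie_lie_eq_zero nF (by simp only [lie_add, h3, h4, lie_neg, lie_smul, h5]; simp)]
    simp only [lie_add, h3, h4, lie_neg, lie_smul, h5, antiRoot]
    module
  · have hw' : latForm C (-w) (-w) = 2 := by rwa [latForm_neg_neg]
    have hvw' : latForm C (-v) w = 0 := by rw [latForm_neg_left, hvw, neg_zero]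
    have o1 : ⁅E, H C fun i => (w i : K)⁆ = 0 := by
      rw [hE, smul_lie, lie_e_H, pair_intCast, latForm_comm, hvw]; simp
    have o2 : ⁅F, H C fun i => (w i : K)⁆ = 0 := by
      rw [hF, smul_lie, lie_e_H, pair_intCast, latForm_comm, hvw']; simp
    have o3 : ⁅E, antiRoot K C w⁆ = 0 := by
      rw [hE, antiRoot, smul_lie, lie_sub, lie_e_e_of_orthogonal hv hw hvw,
        lie_e_e_of_orthogonal hv hw' (by rw [latForm_neg_right, hvw, neg_zero]), sub_zero, smul_zero]
    have o4 : ⁅F, antiRoot K C w⁆ = 0 := by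
      rw [hF, antiRoot, smul_lie, lie_sub, lie_e_e_of_orthogonal hv' hw hvw',
        lie_e_e_of_orthogonal hv' hw' (by rw [latForm_neg_right, hvw', neg_zero]), sub_zero, smul_zero]
    constructor
    · change adExp F nF (adExp E nE _) = _
      rw [adExp_apply_of_lie_eq_zero nE o1, adExp_apply_of_lie_eq_zero nF o2]
    · change adExp F nF (adExp E nE _) = _
      rw [adExp_apply_of_lie_eq_zero nE o3, adExp_apply_of_lie_eq_zero nF o4]

lemma exists_cayley_of_orthogonal {ι : Type*} [Finite ι] {γ : ι → Fin n → ℤ}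
    (h2 : ∀ i, latForm C (γ i) (γ i) = 2) (h0 : ∀ i j, i ≠ j → latForm C (γ i) (γ j) = 0) :
    ∃ τ : LatticeLie K C ≃ₗ⁅K⁆ LatticeLie K C,
      ∀ i, τ (H C fun j => (γ i j : K)) = antiRoot K C (γ i) := by
  classical
  have := Fintype.ofFinite ι
  suffices h : ∀ s : Finset ι, ∃ τ : LatticeLie K C ≃ₗ⁅K⁆ LatticeLie K C,
      ∀ i, τ (H C fun j => (γ i j : K)) =
        if i ∈ s then antiRoot K C (γ i) else H C fun j => (γ i j : K) by
    obtain ⟨τ, hτ⟩ := h Finset.univ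
    exact ⟨τ, fun i => by rw [hτ, if_pos (Finset.mem_univ i)]⟩
  intro s
  induction s using Finset.induction_on with
  | empty => exact ⟨LieEquiv.refl, fun i => by simp⟩
  | insert i s hi ih =>
    obtain ⟨τ, hτ⟩ := ih
    obtain ⟨c, hc, hc'⟩ := exists_cayley (K := K) (h2 i)
    refine ⟨τ.trans c, fun j => ?_⟩
    change c (τ _) = _
    rw [hτ]
    by_cases hj : j = i
    · subst hj
      rw [if_neg hi, if_pos (Finset.mem_insert_self _ _), hc]
    · obtain ⟨h3, h4⟩ := hc' (γ j) (h2 j) (h0 i j (Ne.symm hj))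
      simp only [Finset.mem_insert, hj, false_or]
      split_ifs
      · exact h4
      · exact h3

end Cayley

/-! #### The Cartan involution of the real form -/

section RealForm

variable {n : ℕ} {C : Matrix (Fin n) (Fin n) ℤ} [IsSimplyLacedCartan C] {k : Fin n}

lemma mem_realForm {x : LatticeLie ℂ C} : x ∈ realForm C k ↔ conj k x = x := Iff.rfl

lemma cart_of_mem_realForm {x : LatticeLie ℂ C} (hx : x ∈ realForm C k) (i : Fin n) :
    x.cart i = (x.cart i).im * Complex.I := by
  have h1 : -(starRingEnd ℂ) (x.cart i) = x.cart i := congrFun (congrArg cart hx) i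
  have h2 := congrArg Complex.re h1
  simp at h2
  refine Complex.ext ?_ (by simp)
  simp; linarith

lemma root_of_mem_realForm {x : LatticeLie ℂ C} (hx : x ∈ realForm C k) (v : Fin n → ℤ) :
    coeff x (-v) = ((v k).negOnePow : ℤ) * (starRingEnd ℂ) (coeff x v) := by
  have h1 := coeff_conj k x (-v)
  rw [mem_realForm.mp hx, neg_neg, Pi.neg_apply, Int.negOnePow_neg] at h1
  exact h1

lemma conj_conj (x : LatticeLie ℂ C) : conj k (conj k x) = x := by
  refine ext_coeff (by simp [conj]) fun v => ?_
  rw [coeff_conj, coeff_conj, neg_neg, map_mul, Complex.conj_conj, map_intCast, ← mul_assoc,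
    Pi.neg_apply, Int.negOnePow_neg, negOnePow_mul_self, one_mul]

lemma conj_add (x y : LatticeLie ℂ C) : conj k (x + y) = conj k x + conj k y := by
  ext i
  · simp [conj]; ring
  · simp [conj, coeff_add, mul_add]

lemma conj_smul (c : ℂ) (x : LatticeLie ℂ C) : conj k (c • x) = (starRingEnd ℂ) c • conj k x := by
  ext i
  · simp [conj]
  · simp [conj, coeff_smul]; ring

lemma exists_mem_realForm_add_smul_I (z : LatticeLie ℂ C) :
    ∃ x ∈ realForm C k, ∃ y ∈ realForm C k, z = x + Complex.I • y := by
  refine ⟨(1 / 2 : ℂ) • (z + conj k z), ?_, (-Complex.I / 2) • (z + (-1 : ℂ) • conj k z), ?_, ?_⟩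
  · rw [mem_realForm, conj_smul, conj_add, conj_conj, add_comm (conj k z)]
    simp only [map_div₀, map_one, map_ofNat]
  · rw [mem_realForm, conj_smul, conj_add, conj_smul, conj_conj]
    simp only [map_div₀, map_neg, Complex.conj_I, map_one, map_ofNat]
    module
  · rw [smul_smul, show Complex.I * (-Complex.I / 2) = 1 / 2 by
      linear_combination (-1 / 2 : ℂ) * Complex.I_mul_I]
    module

lemma conj_parityMap (x : LatticeLie ℂ C) : conj k (parityMap k x) = parityMap k (conj k x) := by
  refine LatticeLie.ext rfl (funext fun a => ?_)
  have h1 : -a.1 = (negRoot a).1 := rfl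
  have h2 : (negRoot a).1 k = -a.1 k := rfl
  change _ * (starRingEnd ℂ) (coeff (parityMap k x) (-a.1)) =
    _ * (_ * (starRingEnd ℂ) (coeff x (-a.1)))
  rw [h1, coeff_root, coeff_root]
  change _ * (starRingEnd ℂ) (_ * _) = _
  rw [map_mul, map_intCast, h2, Int.negOnePow_neg]

variable (C k) in
/-- The Cartan involution of the real form. -/
noncomputable def realFormInvolution : realForm C k ≃ₗ⁅ℝ⁆ realForm C k where
  toFun x := ⟨parityMap k x.1, by rw [mem_realForm, conj_parityMap, mem_realForm.mp x.2]⟩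
  map_add' x y := Subtype.ext (map_add _ _ _)
  map_smul' c x := Subtype.ext (LatticeLie.ext rfl (funext fun _ => by simp [parityMap]))
  map_lie' := Subtype.ext (parityMap_lie _ _ _)
  invFun x := ⟨parityMap k x.1, by rw [mem_realForm, conj_parityMap, mem_realForm.mp x.2]⟩
  left_inv x := Subtype.ext (parityMap_parityMap _ _)
  right_inv x := Subtype.ext (parityMap_parityMap _ _)

lemma coeff_parityMap (x : LatticeLie ℂ C) (v : Fin n → ℤ) :
    coeff (parityMap k x) v = ((v k).negOnePow : ℤ) * coeff x v := by
  by_cases hv : v ⬝ᵥ C *ᵥ v = 2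
  · simp [coeff, hv, parityMap]
  · simp [coeff, hv]

lemma isCartanInvolution_realFormInvolution : IsCartanInvolution (realFormInvolution C k) := by
  let β : LinearMap.BilinForm ℝ (realForm C k) := LinearMap.mk₂ ℝ (fun x y => (form x.1 y.1).re)
    (fun x y z => by rw [← Complex.add_re, ← form_add_left]; rfl)
    (fun c x y => by rw [← Complex.smul_re, ← form_smul_left]; rfl)
    (fun x y z => by rw [← Complex.add_re, ← form_add_right]; rfl)
    (fun c x y => by rw [← Complex.smul_re, ← form_smul_right]; rfl)
  refine isCartanInvolution_of_form _ (fun x => Subtype.ext (parityMap_parityMap _ _)) β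
    (fun x y => congrArg Complex.re (form_comm _ _)) (fun x y z => ?_) (fun x y => ?_) (fun x hx => ?_)
    fun x hx => ?_
  · change (form ⁅x.1, y.1⁆ z.1).re = -(form y.1 ⁅x.1, z.1⁆).re
    rw [form_lie, Complex.neg_re]
  · change (form (parityMap k x.1) (parityMap k y.1)).re = (form x.1 y.1).re
    congr 1
    unfold form
    congr 1
    refine Finset.sum_congr rfl fun a _ => ?_
    rw [coeff_parityMap, Pi.neg_apply, Int.negOnePow_neg]
    change _ * _ * _ = _
    linear_combination (x.1.root a * coeff y.1 (-a.1)) * negOnePow_mul_self (K := ℂ) (a.1 k)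
  · change 0 < -(form x.1 (parityMap k x.1)).re
    have h1 : form x.1 (parityMap k x.1) = ((-(∑ i, ∑ j, (x.1.cart i).im * C i j * (x.1.cart j).im) -
        ∑ a, Complex.normSq (x.1.root a) : ℝ) : ℂ) := by
      unfold form
      push_cast
      congr 1
      · change ∑ i, ∑ j, x.1.cart i * C i j * x.1.cart j = _
        rw [← Finset.sum_neg_distrib]
        refine Finset.sum_congr rfl fun i _ => ?_
        rw [← Finset.sum_neg_distrib]
        refine Finset.sum_congr rfl fun j _ => ?_
        rw [cart_of_mem_realForm x.2 i, cart_of_mem_realForm x.2 j]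
        simp
        linear_combination ((x.1.cart i).im * C i j * (x.1.cart j).im : ℂ) * Complex.I_mul_I
      · refine Finset.sum_congr rfl fun a _ => ?_
        rw [coeff_parityMap, root_of_mem_realForm x.2, Pi.neg_apply, Int.negOnePow_neg, ← mul_assoc
          (((a.1 k).negOnePow : ℤ) : ℂ), negOnePow_mul_self, one_mul, coeff_root, Complex.mul_conj]
    rw [h1, Complex.ofReal_re]
    have h2 : 0 ≤ ∑ a, Complex.normSq (x.1.root a) := Finset.sum_nonneg fun _ _ => Complex.normSq_nonneg _
    by_cases hc : (fun i => (x.1.cart i).im) = 0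
    · have h3 : ∀ i, (x.1.cart i).im = 0 := congrFun hc
      have h4 : x.1.root ≠ 0 := fun hr => hx (Subtype.ext (LatticeLie.ext (funext fun i => by
        rw [cart_of_mem_realForm x.2 i, h3]; simp) hr))
      obtain ⟨a, ha⟩ := Function.ne_iff.mp h4
      have h5 : 0 < ∑ a, Complex.normSq (x.1.root a) :=
        Finset.sum_pos' (fun _ _ => Complex.normSq_nonneg _)
          ⟨a, Finset.mem_univ _, Complex.normSq_pos.mpr ha⟩
      simp only [h3]; simp; linarith
    · have := form_real_pos (C := C) hc
      linarith
  · refine Subtype.ext (eq_zero_of_central fun z => ?_)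
    obtain ⟨y, hy, w, hw, rfl⟩ := exists_mem_realForm_add_smul_I (k := k) z
    have h1 : ⁅x.1, y⁆ = 0 := congrArg Subtype.val (hx ⟨y, hy⟩)
    have h2 : ⁅x.1, w⁆ = 0 := congrArg Subtype.val (hx ⟨w, hw⟩)
    rw [lie_add, lie_smul, h1, h2, smul_zero, add_zero]

end RealForm

end LatticeLie

namespace LatticeLie

section Frame

variable {n r : ℕ} {C : Matrix (Fin n) (Fin n) ℤ} [IsSimplyLacedCartan C] {k : Fin n}

variable (C k) in
/-- A maximal set of orthogonal noncompact roots of the real form `realForm C k`. -/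
structure IsOddFrame (γ : Fin r → Fin n → ℤ) : Prop where
  form_self : ∀ i, latForm C (γ i) (γ i) = 2
  form_of_ne : ∀ i j, i ≠ j → latForm C (γ i) (γ j) = 0
  odd : ∀ i, Odd (γ i k)
  complete : ∀ v, latForm C v v = 2 → Odd (v k) → ∃ i, latForm C v (γ i) ≠ 0

lemma coeff_neg (x : LatticeLie ℂ C) (v : Fin n → ℤ) : coeff (-x) v = -coeff x v := by
  unfold coeff; split_ifs <;> simp

lemma coeff_eq_zero (x : LatticeLie ℂ C) {v : Fin n → ℤ} (hv : latForm C v v ≠ 2) :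
    coeff x v = 0 := dif_neg hv

lemma antiRoot_mem_realForm {v : Fin n → ℤ} (hv : latForm C v v = 2) (hk : Odd (v k)) :
    antiRoot ℂ C v ∈ realForm C k := by
  have hv' : latForm C (-v) (-v) = 2 := by rwa [latForm_neg_neg]
  have h1 : ∀ w, coeff (antiRoot ℂ C v) w = (if w = v then 1 else 0) - if w = -v then 1 else 0 :=
    fun w => by
      rw [antiRoot, sub_eq_add_neg, coeff_add, coeff_neg, coeff_e _ _ hv, coeff_e _ _ hv',
        ← sub_eq_add_neg]
  rw [mem_realForm]
  refine ext_coeff (by ext i; simp [conj, antiRoot, sub_eq_add_neg, e]) fun w => ?_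
  rw [coeff_conj, h1, h1]
  have h2 : v ≠ -v := fun h => by
    have := self_eq_neg.mp h
    rw [this] at hk
    simp at hk
  by_cases h3 : w = v
  · subst h3
    simp [h2, h2.symm, Int.negOnePow_odd _ hk]
  by_cases h4 : w = -v
  · subst h4
    simp [h2, h2.symm, Int.negOnePow_neg, Int.negOnePow_odd _ hk]
  · simp [h3, h4, neg_eq_iff_eq_neg]

lemma ofReal_smul_eq (t : ℝ) (x : LatticeLie ℂ C) : (t : ℂ) • x = t • x :=
  LatticeLie.ext (by ext; simp) (by ext; simp)

namespace IsOddFrame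

variable {γ : Fin r → Fin n → ℤ} (hγ : IsOddFrame C k γ)

include hγ

lemma form_neg_self (i : Fin r) : latForm C (-γ i) (-γ i) = 2 := by
  rw [latForm_neg_neg, hγ.form_self]

/-- The parametrization of the span of the elements `e_γ - e_{-γ}`. -/
noncomputable def map : (Fin r → ℝ) →ₗ[ℝ] realForm C k :=
  ∑ i, (LinearMap.proj i : (Fin r → ℝ) →ₗ[ℝ] ℝ).smulRight
    (⟨antiRoot ℂ C (γ i), antiRoot_mem_realForm (hγ.form_self i) (hγ.odd i)⟩ : realForm C k)

lemma coe_map (t : Fin r → ℝ) :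
    (hγ.map t : LatticeLie ℂ C) = ∑ i, (t i : ℂ) • antiRoot ℂ C (γ i) := by
  have h1 : hγ.map t = ∑ i, t i •
      (⟨antiRoot ℂ C (γ i), antiRoot_mem_realForm (hγ.form_self i) (hγ.odd i)⟩ : realForm C k) := by
    simp [map, LinearMap.sum_apply]
  rw [h1]
  refine (map_sum (realForm C k).toSubmodule.subtype _ _).trans
    (Finset.sum_congr rfl fun i _ => ?_)
  rw [ofReal_smul_eq]
  rfl

/-- A Cayley transform conjugates the span of the elements `e_γ - e_{-γ}` to that of the `γ`. -/
lemma exists_conjugation : ∃ τ : LatticeLie ℂ C ≃ₗ⁅ℂ⁆ LatticeLie ℂ C, ∀ t,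
    (hγ.map t : LatticeLie ℂ C) = τ (H C fun j => ∑ i, (t i : ℂ) * γ i j) := by
  obtain ⟨τ, hτ⟩ := exists_cayley_of_orthogonal (K := ℂ) hγ.form_self hγ.form_of_ne
  refine ⟨τ, fun t => ?_⟩
  have h1 : (H C fun j => ∑ i, (t i : ℂ) * γ i j) = ∑ i, (t i : ℂ) • H C fun j => (γ i j : ℂ) := by
    have h2 : ∀ s : Finset (Fin r), (H C fun j => ∑ i ∈ s, (t i : ℂ) * γ i j) =
        ∑ i ∈ s, (t i : ℂ) • H C fun j => (γ i j : ℂ) := fun s => by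
      classical
      induction s using Finset.induction_on with
      | empty => exact LatticeLie.ext (by ext; simp [H]) rfl
      | insert i s hi ih =>
        rw [Finset.sum_insert hi, ← ih]
        exact LatticeLie.ext (by ext j; simp [H, Finset.sum_insert hi]) (by simp [H])
    exact h2 _
  rw [h1, map_sum, coe_map]
  exact Finset.sum_congr rfl fun i _ => by rw [map_smul, hτ]

omit hγ in
lemma pair_sum (t : Fin r → ℝ) (v : Fin n → ℤ) :
    pair C (fun j => ∑ i, (t i : ℂ) * γ i j) v = ((∑ i, latForm C v (γ i) * t i : ℝ) : ℂ) := by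
  have h1 : ∀ i, (latForm C v (γ i) : ℂ) = pair C (fun j => (γ i j : ℂ)) v := fun i => by
    rw [latForm_comm, pair_intCast]
  push_cast
  simp only [h1, pair, Finset.sum_mul]
  rw [Finset.sum_comm]
  exact Finset.sum_congr rfl fun i _ => Finset.sum_congr rfl fun j _ => by ring

lemma coeff_map (t : Fin r → ℝ) (v : Fin n → ℤ) : coeff (hγ.map t : LatticeLie ℂ C) v =
    ∑ i, (t i : ℂ) * ((if v = γ i then 1 else 0) - if v = -γ i then 1 else 0) := by
  rw [coe_map]
  refine (map_sum (AddMonoidHom.mk' (fun y : LatticeLie ℂ C => coeff y v) fun x y =>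
    coeff_add x y v) _ _).trans (Finset.sum_congr rfl fun i _ => ?_)
  change coeff ((t i : ℂ) • antiRoot ℂ C (γ i)) v = _
  rw [coeff_smul, antiRoot, sub_eq_add_neg, coeff_add, coeff_neg,
    coeff_e _ _ (hγ.form_self i), coeff_e _ _ (hγ.form_neg_self i), ← sub_eq_add_neg, smul_eq_mul]

lemma ne_neg (i j : Fin r) : γ i ≠ -γ j := fun h => by
  by_cases hij : i = j
  · subst hij
    have h1 := self_eq_neg.mp h
    have h2 := hγ.odd i
    rw [h1] at h2
    simp at h2
  · have h1 := hγ.form_of_ne i j hij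
    rw [h, latForm_neg_left, hγ.form_self] at h1
    norm_num at h1

lemma injective : Function.Injective γ := fun i j h => by
  by_contra hij
  have h1 := hγ.form_of_ne i j hij
  rw [h, hγ.form_self] at h1
  norm_num at h1

lemma coeff_map_apply (t : Fin r → ℝ) (i : Fin r) :
    coeff (hγ.map t : LatticeLie ℂ C) (γ i) = t i := by
  rw [coeff_map, Finset.sum_eq_single_of_mem i (Finset.mem_univ i)]
  · simp [hγ.ne_neg i i]
  · intro j _ hj
    simp [hγ.ne_neg i j, hγ.injective.eq_iff, hj.symm]

lemma map_injective : Function.Injective hγ.map := fun t t' h => funext fun i => by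
  have h1 := hγ.coeff_map_apply t i
  rw [h, hγ.coeff_map_apply] at h1
  exact_mod_cast h1.symm

lemma cart_map (t : Fin r → ℝ) : (hγ.map t : LatticeLie ℂ C).cart = 0 := by
  rw [coe_map]
  refine (map_sum (AddMonoidHom.mk' (fun y : LatticeLie ℂ C => y.cart) fun _ _ => rfl) _ _).trans
    (Finset.sum_eq_zero fun i _ => ?_)
  change ((t i : ℂ) • antiRoot ℂ C (γ i)).cart = 0
  rw [smul_cart, antiRoot, sub_eq_add_neg, add_cart, neg_cart]
  simp [e]

omit hγ in
/-- A vector of norm `2` that is not orthogonal to the norm `2` vector `w` is `± w` or has inner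
product `± 1` with `w`. -/
lemma _root_.LatticeLie.latForm_cases {v w : Fin n → ℤ} (hv : latForm C v v = 2)
    (hw : latForm C w w = 2) : v = w ∨ v = -w ∨ latForm C v w = 0 ∨ latForm C v w = 1 ∨
      latForm C v w = -1 := by
  have h1 := latForm_ge hv hw
  have h2 := latForm_ge (C := C) (v := -v) (by rwa [latForm_neg_neg]) hw
  rw [latForm_neg_left] at h2
  by_cases h3 : latForm C v w = 2
  · refine Or.inl (sub_eq_zero.mp (latForm_self_eq_zero (C := C) ?_))
    rw [sub_eq_add_neg, latForm_add_self hv (by rwa [latForm_neg_neg]), latForm_neg_right, h3]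
    norm_num
  by_cases h4 : latForm C v w = -2
  · refine Or.inr (Or.inl (eq_neg_of_add_eq_zero_left (latForm_self_eq_zero (C := C) ?_)))
    rw [latForm_add_self hv hw, h4]
    norm_num
  · omega

lemma map_theta (t : Fin r → ℝ) : realFormInvolution C k (hγ.map t) = -hγ.map t := by
  refine Subtype.ext (ext_coeff ?_ fun v => ?_)
  · change (hγ.map t : LatticeLie ℂ C).cart = -(hγ.map t : LatticeLie ℂ C).cart
    rw [cart_map, neg_zero]
  · change coeff (parityMap k (hγ.map t : LatticeLie ℂ C)) v = coeff (-(hγ.map t : LatticeLie ℂ C)) v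
    rw [coeff_parityMap, ← neg_one_smul ℂ, coeff_smul, coeff_map, smul_eq_mul, Finset.mul_sum,
      Finset.mul_sum]
    refine Finset.sum_congr rfl fun i _ => ?_
    by_cases h1 : v = γ i
    · simp [h1, Int.negOnePow_odd _ (hγ.odd i)]
    by_cases h2 : v = -γ i
    · simp [h2, Int.negOnePow_odd _ (hγ.odd i)]
    · simp [h1, h2]

lemma map_lie_map (t t' : Fin r → ℝ) : ⁅hγ.map t, hγ.map t'⁆ = 0 := by
  obtain ⟨τ, hτ⟩ := hγ.exists_conjugation
  refine Subtype.ext ?_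
  change ⁅(hγ.map t : LatticeLie ℂ C), (hγ.map t' : LatticeLie ℂ C)⁆ = 0
  rw [hτ, hτ, ← LieEquiv.map_lie, lie_H_H, map_zero]

lemma maximal_range : Maximal (fun U : Submodule ℝ (realForm C k) =>
    U ≤ noncompactPart (realFormInvolution C k) ∧ ∀ x ∈ U, ∀ y ∈ U, ⁅x, y⁆ = 0)
    (LinearMap.range hγ.map) := by
  refine ⟨⟨?_, ?_⟩, fun U hU hle A hA => ⟨fun i => (coeff (A : LatticeLie ℂ C) (γ i)).re, ?_⟩⟩
  · rintro _ ⟨t, rfl⟩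
    exact hγ.map_theta t
  · rintro _ ⟨t, rfl⟩ _ ⟨t', rfl⟩
    exact hγ.map_lie_map t t'
  obtain ⟨x, hx⟩ := A
  have hθ : parityMap k x = -x := congrArg Subtype.val (hU.1 hA)
  have hcart : x.cart = 0 := self_eq_neg.mp (congrArg cart hθ)
  have heven : ∀ v, Even (v k) → coeff x v = 0 := fun v hv => by
    have h1 := congrArg (fun y => coeff y v) hθ
    simp only [coeff_parityMap, Int.negOnePow_even _ hv, ← neg_one_smul ℂ x, coeff_smul] at h1
    simp at h1
    exact self_eq_neg.mp h1
  have hcomm : ∀ i, ⁅antiRoot ℂ C (γ i), x⁆ = 0 := fun i => by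
    have h1 := hU.2 _ (hle ⟨Pi.single i 1, rfl⟩) _ hA
    have h2 : ⁅(hγ.map (Pi.single i 1) : LatticeLie ℂ C), x⁆ = 0 := congrArg Subtype.val h1
    rw [coe_map, Finset.sum_eq_single_of_mem i (Finset.mem_univ i)] at h2
    · simpa using h2
    · intro j _ hj
      rw [Pi.single_eq_of_ne hj]; simp
  have hneg : ∀ i, coeff x (-γ i) = -coeff x (γ i) := fun i => by
    have h1 := congrFun (congrArg cart (hcomm i)) k
    rw [antiRoot, sub_lie, sub_eq_add_neg, add_cart, neg_cart, Pi.add_apply, Pi.neg_apply,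
      lie_e_cart (hγ.form_self i), lie_e_cart (hγ.form_neg_self i), neg_neg (γ i), zero_cart,
      Pi.zero_apply, Pi.neg_apply] at h1
    have h2 : ((γ i k : ℤ) : ℂ) ≠ 0 := by
      have := hγ.odd i
      intro h
      have h3 : γ i k = 0 := by exact_mod_cast h
      rw [h3] at this
      simp at this
    push_cast at h1
    have h3 : (coeff x (-γ i) + coeff x (γ i)) * (γ i k : ℂ) = 0 := by linear_combination -h1
    exact eq_neg_of_add_eq_zero_left ((mul_eq_zero.mp h3).resolve_right h2)
  have hreal : ∀ i, (starRingEnd ℂ) (coeff x (γ i)) = coeff x (γ i) := fun i => by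
    have h1 := root_of_mem_realForm hx (γ i)
    rw [hneg, Int.negOnePow_odd _ (hγ.odd i)] at h1
    simp at h1
    exact h1.symm
  have hzero : ∀ v, latForm C v v = 2 → Odd (v k) → (∀ i, v ≠ γ i) → (∀ i, v ≠ -γ i) →
      coeff x v = 0 := fun v hv hk h1 h2 => by
    have key : ∀ i w, latForm C w w = 2 →
        latSign C (γ i) (w - γ i) * coeff x (w - γ i) -
          latSign C (-γ i) (w - -γ i) * coeff x (w - -γ i) = 0 := fun i w hw => by
      have h3 := congrFun (congrArg root (hcomm i)) ⟨w, hw⟩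
      rwa [antiRoot, sub_lie, sub_eq_add_neg, add_root, neg_root, Pi.add_apply, Pi.neg_apply,
        lie_e_root (hγ.form_self i) hcart, lie_e_root (hγ.form_neg_self i) hcart,
        ← sub_eq_add_neg] at h3
    have hsign : ∀ v w : Fin n → ℤ, (latSign C v w : ℂ) ≠ 0 := fun v w h => by
      have h3 := latSign_sq (C := C) v w
      have h4 : latSign C v w = 0 := by exact_mod_cast h
      rw [h4] at h3
      norm_num at h3
    obtain ⟨i, hi⟩ := hγ.complete v hv hk
    have hi2 := hγ.form_self i
    have hi' := latForm_comm (C := C) (γ i) v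
    rcases latForm_cases hv hi2 with h | h | h | h | h
    · exact absurd h (h1 i)
    · exact absurd h (h2 i)
    · exact absurd h hi
    · have h3 := key i (v - γ i) (by
        simp only [sub_eq_add_neg, latForm_add_left, latForm_add_right, latForm_neg_left,
          latForm_neg_right, hi', h, hv, hi2]; norm_num)
      rw [coeff_eq_zero x (v := v - γ i - γ i) (by
        simp only [sub_eq_add_neg, latForm_add_left, latForm_add_right, latForm_neg_left,
          latForm_neg_right, hi', h, hv, hi2]; norm_num), sub_neg_eq_add, sub_add_cancel, mul_zero,
        zero_sub, neg_eq_zero] at h3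
      exact (mul_eq_zero.mp h3).resolve_left (hsign _ _)
    · have h3 := key i (v + γ i) (by
        simp only [latForm_add_left, latForm_add_right, hi', h, hv, hi2]; norm_num)
      rw [coeff_eq_zero x (v := v + γ i - -γ i) (by
        simp only [sub_neg_eq_add, latForm_add_left, latForm_add_right, hi', h, hv, hi2]; norm_num),
        add_sub_cancel_right, mul_zero, sub_zero] at h3
      exact (mul_eq_zero.mp h3).resolve_left (hsign _ _)
  refine Subtype.ext (ext_coeff ?_ fun v => ?_)
  · rw [cart_map, hcart]
  by_cases h1 : ∃ i, v = γ i
  · obtain ⟨i, rfl⟩ := h1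
    rw [coeff_map_apply]
    exact Complex.conj_eq_iff_re.mp (hreal i)
  by_cases h2 : ∃ i, v = -γ i
  · obtain ⟨i, rfl⟩ := h2
    rw [root_of_mem_realForm (hγ.map _).2, root_of_mem_realForm hx, coeff_map_apply]
    congr 2
    exact Complex.conj_eq_iff_re.mp (hreal i)
  push Not at h1 h2
  have h3 : coeff (hγ.map fun i => (coeff x (γ i)).re : LatticeLie ℂ C) v = 0 := by
    rw [coeff_map]
    exact Finset.sum_eq_zero fun i _ => by simp [h1 i, h2 i]
  refine h3.trans ?_
  change 0 = coeff x v
  by_cases hv : latForm C v v = 2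
  · rcases Int.even_or_odd (v k) with h4 | h4
    · exact (heven v h4).symm
    · exact (hzero v hv h4 h1 h2).symm
  · exact (coeff_eq_zero x hv).symm

lemma mem_restrictedRoots_iff (l : Dual ℝ (LinearMap.range hγ.map)) :
    l ∈ restrictedRoots (LinearMap.range hγ.map) ↔
      ∃ d ∈ {d : Fin r → ℤ | d ≠ 0 ∧ ∃ v, latForm C v v = 2 ∧ ∀ i, d i = latForm C v (γ i)},
        ∀ t, l (LinearEquiv.ofInjective hγ.map hγ.map_injective t) = ∑ i, d i * t i := by
  let E := LinearEquiv.ofInjective hγ.map hγ.map_injective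
  have hspace : ∀ A, A ∈ restrictedRootSpace (LinearMap.range hγ.map) l ↔
      ∀ t, ⁅hγ.map t, A⁆ = l (E t) • A := fun A => by
    refine ⟨fun h t => h (E t), fun h a => ?_⟩
    obtain ⟨t, rfl⟩ := E.surjective a
    exact h t
  obtain ⟨τ, hτ⟩ := hγ.exists_conjugation
  constructor
  · rintro ⟨hl, hl'⟩
    obtain ⟨x, hx, hx0⟩ := Submodule.exists_mem_ne_zero_of_ne_bot hl'
    rw [hspace] at hx
    obtain ⟨y, hy⟩ : ∃ y, τ y = x := τ.surjective _
    have hy1 : ∀ t, ⁅(H C fun j => ∑ i, (t i : ℂ) * γ i j), y⁆ = (l (E t) : ℂ) • y := fun t => by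
      refine τ.injective ?_
      change τ _ = τ _
      rw [LieEquiv.map_lie, ← hτ, map_smul, hy, ofReal_smul_eq]
      exact congrArg Subtype.val (hx t)
    obtain ⟨t, ht⟩ : ∃ t, l (E t) ≠ 0 := by
      by_contra! h0
      refine hl (LinearMap.ext fun a => ?_)
      obtain ⟨t, rfl⟩ := E.surjective a
      exact h0 t
    have hcart : y.cart = 0 := by
      have h1 := congrArg cart (hy1 t)
      rw [lie_H_cart, smul_cart] at h1
      exact (smul_eq_zero.mp h1.symm).resolve_left (by exact_mod_cast ht)
    obtain ⟨a, ha⟩ : ∃ a, y.root a ≠ 0 := by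
      by_contra! h0
      refine hx0 (Subtype.ext ?_)
      rw [← hy, show y = 0 from LatticeLie.ext hcart (funext h0), map_zero]; rfl
    have h2 : ∀ t, l (E t) = ∑ i, (latForm C a.1 (γ i) : ℝ) * t i := fun t => by
      have h1 := congrFun (congrArg root (hy1 t)) a
      rw [lie_H_root, pair_sum] at h1
      exact_mod_cast (mul_right_cancel₀ ha h1).symm
    refine ⟨fun i => latForm C a.1 (γ i), ⟨fun h0 => ht ?_, a.1, a.2, fun _ => rfl⟩, h2⟩
    rw [h2]
    exact Finset.sum_eq_zero fun i _ => by
      rw [show latForm C a.1 (γ i) = 0 from congrFun h0 i]; simp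
  · rintro ⟨d, ⟨hd0, v, hv, hd⟩, hl⟩
    refine ⟨fun h0 => hd0 (funext fun i => ?_), fun h0 => ?_⟩
    · have h1 := hl (Pi.single i 1)
      rw [h0] at h1
      simpa [Pi.single_apply, eq_comm] using h1
    · have hy : ∀ t, ⁅(hγ.map t : LatticeLie ℂ C), τ (e ℂ C v)⁆ = (l (E t) : ℂ) • τ (e ℂ C v) :=
        fun t => by
          rw [hτ, ← LieEquiv.map_lie, lie_H_e, map_smul, pair_sum, hl]
          simp only [hd]
      obtain ⟨x, hx, y, hy', hxy⟩ := exists_mem_realForm_add_smul_I (k := k) (τ (e ℂ C v))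
      have hind : ∀ u ∈ realForm C k, ∀ w ∈ realForm C k, u + Complex.I • w = 0 → u = 0 ∧ w = 0 :=
        fun u hu w hw h => by
          have h1 := congrArg (conj k) h
          rw [conj_add, conj_smul, mem_realForm.mp hu, mem_realForm.mp hw, Complex.conj_I,
            mem_realForm.mp (realForm C k).zero_mem] at h1
          have h2 : (2 : ℂ) • u = 0 := by linear_combination (norm := module) h + h1
          have h3 : (2 * Complex.I) • w = 0 := by linear_combination (norm := module) h - h1
          exact ⟨(smul_eq_zero.mp h2).resolve_left two_ne_zero,
            (smul_eq_zero.mp h3).resolve_left (mul_ne_zero two_ne_zero Complex.I_ne_zero)⟩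
      have hxy' : ∀ t, ⁅(hγ.map t : LatticeLie ℂ C), x⁆ = l (E t) • x ∧
          ⁅(hγ.map t : LatticeLie ℂ C), y⁆ = l (E t) • y := fun t => by
        have h1 := hy t
        rw [hxy, lie_add, lie_smul] at h1
        have h2 := hind (⁅(hγ.map t : LatticeLie ℂ C), x⁆ - l (E t) • x)
          ((realForm C k).sub_mem ((realForm C k).lie_mem (hγ.map t).2 hx)
            ((realForm C k).smul_mem _ hx))
          (⁅(hγ.map t : LatticeLie ℂ C), y⁆ - l (E t) • y)
          ((realForm C k).sub_mem ((realForm C k).lie_mem (hγ.map t).2 hy')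
            ((realForm C k).smul_mem _ hy')) (by
            rw [← ofReal_smul_eq, ← ofReal_smul_eq]
            linear_combination (norm := module) h1)
        exact ⟨sub_eq_zero.mp h2.1, sub_eq_zero.mp h2.2⟩
      have hz : ∀ z (hz : z ∈ realForm C k), (∀ t, ⁅(hγ.map t : LatticeLie ℂ C), z⁆ = l (E t) • z) →
          z = 0 := fun z hz h => by
        have h1 : (⟨z, hz⟩ : realForm C k) ∈ restrictedRootSpace (LinearMap.range hγ.map) l :=
          (hspace _).mpr fun t => Subtype.ext (h t)
        rw [h0, Submodule.mem_bot] at h1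
        exact congrArg Subtype.val h1
      rw [hz x hx fun t => (hxy' t).1, hz y hy' fun t => (hxy' t).2, smul_zero, add_zero] at hxy
      have h3 : e ℂ C v = 0 := τ.injective (hxy.trans (map_zero τ).symm)
      have h4 := congrArg (fun y => coeff y v) h3
      simp only [coeff_e _ _ hv, if_true] at h4
      simp [coeff] at h4

/-- Bessel's inequality. -/
lemma sum_sq_le {v : Fin n → ℤ} (hv : latForm C v v = 2) :
    ∑ i, latForm C v (γ i) * latForm C v (γ i) ≤ 4 := by
  let u : Fin n → ℤ := ∑ i, latForm C v (γ i) • γ i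
  have hl : ∀ (f : Fin r → ℤ) w, latForm C w (∑ i, f i • γ i) = ∑ i, f i * latForm C w (γ i) :=
    fun f w => by
      simp only [latForm, mulVec_sum, dotProduct_sum, mulVec_smul, dotProduct_smul, smul_eq_mul]
  have h1 : latForm C v u = ∑ i, latForm C v (γ i) * latForm C v (γ i) := hl _ _
  have h2 : latForm C u u = 2 * ∑ i, latForm C v (γ i) * latForm C v (γ i) := by
    rw [hl, Finset.mul_sum]
    refine Finset.sum_congr rfl fun i _ => ?_
    rw [latForm_comm u, hl, Finset.sum_eq_single_of_mem i (Finset.mem_univ i), hγ.form_self]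
    · ring
    · intro j _ hj
      rw [hγ.form_of_ne _ _ hj.symm, mul_zero]
  have h3 := latForm_self_nonneg (C := C) (v + v - u)
  have h4 := latForm_comm (C := C) u v
  simp only [sub_eq_add_neg, latForm_add_left, latForm_add_right, latForm_neg_left,
    latForm_neg_right, h4, h1, h2, hv] at h3
  linarith

end IsOddFrame

end Frame

end LatticeLie

namespace LatticeLie

section RealFormTypes

variable {n r : ℕ} {C : Matrix (Fin n) (Fin n) ℤ} [IsSimplyLacedCartan C] {k : Fin n}

/-! #### The signature of the real form -/

variable (C k) in
/-- Real coordinates on the real form. -/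
noncomputable def realFormEquiv :
    realForm C k ≃ₗ[ℝ] (Fin n → ℝ) × (LatticeRoot C → ℝ) where
  toFun x := (fun i => (x.1.cart i).im, fun a => (x.1.root a).re + (x.1.root a).im)
  map_add' x y := by
    refine Prod.ext (funext fun i => ?_) (funext fun a => ?_)
    · exact Complex.add_im _ _
    · change (x.1.root a + y.1.root a).re + (x.1.root a + y.1.root a).im = _ + _ + (_ + _)
      rw [Complex.add_re, Complex.add_im]; ring
  map_smul' c x := by
    refine Prod.ext (funext fun i => ?_) (funext fun a => ?_)
    · exact Complex.smul_im _ _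
    · change (c • x.1.root a).re + (c • x.1.root a).im = c • (_ + _)
      rw [Complex.smul_re, Complex.smul_im, smul_add]
  invFun p := ⟨⟨fun i => p.1 i * Complex.I, fun a =>
    ⟨(p.2 a + (a.1 k).negOnePow * p.2 (negRoot a)) / 2,
      (p.2 a - (a.1 k).negOnePow * p.2 (negRoot a)) / 2⟩⟩, by
    rw [mem_realForm]
    refine LatticeLie.ext (funext fun i => ?_) (funext fun a => ?_)
    · simp [conj]
    · change _ * (starRingEnd ℂ) (coeff _ (negRoot a).1) = _
      rw [coeff_root]
      have h1 : negRoot (negRoot a) = a := Subtype.ext (neg_neg a.1)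
      have h2 : ((negRoot a).1 k).negOnePow = (a.1 k).negOnePow := Int.negOnePow_neg _
      have h3 := negOnePow_mul_self (K := ℝ) (a.1 k)
      simp only [h1, h2]
      refine Complex.ext ?_ ?_
      · simp [-Int.coe_negOnePow]
        linear_combination (p.2 a / 2) * h3
      · simp [-Int.coe_negOnePow]
        linear_combination (p.2 a / 2) * h3⟩
  left_inv x := by
    refine Subtype.ext (LatticeLie.ext (funext fun i => (cart_of_mem_realForm x.2 i).symm)
      (funext fun a => ?_))
    have h1 : x.1.root (negRoot a) = _ := (coeff_root x.1 (negRoot a)).symm.trans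
      (root_of_mem_realForm x.2 a.1)
    rw [coeff_root] at h1
    have h3 := negOnePow_mul_self (K := ℝ) (a.1 k)
    have h4 : (x.1.root (negRoot a)).re = ((a.1 k).negOnePow : ℤ) * (x.1.root a).re := by
      rw [h1]; simp [-Int.coe_negOnePow]
    have h5 : (x.1.root (negRoot a)).im = -(((a.1 k).negOnePow : ℤ) * (x.1.root a).im) := by
      rw [h1]; simp [-Int.coe_negOnePow]
    refine Complex.ext ?_ ?_
    · change (_ + _ * (_ + _)) / 2 = _
      rw [h4, h5]
      linear_combination ((x.1.root a).re - (x.1.root a).im) / 2 * h3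
    · change (_ - _ * (_ + _)) / 2 = _
      rw [h4, h5]
      linear_combination -((x.1.root a).re - (x.1.root a).im) / 2 * h3
  right_inv p := by
    refine Prod.ext (funext fun i => ?_) (funext fun a => ?_)
    · simp
    · change (_ + _) / 2 + (_ - _) / 2 = _
      ring

lemma killingSignature_realForm_eq :
    killingSignature (realForm C k) = -(n + ∑ a : LatticeRoot C, ((a.1 k).negOnePow : ℤ)) := by
  have h1 := (isCartanInvolution_realFormInvolution (C := C) (k := k)).killingSignature_eq
  let f : (LatticeRoot C → ℝ) →ₗ[ℝ] LatticeRoot C → ℝ :=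
    LinearMap.pi fun a => (((a.1 k).negOnePow : ℤ) : ℝ) • LinearMap.proj a
  have h2 : (realFormInvolution C k : realForm C k →ₗ[ℝ] realForm C k) =
      (realFormEquiv C k).symm.conj (LinearMap.id.prodMap f) := by
    refine LinearMap.ext fun x => (realFormEquiv C k).injective ?_
    rw [LinearEquiv.conj_apply_apply, LinearEquiv.apply_symm_apply]
    refine Prod.ext rfl (funext fun a => ?_)
    change (_ * x.1.root a).re + (_ * x.1.root a).im = _ * (_ + _)
    simp [-Int.coe_negOnePow]
    ring
  rw [h2, LinearMap.trace_conj', LinearMap.trace_prodMap', trace_pi f, LinearMap.trace_id] at h1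
  simp [f, -Int.coe_negOnePow] at h1
  have h3 : ((killingSignature (realForm C k) : ℤ) : ℝ) =
      ((-(n + ∑ a : LatticeRoot C, ((a.1 k).negOnePow : ℤ)) : ℤ) : ℝ) := by
    rw [h1]; push_cast; ring
  exact_mod_cast h3

/-- The reflection in a root. -/
def reflRoot {w : Fin n → ℤ} (hw : latForm C w w = 2) : LatticeRoot C ≃ LatticeRoot C :=
  have hinv : ∀ v, latForm C v v = 2 → latForm C (v - latForm C v w • w) (v - latForm C v w • w) = 2 :=
    fun v hv => by
      have h1 := latForm_comm (C := C) w v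
      unfold latForm at h1 hv hw ⊢
      simp only [sub_dotProduct, mulVec_sub, dotProduct_sub, mulVec_smul, smul_dotProduct,
        dotProduct_smul, smul_eq_mul, h1, hv, hw]
      ring
  Function.Involutive.toPerm (fun a => ⟨a.1 - latForm C a.1 w • w, hinv a.1 a.2⟩) fun a => by
    refine Subtype.ext ?_
    have h1 : latForm C (a.1 - latForm C a.1 w • w) w = -latForm C a.1 w := by
      unfold latForm at hw ⊢
      simp only [sub_dotProduct, smul_dotProduct, smul_eq_mul, hw]
      ring
    change a.1 - _ • w - latForm C (a.1 - latForm C a.1 w • w) w • w = a.1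
    rw [h1]; module

namespace IsOddFrame

variable {γ : Fin r → Fin n → ℤ} (hγ : IsOddFrame C k γ)

include hγ

lemma sum_negOnePow : ∑ a : LatticeRoot C, ((a.1 k).negOnePow : ℤ) =
    (Finset.univ.filter fun a : LatticeRoot C => ∀ i, latForm C a.1 (γ i) = 0).card - 2 * r := by
  classical
  let p : LatticeRoot C → Fin r → ZMod 2 := fun a i => (latForm C a.1 (γ i) : ZMod 2)
  have hodd : ∀ q : Fin r → ZMod 2, q ≠ 0 →
      ∑ a : LatticeRoot C, (if p a = q then ((a.1 k).negOnePow : ℤ) else 0) = 0 := fun q hq => by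
    obtain ⟨i, hi⟩ := Function.ne_iff.mp hq
    refine self_eq_neg.mp ?_
    conv_lhs => rw [← Equiv.sum_comp (reflRoot (hγ.form_self i))]
    rw [← Finset.sum_neg_distrib]
    refine Finset.sum_congr rfl fun a _ => ?_
    have h1 : p (reflRoot (hγ.form_self i) a) = p a := funext fun j => by
      change ((latForm C (a.1 - latForm C a.1 (γ i) • γ i) (γ j) : ℤ) : ZMod 2) =
        ((latForm C a.1 (γ j) : ℤ) : ZMod 2)
      have h2 : latForm C (a.1 - latForm C a.1 (γ i) • γ i) (γ j) =
          latForm C a.1 (γ j) - latForm C a.1 (γ i) * latForm C (γ i) (γ j) := by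
        simp only [latForm, sub_dotProduct, smul_dotProduct, smul_eq_mul]
      rw [ZMod.intCast_eq_intCast_iff_dvd_sub, h2]
      by_cases hij : i = j
      · subst hij
        rw [hγ.form_self]
        exact ⟨latForm C a.1 (γ i), by push_cast; ring⟩
      · rw [hγ.form_of_ne _ _ hij]
        simp
    rw [h1]
    split_ifs with h2
    · have h3 : Odd (latForm C a.1 (γ i)) := by
        rw [← Int.not_even_iff_odd, even_iff_two_dvd]
        intro h4
        refine hi ?_
        rw [← h2]
        exact (ZMod.intCast_zmod_eq_zero_iff_dvd _ 2).mpr (by exact_mod_cast h4)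
      have h4 : (reflRoot (hγ.form_self i) a).1 k = a.1 k - latForm C a.1 (γ i) * γ i k := rfl
      rw [h4, Int.negOnePow_sub, Int.negOnePow_odd _ (h3.mul (hγ.odd i))]
      simp
    · simp
  have heven : ∀ a : LatticeRoot C, (if p a = 0 then ((a.1 k).negOnePow : ℤ) else 0) =
      (if ∀ i, latForm C a.1 (γ i) = 0 then 1 else 0) -
        ∑ i, ((if a = ⟨γ i, hγ.form_self i⟩ then 1 else 0) +
          if a = ⟨-γ i, hγ.form_neg_self i⟩ then 1 else 0) := fun a => by
    simp only [Subtype.ext_iff]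
    have hform : ∀ i j, latForm C (γ i) (γ j) = if i = j then 2 else 0 := fun i j => by
      split_ifs with h
      · rw [h, hγ.form_self]
      · exact hγ.form_of_ne i j h
    by_cases h1 : ∃ j, a.1 = γ j
    · obtain ⟨j, hj⟩ := h1
      have hp : p a = 0 := funext fun i => by
        change ((latForm C a.1 (γ i) : ℤ) : ZMod 2) = 0
        rw [hj, hform]; split_ifs <;> decide
      have hperp : ¬∀ i, latForm C a.1 (γ i) = 0 := fun h => by
        have := h j
        rw [hj, hγ.form_self] at this
        norm_num at this
      rw [if_pos hp, if_neg hperp, hj, Int.negOnePow_odd _ (hγ.odd j)]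
      simp [hγ.injective.eq_iff, hγ.ne_neg]
    by_cases h2 : ∃ j, a.1 = -γ j
    · obtain ⟨j, hj⟩ := h2
      have hp : p a = 0 := funext fun i => by
        change ((latForm C a.1 (γ i) : ℤ) : ZMod 2) = 0
        rw [hj, latForm_neg_left, hform]; split_ifs <;> decide
      have hperp : ¬∀ i, latForm C a.1 (γ i) = 0 := fun h => by
        have := h j
        rw [hj, latForm_neg_left, hγ.form_self] at this
        norm_num at this
      rw [if_pos hp, if_neg hperp, hj, Pi.neg_apply, Int.negOnePow_neg,
        Int.negOnePow_odd _ (hγ.odd j)]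
      simp [hγ.injective.eq_iff, (hγ.ne_neg _ _).symm]
    push Not at h1 h2
    simp only [h1, h2, if_false, add_zero, Finset.sum_const_zero, sub_zero]
    by_cases h3 : ∀ i, latForm C a.1 (γ i) = 0
    · have hp : p a = 0 := funext fun i => by simp [p, h3]
      have hk : Even (a.1 k) := by
        by_contra hk
        obtain ⟨i, hi⟩ := hγ.complete a.1 a.2 (Int.not_even_iff_odd.mp hk)
        exact hi (h3 i)
      rw [if_pos hp, if_pos h3, Int.negOnePow_even _ hk]; rfl
    · have hp : p a ≠ 0 := fun hp => by
        push Not at h3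
        obtain ⟨i, hi⟩ := h3
        have h4 : ((latForm C a.1 (γ i) : ℤ) : ZMod 2) = 0 := congrFun hp i
        rcases latForm_cases a.2 (hγ.form_self i) with h | h | h | h | h
        · exact h1 i h
        · exact h2 i h
        · exact hi h
        · rw [h] at h4; exact absurd h4 (by decide)
        · rw [h] at h4; exact absurd h4 (by decide)
      rw [if_neg hp, if_neg h3]
  have h1 : ∑ a : LatticeRoot C, ((a.1 k).negOnePow : ℤ) = ∑ q : Fin r → ZMod 2,
      ∑ a : LatticeRoot C, if p a = q then ((a.1 k).negOnePow : ℤ) else 0 := by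
    rw [Finset.sum_comm]
    exact Finset.sum_congr rfl fun a _ => by simp
  rw [h1, Finset.sum_eq_single_of_mem 0 (Finset.mem_univ _) fun q _ hq => hodd q hq]
  simp only [heven, Finset.sum_sub_distrib, Finset.card_filter]
  rw [Finset.sum_comm]
  simp [Finset.sum_add_distrib]
  ring

theorem killingSignature_eq : killingSignature (realForm C k) = 2 * r - n -
    (Finset.univ.filter fun a : LatticeRoot C => ∀ i, latForm C a.1 (γ i) = 0).card := by
  rw [killingSignature_realForm_eq, hγ.sum_negOnePow]; ring

lemma card_perp {T : Finset (Fin n → ℤ)} (hT : ∀ v, v ∈ T ↔ latForm C v v = 2 ∧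
    ∀ i, latForm C v (γ i) = 0) :
    (Finset.univ.filter fun a : LatticeRoot C => ∀ i, latForm C a.1 (γ i) = 0).card = T.card := by
  classical
  rw [← Finset.card_map (Function.Embedding.subtype _)]
  congr 1
  ext v
  simp only [Finset.mem_map, Finset.mem_filter, Finset.mem_univ, true_and, hT]
  constructor
  · rintro ⟨a, ha, rfl⟩
    exact ⟨a.2, ha⟩
  · rintro ⟨h1, h2⟩
    exact ⟨⟨v, h1⟩, h2, rfl⟩

/-- The type of the restricted roots. -/
theorem exists_hasType {N : Finset ℤ} (hN : ∀ x ∈ N, 1 ≤ x ∧ x ≤ 4)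
    (hmem : ∀ v, latForm C v v = 2 → (∃ i, latForm C v (γ i) ≠ 0) →
      ∑ i, latForm C v (γ i) * latForm C v (γ i) ∈ N)
    {X P Q : Matrix (Fin r) (Fin r) ℤ} {m : ℤ} (hm : 0 < m) (hPQ : P * Q = m • 1)
    (hX : ∀ i, X i i = 2) (hP : ∀ i, P i ⬝ᵥ P i ∈ N)
    (hXP : ∀ i j, X i j * (P i ⬝ᵥ P i) = 2 * (P i ⬝ᵥ P j)) (U : Finset (Fin n → ℤ))
    (hbox : ∀ b : Fin r → Fin 5, (fun i => (b i : ℤ) - 2) ⬝ᵥ (fun i => (b i : ℤ) - 2) ∈ N →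
      (∃ u ∈ U, latForm C (fun j => (∑ i, ((b i : ℤ) - 2) * γ i j + u j) / 2)
          (fun j => (∑ i, ((b i : ℤ) - 2) * γ i j + u j) / 2) = 2 ∧
        ∀ i, latForm C (fun j => (∑ i, ((b i : ℤ) - 2) * γ i j + u j) / 2) (γ i) = (b i : ℤ) - 2) ∧
      (fun l => ((fun i => (b i : ℤ) - 2) ᵥ* Q) l / m) ᵥ* P = (fun i => (b i : ℤ) - 2) ∧
      ((∀ l, 0 ≤ ((fun i => (b i : ℤ) - 2) ᵥ* Q) l) ∨
        ∀ l, ((fun i => (b i : ℤ) - 2) ᵥ* Q) l ≤ 0))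
    {G : Set (Fin r → ℤ)} (hGR : ∀ v ∈ G, (v ᵥ* P) ⬝ᵥ (v ᵥ* P) ∈ N)
    (hG : ∀ i n, 0 < n → n * n * (P i ⬝ᵥ P i) ∈ N → Pi.single i n ∈ G)
    (hG' : ∀ v ∈ G, ∃ i n, v = Pi.single i n) :
    ∃ D : IwasawaDatum (realForm C k), D.HasType D.roots X {v | WeylClosure X G v} := by
  have hb : ∀ d : Fin r → ℤ, d ⬝ᵥ d ∈ N → ∃ b : Fin r → Fin 5, d = fun i => (b i : ℤ) - 2 :=
    fun d hd => by
      have h1 : ∀ i, -2 ≤ d i ∧ d i ≤ 2 := fun i => by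
        have h2 : d i * d i ≤ d ⬝ᵥ d :=
          Finset.single_le_sum (f := fun j => d j * d j) (fun j _ => mul_self_nonneg _)
            (Finset.mem_univ i)
        have h3 := (hN _ hd).2
        constructor <;> nlinarith
      exact ⟨fun i => ⟨(d i + 2).toNat, by have := h1 i; omega⟩, funext fun i => by
        have := h1 i
        simp only
        omega⟩
  have hR : ∀ d : Fin r → ℤ, d ∈ {d : Fin r → ℤ | d ≠ 0 ∧
      ∃ v, latForm C v v = 2 ∧ ∀ i, d i = latForm C v (γ i)} ↔ d ⬝ᵥ d ∈ N := fun d => by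
    constructor
    · rintro ⟨hd0, v, hv, hd⟩
      obtain ⟨i, hi⟩ := Function.ne_iff.mp hd0
      have h1 := hmem v hv ⟨i, by rw [← hd]; exact hi⟩
      simp only [← hd] at h1
      exact h1
    · intro hd
      refine ⟨fun h0 => ?_, ?_⟩
      · rw [h0, zero_dotProduct] at hd
        have := (hN _ hd).1
        norm_num at this
      · obtain ⟨b, rfl⟩ := hb d hd
        obtain ⟨⟨u, -, h1, h2⟩, -⟩ := hbox b hd
        exact ⟨_, h1, fun i => (h2 i).symm⟩
  refine exists_hasType_of_coordinates isCartanInvolution_realFormInvolution hγ.maximal_range _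
    hγ.mem_restrictedRoots_iff (N := (N : Set ℤ)) hR hm.ne' hPQ hX (fun i => (hR _).mpr (hP i)) hXP
    (fun d hd => ?_) (fun c hc => ?_) (fun v hv => (hR _).mpr (hGR v hv)) (fun i l hl h => ?_) hG'
  · rw [hR] at hd
    obtain ⟨b, rfl⟩ := hb d hd
    exact ⟨_, (hbox b hd).2.1.symm⟩
  · rw [hR] at hc
    obtain ⟨b, hb⟩ := hb _ hc
    have h1 : (c ᵥ* P) ᵥ* Q = m • c := by
      rw [vecMul_vecMul, hPQ, vecMul_smul, vecMul_one]
    rw [hb] at hc h1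
    have h2 := (hbox b hc).2.2
    rw [h1] at h2
    simp only [Pi.smul_apply, smul_eq_mul] at h2
    refine h2.imp (fun h l => ?_) fun h l => ?_
    · have := h l; by_contra! h3; nlinarith
    · have := h l; by_contra! h3; nlinarith
  · rw [hR, smul_dotProduct, dotProduct_smul, smul_eq_mul, smul_eq_mul, ← mul_assoc] at h
    exact hG i l hl h

end IsOddFrame

end RealFormTypes

end LatticeLie

namespace LatticeLie

section ExceptionalTypes

/-- Orthogonal noncompact roots of `E_{6|-14}`. -/
def frameE₆ : Fin 2 → Fin 6 → ℤ := ![![1, 0, 0, 0, 0, 0], ![1, 1, 2, 2, 1, 0]]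

/-- Orthogonal noncompact roots of `E_{7|-5}`. -/
def frameE₇ : Fin 4 → Fin 7 → ℤ := ![![1, 0, 0, 0, 0, 0, 0], ![1, 1, 2, 2, 1, 0, 0],
  ![1, 1, 2, 2, 2, 2, 1], ![1, 2, 2, 4, 3, 2, 1]]

lemma latForm_frameE₆ (v : Fin 6 → ℤ) : latForm CartanMatrix.E₆ v (frameE₆ 0) = 2 * v 0 - v 2 ∧
    latForm CartanMatrix.E₆ v (frameE₆ 1) = v 2 - v 5 := by
  have h1 : CartanMatrix.E₆ *ᵥ frameE₆ 0 = ![2, 0, -1, 0, 0, 0] := by decide +kernel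
  have h2 : CartanMatrix.E₆ *ᵥ frameE₆ 1 = ![0, 0, 1, 0, 0, -1] := by decide +kernel
  simp only [latForm, h1, h2]
  simp [dotProduct, Fin.sum_univ_succ]
  constructor <;> ring

lemma latForm_frameE₇ (v : Fin 7 → ℤ) : latForm CartanMatrix.E₇ v (frameE₇ 0) = 2 * v 0 - v 2 ∧
    latForm CartanMatrix.E₇ v (frameE₇ 1) = v 2 - v 5 ∧
    latForm CartanMatrix.E₇ v (frameE₇ 2) = v 2 - v 3 + v 5 ∧
    latForm CartanMatrix.E₇ v (frameE₇ 3) = v 3 - v 2 := by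
  have h1 : CartanMatrix.E₇ *ᵥ frameE₇ 0 = ![2, 0, -1, 0, 0, 0, 0] := by decide +kernel
  have h2 : CartanMatrix.E₇ *ᵥ frameE₇ 1 = ![0, 0, 1, 0, 0, -1, 0] := by decide +kernel
  have h3 : CartanMatrix.E₇ *ᵥ frameE₇ 2 = ![0, 0, 1, -1, 0, 1, 0] := by decide +kernel
  have h4 : CartanMatrix.E₇ *ᵥ frameE₇ 3 = ![0, 0, -1, 1, 0, 0, 0] := by decide +kernel
  simp only [latForm, h1, h2, h3, h4]
  simp [dotProduct, Fin.sum_univ_succ]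
  refine ⟨?_, ?_, ?_, ?_⟩ <;> ring

/-- The roots of `E₆` orthogonal to the frame, which form a root system of type `A₃`. -/
def perpE₆ : Finset (Fin 6 → ℤ) :=
  {![0, 1, 0, 0, 0, 0], ![0, 0, 0, 1, 0, 0], ![0, 0, 0, 0, 1, 0], ![0, 1, 0, 1, 0, 0],
    ![0, 0, 0, 1, 1, 0], ![0, 1, 0, 1, 1, 0], ![0, -1, 0, 0, 0, 0], ![0, 0, 0, -1, 0, 0],
    ![0, 0, 0, 0, -1, 0], ![0, -1, 0, -1, 0, 0], ![0, 0, 0, -1, -1, 0], ![0, -1, 0, -1, -1, 0]}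

/-- The roots of `E₇` orthogonal to the frame, which form a root system of type `A₁ × A₁ × A₁`. -/
def perpE₇ : Finset (Fin 7 → ℤ) :=
  {![0, 1, 0, 0, 0, 0, 0], ![0, 0, 0, 0, 1, 0, 0], ![0, 0, 0, 0, 0, 0, 1], ![0, -1, 0, 0, 0, 0, 0],
    ![0, 0, 0, 0, -1, 0, 0], ![0, 0, 0, 0, 0, 0, -1]}

lemma mem_perpE₆ (v : Fin 6 → ℤ) : v ∈ perpE₆ ↔ latForm CartanMatrix.E₆ v v = 2 ∧
    ∀ i, latForm CartanMatrix.E₆ v (frameE₆ i) = 0 := by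
  constructor
  · have h : ∀ v ∈ perpE₆, latForm CartanMatrix.E₆ v v = 2 ∧
        ∀ i, latForm CartanMatrix.E₆ v (frameE₆ i) = 0 := by decide +kernel
    exact h v
  · rintro ⟨h1, h2⟩
    obtain ⟨h3, h4⟩ := latForm_frameE₆ v
    rw [h2] at h3 h4
    have hv : v = ![v 0, v 1, v 2, v 3, v 4, v 5] := by
      ext i; fin_cases i <;> rfl
    have e2 : v 2 = 2 * v 0 := by omega
    have e5 : v 5 = 2 * v 0 := by omega
    simp [latForm, CartanMatrix.E₆, dotProduct, mulVec, Fin.sum_univ_succ] at h1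
    rw [e2, e5] at hv h1
    generalize v 0 = a at *
    generalize v 1 = b at *
    generalize v 3 = c at *
    generalize v 4 = d at *
    have ha : a = 0 := by
      have h5 : a * a ≤ 0 := by
        by_contra! h5
        nlinarith [sq_nonneg (2 * b - c), sq_nonneg (3 * c - 4 * a - 2 * d),
          sq_nonneg (2 * d - 4 * a)]
      nlinarith
    subst ha
    have hb : -1 ≤ b ∧ b ≤ 1 := by
      constructor <;> nlinarith [sq_nonneg (b - c), sq_nonneg (2 * d - c), sq_nonneg (3 * c - 2 * b)]
    have hd : -1 ≤ d ∧ d ≤ 1 := by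
      constructor <;> nlinarith [sq_nonneg (2 * b - c), sq_nonneg (2 * d - c), sq_nonneg (3 * c - 2 * d)]
    have hc : -1 ≤ c ∧ c ≤ 1 := by
      constructor <;> nlinarith [sq_nonneg (2 * b - c), sq_nonneg (2 * d - c)]
    obtain ⟨hb1, hb2⟩ := hb
    obtain ⟨hc1, hc2⟩ := hc
    obtain ⟨hd1, hd2⟩ := hd
    rw [hv]
    interval_cases b <;> interval_cases c <;> interval_cases d <;>
      first | (exfalso; omega) | decide +kernel

lemma mem_perpE₇ (v : Fin 7 → ℤ) : v ∈ perpE₇ ↔ latForm CartanMatrix.E₇ v v = 2 ∧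
    ∀ i, latForm CartanMatrix.E₇ v (frameE₇ i) = 0 := by
  constructor
  · have h : ∀ v ∈ perpE₇, latForm CartanMatrix.E₇ v v = 2 ∧
        ∀ i, latForm CartanMatrix.E₇ v (frameE₇ i) = 0 := by decide +kernel
    exact h v
  · rintro ⟨h1, h2⟩
    obtain ⟨h3, h4, h5, h6⟩ := latForm_frameE₇ v
    rw [h2] at h3 h4 h5 h6
    have hv : v = ![v 0, v 1, v 2, v 3, v 4, v 5, v 6] := by
      ext i; fin_cases i <;> rfl
    have e0 : v 0 = 0 := by omega
    have e2 : v 2 = 0 := by omega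
    have e3 : v 3 = 0 := by omega
    have e5 : v 5 = 0 := by omega
    simp [latForm, CartanMatrix.E₇, dotProduct, mulVec, Fin.sum_univ_succ] at h1
    rw [e0, e2, e3, e5] at hv h1
    generalize v 1 = b at *
    generalize v 4 = c at *
    generalize v 6 = d at *
    have hb : -1 ≤ b ∧ b ≤ 1 := by
      constructor <;> nlinarith [sq_nonneg c, sq_nonneg d]
    have hc : -1 ≤ c ∧ c ≤ 1 := by
      constructor <;> nlinarith [sq_nonneg b, sq_nonneg d]
    have hd : -1 ≤ d ∧ d ≤ 1 := by
      constructor <;> nlinarith [sq_nonneg b, sq_nonneg c]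
    obtain ⟨hb1, hb2⟩ := hb
    obtain ⟨hc1, hc2⟩ := hc
    obtain ⟨hd1, hd2⟩ := hd
    rw [hv]
    interval_cases b <;> interval_cases c <;> interval_cases d <;>
      first | (exfalso; omega) | decide +kernel

lemma isOddFrame_frameE₆ : IsOddFrame CartanMatrix.E₆ 0 frameE₆ where
  form_self := by decide +kernel
  form_of_ne := by decide +kernel
  odd := by decide +kernel
  complete v hv hodd := by
    by_contra! h
    have h1 : ∀ v ∈ perpE₆, ¬Odd (v 0) := by decide +kernel
    exact h1 v ((mem_perpE₆ v).mpr ⟨hv, h⟩) hodd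

lemma isOddFrame_frameE₇ : IsOddFrame CartanMatrix.E₇ 0 frameE₇ where
  form_self := by decide +kernel
  form_of_ne := by decide +kernel
  odd := by decide +kernel
  complete v hv hodd := by
    by_contra! h
    have h1 : ∀ v ∈ perpE₇, ¬Odd (v 0) := by decide +kernel
    exact h1 v ((mem_perpE₇ v).mpr ⟨hv, h⟩) hodd

theorem killingSignature_E₆ : killingSignature (realForm CartanMatrix.E₆ 0) = -14 := by
  rw [isOddFrame_frameE₆.killingSignature_eq, isOddFrame_frameE₆.card_perp mem_perpE₆,
    show perpE₆.card = 12 by decide +kernel]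
  norm_num

theorem killingSignature_E₇ : killingSignature (realForm CartanMatrix.E₇ 0) = -5 := by
  rw [isOddFrame_frameE₇.killingSignature_eq, isOddFrame_frameE₇.card_perp mem_perpE₇,
    show perpE₇.card = 6 by decide +kernel]
  norm_num

theorem exists_hasType_E₆ : ∃ D : IwasawaDatum (realForm CartanMatrix.E₆ 0),
    D.HasType D.roots (CartanMatrix.B 2)ᵀ (bcRoots 2) := by
  refine isOddFrame_frameE₆.exists_hasType (N := {1, 2, 4}) (by decide +kernel) (fun v hv hv0 => ?_)
    (P := simpleB 2) (Q := simpleBInv 2) (m := 1) one_pos (by decide +kernel) (by decide +kernel)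
    (by decide +kernel) (by decide +kernel)
    {0, ![0, -1, 0, 0, -1, 0], ![-1, -1, -2, -2, -1, -2], ![-1, 0, -2, -2, -2, -2]}
    (by decide +kernel) ?_ (fun i m hm h => ?_) ?_
  · have h1 := isOddFrame_frameE₆.sum_sq_le hv
    rw [Fin.sum_univ_two] at h1 ⊢
    have h2 : ∀ i, -2 ≤ latForm CartanMatrix.E₆ v (frameE₆ i) ∧
        latForm CartanMatrix.E₆ v (frameE₆ i) ≤ 2 := fun i => by
      rcases latForm_cases hv (isOddFrame_frameE₆.form_self i) with h | h | h | h | h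
      · rw [h, isOddFrame_frameE₆.form_self]; norm_num
      · rw [h, latForm_neg_left, isOddFrame_frameE₆.form_self]; norm_num
      all_goals rw [h]; norm_num
    obtain ⟨i, hi⟩ := hv0
    have h3 : ¬(latForm CartanMatrix.E₆ v (frameE₆ 0) = 0 ∧
        latForm CartanMatrix.E₆ v (frameE₆ 1) = 0) := by
      rintro ⟨h, h'⟩
      fin_cases i
      · exact hi h
      · exact hi h'
    obtain ⟨a1, a2⟩ := h2 0
    obtain ⟨b1, b2⟩ := h2 1
    generalize latForm CartanMatrix.E₆ v (frameE₆ 0) = a at *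
    generalize latForm CartanMatrix.E₆ v (frameE₆ 1) = b at *
    interval_cases a <;> interval_cases b <;> first | (exfalso; omega) | decide
  · rintro v (⟨i, rfl⟩ | ⟨i, hi, rfl⟩)
    · revert i; decide +kernel
    · revert hi; revert i; decide +kernel
  · have h2 : i = 0 ∧ m = 1 ∨ i = 1 ∧ (m = 1 ∨ m = 2) := by
      have h3 : m ≤ 2 := by
        by_contra! h4
        have h5 : ∀ i, 1 ≤ simpleB 2 i ⬝ᵥ simpleB 2 i := by decide +kernel
        have h6 : ∀ x ∈ ({1, 2, 4} : Finset ℤ), x ≤ 4 := by decide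
        have := h6 _ h
        nlinarith [h5 i]
      interval_cases m <;> revert h <;> revert i <;> decide +kernel
    rcases h2 with ⟨rfl, rfl⟩ | ⟨rfl, rfl | rfl⟩
    · exact Or.inl ⟨_, rfl⟩
    · exact Or.inl ⟨_, rfl⟩
    · exact Or.inr ⟨1, rfl, rfl⟩
  · rintro v (⟨i, rfl⟩ | ⟨i, -, rfl⟩)
    · exact ⟨i, 1, rfl⟩
    · exact ⟨i, 2, rfl⟩

theorem exists_hasType_E₇ : ∃ D : IwasawaDatum (realForm CartanMatrix.E₇ 0),
    D.HasType D.roots CartanMatrix.F₄ᵀ (finiteRoots CartanMatrix.F₄ᵀ) := by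
  have hN : ∀ x : ℤ, x ∈ ({2, 4} : Finset ℤ) ↔ x = 2 ∨ x = 4 := by simp
  refine isOddFrame_frameE₇.exists_hasType (N := {2, 4}) (by decide +kernel) (fun v hv hv0 => ?_)
    (P := !![1, -1, -1, -1; 0, 0, 0, 2; 0, 0, 1, -1; 0, 1, -1, 0])
    (Q := !![2, 3, 4, 2; 0, 1, 2, 2; 0, 1, 2, 0; 0, 1, 0, 0]) (m := 2) two_pos (by decide +kernel)
    (by decide +kernel) (by decide +kernel) (by decide +kernel)
    {0, ![0, -1, 0, 0, -1, 0, 0], ![0, 0, 0, 0, 1, 0, 1], ![0, 1, 0, 0, 0, 0, 1]}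
    (by decide +kernel) ?_ (fun i m hm h => ?_) ?_
  · have h1 := isOddFrame_frameE₇.sum_sq_le hv
    obtain ⟨i, hi⟩ := hv0
    have h2 : 0 < ∑ i, latForm CartanMatrix.E₇ v (frameE₇ i) * latForm CartanMatrix.E₇ v (frameE₇ i) :=
      Finset.sum_pos' (fun _ _ => mul_self_nonneg _) ⟨i, Finset.mem_univ _, mul_self_pos.mpr hi⟩
    have h3 : Even (∑ i, latForm CartanMatrix.E₇ v (frameE₇ i) *
        latForm CartanMatrix.E₇ v (frameE₇ i)) := by
      obtain ⟨e0, e1, e2, e3⟩ := latForm_frameE₇ v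
      rw [Fin.sum_univ_four, e0, e1, e2, e3]
      exact ⟨2 * v 0 * v 0 - 2 * v 0 * v 2 + 2 * v 2 * v 2 - 2 * v 2 * v 3 + v 3 * v 3 + v 5 * v 5
        - v 3 * v 5, by ring⟩
    obtain ⟨l, hl⟩ := h3
    rw [hN]
    omega
  · rintro v ⟨i, rfl⟩
    revert i; decide +kernel
  · refine ⟨i, ?_⟩
    congr 1
    by_contra hm1
    have h5 : ∀ i, (!![1, -1, -1, -1; 0, 0, 0, 2; 0, 0, 1, -1; 0, 1, -1, 0] : Matrix _ _ ℤ) i ⬝ᵥ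
      (!![1, -1, -1, -1; 0, 0, 0, 2; 0, 0, 1, -1; 0, 1, -1, 0] : Matrix _ _ ℤ) i ≥ 2 := by
      decide +kernel
    have h6 := h5 i
    rw [hN] at h
    have h7 : 2 ≤ m := by omega
    have h8 : 4 ≤ m * m := by nlinarith
    rcases h with h | h <;> nlinarith
  · rintro v ⟨i, rfl⟩
    exact ⟨i, 1, rfl⟩

theorem exists_hasType_E₈ : ∃ D : IwasawaDatum (LatticeLie ℝ CartanMatrix.E₈),
    D.HasType D.roots CartanMatrix.E₈ᵀ (finiteRoots CartanMatrix.E₈ᵀ) := by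
  have h1 : CartanMatrix.E₈ᵀ = CartanMatrix.E₈ := by decide +kernel
  have h2 : ∀ i j, i ≠ j → 1 * CartanMatrix.E₈ i j ≤ 0 := by decide +kernel
  rw [h1]
  exact exists_hasType_split fun i j hij => by simpa using h2 i j hij

end ExceptionalTypes

end LatticeLie

theorem mainTheorem2 :
    -- `N = 1`: `sl(2, ℝ)`, `a_1`, `A_1`, `A_1^∧∧`
    IsUntwistedTableLine U3_N1 (CartanMatrix.A 1)ᵀ ∧
    -- `N = 2`: `su(2, 1)`, `bc_1`, `A_1`, `A_2^{(2)∧}`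
    IsTableLine U3_N2 (CartanMatrix.B 1)ᵀ (bcRoots 1) (CartanMatrix.A 1)ᵀ twistedA2Ext ∧
    -- `N = 3`: `su(4, 1)`, `bc_1`, `A_1`, `A_2^{(2)∧}`
    IsTableLine U3_N3 (CartanMatrix.B 1)ᵀ (bcRoots 1) (CartanMatrix.A 1)ᵀ twistedA2Ext ∧
    -- `N = 4`: `so(8, 2)`, `c_2`, `C_2`, `C_2^∧∧`
    IsUntwistedTableLine (U3_N4 0) (CartanMatrix.C 2)ᵀ ∧
    -- `N = 5`: `E_{6|-14}`, `bc_2`, `C_2`, `A_4^{(2)∧}`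
    (killingSignature U3_N5 = -14 ∧
      IsTableLine U3_N5 (CartanMatrix.B 2)ᵀ (bcRoots 2) (CartanMatrix.C 2)ᵀ twistedA4Ext) ∧
    -- `N = 6`: `E_{7|-5}`, `f_4`, `F_4`, `F_4^∧∧`
    (killingSignature U3_N6 = -5 ∧ IsUntwistedTableLine U3_N6 (CartanMatrix.F₄)ᵀ) ∧
    -- `N = 8`: `E_{8|8}`, `e_8`, `E_8`, `E_8^∧∧`
    (killingSignature U3_N8 = 8 ∧ IsUntwistedTableLine U3_N8 (CartanMatrix.E₈)ᵀ) ∧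
    -- `N = 4`, `k < 6`: `so(8, k+2)`, `b_{k+2}`, `B_{k+2}`, `B_{k+2}^∧∧`
    (∀ k < 6, IsUntwistedTableLine (U3_N4 k) (CartanMatrix.B (k + 2))ᵀ) ∧
    -- `N = 4`, `k = 6`: `so(8, 8)`, `d_8`, `D_8`, `D_8^∧∧`
    IsUntwistedTableLine (U3_N4 6) (CartanMatrix.D 8)ᵀ ∧
    -- `N = 4`, `k > 6`: `so(8, k+2)`, `b_8`, `B_8`, `B_8^∧∧`
    (∀ k > 6, IsUntwistedTableLine (U3_N4 k) (CartanMatrix.B 8)ᵀ) := by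
  refine ⟨isUntwistedTableLine_A₁ exists_hasType_sl2, isTableLine_BC₁ (exists_hasType_su 0),
    isTableLine_BC₁ (exists_hasType_su 2), isUntwistedTableLine_C₂ ?_,
    ⟨LatticeLie.killingSignature_E₆, isTableLine_BC₂ LatticeLie.exists_hasType_E₆⟩,
    ⟨LatticeLie.killingSignature_E₇, isUntwistedTableLine_F₄ LatticeLie.exists_hasType_E₇⟩,
    ⟨LatticeLie.killingSignature_split, isUntwistedTableLine_E₈ LatticeLie.exists_hasType_E₈⟩,
    fun k hk => isUntwistedTableLine_B (by omega) (by omega) ?_,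
    isUntwistedTableLine_D₈ exists_hasType_so_D,
    fun k hk => isUntwistedTableLine_B (by omega) le_rfl ?_⟩
  · obtain ⟨D, hD⟩ := exists_hasType_so_B (p := 8) (q := 2) (r := 2) (by omega) le_rfl (Or.inr rfl)
      (by omega) le_rfl (by omega)
    exact ⟨D, hasType_C₂ hD⟩
  · exact exists_hasType_so_B (by omega) le_rfl (Or.inr rfl) (by omega) (by omega) (by omega)
  · exact exists_hasType_so_B le_rfl (by omega) (Or.inl rfl) (by omega) (by omega) le_rfl
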